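/- Let $F$ be a non-Archimedean local field with ring of integers $\mathcal O_F$, maximal ideal $\mathfrak p_F$, uniformizer $\pi_F$, residue field $k$ of order $q$ and normalized absolute value $|\cdot|_F$ ($|\pi_F|_F=q^{-1}$). Let $B$ be a central division algebra of dimension $4$ over $F$, with maximal order $\mathcal O_B$, whose maximal ideal is $\mathfrak P_B$. Put $\mathbf A=M_2(F)\times B$ and $\mathbf G=\mathbf A^\times=\mathrm{GL}_2(F)\times B^\times$; for $g=(g_1,g_2)\in\mathbf G$ put $\|g_1\|=|\det g_1|_F$ and $\|g_2\|=|\mathrm N g_2|_F$ ($\mathrm N$ and $\mathrm{tr}$ are the reduced norm and trace). Let $\psi_F$ be an additive character of $F$ of level one (trivial on $\mathfrak p_F$, not on $\mathcal O_F$). **The stratum.** Let $E/F$ be a separable quadratic extension, embedded in $M_2(F)$ and in $B$, and let $\Delta:E\to\mathbf A$ be the diagonal embedding. Let $S=(\mathfrak A,n,\alpha)$ with $n\ge 1$ be a simple stratum in $M_2(F)$ with $E=F(\alpha)$: $\mathfrak A$ is the chain order of a lattice chain of period $e=e(E/F)$, with radical $\mathfrak P$; $\alpha\in\mathfrak P^{-n}$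 has valuation exactly $-n$ in $E$; and either $E/F$ is ramified and $n$ is odd, or $E/F$ is unramified and the minimal polynomial of $\pi_F^n\alpha$ is irreducible mod $\mathfrak p_F$. Put $n'=n$ if $E/F$ is ramified and $n'=2n$ otherwise. **The linking order.** Let $A_1=M_2(F)$, $\mathfrak A_1=\mathfrak A$, $A_2=B$, $\mathfrak A_2=\mathcal O_B$. Let $C_i$ be the orthogonal complement of $E$ in $A_i$ for $(x,y)\mapsto \mathrm{tr}(xy)$, and $\mathfrak C_i=C_i\cap\mathfrak A_i$. Put $V_i^m=\mathfrak p_E^{\lfloor m/2\rfloor}\mathfrak C_i$ if $i=2$ and $E/F$ is unramified, and $V_i^m=\mathfrak p_E^{\lfloor (m+1)/2\rfloor}\mathfrak C_i$ otherwise. Let $$\mathcal L_S=\Delta(\mathcal O_E)+\mathfrak p_E^n\times\mathfrak p_E^n+V_1^n\times V_2^n,\qquad \mathcal L_S^\circ=\Delta(\mathfrak p_E)+\mathfrak p_E^{n+1}\times\mathfrak p_E^{n+1}+V_1^{n+1}\times V_2^{n+1},$$ and $\mathcal R_S=\mathcal L_S/\mathcal L_S^\circ$. **The representations.** Let $\rho_S$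 be the finite-dimensional irreducible complex representation of $\mathcal L_S^\times$ determined up to isomorphism by the following conditions: it is inflated from $\mathcal R_S^\times$; it is trivial on $\Delta(\mathcal O_F^\times)$; the group $(1+\mathfrak P^n)\times(1+\mathfrak P_B^{n'})$ is contained in $\mathcal L_S^\times$ and acts through the character $(1+x_1,1+x_2)\mapsto\psi_F(\mathrm{tr}(\alpha x_1))\,\psi_F(\mathrm{tr}(\alpha x_2))^{-1}$; and, if $E/F$ is unramified, the restriction of $\rho_S$ to the image $k_E^\times$ of $\Delta(\mathcal O_E^\times)$ in $\mathcal R_S^\times$ is the direct sum of the nontrivial characters of $k_E^\times/k^\times$, each once. (Such a $\rho_S$ exists exactly when $E/F$ is unramified or tamely ramified.) Let $\omega$ be a character of $F^\times$, and let $\rho_{S,\omega}$ be an extension of $\rho_S$ to $\mathcal K_S=(F^\times\times F^\times)\,\Delta(E^\times)\,\mathcal L_S^\times$ on which $(z_1,z_2)\in F^\times\times F^\times$ acts by $\omega(z_1z_2^{-1})$ and, if $E/F$ is ramified, $\Delta(\beta)$ acts by $(-1)^{v_E(\beta)}$ for $\beta\in E^\times$. Let $\Pi_{S,\omega}$ be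 the compactly supported smooth induction of $\rho_{S,\omega}$ from $\mathcal K_S$ to $\mathbf G$, and let $\mathcal C(\Pi_{S,\omega})$ be the span of its matrix coefficients $g\mapsto\langle w',\Pi_{S,\omega}(g)w\rangle$, with $w$ in the space of $\Pi_{S,\omega}$ and $w'$ in its smooth dual. **The Fourier transform.** Let $\psi$ be a nontrivial continuous additive character of $F$, put $\psi_{\mathbf A}(x_1,x_2)=\psi(\mathrm{tr}\,x_1)\,\psi(-\mathrm{tr}\,x_2)$, and let $\mu$ be the Haar measure on $\mathbf A$ that is self-dual for $\psi_{\mathbf A}$. For a function $f$ on $\mathbf G$ and real $s$ put $f_s(g)=f(g)\|g_1\|^{s-2}\|g_2\|^{-s}$ and $\check f(g)=f(g^{-1})$; functions on $\mathbf G$ are extended by $0$ to $\mathbf A$. **Proposition.** Let $f\in\mathcal C(\Pi_{S,\omega})$, $s\in\mathbb R$ and $y\in\mathbf A$. Then $x\mapsto f_s(x)\psi_{\mathbf A}(xy)$ is integrable over each coset $c\in\mathbf G/\mathcal L_S^\times$, its integral vanishes for all but finitely many $c$, and the formal Fourier transform $$\widehat{f_s}(y)=\sum_{c\in\mathbf G/\mathcal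 L_S^\times}\int_c f_s(x)\,\psi_{\mathbf A}(xy)\,d\mu(x)$$ satisfies $\widehat{f_s}(y)=-\check f_{2-s}(y)$, where $\check f_{2-s}=(\check f)_{2-s}$. -/

import Mathlib

open scoped ValuativeRel

noncomputable section

namespace LinkingOrder

/-! ### Compact induction and matrix coefficients -/

section Induction

variable {G V : Type*} [Group G] [TopologicalSpace G] [IsTopologicalGroup G]
  [AddCommGroup V] [Module ℂ V]

/-- The space of the compactly supported (smooth) induction of a representation `ρ` of a subgroup
`K` of `G`: functions `φ : G → V` with `φ (k x) = ρ k (φ x)`, invariant under right translation by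
some open subgroup, and supported on `K * C` for some compact set `C`. -/
def cIndSpace (K : Subgroup G) (ρ : Representation ℂ K V) : Submodule ℂ (G → V) where
  carrier := {φ | (∀ (k : K) (x : G), φ (k * x) = ρ k (φ x)) ∧
    (∃ U : Subgroup G, IsOpen (U : Set G) ∧ ∀ u ∈ U, ∀ x, φ (x * u) = φ x) ∧
    ∃ C : Set G, IsCompact C ∧ ∀ x, φ x ≠ 0 → ∃ k ∈ K, ∃ c ∈ C, x = k * c}
  zero_mem' := ⟨by simp, ⟨⊤, isOpen_univ, by simp⟩, ⟨∅, isCompact_empty, by simp⟩⟩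
  add_mem' := by
    rintro φ φ' ⟨h1, ⟨U, hU, h2⟩, ⟨C, hC, h3⟩⟩ ⟨h1', ⟨U', hU', h2'⟩, ⟨C', hC', h3'⟩⟩
    refine ⟨fun k x => by simp [h1, h1'], ⟨U ⊓ U', hU.inter hU', fun u hu x => ?_⟩,
      ⟨C ∪ C', hC.union hC', fun x hx => ?_⟩⟩
    · simp [h2 u hu.1, h2' u hu.2]
    · by_cases h : φ x = 0
      · have h' : φ' x ≠ 0 := fun h' => hx (by simp [h, h'])
        obtain ⟨k, hk, c, hc, e⟩ := h3' x h'
        exact ⟨k, hk, c, Or.inr hc, e⟩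
      · obtain ⟨k, hk, c, hc, e⟩ := h3 x h
        exact ⟨k, hk, c, Or.inl hc, e⟩
  smul_mem' := by
    rintro a φ ⟨h1, ⟨U, hU, h2⟩, ⟨C, hC, h3⟩⟩
    refine ⟨fun k x => by simp [h1], ⟨U, hU, fun u hu x => by simp [h2 u hu]⟩,
      ⟨C, hC, fun x hx => h3 x fun h => hx (by simp [h])⟩⟩

/-- The compactly induced representation: `G` acts on `cIndSpace K ρ` by right translation. -/
def cInd (K : Subgroup G) (ρ : Representation ℂ K V) :
    Representation ℂ G (cIndSpace K ρ) where
  toFun g :=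
    { toFun := fun φ => ⟨fun x => φ.1 (x * g), by
        obtain ⟨φ, h1, ⟨U, hU, h2⟩, ⟨C, hC, h3⟩⟩ := φ
        refine ⟨fun k x => by simp [mul_assoc, h1],
          ⟨U.comap (MulAut.conj g⁻¹).toMonoidHom, ?_, fun u hu x => ?_⟩,
          ⟨(fun c => c * g⁻¹) '' C, hC.image (by fun_prop), fun x hx => ?_⟩⟩
        · exact hU.preimage (f := fun x : G => g⁻¹ * x * g⁻¹⁻¹) (by fun_prop)
        · have hu' : g⁻¹ * u * g ∈ U := by simpa using hu
          have := h2 _ hu' (x * g)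
          simpa [mul_assoc] using this
        · obtain ⟨k, hk, c, hc, e⟩ := h3 _ hx
          exact ⟨k, hk, c * g⁻¹, ⟨c, hc, rfl⟩, by rw [← mul_assoc, ← e]; simp⟩⟩
      map_add' := fun _ _ => rfl
      map_smul' := fun _ _ => rfl }
  map_one' := by ext φ x; simp
  map_mul' g h := by ext φ x; simp [mul_assoc]

/-- The space `𝒞(π)` spanned by the matrix coefficients `g ↦ ⟨w', π(g) w⟩`, where `w` runs over
the space of `π` and `w'` over its smooth dual (linear functionals fixed by an open subgroup). -/
def matrixCoeffs {W : Type*} [AddCommGroup W] [Module ℂ W] (π : Representation ℂ G W) :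
    Submodule ℂ (G → ℂ) :=
  Submodule.span ℂ {f | ∃ (w' : W →ₗ[ℂ] ℂ) (w : W),
    (∃ U : Subgroup G, IsOpen (U : Set G) ∧ ∀ u ∈ U, ∀ x, w' (π u x) = w' x) ∧
    f = fun g => w' (π g w)}

end Induction

/-! ### The local field `F`, the quadratic extension `E` and the quaternion algebra `B` -/

section Basic

variable (F : Type*) [Field F] [ValuativeRel F] [TopologicalSpace F]
  [IsNonarchimedeanLocalField F]

open Classical in
/-- The normalized absolute value of `F`: a uniformizer has absolute value `q⁻¹`, where `q` is the
order of the residue field. -/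
def normF (x : F) : ℝ :=
  if x = 0 then 0 else
    (Nat.card 𝓀[F] : ℝ) ^ WithZero.log
      (IsNonarchimedeanLocalField.valueGroupWithZeroIsoInt F (ValuativeRel.valuation F x))

/-- `M₂(F)`. -/
abbrev M2 : Type _ := Matrix (Fin 2) (Fin 2) F

section Quat

variable {F} {B : Type*} [DivisionRing B] [Algebra F B]

/-- The reduced characteristic polynomial of an element of a quaternion division algebra. -/
def redCharpoly (b : B) : Polynomial F :=
  minpoly F b ^ (2 / (minpoly F b).natDegree)

/-- The reduced trace. -/
def redTrace (b : B) : F := -(redCharpoly (F := F) b).coeff 1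

/-- The reduced norm. -/
def redNorm (b : B) : F := (redCharpoly (F := F) b).coeff 0

/-- The power `𝔓_B ^ m` of the maximal ideal of the maximal order `𝒪_B`: the elements whose
reduced norm lies in `𝔭_F ^ m`. In particular `radB 0 = 𝒪_B`. -/
def radB (F B : Type*) [Field F] [ValuativeRel F] [TopologicalSpace F]
    [IsNonarchimedeanLocalField F] [DivisionRing B] [Algebra F B] (m : ℕ) : Set B :=
  {b | ∃ c : 𝒪[F], c ∈ 𝓂[F] ^ m ∧ (c : F) = redNorm b}

end Quat

/-- A lattice chain in `F ⊕ F`: a strictly decreasing family of `𝒪_F`-lattices with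
`𝔭_F Lᵢ = L_{i + e}`. -/
structure LatticeChain where
  /-- the lattices -/
  L : ℤ → Submodule 𝒪[F] (Fin 2 → F)
  isLattice : ∀ i, Submodule.IsLattice F (L i)
  strictAnti : StrictAnti L
  /-- the period -/
  e : ℕ
  e_pos : 0 < e
  period : ∀ i, L (i + e) = 𝓂[F] • L i

variable {F}

/-- The set of matrices `a` with `a Lᵢ ⊆ L_{i + m}` for all `i`. For `m = 0` this is the chain
order `𝔄` of the lattice chain; in general it is the `m`-th power `𝔓 ^ m` of the
Jacobson radical `𝔓` of `𝔄`. -/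
def LatticeChain.rad (Λ : LatticeChain F) (m : ℤ) : Set (M2 F) :=
  {a | ∀ i, ∀ x ∈ Λ.L i, a.mulVec x ∈ Λ.L (i + m)}

variable (F) (E : Type*) [Field E] [Algebra F E]

/-- The ring of integers of `E`. -/
abbrev OE : Type _ := integralClosure 𝒪[F] E

/-- The maximal ideal of the local ring `𝒪_E`. -/
def maxE : Ideal (OE F E) := (⊥ : Ideal (OE F E)).jacobson

/-- `𝔭_E ^ m`, as a subset of `E`. -/
def pE (m : ℕ) : Set E := {x | ∃ y : OE F E, y ∈ maxE F E ^ m ∧ (y : E) = x}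

/-- `E / F` is unramified. -/
def Unramified : Prop := (𝓂[F]).map (algebraMap 𝒪[F] (OE F E)) = maxE F E

variable {E}

/-- The normalized valuation of `x ∈ Eˣ` is `m`. -/
def HasOrd (x : E) (m : ℤ) : Prop :=
  ∃ (u : (OE F E)ˣ) (t : OE F E), Ideal.span {t} = maxE F E ∧ x = ((u : OE F E) : E) * (t : E) ^ m

/-- Given an embedding `ι` of `E` into an `F`-algebra `A` with trace function `tr`, an order `𝔄`
of `A` and the complement `C` of `E` in `A` with respect to `(x, y) ↦ tr (x * y)`, this is
`ℭ = 𝔄 ∩ C`. -/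
def complOrder {A : Type*} [Ring A] [Algebra F A] (tr : A → F) (ι : E →ₐ[F] A) (𝔄 : Set A) :
    Set A :=
  {c | c ∈ 𝔄 ∧ ∀ x : E, tr (c * ι x) = 0}

/-- The additive group `𝔭_E ^ m ℭ`. -/
def pCompl {A : Type*} [Ring A] [Algebra F A] (tr : A → F) (ι : E →ₐ[F] A) (𝔄 : Set A) (m : ℕ) :
    AddSubgroup A :=
  AddSubgroup.closure {x | ∃ b ∈ pE F E m, ∃ c ∈ complOrder F tr ι 𝔄, x = ι b * c}

end Basic

/-! ### The algebra `M₂(F) × B` and its unit group -/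

section Product

variable (F : Type*) [Field F] [ValuativeRel F] [TopologicalSpace F]
  [IsNonarchimedeanLocalField F] (B : Type*) [DivisionRing B] [Algebra F B]

/-- The algebra `𝐀 = M₂(F) × B`. -/
abbrev AA : Type _ := M2 F × B

/-- The group `𝐆 = GL₂(F) × Bˣ`. -/
abbrev GG : Type _ := (M2 F)ˣ × Bˣ

variable {F B}

/-- The inclusion of `𝐆` into `𝐀`. -/
def toA (g : GG F B) : AA F B := ((g.1 : M2 F), (g.2 : B))

/-- `‖g₁‖ = |det g₁|_F`. -/
def norm₁ (g : GG F B) : ℝ := normF F (Matrix.det (g.1 : M2 F))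

/-- `‖g₂‖ = |N g₂|_F`. -/
def norm₂ (g : GG F B) : ℝ := normF F (redNorm (g.2 : B))

/-- `f_s(g) = f(g) ‖g₁‖ ^ (s - 2) ‖g₂‖ ^ (-s)`. -/
def twist (f : GG F B → ℂ) (s : ℝ) : GG F B → ℂ :=
  fun g => f g * ((norm₁ g ^ (s - 2) : ℝ) : ℂ) * ((norm₂ g ^ (-s) : ℝ) : ℂ)

/-- `f̌(g) = f(g⁻¹)`. -/
def check (f : GG F B → ℂ) : GG F B → ℂ := fun g => f g⁻¹

/-- The additive character `ψ_𝐀(x₁, x₂) = ψ(tr x₁) ψ(-tr x₂)` of `𝐀`. -/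
def psiA (ψ : AddChar F Circle) (x : AA F B) : ℂ :=
  (ψ (Matrix.trace x.1) : ℂ) * (ψ (-redTrace x.2) : ℂ)

/-- Extension by zero of a function on `𝐆` to a function on `𝐀`. -/
def extZero (f : GG F B → ℂ) : AA F B → ℂ := Function.extend toA f 0

variable [TopologicalSpace B] [MeasurableSpace (AA F B)]

/-- The measure `μ` is self-dual with respect to `ψ_𝐀`: the Fourier transform
`Φ̂(y) = ∫ Φ(x) ψ_𝐀(x y) dμ(x)` satisfies `Φ̂̂(x) = Φ(-x)` for all locally constant `Φ` of compact
support. -/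
def IsSelfDual (ψ : AddChar F Circle) (μ : MeasureTheory.Measure (AA F B)) : Prop :=
  ∀ Φ : AA F B → ℂ, IsLocallyConstant Φ → HasCompactSupport Φ →
    ∀ x, ∫ y, (∫ z, Φ z * psiA ψ (z * y) ∂μ) * psiA ψ (y * x) ∂μ = Φ (-x)

/-- The subset of `𝐀` underlying a coset of a subgroup `H` of `𝐆`. -/
def cosetSet {H : Subgroup (GG F B)} (c : GG F B ⧸ H) : Set (AA F B) :=
  toA '' {g | (QuotientGroup.mk g : GG F B ⧸ H) = c}

/-- The integrand `x ↦ f(x) ψ_𝐀(x y)` of the Fourier transform of a function on `𝐆`. -/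
def fourierIntegrand (ψ : AddChar F Circle) (f : GG F B → ℂ) (y : AA F B) : AA F B → ℂ :=
  fun x => extZero f x * psiA ψ (x * y)

/-- The formal Fourier transform of a function `f` on `𝐆`: the sum over the cosets of `H` in `𝐆` of
the integrals of `f(x) ψ_𝐀(x y)` over these cosets. -/
def formalFourier (H : Subgroup (GG F B)) (ψ : AddChar F Circle)
    (μ : MeasureTheory.Measure (AA F B)) (f : GG F B → ℂ) (y : AA F B) : ℂ :=
  ∑ᶠ c : GG F B ⧸ H, ∫ x in cosetSet c, fourierIntegrand ψ f y x ∂μ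

end Product

/-! ### Simple strata, linking orders and the representations attached to them -/

variable {F E B : Type*} [Field F] [ValuativeRel F] [TopologicalSpace F]
  [IsNonarchimedeanLocalField F] [Field E] [Algebra F E] [DivisionRing B] [Algebra F B]

/-- The stratum `(𝔄, n, α)` in `M₂(F)`, where `𝔄` is the chain order of a lattice chain
and `α ∈ E` is viewed in `M₂(F)` through `ι₁`, together with an embedding `ι₂` of `E` into `B`. -/
structure StratumData (F E B : Type*) [Field F] [ValuativeRel F] [TopologicalSpace F]
    [IsNonarchimedeanLocalField F] [Field E] [Algebra F E] [DivisionRing B] [Algebra F B] where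
  /-- the lattice chain that defines the chain order -/
  chain : LatticeChain F
  /-- the integer `n` of the stratum -/
  n : ℕ
  /-- the element of the stratum -/
  α : E
  /-- the embedding of `E` into `M₂(F)` -/
  ι₁ : E →ₐ[F] M2 F
  /-- the embedding of `E` into `B` -/
  ι₂ : E →ₐ[F] B

namespace StratumData

/-- The stratum `S = (𝔄, n, α)` in `M₂(F)` is simple (relative to a uniformizer `ϖ` of `F`), with
`E = F(α)` a quadratic extension of `F` with the ramification index of `𝔄`. -/
def IsSimple (S : StratumData F E B) (ϖ : 𝒪[F]) : Prop :=
  Module.finrank F E = 2 ∧ IntermediateField.adjoin F {S.α} = ⊤ ∧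
  S.ι₁ S.α ∈ S.chain.rad (-S.n) ∧ HasOrd F S.α (-S.n) ∧
  ((¬ Unramified F E ∧ S.chain.e = 2 ∧ Odd S.n) ∨
   (Unramified F E ∧ S.chain.e = 1 ∧
    Irreducible ((minpoly 𝒪[F] ((ϖ : F) ^ S.n • S.α)).map (IsLocalRing.residue 𝒪[F]))))

open Classical in
/-- The integer `n'` of the corresponding stratum `S' = (𝒪_B, n', α)` in `B`. -/
def n' (S : StratumData F E B) : ℕ := if Unramified F E then 2 * S.n else S.n

/-- The module `V₁ᵐ ⊆ M₂(F)`. -/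
def V₁ (S : StratumData F E B) (m : ℕ) : AddSubgroup (M2 F) :=
  pCompl F Matrix.trace S.ι₁ (S.chain.rad 0) ((m + 1) / 2)

open Classical in
/-- The module `V₂ᵐ ⊆ B`. -/
def V₂ (S : StratumData F E B) (m : ℕ) : AddSubgroup B :=
  pCompl F redTrace S.ι₂ (radB F B 0) (if Unramified F E then m / 2 else (m + 1) / 2)

/-- `Δ(𝔭_E ^ i) + 𝔭_E ^ m × 𝔭_E ^ m + V₁ᵐ × V₂ᵐ`. -/
def linkSet (S : StratumData F E B) (i m : ℕ) : Set (AA F B) :=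
  {x | ∃ a ∈ pE F E i, ∃ b₁ ∈ pE F E m, ∃ b₂ ∈ pE F E m, ∃ v₁ ∈ S.V₁ m, ∃ v₂ ∈ S.V₂ m,
    x = (S.ι₁ a + S.ι₁ b₁ + v₁, S.ι₂ a + S.ι₂ b₂ + v₂)}

/-- The linking order `ℒ_S = Δ(𝒪_E) + 𝔭_E ^ n × 𝔭_E ^ n + V₁ⁿ × V₂ⁿ`. -/
def linkingOrder (S : StratumData F E B) : Set (AA F B) := S.linkSet 0 S.n

/-- The ideal `ℒ_S° = Δ(𝔭_E) + 𝔭_E ^ (n+1) × 𝔭_E ^ (n+1) + V₁ⁿ⁺¹ × V₂ⁿ⁺¹` of the linking order. -/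
def linkingIdeal (S : StratumData F E B) : Set (AA F B) := S.linkSet 1 (S.n + 1)

/-- The unit group `ℒ_Sˣ`. The generating set is already a group, since `ℒ_S` is a ring. -/
def linkingUnits (S : StratumData F E B) : Subgroup (GG F B) :=
  Subgroup.closure {g | toA g ∈ S.linkingOrder ∧ toA g⁻¹ ∈ S.linkingOrder}

/-- The diagonal embedding `Δ : Eˣ → 𝐆`. -/
def diag (S : StratumData F E B) : Eˣ →* GG F B :=
  (Units.map (S.ι₁ : E →* M2 F)).prod (Units.map (S.ι₂ : E →* B))

/-- The restriction of `Δ` to `𝒪_Eˣ`. -/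
def diagO (S : StratumData F E B) : (OE F E)ˣ →* GG F B :=
  S.diag.comp (Units.map (algebraMap (OE F E) E : OE F E →* E))

/-- The embedding of `Z(𝐆) = Fˣ × Fˣ` into `𝐆`. -/
def centerHom (F B : Type*) [Field F] [ValuativeRel F] [TopologicalSpace F]
    [IsNonarchimedeanLocalField F] [DivisionRing B] [Algebra F B] : Fˣ × Fˣ →* GG F B :=
  (Units.map (algebraMap F (M2 F) : F →* M2 F)).prodMap (Units.map (algebraMap F B : F →* B))

/-- The group `𝒦_S = Z(𝐆) Δ(Eˣ) ℒ_Sˣ`. -/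
def K (S : StratumData F E B) : Subgroup (GG F B) :=
  (centerHom F B).range ⊔ S.diag.range ⊔ S.linkingUnits

lemma linkingUnits_le_K (S : StratumData F E B) : S.linkingUnits ≤ S.K := le_sup_right

variable {V : Type*} [AddCommGroup V] [Module ℂ V]

/-- The `χ`-eigenspace of `Δ(𝒪_Eˣ)` in a representation of `ℒ_Sˣ`. -/
def torusEigenspace (S : StratumData F E B) (σ : Representation ℂ S.linkingUnits V)
    (χ : (OE F E)ˣ →* ℂˣ) : Submodule ℂ V where
  carrier := {v | ∀ (u : (OE F E)ˣ) (g : S.linkingUnits), (g : GG F B) = S.diagO u →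
    σ g v = (χ u : ℂ) • v}
  zero_mem' := by simp
  add_mem' := by
    intro v w hv hw u g h
    rw [map_add, hv u g h, hw u g h, smul_add]
  smul_mem' := by
    intro a v hv u g h
    rw [map_smul, hv u g h, smul_comm]

open Classical in
/-- `σ` is (a model of) the irreducible representation `ρ_S` of `ℒ_Sˣ`, which is determined up to
isomorphism by these conditions:
* it is inflated from `ℛ_Sˣ`, where `ℛ_S = ℒ_S / ℒ_S°`;
* it is trivial on `kˣ`, the image of `Δ(𝒪_Fˣ)` in `ℛ_Sˣ`;
* `1 + 𝔓₁ⁿ × 𝔓₂^{n'}` is contained in `ℒ_Sˣ` and acts through the character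
  `ψ_S (1 + x₁, 1 + x₂) = ψ_F (tr (α x₁)) ψ_F (tr (α x₂))⁻¹`;
* if `E / F` is unramified, its restriction to the torus `k_Eˣ`, the image of `Δ(𝒪_Eˣ)` in `ℛ_Sˣ`,
  is exactly the direct sum of the nontrivial characters of `k_Eˣ / kˣ`. -/
structure IsRhoS (S : StratumData F E B) (ψF : AddChar F Circle)
    (σ : Representation ℂ S.linkingUnits V) : Prop where
  irreducible : σ.IsIrreducible
  inflated : ∀ g : S.linkingUnits, toA (g : GG F B) - 1 ∈ S.linkingIdeal → σ g = 1
  trivial_k : ∀ (g : S.linkingUnits) (u : 𝒪[F]ˣ),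
    (g : GG F B) = S.diagO (Units.map (algebraMap 𝒪[F] (OE F E) : 𝒪[F] →* OE F E) u) → σ g = 1
  stratum : ∀ g : GG F B, (g.1 : M2 F) - 1 ∈ S.chain.rad S.n → (g.2 : B) - 1 ∈ radB F B S.n' →
    ∃ hg : g ∈ S.linkingUnits,
      σ ⟨g, hg⟩ = ((ψF (Matrix.trace (S.ι₁ S.α * ((g.1 : M2 F) - 1))) : ℂ) *
        ((ψF (redTrace (S.ι₂ S.α * ((g.2 : B) - 1))) : ℂ))⁻¹) • (1 : Module.End ℂ V)
  torus : Unramified F E → ∀ χ : (OE F E)ˣ →* ℂˣ,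
    (∀ u : (OE F E)ˣ, (u : OE F E) - 1 ∈ maxE F E → χ u = 1) →
    (∀ u : 𝒪[F]ˣ, χ (Units.map (algebraMap 𝒪[F] (OE F E) : 𝒪[F] →* OE F E) u) = 1) →
    Module.finrank ℂ (S.torusEigenspace σ χ) = if χ = 1 then 0 else 1

/-- `ρ` is the extension `ρ_{S,ω}` of `σ = ρ_S` to `𝒦_S`: its restriction to the center is
`(z₁, z₂) ↦ ω(z₁ z₂⁻¹)` and, if `E / F` is ramified, `Δ(β)` acts through the sign
`(-1) ^ v_E(β)`. -/
structure IsRhoExt (S : StratumData F E B) (ω : Fˣ →* ℂˣ)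
    (σ : Representation ℂ S.linkingUnits V) (ρ : Representation ℂ S.K V) : Prop where
  extends_σ : ∀ g : S.linkingUnits, ρ (Subgroup.inclusion S.linkingUnits_le_K g) = σ g
  central : ∀ (k : S.K) (z : Fˣ × Fˣ), (k : GG F B) = centerHom F B z →
    ρ k = (ω (z.1 * z.2⁻¹) : ℂ) • (1 : Module.End ℂ V)
  sign : ¬ Unramified F E → ∀ (k : S.K) (β : Eˣ) (m : ℤ), (k : GG F B) = S.diag β →
    HasOrd F (β : E) m → ρ k = ((-1 : ℂ) ^ m) • (1 : Module.End ℂ V)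

end StratumData

end LinkingOrder

end

open LinkingOrder

set_option linter.style.haveILetI false
set_option linter.unusedSectionVars false

namespace LinkingOrder

open Algebra (smul_def algebraMap_eq_smul_one)
open AlgHom (commutes)
open Additive (ofMul)
open LinearMap (trace)
open Subgroup (coe_mul coe_one inclusion mem_sup_left)
open Module (finrank End)
open IsLocalRing (residue residue_surjective)
open Finset (sum_congr mul_sum mem_univ)
open FiniteDimensional (of_finrank_pos)
open Prod (fst_mul snd_mul fst_sub fst_neg fst_one snd_sub snd_neg)
open Matrix (mulVec_mulVec one_mulVec det_mul det_fin_two trace_fin_two isUnit_iff_isUnit_det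
  smul_mulVec zero_mulVec trace_smul of_apply trace_mul_comm)
open AddChar (map_add_eq_mul map_zero_eq_one)
open Function (Injective onFun)
open Units (mk0 inv_mul)
open Fintype (ofFinite)
open Polynomial (aeval)
open Filter (mem_of_superset)

variable {F E B : Type*} [Field F] [ValuativeRel F] [TopologicalSpace F]
  [IsNonarchimedeanLocalField F] [Field E] [Algebra F E] [DivisionRing B] [Algebra F B]

local notation "ε(" a ", " b ", " s ")" => algebraMap F E a + algebraMap F E b * s

section LocalField

variable (F) in
/-- The order of the residue field. -/
noncomputable def resCard : ℝ := (Nat.card 𝓀[F] : ℝ)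

variable (F) in
lemma one_lt_resCard : 1 < resCard F := by
  have := Finite.one_lt_card (α := 𝓀[F])
  unfold resCard
  exact_mod_cast this

variable (F) in
lemma resCard_pos : 0 < resCard F := zero_lt_one.trans (one_lt_resCard F)

@[simp] lemma normF_zero : normF F 0 = 0 := by simp [normF]

/-- The exponent of the absolute value. -/
noncomputable def logF (x : F) : ℤ := WithZero.log
  (IsNonarchimedeanLocalField.valueGroupWithZeroIsoInt F (ValuativeRel.valuation F x))

lemma normF_of_ne {x : F} (hx : x ≠ 0) : normF F x = resCard F ^ logF x := by
  simp [normF, hx, resCard, logF]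

lemma normF_nonneg (x : F) : 0 ≤ normF F x := by
  by_cases hx : x = 0
  · simp [hx]
  · rw [normF_of_ne hx]; exact (zpow_pos (resCard_pos F) _).le

lemma normF_pos {x : F} (hx : x ≠ 0) : 0 < normF F x := by
  rw [normF_of_ne hx]; exact zpow_pos (resCard_pos F) _

@[simp] lemma normF_eq_zero {x : F} : normF F x = 0 ↔ x = 0 :=
  ⟨fun h => by by_contra hx; exact (normF_pos hx).ne' h, fun h => by simp [h]⟩

lemma iso_ne_zero {x : F} (hx : x ≠ 0) : IsNonarchimedeanLocalField.valueGroupWithZeroIsoInt F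
    (ValuativeRel.valuation F x) ≠ 0 := by
  simpa using hx

lemma logF_mul {x y : F} (hx : x ≠ 0) (hy : y ≠ 0) : logF (x * y) = logF x + logF y := by
  unfold logF
  rw [map_mul, map_mul, WithZero.log_mul (iso_ne_zero hx) (iso_ne_zero hy)]

@[simp] lemma normF_mul (x y : F) : normF F (x * y) = normF F x * normF F y := by
  by_cases hx : x = 0
  · simp [hx]
  by_cases hy : y = 0
  · simp [hy]
  rw [normF_of_ne hx, normF_of_ne hy, normF_of_ne (mul_ne_zero hx hy), logF_mul hx hy,
    zpow_add₀ (resCard_pos F).ne']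

@[simp] lemma normF_one : normF F 1 = 1 := by
  have h := normF_mul (1 : F) 1
  have h0 : normF F 1 ≠ 0 := by simp
  rw [mul_one] at h
  exact (mul_right_cancel₀ h0 (by rw [one_mul]; exact h)).symm

variable (F) in
/-- The absolute value as a monoid homomorphism. -/
noncomputable def normHom : F →*₀ ℝ where
  toFun := normF F
  map_zero' := normF_zero
  map_one' := normF_one
  map_mul' := normF_mul

@[simp] lemma normF_pow (x : F) (m : ℕ) : normF F (x ^ m) = normF F x ^ m :=
  map_pow (normHom F) x m

@[simp] lemma normF_inv (x : F) : normF F x⁻¹ = (normF F x)⁻¹ := map_inv₀ (normHom F) x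

@[simp] lemma normF_zpow (x : F) (m : ℤ) : normF F (x ^ m) = normF F x ^ m :=
  map_zpow₀ (normHom F) x m

@[simp] lemma normF_div (x y : F) : normF F (x / y) = normF F x / normF F y :=
  map_div₀ (normHom F) x y

lemma normF_le_normF {x y : F} :
    normF F x ≤ normF F y ↔ ValuativeRel.valuation F x ≤ ValuativeRel.valuation F y := by
  by_cases hx : x = 0
  · simp [hx, normF_nonneg]
  by_cases hy : y = 0
  · simp only [hy, normF_zero, map_zero, le_zero_iff, map_eq_zero]
    exact ⟨fun h => absurd h (normF_pos hx).not_ge, fun h => absurd h hx⟩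
  rw [normF_of_ne hx, normF_of_ne hy, zpow_le_zpow_iff_right₀ (one_lt_resCard F), logF, logF,
    WithZero.log_le_log (iso_ne_zero hx) (iso_ne_zero hy), map_le_map_iff]

lemma normF_le_one {x : F} : normF F x ≤ 1 ↔ x ∈ 𝒪[F] := by
  rw [← normF_one (F := F), normF_le_normF, Valuation.mem_integer_iff, map_one]

@[simp] lemma normF_coe_le (x : 𝒪[F]) : normF F (x : F) ≤ 1 := normF_le_one.2 x.2

lemma normF_add_le (x y : F) : normF F (x + y) ≤ max (normF F x) (normF F y) := by
  rw [le_max_iff, normF_le_normF, normF_le_normF, ← le_max_iff]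
  exact Valuation.map_add _ _ _

@[simp] lemma normF_neg (x : F) : normF F (-x) = normF F x := by
  apply le_antisymm <;> rw [normF_le_normF, Valuation.map_neg]

lemma normF_sub_le (x y : F) : normF F (x - y) ≤ max (normF F x) (normF F y) := by
  rw [sub_eq_add_neg, ← normF_neg y]; exact normF_add_le _ _

lemma normF_isUnit {x : 𝒪[F]} : IsUnit x ↔ normF F (x : F) = 1 := by
  constructor
  · rintro ⟨u, rfl⟩
    have h : normF F ((u : 𝒪[F]) : F) * normF F (((u⁻¹ : 𝒪[F]ˣ) : 𝒪[F]) : F) = 1 := by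
      rw [← normF_mul, ← Subring.coe_mul, Units.mul_inv]; exact normF_one
    have h1 := normF_coe_le (u : 𝒪[F])
    have h2 := normF_coe_le ((u⁻¹ : 𝒪[F]ˣ) : 𝒪[F])
    have h3 := normF_nonneg ((u : 𝒪[F]) : F)
    nlinarith
  · intro h
    have hx : (x : F) ≠ 0 := by rintro h0; simp [h0] at h
    have hi : (x : F)⁻¹ ∈ 𝒪[F] := normF_le_one.1 (by rw [normF_inv, h, inv_one])
    exact IsUnit.of_mul_eq_one (⟨_, hi⟩ : 𝒪[F]) (Subtype.ext (mul_inv_cancel₀ hx))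

lemma normF_lt_one_iff {x : 𝒪[F]} : normF F (x : F) < 1 ↔ x ∈ 𝓂[F] := by
  rw [IsLocalRing.mem_maximalIdeal, mem_nonunits_iff, normF_isUnit]
  exact ⟨fun h => h.ne, fun h => lt_of_le_of_ne (normF_coe_le x) h⟩

variable {ϖ : 𝒪[F]} (hϖ : Irreducible ϖ)
include hϖ

lemma uniformizer_ne_zero : (ϖ : F) ≠ 0 := fun h => hϖ.ne_zero (Subtype.ext h)

omit hϖ in
variable (F) in
lemma exists_logF_eq (m : ℤ) : ∃ x : F, x ≠ 0 ∧ logF x = m := by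
  obtain ⟨y, hy⟩ := (IsNonarchimedeanLocalField.valueGroupWithZeroIsoInt F).surjective
    (WithZero.exp m)
  obtain ⟨x, rfl⟩ := ValuativeRel.valuation_surjective y
  refine ⟨x, ?_, ?_⟩
  · rintro rfl
    simp only [map_zero] at hy
    exact WithZero.exp_ne_zero hy.symm
  · exact (congrArg WithZero.log hy).trans (WithZero.log_exp m)

lemma normF_uniformizer : normF F (ϖ : F) = (resCard F)⁻¹ := by
  have h0 := uniformizer_ne_zero hϖ
  have hlt : normF F (ϖ : F) < 1 := by
    rw [normF_lt_one_iff, IsLocalRing.mem_maximalIdeal]; exact hϖ.not_isUnit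
  obtain ⟨x, hx, hl⟩ := exists_logF_eq F (-1)
  have hxn : normF F x = (resCard F)⁻¹ := by rw [normF_of_ne hx, hl, zpow_neg_one]
  have hx1 : normF F x < 1 := by rw [hxn]; exact inv_lt_one_of_one_lt₀ (one_lt_resCard F)
  have hxm : (⟨x, normF_le_one.1 hx1.le⟩ : 𝒪[F]) ∈ 𝓂[F] := normF_lt_one_iff.1 hx1
  rw [hϖ.maximalIdeal_eq, Ideal.mem_span_singleton] at hxm
  obtain ⟨c, hc⟩ := hxm
  have hc' : x = (ϖ : F) * c := congrArg Subtype.val hc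
  apply le_antisymm
  · rw [normF_of_ne h0] at hlt ⊢
    rw [← zpow_neg_one, zpow_le_zpow_iff_right₀ (one_lt_resCard F)]
    rw [← zpow_zero (resCard F), zpow_lt_zpow_iff_right₀ (one_lt_resCard F)] at hlt
    omega
  · rw [← hxn, hc', normF_mul]
    exact mul_le_of_le_one_right (normF_nonneg _) (normF_coe_le c)

omit hϖ in
lemma normF_lt_one_le {x : F} (h : normF F x < 1) : normF F x ≤ (resCard F)⁻¹ := by
  by_cases hx : x = 0
  · simp [hx, (resCard_pos F).le]
  rw [normF_of_ne hx] at h ⊢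
  rw [← zpow_neg_one, zpow_le_zpow_iff_right₀ (one_lt_resCard F)]
  rw [← zpow_zero (resCard F), zpow_lt_zpow_iff_right₀ (one_lt_resCard F)] at h
  omega

lemma mem_max_pow {x : 𝒪[F]} {m : ℕ} : x ∈ 𝓂[F] ^ m ↔ normF F (x : F) ≤ (resCard F ^ m)⁻¹ := by
  have h0 := uniformizer_ne_zero hϖ
  have hq := resCard_pos F
  rw [hϖ.maximalIdeal_eq, Ideal.span_singleton_pow, Ideal.mem_span_singleton]
  constructor
  · rintro ⟨c, rfl⟩
    simp only [Subring.coe_mul, SubmonoidClass.coe_pow, normF_mul, normF_pow, normF_uniformizer hϖ]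
    rw [inv_pow]
    exact mul_le_of_le_one_right (by positivity) (normF_coe_le c)
  · intro h
    have : (x : F) / (ϖ : F) ^ m ∈ 𝒪[F] := by
      rw [← normF_le_one, normF_div, normF_pow, normF_uniformizer hϖ, inv_pow]
      rw [div_le_one (by positivity)]; exact h
    exact ⟨⟨_, this⟩, Subtype.ext (by simp; field_simp)⟩

omit hϖ in
/-- A monic quadratic polynomial without roots has a single slope. -/
lemma normF_sq_le_of_no_root {T N : F} (h : ∀ x : F, x ^ 2 - T * x + N ≠ 0) :
    normF F T ^ 2 ≤ normF F N := by
  by_contra! hlt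
  have hT : T ≠ 0 := by rintro rfl; simp at hlt; exact absurd hlt (normF_nonneg _).not_gt
  letI := IsTopologicalAddGroup.rightUniformSpace F
  haveI := isUniformAddGroup_of_addCommGroup (G := F)
  have he : normF F (N / T ^ 2) < 1 := by
    rw [normF_div, normF_pow, div_lt_one (pow_pos (normF_pos hT) 2)]; exact hlt
  set ε : 𝒪[F] := ⟨N / T ^ 2, normF_le_one.1 he.le⟩
  have hε : ε ∈ 𝓂[F] := normF_lt_one_iff.1 he
  haveI : HenselianLocalRing 𝒪[F] :=
    { is_henselian := fun f hf a₀ h1 h2 =>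
        HenselianRing.is_henselian (I := 𝓂[F]) f hf a₀ h1 (h2.map _) }
  obtain ⟨a, ha, -⟩ := HenselianLocalRing.is_henselian
    (Polynomial.X ^ 2 - Polynomial.X + Polynomial.C ε : Polynomial 𝒪[F])
    (by monicity!) 0 (by simpa using hε) (by simp)
  have ha' : (a : F) ^ 2 - a + N / T ^ 2 = 0 := by
    have := congrArg Subtype.val ha
    simpa [Polynomial.IsRoot, ε] using this
  apply h (T * a)
  field_simp at ha'
  linear_combination ha'

end LocalField

section LocalFieldTopology

lemma exists_normF_eq_zpow (m : ℤ) : ∃ x : F, x ≠ 0 ∧ normF F x = resCard F ^ m := by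
  obtain ⟨x, hx, h⟩ := exists_logF_eq F m
  exact ⟨x, hx, by rw [normF_of_ne hx, h]⟩

lemma isCompact_normF_le (m : ℤ) : IsCompact {x : F | normF F x ≤ resCard F ^ m} := by
  obtain ⟨y, -, hy⟩ := exists_normF_eq_zpow (F := F) m
  have := IsNonarchimedeanLocalField.isCompact_closedBall F (ValuativeRel.valuation F y)
  simpa only [← normF_le_normF, hy] using this

lemma isOpen_normF_le (m : ℤ) : IsOpen {x : F | normF F x ≤ resCard F ^ m} := by
  obtain ⟨y, hy0, hy⟩ := exists_normF_eq_zpow (F := F) m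
  rw [isOpen_iff_mem_nhds]
  intro x hx
  rw [IsValuativeTopology.mem_nhds_iff']
  have h0 : ValuativeRel.valuation F y ≠ 0 := by simpa using hy0
  refine ⟨mk0 _ h0, fun z hz => ?_⟩
  have h1 : normF F (z - x) ≤ normF F y := by rw [normF_le_normF]; exact le_of_lt hz
  have : z = (z - x) + x := by ring
  simp only [Set.mem_ofPred_eq] at hx ⊢
  rw [this]
  exact (normF_add_le _ _).trans (max_le (h1.trans hy.le) hx)

lemma exists_normF_le_subset {U : Set F} (hU : U ∈ nhds (0 : F)) :
    ∃ m : ℕ, {x : F | normF F x ≤ (resCard F ^ m)⁻¹} ⊆ U := by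
  obtain ⟨γ, hγ, hsub⟩ := (IsValuativeTopology.hasBasis_nhds_zero' F).mem_iff.1 hU
  obtain ⟨y, rfl⟩ := ValuativeRel.valuation_surjective γ
  have hy : y ≠ 0 := by rintro rfl; simp at hγ
  refine ⟨(1 - logF y).toNat, fun x hx => hsub ?_⟩
  have h1 : normF F x < normF F y := by
    refine lt_of_le_of_lt hx ?_
    rw [normF_of_ne hy, ← zpow_natCast, ← zpow_neg, zpow_lt_zpow_iff_right₀ (one_lt_resCard F)]
    have := Int.self_le_toNat (1 - logF y)
    omega
  simp only [Set.mem_ofPred_eq]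
  rw [← not_le, ← normF_le_normF, not_le]; exact h1

omit [IsNonarchimedeanLocalField F] in
lemma circle_no_small {z : Circle} (h : ∀ k : ℕ, ‖((z ^ k : Circle) : ℂ) - 1‖ < 1 / 2) : z = 1 := by
  by_contra hz
  have hz' : ((z : ℂ) - 1) ≠ 0 := fun h0 => hz (by ext; simpa using sub_eq_zero.1 h0)
  have key : ∀ k : ℕ, (3 / 2 : ℝ) ^ k * ‖(z : ℂ) - 1‖ ≤ ‖((z ^ (2 ^ k) : Circle) : ℂ) - 1‖ := by
    intro k
    induction k with
    | zero => simp
    | succ k ih =>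
      set w : ℂ := ((z ^ (2 ^ k) : Circle) : ℂ) with hw
      have e : ((z ^ (2 ^ (k + 1)) : Circle) : ℂ) - 1 = (w - 1) * (w + 1) := by
        rw [hw, pow_succ, pow_mul]; push_cast; ring
      rw [e, norm_mul]
      have h1 : ‖w - 1‖ < 1 / 2 := h _
      have h2 : 3 / 2 ≤ ‖w + 1‖ := by
        have h3 : (2 : ℂ) = (w + 1) - (w - 1) := by ring
        have h4 : ‖(2 : ℂ)‖ ≤ ‖w + 1‖ + ‖w - 1‖ := by
          conv_lhs => rw [h3]
          exact norm_sub_le _ _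
        simp at h4; linarith
      have h5 := norm_nonneg (w - 1)
      rw [pow_succ]
      nlinarith
  have hp : 0 < ‖(z : ℂ) - 1‖ := norm_pos_iff.2 hz'
  obtain ⟨k, hk⟩ := pow_unbounded_of_one_lt (1 / ‖(z : ℂ) - 1‖) (by norm_num : (1 : ℝ) < 3 / 2)
  rw [div_lt_iff₀ hp] at hk
  linarith [key k, h (2 ^ k)]

/-- A continuous character is trivial on a small ball. -/
lemma exists_trivial_ball {ψ : AddChar F Circle} (hψ : Continuous ψ) :
    ∃ m : ℤ, ∀ x : F, normF F x ≤ resCard F ^ m → ψ x = 1 := by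
  have hU : {x : F | ‖((ψ x : Circle) : ℂ) - 1‖ < 1 / 2} ∈ nhds (0 : F) := by
    refine IsOpen.mem_nhds (isOpen_lt (by fun_prop) continuous_const) ?_
    simp
  obtain ⟨m, hm⟩ := exists_normF_le_subset hU
  refine ⟨-m, fun x hx => circle_no_small fun k => ?_⟩
  rw [← AddChar.map_nsmul_eq_pow]
  apply hm
  rw [zpow_neg, zpow_natCast] at hx
  refine le_trans ?_ hx
  rw [nsmul_eq_mul, normF_mul]
  refine mul_le_of_le_one_left (normF_nonneg _) (normF_le_one.2 (natCast_mem _ k))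

/-- The character of the residue field attached to a character of level one. -/
noncomputable def resChar (ψ : AddChar F Circle) (h : ∀ x : 𝒪[F], x ∈ 𝓂[F] → ψ x = 1) :
    AddChar 𝓀[F] Circle where
  toFun x := Quotient.liftOn' x (fun y : 𝒪[F] => ψ y) (fun a b hab => by
    have h1 : -a + b ∈ 𝓂[F] := QuotientAddGroup.leftRel_apply.1 hab
    have h2 := h _ h1
    have h3 : (b : F) = a + ((-a + b : 𝒪[F]) : F) := by push_cast; ring
    show ψ a = ψ b
    rw [h3, map_add_eq_mul, h2, mul_one])
  map_zero_eq_one' := by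
    show ψ ((0 : 𝒪[F]) : F) = 1
    simp
  map_add_eq_mul' a b := by
    induction a using Quotient.inductionOn'
    induction b using Quotient.inductionOn'
    rename_i a b
    show ψ ((a + b : 𝒪[F]) : F) = ψ a * ψ b
    push_cast; exact map_add_eq_mul _ _ _

lemma exists_level_one {ψ : AddChar F Circle} (hψ : Continuous ψ) (hψ' : ψ ≠ 1) :
    ∃ c : F, c ≠ 0 ∧ (∀ x : 𝒪[F], x ∈ 𝓂[F] → ψ (c * x) = 1) ∧ ∃ x : 𝒪[F], ψ (c * x) ≠ 1 := by
  obtain ⟨m, hm⟩ := exists_trivial_ball hψ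
  obtain ⟨a, ha⟩ : ∃ a, ψ a ≠ 1 := by by_contra! h; exact hψ' (by ext x; simp [h x])
  have ha0 : a ≠ 0 := by rintro rfl; simp at ha
  obtain ⟨M, hM, hmax⟩ := Int.exists_greatest_of_bdd
    (P := fun m => ∀ x : F, normF F x ≤ resCard F ^ m → ψ x = 1)
    ⟨logF a, fun z hz => by
      by_contra! hlt
      exact ha (hz a (by
        rw [normF_of_ne ha0, zpow_le_zpow_iff_right₀ (one_lt_resCard F)]; exact hlt.le))⟩ ⟨m, hm⟩
  obtain ⟨c, hc, hcn⟩ := exists_normF_eq_zpow (F := F) (M + 1)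
  refine ⟨c, hc, fun x hx => hM _ ?_, ?_⟩
  · have h1 := normF_lt_one_le (normF_lt_one_iff.2 hx)
    rw [normF_mul, hcn, zpow_add_one₀ (resCard_pos F).ne', mul_assoc]
    refine mul_le_of_le_one_right (zpow_pos (resCard_pos F) _).le ?_
    calc resCard F * normF F x ≤ resCard F * (resCard F)⁻¹ := by
          gcongr; exact (resCard_pos F).le
      _ = 1 := mul_inv_cancel₀ (resCard_pos F).ne'
  · by_contra! h
    have := hmax (M + 1) fun x hx => by
      have h1 : normF F (x / c) ≤ 1 := by
        rw [normF_div, hcn]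
        exact div_le_one_of_le₀ hx (zpow_pos (resCard_pos F) _).le
      have h2 := h ⟨x / c, normF_le_one.1 h1⟩
      simpa [mul_div_cancel₀, hc, mul_div_assoc'] using h2
    omega

/-- The character is trivial on the maximal ideal. -/
def TrivialOnMax (ψF : AddChar F Circle) : Prop := ∀ x : 𝒪[F], x ∈ 𝓂[F] → ψF x = 1

/-- The character is nontrivial on the integers. -/
def NontrivialOnInt (ψF : AddChar F Circle) : Prop := ∃ x : 𝒪[F], ψF x ≠ 1

/-- Two characters, one of them of level one, agree on `𝒪_F` after rescaling. -/
lemma exists_scaling {ψF ψ : AddChar F Circle} (hψF : TrivialOnMax ψF)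
    (hψF' : NontrivialOnInt ψF) (hψ : Continuous ψ) (hψ' : ψ ≠ 1) :
    ∃ c : F, c ≠ 0 ∧ ∀ x : F, normF F x ≤ 1 → ψ (c * x) = ψF (-x) := by
  obtain ⟨c, hc, h1, x1, hx1⟩ := exists_level_one hψ hψ'
  set ψ₂ : AddChar F Circle := ψ.mulShift c
  set χ := resChar ψ₂ h1
  set χF := resChar ψF hψF
  have hχ : χ ≠ 1 := fun h => hx1 (by
    have := DFunLike.congr_fun h (residue _ x1)
    change ψ (c * x1) = 1 at this
    exact this)
  have := ofFinite 𝓀[F]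
  set e := AddChar.circleEquivComplex (α := 𝓀[F])
  have hinj : Injective (fun a => e (χ.mulShift a)) :=
    e.injective.comp (AddChar.to_mulShift_inj_of_isPrimitive (AddChar.IsPrimitive.of_ne_one hχ))
  have hbij := (Fintype.bijective_iff_injective_and_card (fun a => e (χ.mulShift a))).2
    ⟨hinj, AddChar.card_eq.symm⟩
  obtain ⟨u, hu⟩ := hbij.2 (e (χF.mulShift (-1)))
  have hu' : χ.mulShift u = χF.mulShift (-1) := e.injective hu
  obtain ⟨u, rfl⟩ := residue_surjective u
  have key : ∀ x : 𝒪[F], ψ (c * (u * x)) = ψF (-x) := fun x => by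
    have := DFunLike.congr_fun hu' (residue _ x)
    simp only [AddChar.mulShift_apply] at this
    rw [← map_mul, neg_one_mul, ← map_neg] at this
    change ψ (c * ((u * x : 𝒪[F]) : F)) = ψF ((-x : 𝒪[F]) : F) at this
    simpa using this
  have hu0 : (u : F) ≠ 0 := by
    intro h0
    obtain ⟨x, hx⟩ := hψF'
    apply hx
    have := key (-x)
    simp only [h0, zero_mul, mul_zero, map_zero_eq_one] at this
    simpa using this.symm
  exact ⟨c * u, mul_ne_zero hc hu0, fun x hx => by
    have := key ⟨x, normF_le_one.1 hx⟩
    rw [mul_assoc]; exact this⟩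

end LocalFieldTopology

section QuaternionStructure

/-- `tr` and `nr` behave like the reduced trace and norm of a quaternion algebra. -/
structure IsQuat {F A : Type*} [Field F] [Ring A] [Algebra F A] (tr nr : A → F) : Prop where
  tr_add : ∀ a b, tr (a + b) = tr a + tr b
  tr_smul : ∀ (r : F) a, tr (r • a) = r * tr a
  tr_comm : ∀ a b, tr (a * b) = tr (b * a)
  tr_one : tr 1 = 2
  nr_mul : ∀ a b, nr (a * b) = nr a * nr b
  mul_star : ∀ a, a * (algebraMap F A (tr a) - a) = algebraMap F A (nr a)
  star_anti : ∀ a b, algebraMap F A (tr (a * b)) - a * b =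
    (algebraMap F A (tr b) - b) * (algebraMap F A (tr a) - a)

lemma isQuat_M2 (K : Type*) [Field K] : IsQuat (F := K) (A := M2 K) Matrix.trace Matrix.det where
  tr_add := Matrix.trace_add
  tr_smul r a := by simp
  tr_comm := trace_mul_comm
  tr_one := by simp
  nr_mul := det_mul
  mul_star a := by
    ext i j
    fin_cases i <;> fin_cases j <;>
      simp [Matrix.mul_apply, trace_fin_two, det_fin_two, Matrix.algebraMap_matrix_apply] <;>
      ring
  star_anti a b := by
    ext i j
    fin_cases i <;> fin_cases j <;>
      simp [Matrix.mul_apply, trace_fin_two, Matrix.algebraMap_matrix_apply] <;>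
      ring

/-- A matrix that is not scalar has only one monic quadratic annihilating polynomial. -/
lemma trace_det_of_quadratic {K : Type*} [Field K] (M : M2 K) (T N : K)
    (h : M * M - T • M + N • (1 : M2 K) = 0) (hM : ∀ e : K, M ≠ e • (1 : M2 K)) :
    M.trace = T ∧ M.det = N := by
  have h2 : M * M - M.trace • M + M.det • (1 : M2 K) = 0 := by
    have := (isQuat_M2 K).mul_star M
    rw [mul_sub, algebraMap_eq_smul_one, algebraMap_eq_smul_one] at this
    rw [← this]; simp
  have h3 : (M.trace - T) • M = (M.det - N) • (1 : M2 K) := by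
    rw [sub_smul, sub_smul]
    have := h.trans h2.symm
    rw [← sub_eq_zero] at this ⊢
    rw [← this]; abel
  have h4 : M.trace - T = 0 := by
    by_contra h0
    refine hM ((M.trace - T)⁻¹ * (M.det - N)) ?_
    rw [mul_smul, ← h3, smul_smul, inv_mul_cancel₀ h0, one_smul]
  rw [h4, zero_smul] at h3
  refine ⟨sub_eq_zero.1 h4, ?_⟩
  have := congrFun (congrFun h3 0) 0
  simp at this
  exact sub_eq_zero.1 this.symm

variable {F B : Type*} [Field F] [DivisionRing B] [Algebra F B] [Algebra.IsCentral F B]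

lemma mem_range_of_central {b : B} (h : ∀ x : B, b * x = x * b) : ∃ a : F, algebraMap F B a = b := by
  have : b ∈ Subalgebra.center F B := by rw [Subalgebra.mem_center_iff]; exact fun x => (h x).symm
  rw [Algebra.IsCentral.center_eq_bot] at this
  exact Algebra.mem_bot.1 this

variable (hB : finrank F B = 4)
include hB

lemma natDegree_minpoly_eq_two {b : B} (h : ∀ a : F, algebraMap F B a ≠ b) :
    (minpoly F b).natDegree = 2 := by
  have : FiniteDimensional F B := of_finrank_pos (by omega)
  have hint : IsIntegral F b := IsIntegral.of_finite F b
  have hirr : Irreducible (minpoly F b) := minpoly.irreducible hint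
  haveI : Fact (Irreducible (minpoly F b)) := ⟨hirr⟩
  let K := AdjoinRoot (minpoly F b)
  have hev : Polynomial.eval₂ (algebraMap F B) b (minpoly F b) = 0 := minpoly.aeval F b
  let φ : K →+* B := Ideal.Quotient.lift _
    ((aeval (R := F) b : Polynomial F →ₐ[F] B) : Polynomial F →+* B) (by
      intro p hp
      obtain ⟨r, rfl⟩ := Ideal.mem_span_singleton'.1 hp
      have : aeval b (minpoly F b) = 0 := minpoly.aeval F b
      simp [this])
  have hφ : ∀ p : Polynomial F, φ (AdjoinRoot.mk _ p) = aeval b p := fun p => rfl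
  have hφF : ∀ a : F, φ (algebraMap F K a) = algebraMap F B a := fun a => by
    have := hφ (Polynomial.C a)
    rw [Polynomial.aeval_C] at this; exact this
  letI : Module K B := Module.compHom B φ
  have hsm : ∀ (k : K) (x : B), k • x = φ k * x := fun _ _ => rfl
  haveI : IsScalarTower F K B := ⟨fun a k x => by
    rw [hsm, hsm, smul_def, smul_def, map_mul, hφF, mul_assoc]⟩
  have hdim : finrank F K = (minpoly F b).natDegree := by
    rw [(AdjoinRoot.powerBasis hirr.ne_zero).finrank, AdjoinRoot.powerBasis_dim]
  haveI : FiniteDimensional F K := (AdjoinRoot.powerBasis hirr.ne_zero).finite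
  haveI : Module.Free K B := inferInstance
  have hmul : finrank F K * finrank K B = 4 := by rw [Module.finrank_mul_finrank, hB]
  rw [hdim] at hmul
  set d := (minpoly F b).natDegree with hd
  have hdvd : d ∣ 4 := ⟨_, hmul.symm⟩
  have hle := Nat.le_of_dvd (by norm_num) hdvd
  have h1 : d ≠ 1 := by
    intro h1
    obtain ⟨a, ha⟩ := minpoly.mem_range_of_degree_eq_one F b
      (by rw [Polynomial.degree_eq_natDegree hirr.ne_zero, ← hd, h1]; rfl)
    exact h a ha
  have h4 : d ≠ 4 := by
    intro h4
    let L : K →ₗ[F] B :=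
      { toFun := φ, map_add' := map_add φ
        map_smul' := fun a k => by
          simp only [RingHom.id_apply]
          rw [smul_def, smul_def, map_mul, hφF] }
    have hinj : Injective L := φ.injective
    have hsurj : Function.Surjective L := (LinearMap.injective_iff_surjective_of_finrank_eq_finrank
        (by rw [hdim, hB]; exact h4)).1 hinj
    obtain ⟨a, ha⟩ := mem_range_of_central (F := F) (b := b) (fun x => by
      obtain ⟨y, hy⟩ := hsurj b
      obtain ⟨z, hz⟩ := hsurj x
      have : φ y * φ z = φ z * φ y := by rw [← map_mul, ← map_mul, mul_comm]
      rw [← hz]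
      rwa [show φ y = b from hy] at this)
    exact h a ha
  interval_cases d
  · omega
  · omega
  · rfl
  · omega
  · omega

lemma redCharpoly_monic_natDegree (b : B) :
    (redCharpoly (F := F) b).Monic ∧ (redCharpoly (F := F) b).natDegree = 2 ∧
      aeval b (redCharpoly (F := F) b) = 0 := by
  have : FiniteDimensional F B := of_finrank_pos (by omega)
  have hint : IsIntegral F b := IsIntegral.of_finite F b
  have hm := minpoly.monic hint
  by_cases h : ∃ a : F, algebraMap F B a = b
  · obtain ⟨a, rfl⟩ := h
    have e : redCharpoly (F := F) (algebraMap F B a) = (Polynomial.X - Polynomial.C a) ^ 2 := by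
      simp [redCharpoly, minpoly.eq_X_sub_C]
    rw [e]
    refine ⟨(Polynomial.monic_X_sub_C a).pow 2, by simp, by simp⟩
  · push Not at h
    have h2 := natDegree_minpoly_eq_two hB h
    have e : redCharpoly (F := F) b = minpoly F b := by simp [redCharpoly, h2]
    rw [e]
    exact ⟨hm, h2, minpoly.aeval F b⟩

lemma redChar_quadratic (b : B) :
    b * b - redTrace (F := F) b • b + redNorm (F := F) b • (1 : B) = 0 := by
  obtain ⟨hm, hd, he⟩ := redCharpoly_monic_natDegree hB b
  rw [Polynomial.aeval_eq_sum_range, hd] at he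
  have hl : (redCharpoly (F := F) b).coeff 2 = 1 := by rw [← hd]; exact hm
  simp [Finset.sum_range_succ, hl] at he
  rw [redTrace, redNorm, neg_smul, sub_neg_eq_add, ← he]
  rw [pow_two]; abel

omit hB [Algebra.IsCentral F B] in
lemma redChar_algebraMap (a : F) :
    redTrace (F := F) (algebraMap F B a) = 2 * a ∧ redNorm (F := F) (algebraMap F B a) = a ^ 2 := by
  have e : redCharpoly (F := F) (algebraMap F B a) =
      Polynomial.X ^ 2 - Polynomial.C (2 * a) * Polynomial.X + Polynomial.C (a ^ 2) := by
    simp only [redCharpoly, minpoly.eq_X_sub_C, map_mul, map_ofNat, map_pow,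
      Polynomial.natDegree_X_sub_C]
    ring
  constructor
  · rw [redTrace, e]; generalize a ^ 2 = n; simp [Polynomial.coeff_C]
  · rw [redNorm, e]; generalize a ^ 2 = n; simp

variable {E : Type*} [Field E] [Algebra F E] (hE : finrank F E = 2) (ι : E →ₐ[F] B)
include hE ι

/-- A quaternion division algebra acts on itself, as a right vector space of dimension two over a
quadratic subfield. -/
lemma exists_matrix_rep : ∃ φ : B →+* M2 E,
    ∀ a : F, φ (algebraMap F B a) = algebraMap F E a • (1 : M2 E) := by
  have : FiniteDimensional F B := of_finrank_pos (by omega)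
  have : FiniteDimensional F E := of_finrank_pos (by omega)
  let op : E →+* Bᵐᵒᵖ := (ι.toRingHom.op).comp (RingEquiv.toOpposite E : E ≃+* Eᵐᵒᵖ).toRingHom
  letI : Module E B := Module.compHom B op
  have hsm : ∀ (e : E) (x : B), e • x = x * ι e := fun _ _ => rfl
  haveI : IsScalarTower F E B := ⟨fun a k x => by rw [hsm, hsm, map_smul, mul_smul_comm]⟩
  haveI : FiniteDimensional E B := Module.Finite.of_restrictScalars_finite F E B
  have h2 : finrank E B = 2 := by
    have := Module.finrank_mul_finrank F E B
    rw [hE, hB] at this; omega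
  let bs : Module.Basis (Fin 2) E B := Module.finBasisOfFinrankEq E B h2
  let lm : B →+* End E B :=
    { toFun := fun b =>
        { toFun := fun x => b * x, map_add' := mul_add b
          map_smul' := fun e x => by simp [hsm, mul_assoc] }
      map_one' := by ext x; simp
      map_mul' := fun a b => by ext x; simp [mul_assoc]
      map_zero' := by ext x; simp
      map_add' := fun a b => by ext x; simp [add_mul] }
  refine ⟨((LinearMap.toMatrixAlgEquiv bs : End E B ≃ₐ[E] _) : _ →+* _).comp lm, fun a => ?_⟩
  have : lm (algebraMap F B a) = algebraMap F E a • (1 : End E B) := by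
    ext x
    show algebraMap F B a * x = algebraMap F E a • x
    rw [hsm, commutes, Algebra.commutes]
  simp only [RingHom.comp_apply, this]
  show LinearMap.toMatrixAlgEquiv bs _ = _
  rw [map_smul, map_one]

lemma exists_matrix_rep_compat : ∃ φ : B →+* M2 E, Injective φ ∧
    (∀ a : F, φ (algebraMap F B a) = algebraMap F E a • (1 : M2 E)) ∧
    ∀ b, (φ b).trace = algebraMap F E (redTrace b) ∧ (φ b).det = algebraMap F E (redNorm b) := by
  obtain ⟨φ, hφ⟩ := exists_matrix_rep hB hE ι
  have hinj : Injective φ := φ.injective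
  refine ⟨φ, hinj, hφ, fun b => ?_⟩
  by_cases hb : ∃ a : F, algebraMap F B a = b
  · obtain ⟨a, rfl⟩ := hb
    rw [hφ, (redChar_algebraMap a).1, (redChar_algebraMap a).2]
    rw [trace_smul, Matrix.trace_one, Matrix.det_smul, Matrix.det_one, map_mul, map_pow, map_ofNat]
    simp [mul_comm]
  · apply trace_det_of_quadratic
    · have := congrArg φ (redChar_quadratic hB b)
      rw [smul_def, smul_def] at this
      simpa [hφ] using this
    · intro e he
      apply hb
      apply mem_range_of_central
      intro x
      apply hinj
      rw [map_mul, map_mul, he]; simp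

lemma isQuat_B : IsQuat (F := F) (A := B) redTrace redNorm := by
  obtain ⟨φ, hinj, hφ, hc⟩ := exists_matrix_rep_compat hB hE ι
  have hi : Injective (algebraMap F E) := (algebraMap F E).injective
  have hM := isQuat_M2 E
  have hstar : ∀ b, φ (algebraMap F B (redTrace b) - b) = algebraMap E (M2 E) (φ b).trace - φ b := by
    intro b
    rw [map_sub, hφ, (hc b).1, ← algebraMap_eq_smul_one (A := M2 E)]
  refine ⟨fun a b => hi ?_, fun r a => hi ?_, fun a b => hi ?_, hi ?_, fun a b => hi ?_,
    fun a => hinj ?_, fun a b => hinj ?_⟩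
  · rw [map_add, ← (hc _).1, ← (hc _).1, ← (hc _).1, map_add, hM.tr_add]
  · rw [map_mul, ← (hc _).1, ← (hc _).1, smul_def, map_mul, hφ, smul_mul_assoc, one_mul, hM.tr_smul]
  · rw [← (hc _).1, ← (hc _).1, map_mul, map_mul, hM.tr_comm]
  · rw [← (hc _).1, map_one, hM.tr_one, map_ofNat]
  · rw [map_mul, ← (hc _).2, ← (hc _).2, ← (hc _).2, map_mul, hM.nr_mul]
  · rw [map_mul, hstar, hM.mul_star, hφ, (hc _).2, algebraMap_eq_smul_one]
  · rw [hstar, map_mul, map_mul, hstar, hstar, hM.star_anti]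

omit hE in
/-- Trace and norm of elements of `E` are the same in `M₂(F)` as in `B`. -/
lemma trace_det_eq (ι₁ : E →ₐ[F] M2 F) (x : E) :
    (ι₁ x).trace = redTrace (ι x) ∧ (ι₁ x).det = redNorm (ι x) := by
  by_cases hx : ∃ a : F, algebraMap F E a = x
  · obtain ⟨a, rfl⟩ := hx
    rw [commutes, commutes, (redChar_algebraMap a).1, (redChar_algebraMap a).2]
    simp [trace_fin_two, det_fin_two, Matrix.algebraMap_matrix_apply]
    constructor <;> ring
  · have hq : x * x - redTrace (F := F) (ι x) • x + redNorm (F := F) (ι x) • (1 : E) = 0 := by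
      apply ι.injective
      simpa using redChar_quadratic hB (ι x)
    apply trace_det_of_quadratic
    · simpa using congrArg ι₁ hq
    · intro e he
      apply hx
      refine ⟨e, ι₁.injective ?_⟩
      change ι₁ _ = ι₁ x
      rw [he, commutes, algebraMap_eq_smul_one]

end QuaternionStructure

section QuatGeneral

variable {F A : Type*} [Field F] [Ring A] [Algebra F A] {tr nr : A → F} (h : IsQuat tr nr)
include h

lemma IsQuat.tr_zero : tr 0 = 0 := by simpa using h.tr_smul 0 0

lemma IsQuat.tr_neg (a : A) : tr (-a) = - tr a := by simpa using h.tr_smul (-1) a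

lemma IsQuat.tr_sub (a b : A) : tr (a - b) = tr a - tr b := by
  rw [sub_eq_add_neg, h.tr_add, h.tr_neg, sub_eq_add_neg]

lemma IsQuat.tr_algebraMap_mul (r : F) (a : A) : tr (algebraMap F A r * a) = r * tr a := by
  rw [← smul_def, h.tr_smul]

lemma IsQuat.tr_algebraMap (r : F) : tr (algebraMap F A r) = 2 * r := by
  have := h.tr_algebraMap_mul r 1
  rw [mul_one, h.tr_one] at this
  rw [this, mul_comm]

lemma IsQuat.quad (a : A) : a * a - algebraMap F A (tr a) * a + algebraMap F A (nr a) = 0 := by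
  rw [← h.mul_star a, mul_sub, Algebra.commutes]; abel

variable [Nontrivial A]

lemma IsQuat.nr_add_one (a : A) : nr (a + 1) = nr a + tr a + 1 := by
  apply (algebraMap F A).injective
  rw [← h.mul_star (a + 1), h.tr_add, h.tr_one]
  simp only [map_add, map_one, ← h.mul_star a, map_ofNat]
  have := Algebra.commutes (R := F) (tr a) a
  noncomm_ring

lemma IsQuat.nr_algebraMap (r : F) : nr (algebraMap F A r) = r ^ 2 := by
  apply (algebraMap F A).injective
  rw [← h.mul_star, h.tr_algebraMap, ← map_sub, ← map_mul]; congr 1; ring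

lemma IsQuat.nr_one : nr 1 = 1 := by
  have := h.nr_algebraMap 1; simpa using this

lemma IsQuat.nr_zero : nr 0 = 0 := by
  have := h.nr_algebraMap 0; simpa using this

lemma IsQuat.nr_neg (a : A) : nr (-a) = nr a := by
  have h1 := h.nr_mul (algebraMap F A (-1)) a
  rw [h.nr_algebraMap] at h1; simpa using h1

/-- The canonical involution has the same norm. -/
lemma IsQuat.nr_star (a : A) (ha : nr a ≠ 0) : nr (algebraMap F A (tr a) - a) = nr a := by
  have h1 := congrArg nr (h.mul_star a)
  rw [h.nr_mul, h.nr_algebraMap, pow_two] at h1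
  exact mul_left_cancel₀ ha h1

end QuatGeneral

section DivisionNorm

variable {A : Type*} [DivisionRing A] [Algebra F A] {tr nr : A → F} (h : IsQuat tr nr)

/-- The norm on a division algebra attached to its reduced norm. -/
noncomputable def nrm (nr : A → F) (a : A) : ℝ := normF F (nr a)

omit [Algebra F A] in
lemma nrm_nonneg (nr : A → F) (a : A) : 0 ≤ nrm nr a := normF_nonneg _

include h

@[simp] lemma IsQuat.nrm_mul (a b : A) : nrm nr (a * b) = nrm nr a * nrm nr b := by
  simp [nrm, h.nr_mul]

@[simp] lemma IsQuat.nrm_one : nrm nr (1 : A) = 1 := by simp [nrm, h.nr_one]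

@[simp] lemma IsQuat.nrm_zero : nrm nr (0 : A) = 0 := by simp [nrm, h.nr_zero]

@[simp] lemma IsQuat.nrm_neg (a : A) : nrm nr (-a) = nrm nr a := by simp [nrm, h.nr_neg]

lemma IsQuat.nrm_algebraMap (r : F) : nrm nr (algebraMap F A r) = normF F r ^ 2 := by
  simp [nrm, h.nr_algebraMap]

lemma IsQuat.nrm_pos {a : A} (ha : a ≠ 0) : 0 < nrm nr a := by
  refine lt_of_le_of_ne (nrm_nonneg _ _) fun h0 => ?_
  have := h.nrm_mul a a⁻¹
  rw [mul_inv_cancel₀ ha, h.nrm_one, ← h0, zero_mul] at this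
  exact one_ne_zero this

lemma IsQuat.nr_ne_zero {a : A} (ha : a ≠ 0) : nr a ≠ 0 := fun h0 => by
  have := h.nrm_pos ha
  simp [nrm, h0] at this

@[simp] lemma IsQuat.nrm_inv (a : A) : nrm nr a⁻¹ = (nrm nr a)⁻¹ := by
  by_cases ha : a = 0
  · simp [ha, h.nrm_zero]
  · exact eq_inv_of_mul_eq_one_left (by rw [← h.nrm_mul, inv_mul_cancel₀ ha, h.nrm_one])

lemma IsQuat.nrm_pow (a : A) (m : ℕ) : nrm nr (a ^ m) = nrm nr a ^ m := by
  induction m with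
  | zero => simp [h.nrm_one]
  | succ m ih => rw [pow_succ, h.nrm_mul, ih, pow_succ]

lemma IsQuat.nrm_zpow (a : A) (m : ℤ) : nrm nr (a ^ m) = nrm nr a ^ m := by
  cases m with
  | ofNat m => simp [h.nrm_pow]
  | negSucc m => simp [zpow_negSucc, h.nrm_inv, h.nrm_pow]

lemma IsQuat.norm_tr_sq_le (a : A) : normF F (tr a) ^ 2 ≤ nrm nr a := by
  by_cases ha : ∃ r : F, algebraMap F A r = a
  · obtain ⟨r, rfl⟩ := ha
    rw [h.tr_algebraMap, h.nrm_algebraMap, normF_mul, mul_pow]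
    refine mul_le_of_le_one_left (by positivity) (pow_le_one₀ (normF_nonneg _) ?_)
    exact normF_le_one.2 (ofNat_mem _ 2)
  · refine normF_sq_le_of_no_root fun x hx => ?_
    have h1 : (a - algebraMap F A x) * (a - algebraMap F A (tr a - x)) = 0 := by
      have h2 := h.quad a
      have h3 : nr a = tr a * x - x ^ 2 := by linear_combination hx
      rw [h3] at h2
      rw [← h2]
      have h4 := Algebra.commutes (R := F) (tr a) a
      have h5 := Algebra.commutes (R := F) x a
      simp only [map_sub, map_mul, map_pow]
      have h6 := Algebra.commutes (R := F) (tr a) (algebraMap F A x)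
      simp only [sub_mul, mul_sub, h4, h5, h6, pow_two]; abel
    rcases mul_eq_zero.1 h1 with h2 | h2
    · exact ha ⟨_, (sub_eq_zero.1 h2).symm⟩
    · exact ha ⟨_, (sub_eq_zero.1 h2).symm⟩

lemma IsQuat.nrm_add_le (a b : A) : nrm nr (a + b) ≤ max (nrm nr a) (nrm nr b) := by
  have key : ∀ c : A, nrm nr c ≤ 1 → nrm nr (c + 1) ≤ 1 := by
    intro c hc
    have ht : normF F (tr c) ≤ 1 := by
      have := (h.norm_tr_sq_le c).trans hc
      by_contra! hlt
      nlinarith [normF_nonneg (tr c)]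
    rw [nrm, h.nr_add_one]
    refine (normF_add_le _ _).trans (max_le ((normF_add_le _ _).trans (max_le hc ht)) (by simp))
  have main : ∀ a b : A, nrm nr a ≤ nrm nr b → nrm nr (a + b) ≤ nrm nr b := by
    intro a b hab
    by_cases hb : b = 0
    · subst hb; simpa using hab
    have e : a + b = (a * b⁻¹ + 1) * b := by rw [add_mul, mul_assoc, inv_mul_cancel₀ hb]; simp
    have hb' := h.nrm_pos hb
    rw [e, h.nrm_mul]
    refine mul_le_of_le_one_left hb'.le (key _ ?_)
    rw [h.nrm_mul, h.nrm_inv, ← div_eq_mul_inv]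
    exact div_le_one_of_le₀ hab hb'.le
  rcases le_total (nrm nr a) (nrm nr b) with hab | hab
  · exact (main a b hab).trans (le_max_right _ _)
  · rw [add_comm]; exact (main b a hab).trans (le_max_left _ _)

lemma IsQuat.nrm_sub_le (a b : A) : nrm nr (a - b) ≤ max (nrm nr a) (nrm nr b) := by
  rw [sub_eq_add_neg, ← h.nrm_neg b]; exact h.nrm_add_le _ _

lemma IsQuat.nrm_add_le_of {a b : A} {r : ℝ} (ha : nrm nr a ≤ r) (hb : nrm nr b ≤ r) :
    nrm nr (a + b) ≤ r := (h.nrm_add_le a b).trans (max_le ha hb)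

lemma IsQuat.nrm_sub_le_of {a b : A} {r : ℝ} (ha : nrm nr a ≤ r) (hb : nrm nr b ≤ r) :
    nrm nr (a - b) ≤ r := (h.nrm_sub_le a b).trans (max_le ha hb)

lemma IsQuat.nrm_eq_of_lt {a b : A} (hab : nrm nr a < nrm nr b) : nrm nr (a + b) = nrm nr b := by
  refine le_antisymm ((h.nrm_add_le a b).trans (max_le hab.le le_rfl)) ?_
  by_contra! hlt
  have := h.nrm_sub_le (a + b) a
  rw [add_sub_cancel_left] at this
  exact absurd this (not_le.2 (max_lt hlt hab))

lemma IsQuat.nrm_sum_le {κ : Type*} (s : Finset κ) (f : κ → A) {r : ℝ} (hr : 0 ≤ r)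
    (hf : ∀ i ∈ s, nrm nr (f i) ≤ r) : nrm nr (∑ i ∈ s, f i) ≤ r := by
  classical
  induction s using Finset.induction_on with
  | empty => simpa [h.nrm_zero] using hr
  | insert a s ha ih =>
    rw [Finset.sum_insert ha]
    exact h.nrm_add_le_of (hf _ (Finset.mem_insert_self _ _))
      (ih fun i hi => hf i (Finset.mem_insert_of_mem hi))

lemma IsQuat.normF_tr_le_one {a : A} (ha : nrm nr a ≤ 1) : normF F (tr a) ≤ 1 := by
  have := (h.norm_tr_sq_le a).trans ha
  by_contra! hlt
  nlinarith [normF_nonneg (tr a)]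

lemma IsQuat.normF_tr_lt_one {a : A} (ha : nrm nr a < 1) : normF F (tr a) < 1 := by
  have := (h.norm_tr_sq_le a).trans_lt ha
  by_contra! hlt
  nlinarith [normF_nonneg (tr a)]

lemma IsQuat.nrm_star (a : A) : nrm nr (algebraMap F A (tr a) - a) = nrm nr a := by
  by_cases ha : a = 0
  · simp [ha, h.tr_zero]
  · rw [nrm, h.nr_star a (h.nr_ne_zero ha), nrm]

end DivisionNorm

section QuadraticExtension

variable {tr nr : E → F} (h : IsQuat tr nr)
include h

lemma mem_OE_iff {x : E} : x ∈ integralClosure 𝒪[F] E ↔ nrm nr x ≤ 1 := by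
  constructor
  · rintro ⟨p, hp, hx⟩
    by_contra! hlt
    have hx0 : x ≠ 0 := by rintro rfl; simp [h.nrm_zero] at hlt; linarith
    rcases Nat.eq_zero_or_pos p.natDegree with h0 | hpos
    · rw [(Polynomial.Monic.natDegree_eq_zero hp).1 h0] at hx; simp at hx
    rw [Polynomial.eval₂_eq_sum_range, Finset.sum_range_succ, hp.coeff_natDegree, map_one,
      one_mul, add_eq_zero_iff_eq_neg'] at hx
    have h1 : nrm nr (x ^ p.natDegree) ≤ nrm nr x ^ (p.natDegree - 1) := by
      rw [hx, h.nrm_neg]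
      refine h.nrm_sum_le _ _ (by positivity) fun i hi => ?_
      rw [h.nrm_mul, h.nrm_pow]
      have h2 : nrm nr (algebraMap 𝒪[F] E (p.coeff i)) ≤ 1 := by
        have : algebraMap 𝒪[F] E (p.coeff i) = algebraMap F E (p.coeff i : F) := rfl
        rw [this, h.nrm_algebraMap]
        exact pow_le_one₀ (normF_nonneg _) (normF_coe_le _)
      refine (mul_le_of_le_one_left (pow_nonneg (nrm_nonneg _ _) _) h2).trans
        (pow_le_pow_right₀ hlt.le ?_)
      have := Finset.mem_range.1 hi
      omega
    rw [h.nrm_pow] at h1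
    have := (pow_le_pow_iff_right₀ hlt).1 h1
    omega
  · intro hx
    have ht := normF_le_one.1 (h.normF_tr_le_one hx)
    have hn := normF_le_one.1 hx
    refine ⟨Polynomial.X ^ 2 - Polynomial.C (⟨tr x, ht⟩ : 𝒪[F]) * Polynomial.X +
      Polynomial.C (⟨nr x, hn⟩ : 𝒪[F]), by monicity!, ?_⟩
    have := h.quad x
    simp only [Polynomial.eval₂_add, Polynomial.eval₂_sub, Polynomial.eval₂_mul,
      Polynomial.eval₂_X, Polynomial.eval₂_X_pow, Polynomial.eval₂_C]
    rw [pow_two]; exact this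

lemma nrm_OE_le (x : OE F E) : nrm nr (x : E) ≤ 1 := (mem_OE_iff h).1 x.2

lemma isUnit_OE_iff {x : OE F E} : IsUnit x ↔ nrm nr (x : E) = 1 := by
  constructor
  · rintro ⟨u, rfl⟩
    have h1 : nrm nr ((u : OE F E) : E) * nrm nr (((u⁻¹ : (OE F E)ˣ) : OE F E) : E) = 1 := by
      rw [← h.nrm_mul, ← MulMemClass.coe_mul, Units.mul_inv]; exact h.nrm_one
    have h2 := nrm_OE_le h (u : OE F E)
    have h3 := nrm_OE_le h ((u⁻¹ : (OE F E)ˣ) : OE F E)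
    have h4 := nrm_nonneg nr ((u : OE F E) : E)
    nlinarith
  · intro hx
    have hx0 : (x : E) ≠ 0 := by rintro h0; rw [h0, h.nrm_zero] at hx; exact zero_ne_one hx
    have hi : (x : E)⁻¹ ∈ integralClosure 𝒪[F] E := (mem_OE_iff h).2 (by rw [h.nrm_inv, hx, inv_one])
    exact IsUnit.of_mul_eq_one (⟨_, hi⟩ : OE F E) (Subtype.ext (mul_inv_cancel₀ hx0))

lemma exists_unit_OE {x : E} (hx : nrm nr x = 1) : ∃ u : (OE F E)ˣ, ((u : OE F E) : E) = x := by
  obtain ⟨u, hu⟩ := (isUnit_OE_iff h (x := ⟨x, (mem_OE_iff h).2 hx.le⟩)).2 hx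
  exact ⟨u, by rw [hu]⟩

lemma mem_maxE_iff {x : OE F E} : x ∈ maxE F E ↔ nrm nr (x : E) < 1 := by
  rw [maxE, Ideal.mem_jacobson_bot]
  constructor
  · intro hx
    refine lt_of_le_of_ne (nrm_OE_le h x) fun h1 => ?_
    obtain ⟨u, hu⟩ := (isUnit_OE_iff h).2 h1
    have e : x * (-((u⁻¹ : (OE F E)ˣ) : OE F E)) + 1 = 0 := by
      rw [← hu]
      exact (congrArg (· + 1) ((mul_neg _ _).trans (congrArg Neg.neg u.mul_inv))).trans
        (neg_add_cancel 1)
    exact not_isUnit_zero ((congrArg IsUnit e).mp (hx _))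
  · intro hx y
    rw [isUnit_OE_iff h]
    have h1 : nrm nr ((x : E) * y) < 1 := by
      rw [h.nrm_mul]
      exact lt_of_le_of_lt (mul_le_of_le_one_right (nrm_nonneg _ _) (nrm_OE_le h y)) hx
    have := h.nrm_eq_of_lt (a := (x : E) * y) (b := 1) (by rwa [h.nrm_one])
    rw [h.nrm_one] at this
    exact this

variable {ϖ : 𝒪[F]} (hϖ : Irreducible ϖ) {t : OE F E} (ht : Ideal.span {t} = maxE F E)
include ht

lemma gen_le {x : E} (hx : nrm nr x < 1) : nrm nr x ≤ nrm nr (t : E) := by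
  have : (⟨x, (mem_OE_iff h).2 hx.le⟩ : OE F E) ∈ maxE F E := (mem_maxE_iff h).2 hx
  rw [← ht, Ideal.mem_span_singleton] at this
  obtain ⟨c, hc⟩ := this
  have hc' : x = (t : E) * c := congrArg Subtype.val hc
  rw [hc', h.nrm_mul]
  exact mul_le_of_le_one_right (nrm_nonneg _ _) (nrm_OE_le h c)

lemma gen_lt_one : nrm nr (t : E) < 1 := by
  rw [← mem_maxE_iff h, ← ht]; exact Ideal.mem_span_singleton_self t

include hϖ in
lemma gen_ne_zero : (t : E) ≠ 0 := by
  intro h0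
  have h1 : nrm nr (algebraMap F E ϖ) = (resCard F)⁻¹ ^ 2 := by
    rw [h.nrm_algebraMap, normF_uniformizer hϖ]
  have hq := one_lt_resCard F
  have h2 : nrm nr (algebraMap F E ϖ) < 1 := by
    rw [h1]; exact pow_lt_one₀ (by positivity) (inv_lt_one_of_one_lt₀ hq) (by norm_num)
  have := gen_le h ht h2
  rw [h0, h.nrm_zero, h1] at this
  have : 0 < (resCard F)⁻¹ ^ 2 := by positivity
  linarith

include hϖ in
lemma gen_pos : 0 < nrm nr (t : E) := h.nrm_pos (gen_ne_zero h hϖ ht)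

include hϖ in
lemma mem_pE_iff {x : E} {m : ℕ} : x ∈ pE F E m ↔ nrm nr x ≤ nrm nr (t : E) ^ m := by
  have ht0 := gen_ne_zero h hϖ ht
  rw [pE, ← ht, Ideal.span_singleton_pow]
  constructor
  · rintro ⟨y, hy, rfl⟩
    obtain ⟨c, rfl⟩ := Ideal.mem_span_singleton.1 hy
    simp only [MulMemClass.coe_mul, SubmonoidClass.coe_pow, h.nrm_mul, h.nrm_pow]
    exact mul_le_of_le_one_right (pow_nonneg (nrm_nonneg _ _) _) (nrm_OE_le h c)
  · intro hx
    have hc : x / (t : E) ^ m ∈ integralClosure 𝒪[F] E := by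
      rw [mem_OE_iff h, div_eq_mul_inv, h.nrm_mul, h.nrm_inv, h.nrm_pow, ← div_eq_mul_inv]
      exact div_le_one_of_le₀ hx (pow_nonneg (nrm_nonneg _ _) _)
    refine ⟨t ^ m * ⟨_, hc⟩, Ideal.mem_span_singleton.2 ⟨_, rfl⟩, ?_⟩
    simp only [MulMemClass.coe_mul, SubmonoidClass.coe_pow]
    field_simp

include hϖ in
lemma nrm_of_hasOrd {x : E} {m : ℤ} (hx : HasOrd F x m) : nrm nr x = nrm nr (t : E) ^ m := by
  obtain ⟨u, t', ht', rfl⟩ := hx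
  have h1 : nrm nr (t' : E) = nrm nr (t : E) :=
    le_antisymm (gen_le h ht (gen_lt_one h ht')) (gen_le h ht' (gen_lt_one h ht))
  rw [h.nrm_mul, h.nrm_zpow, h1, (isUnit_OE_iff h).1 u.isUnit, one_mul]

include hϖ in
lemma gen_nrm_of_unramified (hu : Unramified F E) : nrm nr (t : E) = (resCard F)⁻¹ ^ 2 := by
  have h1 : nrm nr (algebraMap F E ϖ) = (resCard F)⁻¹ ^ 2 := by
    rw [h.nrm_algebraMap, normF_uniformizer hϖ]
  rw [← h1]
  have e : Ideal.span {algebraMap 𝒪[F] (OE F E) ϖ} = maxE F E := by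
    rw [← hu, hϖ.maximalIdeal_eq, Ideal.map_span, Set.image_singleton]
  exact le_antisymm (gen_le h e (gen_lt_one h ht)) (gen_le h ht (gen_lt_one h e))

include hϖ in
lemma gen_nrm_of_ramified (hu : ¬ Unramified F E) : nrm nr (t : E) = (resCard F)⁻¹ := by
  have hq := one_lt_resCard F
  have h1 : nrm nr (algebraMap F E ϖ) = (resCard F)⁻¹ ^ 2 := by
    rw [h.nrm_algebraMap, normF_uniformizer hϖ]
  have h2 : nrm nr (algebraMap F E ϖ) < 1 := by
    rw [h1]; exact pow_lt_one₀ (by positivity) (inv_lt_one_of_one_lt₀ hq) (by norm_num)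
  set y : E := algebraMap F E ϖ / t with hy
  have ht0 := gen_ne_zero h hϖ ht
  have hyt : algebraMap F E ϖ = y * t := by rw [hy]; field_simp
  have hle := gen_le h ht h2
  have hpos := gen_pos h hϖ ht
  have hy1 : nrm nr y ≤ 1 := by
    rw [hy, div_eq_mul_inv, h.nrm_mul, h.nrm_inv, ← div_eq_mul_inv]
    exact div_le_one_of_le₀ hle hpos.le
  have hy2 : nrm nr y < 1 := by
    refine lt_of_le_of_ne hy1 fun h3 => hu ?_
    rw [Unramified, hϖ.maximalIdeal_eq, Ideal.map_span, Set.image_singleton, ← ht]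
    obtain ⟨u, hu⟩ := exists_unit_OE h h3
    rw [Ideal.span_singleton_eq_span_singleton]
    refine ⟨u⁻¹, ?_⟩
    rw [Units.mul_inv_eq_iff_eq_mul]
    apply Subtype.ext
    show algebraMap F E ϖ = t * (u : OE F E)
    rw [hu, hyt, mul_comm]
  have hy3 := gen_le h ht hy2
  apply le_antisymm
  · exact normF_lt_one_le (gen_lt_one h ht)
  · have h4 : (resCard F)⁻¹ ^ 2 ≤ nrm nr (t : E) ^ 2 := by
      rw [← h1, hyt, h.nrm_mul, pow_two]
      gcongr
    exact (pow_le_pow_iff_left₀ (by positivity) hpos.le (by norm_num)).1 h4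

end QuadraticExtension

section Setup

/-- The quadratic extension `E / F` with its trace and norm, a uniformizer `ϖ` of `F`, a uniformizer
`t` of `E` and an element `s` with `𝒪_E = 𝒪_F ⊕ 𝒪_F s`. -/
structure QuadExt (tr nr : E → F) (ϖ : 𝒪[F]) (t s : E) : Prop where
  quat : IsQuat tr nr
  irr : Irreducible ϖ
  t_lt : nrm nr t < 1
  gen : ∀ x, nrm nr x < 1 → nrm nr x ≤ nrm nr t
  t_unif : nrm nr t = (resCard F)⁻¹ ∨ nrm nr t = (resCard F)⁻¹ ^ 2
  coords : ∀ x, ∃ a b : F, x = ε(a, b, s)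
  le_left : ∀ a b : F, nrm nr (algebraMap F E a) ≤ nrm nr ε(a, b, s)
  le_right : ∀ a b : F, nrm nr (algebraMap F E b * s) ≤ nrm nr ε(a, b, s)
  s_le : nrm nr s ≤ 1
  le_s : (resCard F)⁻¹ ≤ nrm nr s

lemma exists_coords (hE : finrank F E = 2) {s : E} (hs : ∀ a : F, algebraMap F E a ≠ s)
    (x : E) : ∃ a b : F, x = ε(a, b, s) := by
  have hli : LinearIndependent F ![(1 : E), s] := by
    rw [LinearIndependent.pair_iff]
    intro a b hab
    by_cases hb : b = 0
    · subst hb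
      simp at hab
      exact ⟨hab, rfl⟩
    · exfalso
      apply hs (-a / b)
      have hb' : algebraMap F E b ≠ 0 := by simpa using hb
      rw [map_div₀, map_neg, div_eq_iff hb']
      rw [smul_def, smul_def, mul_one] at hab
      linear_combination -hab
  have : FiniteDimensional F E := of_finrank_pos (by omega)
  have hsp : Submodule.span F (Set.range ![(1 : E), s]) = ⊤ :=
    hli.span_eq_top_of_card_eq_finrank (by simp [hE])
  have hx : x ∈ Submodule.span F (Set.range ![(1 : E), s]) := by rw [hsp]; trivial
  rw [Matrix.range_cons, Matrix.range_cons, Matrix.range_empty, Set.union_empty,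
    Set.singleton_union, Submodule.mem_span_pair] at hx
  obtain ⟨a, b, rfl⟩ := hx
  exact ⟨a, b, by simp [smul_def]⟩

section Irr

variable {tr nr : E → F} (h : IsQuat tr nr)
include h

local notation "𝓟" x:max hx:max => (Polynomial.X ^ 2 -
  Polynomial.C (Subtype.mk (tr x) (Iff.mp normF_le_one (IsQuat.normF_tr_le_one h hx)) : 𝒪[F]) * Polynomial.X +
  Polynomial.C (Subtype.mk (nr x) (Iff.mp normF_le_one hx) : 𝒪[F]) : Polynomial 𝒪[F])

lemma minpoly_integer_eq {x : E} (hx : nrm nr x ≤ 1) (hxF : ∀ a : F, algebraMap F E a ≠ x) :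
    minpoly 𝒪[F] x = 𝓟 x hx := by
  set p : Polynomial 𝒪[F] := 𝓟 x hx with hp
  have hpm : p.Monic := by rw [hp]; monicity!
  have hpd : p.natDegree = 2 := by rw [hp]; compute_degree!
  have hev : aeval x p = 0 := by
    have := h.quad x
    simp only [hp, map_add, map_sub, map_mul, Polynomial.aeval_X, Polynomial.aeval_X_pow,
      Polynomial.aeval_C]
    rw [pow_two]; exact this
  have hint : IsIntegral 𝒪[F] x := (mem_OE_iff h).2 hx
  have hdvd : minpoly 𝒪[F] x ∣ p := minpoly.isIntegrallyClosed_dvd hint hev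
  have h2 : 2 ≤ (minpoly 𝒪[F] x).natDegree := by
    rw [minpoly.two_le_natDegree_iff hint]
    rintro ⟨a, ha⟩
    exact hxF a ha
  exact (Polynomial.eq_of_monic_of_dvd_of_natDegree_le (minpoly.monic hint) hpm hdvd (by omega)).symm

lemma nrm_of_irreducible {x : E} (hx : nrm nr x ≤ 1) (hxF : ∀ a : F, algebraMap F E a ≠ x)
    (hirr : Irreducible ((minpoly 𝒪[F] x).map (residue 𝒪[F]))) (a : F)
    (ha : normF F a ≤ 1) : nrm nr (algebraMap F E a + x) = 1 := by
  rw [minpoly_integer_eq h hx hxF] at hirr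
  have hle : nrm nr (algebraMap F E a + x) ≤ 1 :=
    h.nrm_add_le_of (by rw [h.nrm_algebraMap]; exact pow_le_one₀ (normF_nonneg _) ha) hx
  refine le_antisymm hle (not_lt.1 fun hlt => ?_)
  have e : nr (algebraMap F E a + x) = a ^ 2 + a * tr x + nr x := by
    apply (algebraMap F E).injective
    rw [← h.mul_star, h.tr_add, h.tr_algebraMap, map_add, map_add, map_add, map_mul, map_mul,
      map_pow, ← h.mul_star x, map_ofNat]; ring
  set p := (𝓟 x hx).map (residue 𝒪[F]) with hp
  have hd : p.natDegree = 2 := by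
    rw [hp, Polynomial.natDegree_map_eq_of_isUnit_leadingCoeff]
    · compute_degree!
    · have : (𝓟 x hx).Monic := by monicity!
      rw [this]; exact isUnit_one
  have hroot : p.IsRoot (residue 𝒪[F] (-⟨a, normF_le_one.1 ha⟩)) := by
    rw [Polynomial.IsRoot, hp, Polynomial.eval_map, Polynomial.eval₂_hom]
    rw [IsLocalRing.residue_eq_zero_iff, ← normF_lt_one_iff]
    have : ((Polynomial.eval (-⟨a, normF_le_one.1 ha⟩ : 𝒪[F]) (𝓟 x hx) : 𝒪[F]) : F)
        = nr (algebraMap F E a + x) := by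
      rw [e]; simp; ring
    rw [this]; exact hlt
  have := Polynomial.degree_eq_one_of_irreducible_of_root hirr hroot
  rw [Polynomial.degree_eq_natDegree hirr.ne_zero, hd] at this
  norm_num at this

end Irr

/-- The element `ϖ ^ k α` generates `𝒪_E`. -/
lemma exists_quadExt (hE : finrank F E = 2) {tr nr : E → F} (h : IsQuat tr nr)
    {ϖ : 𝒪[F]} (hϖ : Irreducible ϖ) {t : OE F E} (ht : Ideal.span {t} = maxE F E) {α : E} {n : ℕ}
    (hα : ∀ a : F, algebraMap F E a ≠ α) (hαn : nrm nr α = nrm nr (t : E) ^ (-(n : ℤ)))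
    (hcase : (¬ Unramified F E ∧ Odd n) ∨ (Unramified F E ∧
      Irreducible ((minpoly 𝒪[F] ((ϖ : F) ^ n • α)).map (residue 𝒪[F])))) :
    ∃ k : ℕ, QuadExt tr nr ϖ (t : E) ((ϖ : F) ^ k • α) ∧
      (Unramified F E → k = n) ∧ (¬ Unramified F E → 2 * k = n + 1) := by
  have hq := one_lt_resCard F
  have hq0 := resCard_pos F
  have hπ := normF_uniformizer hϖ
  have hπ0 := uniformizer_ne_zero hϖ
  have hns : ∀ k : ℕ, ∀ a : F, algebraMap F E a ≠ (ϖ : F) ^ k • α := by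
    intro k a hk
    apply hα (((ϖ : F) ^ k)⁻¹ * a)
    rw [map_mul, hk, smul_def, ← mul_assoc, ← map_mul, inv_mul_cancel₀ (pow_ne_zero _ hπ0)]
    simp
  have hnsk : ∀ k : ℕ, nrm nr ((ϖ : F) ^ k • α) = (resCard F)⁻¹ ^ (2 * k) *
      nrm nr (t : E) ^ (-(n : ℤ)) := by
    intro k
    rw [smul_def, h.nrm_mul, h.nrm_algebraMap, hαn, normF_pow, hπ]; ring
  rcases hcase with ⟨hr, l, hl⟩ | ⟨hu, hirr⟩
  · have hτ := gen_nrm_of_ramified h hϖ ht hr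
    refine ⟨l + 1, ?_, fun hu => absurd hu hr, fun _ => by omega⟩
    have hs : nrm nr ((ϖ : F) ^ (l + 1) • α) = (resCard F)⁻¹ := by
      rw [hnsk, hτ, ← zpow_natCast, ← zpow_add₀ (by positivity)]
      convert zpow_one _ using 2
      push_cast [hl]; ring
    have hne : ∀ a b : F, b ≠ 0 → a ≠ 0 → nrm nr (algebraMap F E a) ≠
        nrm nr (algebraMap F E b * ((ϖ : F) ^ (l + 1) • α)) := by
      intro a b hb ha
      rw [h.nrm_mul, hs, h.nrm_algebraMap, h.nrm_algebraMap, normF_of_ne ha, normF_of_ne hb,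
        ← zpow_natCast, ← zpow_natCast, ← zpow_mul, ← zpow_mul, ← zpow_neg_one,
        ← zpow_add₀ hq0.ne']
      intro he
      have := zpow_right_injective₀ hq0 hq.ne' he
      push_cast at this; omega
    have key : ∀ a b : F, nrm nr (algebraMap F E a) ≤
        nrm nr (algebraMap F E a + algebraMap F E b * ((ϖ : F) ^ (l + 1) • α)) ∧
        nrm nr (algebraMap F E b * ((ϖ : F) ^ (l + 1) • α)) ≤
        nrm nr (algebraMap F E a + algebraMap F E b * ((ϖ : F) ^ (l + 1) • α)) := by
      intro a b
      by_cases ha : a = 0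
      · subst ha; simp [h.nrm_zero, nrm_nonneg]
      by_cases hb : b = 0
      · subst hb; simp [h.nrm_zero, nrm_nonneg]
      rcases lt_or_gt_of_ne (hne a b hb ha) with hlt | hlt
      · rw [h.nrm_eq_of_lt hlt]; exact ⟨hlt.le, le_rfl⟩
      · rw [add_comm, h.nrm_eq_of_lt hlt]; exact ⟨le_rfl, hlt.le⟩
    exact ⟨h, hϖ, gen_lt_one h ht, fun x => gen_le h ht, Or.inl hτ, exists_coords hE (hns _),
      fun a b => (key a b).1, fun a b => (key a b).2,
      by rw [hs]; exact inv_le_one_of_one_le₀ hq.le, hs.ge⟩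
  · have hτ := gen_nrm_of_unramified h hϖ ht hu
    refine ⟨n, ?_, fun _ => rfl, fun h => absurd hu h⟩
    have hs : nrm nr ((ϖ : F) ^ n • α) = 1 := by
      rw [hnsk, hτ, ← zpow_natCast, ← zpow_natCast, ← zpow_mul, ← zpow_add₀ (by positivity)]
      convert zpow_zero _ using 2
      push_cast; ring
    have hirr' := nrm_of_irreducible h hs.le (hns n) hirr
    have heq : ∀ a b : F, nrm nr (algebraMap F E a) ≤ nrm nr (algebraMap F E b) → b ≠ 0 →
        nrm nr (algebraMap F E a + algebraMap F E b * ((ϖ : F) ^ n • α)) =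
          nrm nr (algebraMap F E b) := by
      intro a b hab hb
      have hb' : algebraMap F E b ≠ 0 := by simpa using hb
      have e : algebraMap F E a + algebraMap F E b * ((ϖ : F) ^ n • α) =
          algebraMap F E b * (algebraMap F E (a / b) + ((ϖ : F) ^ n • α)) := by
        rw [map_div₀]; field_simp
      rw [e, h.nrm_mul, hirr', mul_one]
      rw [h.nrm_algebraMap, h.nrm_algebraMap,
        pow_le_pow_iff_left₀ (normF_nonneg _) (normF_nonneg _) (by norm_num)] at hab
      rw [normF_div]; exact div_le_one_of_le₀ hab (normF_nonneg _)
    have key : ∀ a b : F, nrm nr (algebraMap F E a) ≤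
        nrm nr (algebraMap F E a + algebraMap F E b * ((ϖ : F) ^ n • α)) ∧
        nrm nr (algebraMap F E b * ((ϖ : F) ^ n • α)) ≤
        nrm nr (algebraMap F E a + algebraMap F E b * ((ϖ : F) ^ n • α)) := by
      intro a b
      by_cases hb : b = 0
      · subst hb; simp [h.nrm_zero, nrm_nonneg]
      have hbs : nrm nr (algebraMap F E b * ((ϖ : F) ^ n • α)) = nrm nr (algebraMap F E b) := by
        rw [h.nrm_mul, hs, mul_one]
      rcases le_or_gt (nrm nr (algebraMap F E a)) (nrm nr (algebraMap F E b)) with hle | hlt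
      · rw [heq a b hle hb, hbs]; exact ⟨hle, le_rfl⟩
      · rw [← hbs] at hlt
        rw [add_comm, h.nrm_eq_of_lt hlt]; exact ⟨le_rfl, hlt.le⟩
    exact ⟨h, hϖ, gen_lt_one h ht, fun x => gen_le h ht, Or.inr hτ, exists_coords hE (hns _),
      fun a b => (key a b).1, fun a b => (key a b).2, hs.le,
      by rw [hs]; exact inv_le_one_of_one_le₀ hq.le⟩

namespace QuadExt

variable {tr nr : E → F} {ϖ : 𝒪[F]} {t s : E} (D : QuadExt tr nr ϖ t s)
include D

lemma t_pos : 0 < nrm nr t := by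
  have := resCard_pos F
  rcases D.t_unif with h | h <;> rw [h] <;> positivity

lemma exists_zpow {x : E} (hx : x ≠ 0) : ∃ j : ℤ, nrm nr x = nrm nr t ^ j := by
  have h := D.quat
  obtain ⟨j, hj1, hj2⟩ := exists_mem_Ico_zpow (h.nrm_pos hx) (one_lt_inv₀ D.t_pos |>.2 D.t_lt)
  rw [inv_zpow'] at hj1 hj2
  have h1 : nrm nr (x * t ^ (j + 1)) < 1 := by
    rw [h.nrm_mul, h.nrm_zpow]
    have := mul_lt_mul_of_pos_right hj2 (zpow_pos D.t_pos (j + 1))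
    rwa [← zpow_add₀ D.t_pos.ne', neg_add_cancel, zpow_zero] at this
  have h2 := D.gen _ h1
  refine ⟨-j, le_antisymm ?_ hj1⟩
  rw [h.nrm_mul, h.nrm_zpow] at h2
  have := mul_le_mul_of_nonneg_right h2 (zpow_pos D.t_pos (-(j + 1))).le
  rw [mul_assoc, ← zpow_add₀ D.t_pos.ne', add_neg_cancel, zpow_zero, mul_one,
    ← zpow_one_add₀ D.t_pos.ne'] at this
  convert this using 2; ring

lemma zpow_le {i j : ℤ} : nrm nr t ^ i ≤ nrm nr t ^ j ↔ j ≤ i :=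
  zpow_le_zpow_iff_right_of_lt_one₀ D.t_pos D.t_lt

lemma lt_iff_le {x : E} {j : ℤ} : nrm nr x < nrm nr t ^ j ↔ nrm nr x ≤ nrm nr t ^ (j + 1) := by
  by_cases hx : x = 0
  · subst hx
    rw [D.quat.nrm_zero]
    exact ⟨fun _ => (zpow_pos D.t_pos _).le, fun _ => zpow_pos D.t_pos _⟩
  obtain ⟨i, hi⟩ := D.exists_zpow hx
  rw [hi, D.zpow_le, zpow_lt_zpow_iff_right_of_lt_one₀ D.t_pos D.t_lt]; omega

lemma coords_int {a b : F} (h : nrm nr ε(a, b, s) ≤ 1) : normF F a ≤ 1 ∧ normF F b ≤ 1 := by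
  have hq := one_lt_resCard F
  have h1 := (D.le_left a b).trans h
  have h2 := (D.le_right a b).trans h
  rw [D.quat.nrm_algebraMap] at h1
  rw [D.quat.nrm_mul, D.quat.nrm_algebraMap] at h2
  constructor
  · by_contra! hlt; nlinarith
  · by_cases hb : b = 0
    · simp [hb]
    by_contra! hlt
    have h3 : resCard F ≤ normF F b := by
      rw [normF_of_ne hb, ← zpow_zero (resCard F), zpow_lt_zpow_iff_right₀ hq] at hlt
      rw [normF_of_ne hb]
      conv_lhs => rw [← zpow_one (resCard F)]
      rw [zpow_le_zpow_iff_right₀ hq]; omega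
    have h4 : resCard F ^ 2 * (resCard F)⁻¹ ≤ 1 := by
      refine le_trans ?_ h2
      have := D.le_s
      gcongr
    rw [pow_two, mul_assoc, mul_inv_cancel₀ (by positivity)] at h4
    linarith

end QuadExt

end Setup

section Chain

open scoped Matrix

variable (Λ : LatticeChain F)

lemma LatticeChain.L_antitone {i j : ℤ} (h : i ≤ j) : Λ.L j ≤ Λ.L i := Λ.strictAnti.antitone h

lemma LatticeChain.smul_mem {i : ℤ} {w : Fin 2 → F} (hw : w ∈ Λ.L i) {r : F} (hr : normF F r ≤ 1) :
    r • w ∈ Λ.L i := (Λ.L i).smul_mem (⟨r, normF_le_one.1 hr⟩ : 𝒪[F]) hw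

variable {ϖ : 𝒪[F]} (hϖ : Irreducible ϖ)
include hϖ

lemma LatticeChain.mem_add_e {i : ℤ} {w : Fin 2 → F} :
    w ∈ Λ.L (i + Λ.e) ↔ (ϖ : F)⁻¹ • w ∈ Λ.L i := by
  have hπ0 := uniformizer_ne_zero hϖ
  rw [Λ.period, hϖ.maximalIdeal_eq, Submodule.ideal_span_singleton_smul,
    Submodule.mem_smul_pointwise_iff_exists]
  constructor
  · rintro ⟨y, hy, rfl⟩
    have : (ϖ : F)⁻¹ • (ϖ • y) = y := by
      show (ϖ : F)⁻¹ • ((ϖ : F) • y) = y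
      rw [smul_smul, inv_mul_cancel₀ hπ0, one_smul]
    rwa [this]
  · intro hw
    refine ⟨_, hw, ?_⟩
    show (ϖ : F) • _ = w
    rw [smul_smul, mul_inv_cancel₀ hπ0, one_smul]

lemma LatticeChain.mem_add_e_mul {i : ℤ} {w : Fin 2 → F} (k : ℤ) :
    w ∈ Λ.L (i + Λ.e * k) ↔ (ϖ : F) ^ (-k) • w ∈ Λ.L i := by
  have hπ0 := uniformizer_ne_zero hϖ
  revert w
  suffices H : ∀ w : Fin 2 → F, w ∈ Λ.L (i + Λ.e * k) ↔ (ϖ : F) ^ (-k) • w ∈ Λ.L i from @H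
  induction k using Int.induction_on with
  | zero => simp
  | succ k ih =>
    intro w
    rw [mul_add, mul_one, ← add_assoc, Λ.mem_add_e hϖ, ih, smul_smul, ← zpow_neg_one,
      ← zpow_add₀ hπ0]
    congr! 3; ring
  | pred k ih =>
    intro w
    have h1 := Λ.mem_add_e hϖ (i := i + Λ.e * (-k - 1)) (w := (ϖ : F) • w)
    rw [smul_smul, inv_mul_cancel₀ hπ0, one_smul] at h1
    rw [← h1]
    have : i + Λ.e * (-(k : ℤ) - 1) + Λ.e = i + Λ.e * (-k) := by ring
    rw [this, ih, smul_smul, ← zpow_add_one₀ hπ0]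
    congr! 3; ring

omit hϖ in
lemma LatticeChain.rad_antitone {a : M2 F} {i j : ℤ} (h : i ≤ j) (ha : a ∈ Λ.rad j) :
    a ∈ Λ.rad i := fun l x hx => Λ.L_antitone (by omega) (ha l x hx)

omit hϖ in
lemma LatticeChain.rad_mul {a b : M2 F} {i j k : ℤ} (ha : a ∈ Λ.rad i) (hb : b ∈ Λ.rad j)
    (hk : i + j = k) : a * b ∈ Λ.rad k := fun l x hx => by
  rw [← mulVec_mulVec]
  have := ha _ _ (hb l x hx)
  rwa [add_assoc, add_comm j i, hk] at this

omit hϖ in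
lemma LatticeChain.rad_add {a b : M2 F} {i : ℤ} (ha : a ∈ Λ.rad i) (hb : b ∈ Λ.rad i) :
    a + b ∈ Λ.rad i := fun l x hx => by
  rw [Matrix.add_mulVec]; exact add_mem (ha l x hx) (hb l x hx)

omit hϖ in
lemma LatticeChain.rad_neg {a : M2 F} {i : ℤ} (ha : a ∈ Λ.rad i) : -a ∈ Λ.rad i := fun l x hx => by
  rw [Matrix.neg_mulVec]; exact neg_mem (ha l x hx)

omit hϖ in
lemma LatticeChain.rad_sub {a b : M2 F} {i : ℤ} (ha : a ∈ Λ.rad i) (hb : b ∈ Λ.rad i) :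
    a - b ∈ Λ.rad i := by
  rw [sub_eq_add_neg]; exact Λ.rad_add ha (Λ.rad_neg hb)

omit hϖ in
lemma LatticeChain.zero_mem_rad {i : ℤ} : (0 : M2 F) ∈ Λ.rad i := fun l x _ => by
  rw [zero_mulVec]; exact zero_mem _

omit hϖ in
lemma LatticeChain.one_mem_rad : (1 : M2 F) ∈ Λ.rad 0 := fun l x hx => by
  rw [one_mulVec, add_zero]; exact hx

lemma LatticeChain.scalar_mem_rad {r : F} {k : ℤ} (hr : normF F r ≤ (resCard F)⁻¹ ^ k) :
    algebraMap F (M2 F) r ∈ Λ.rad (Λ.e * k) := fun l x hx => by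
  rw [algebraMap_eq_smul_one, smul_mulVec, one_mulVec, Λ.mem_add_e_mul hϖ, smul_smul]
  refine Λ.smul_mem hx ?_
  rw [normF_mul, normF_zpow, normF_uniformizer hϖ, zpow_neg]
  have := resCard_pos F
  rw [inv_mul_le_iff₀ (by positivity), mul_one]; exact hr

lemma LatticeChain.mem_rad_of_zero {a : M2 F} {j : ℤ} (ha : ∀ x ∈ Λ.L 0, a *ᵥ x ∈ Λ.L j) :
    a ∈ Λ.rad (j - Λ.e + 1) := fun i x hx => by
  have he : (0 : ℤ) < Λ.e := by exact_mod_cast Λ.e_pos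
  have h1 := Int.emod_add_mul_ediv i Λ.e
  have h2 := Int.emod_nonneg i he.ne'
  have h3 := Int.emod_lt_of_pos i he
  have hx' : x ∈ Λ.L (0 + Λ.e * (i / Λ.e)) := Λ.L_antitone (by omega) hx
  have h4 := ha _ ((Λ.mem_add_e_mul hϖ _).1 hx')
  rw [Matrix.mulVec_smul, ← Λ.mem_add_e_mul hϖ] at h4
  exact Λ.L_antitone (by omega) h4

/-- The lattice chain is the chain of powers of `𝔭_E`. -/
structure ChainExt (Λ : LatticeChain F) (ι : E →ₐ[F] M2 F) (tr nr : E → F) (ϖ : 𝒪[F])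
    (t s : E) : Prop extends QuadExt tr nr ϖ t s where
  dim : finrank F E = 2
  det_eq : ∀ x, (ι x).det = nr x
  emb : ∀ (x : E) (m : ℤ), nrm nr x ≤ nrm nr t ^ m → ι x ∈ Λ.rad m
  e_le : Λ.e ≤ 2
  t_e : nrm nr t ^ Λ.e = (resCard F)⁻¹ ^ 2

lemma exists_chainExt {ι : E →ₐ[F] M2 F} {tr nr : E → F} {t α : E} {n k : ℕ}
    (D : QuadExt tr nr ϖ t ((ϖ : F) ^ k • α)) (dim : finrank F E = 2)
    (trace_eq : ∀ x, (ι x).trace = tr x) (det_eq : ∀ x, (ι x).det = nr x)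
    (hα : ι α ∈ Λ.rad (-n)) (hαn : nrm nr α = nrm nr t ^ (-(n : ℤ)))
    (hcase : (Λ.e = 1 ∧ nrm nr t = (resCard F)⁻¹ ^ 2 ∧ k = n) ∨
      (Λ.e = 2 ∧ nrm nr t = (resCard F)⁻¹ ∧ 2 * k = n + 1)) :
    ChainExt Λ ι tr nr ϖ t ((ϖ : F) ^ k • α) := by
  have hq := one_lt_resCard F
  have hq0 := resCard_pos F
  have h := D.quat
  have hπ := normF_uniformizer hϖ
  have hπ0 := uniformizer_ne_zero hϖ
  have hα0 : α ≠ 0 := by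
    rintro rfl
    rw [h.nrm_zero] at hαn
    exact (zpow_pos D.t_pos _).ne hαn
  have te : nrm nr t ^ Λ.e = (resCard F)⁻¹ ^ 2 := by
    rcases hcase with ⟨h1, h2, -⟩ | ⟨h1, h2, -⟩ <;> rw [h1, h2]; simp
  have scal : ∀ (r : F) (j : ℤ), normF F r ^ 2 ≤ nrm nr t ^ j → algebraMap F (M2 F) r ∈ Λ.rad j := by
    intro r j hr
    rcases hcase with ⟨h1, h2, -⟩ | ⟨h1, h2, -⟩
    · have := Λ.scalar_mem_rad hϖ (r := r) (k := j) (by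
        have h3 : ((resCard F)⁻¹ ^ 2) ^ j = ((resCard F)⁻¹ ^ j) ^ 2 := by
          rw [← zpow_natCast, ← zpow_natCast, ← zpow_mul, ← zpow_mul, mul_comm]
        rw [h2, h3] at hr
        exact (pow_le_pow_iff_left₀ (normF_nonneg _) (by positivity) (by norm_num)).1 hr)
      rw [h1] at this; simpa using this
    · by_cases hr0 : r = 0
      · subst hr0; rw [map_zero]; exact Λ.zero_mem_rad
      have h3 : j ≤ 2 * (-logF r) := by
        rw [h2, normF_of_ne hr0, ← zpow_natCast, ← zpow_mul, inv_zpow', zpow_le_zpow_iff_right₀ hq] at hr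
        push_cast at hr; omega
      have := Λ.scalar_mem_rad hϖ (r := r) (k := -logF r) (by
        rw [normF_of_ne hr0, inv_zpow', neg_neg])
      rw [h1] at this
      exact Λ.rad_antitone (by push_cast; exact h3) this
  have hαi : ι α⁻¹ ∈ Λ.rad n := by
    have h1 : α⁻¹ = algebraMap F E (nr α)⁻¹ * (algebraMap F E (tr α) - α) := by
      have h2 := h.mul_star α
      have h3 : algebraMap F E (nr α) ≠ 0 := by simpa using h.nr_ne_zero hα0
      rw [map_inv₀]
      field_simp
      rw [← h2]
    rw [h1, map_mul, map_sub, commutes, commutes]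
    have h4 : algebraMap F (M2 F) (nr α)⁻¹ ∈ Λ.rad (2 * n) := by
      apply scal
      have : normF F (nr α) = nrm nr t ^ (-(n : ℤ)) := hαn
      rw [normF_inv, this, ← zpow_neg, neg_neg, ← zpow_natCast, ← zpow_mul]
      rw [mul_comm]; rfl
    have h5 : algebraMap F (M2 F) (tr α) - ι α ∈ Λ.rad (-n) :=
      Λ.rad_sub (scal _ _ ((h.norm_tr_sq_le α).trans hαn.le)) hα
    exact Λ.rad_mul h4 h5 (by ring)
  have hs : ι ((ϖ : F) ^ k • α) ∈ Λ.rad 0 := by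
    have h1 : algebraMap F (M2 F) ((ϖ : F) ^ k) ∈ Λ.rad n := by
      apply scal
      rw [normF_pow, hπ]
      rcases hcase with ⟨-, h2, h3⟩ | ⟨-, h2, h3⟩ <;> rw [h2, zpow_natCast, ← pow_mul]
      · rw [h3, ← pow_mul, mul_comm]
      · rw [mul_comm, h3, pow_succ]
        exact mul_le_of_le_one_right (by positivity) (inv_le_one_of_one_le₀ hq.le)
    rw [map_smul, smul_def]
    exact Λ.rad_mul h1 hα (by ring)
  have hint : ∀ x, nrm nr x ≤ 1 → ι x ∈ Λ.rad 0 := by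
    intro x hx
    obtain ⟨a, b, rfl⟩ := D.coords x
    obtain ⟨ha, hb⟩ := D.coords_int hx
    rw [map_add, map_mul, commutes, commutes]
    refine Λ.rad_add (scal _ _ ?_) ?_
    · rw [zpow_zero]; exact pow_le_one₀ (normF_nonneg _) ha
    · have h1 : algebraMap F (M2 F) b ∈ Λ.rad 0 := scal _ _ (by
        rw [zpow_zero]; exact pow_le_one₀ (normF_nonneg _) hb)
      exact Λ.rad_mul h1 hs (by ring)
  have hunif : ∃ p : E, nrm nr p = nrm nr t ∧ ι p ∈ Λ.rad 1 ∧ ι p⁻¹ ∈ Λ.rad (-1) := by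
    rcases hcase with ⟨h1, h2, -⟩ | ⟨h1, h2, h3⟩
    · refine ⟨algebraMap F E ϖ, ?_, ?_, ?_⟩
      · rw [h.nrm_algebraMap, h2, hπ]
      · rw [commutes]; apply scal; rw [hπ, h2, zpow_one]
      · rw [← map_inv₀, commutes]; apply scal
        rw [normF_inv, hπ, h2, zpow_neg_one, inv_pow, inv_pow]
    · have hsn : nrm nr ((ϖ : F) ^ k • α) = nrm nr t := by
        rw [smul_def, h.nrm_mul, h.nrm_algebraMap, hαn, normF_pow, hπ, h2, ← pow_mul,
          mul_comm k, h3, zpow_neg, zpow_natCast, pow_succ]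
        field_simp
      have h4 : ∀ r : F, normF F r = (resCard F)⁻¹ ^ k → ι (algebraMap F E r * α) ∈ Λ.rad 1 := by
        intro r hr
        rw [map_mul, commutes]
        have h5 := scal r (n + 1) (by rw [hr, h2, ← pow_mul, mul_comm k, h3]; exact_mod_cast le_rfl)
        exact Λ.rad_mul h5 hα (by ring)
      refine ⟨(ϖ : F) ^ k • α, hsn, ?_, ?_⟩
      · rw [smul_def]; apply h4; rw [normF_pow, hπ]
      · rw [smul_def, mul_inv, ← map_inv₀, map_mul, commutes]
        have h5 := scal ((ϖ : F) ^ k)⁻¹ (-(n + 1)) (by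
          rw [normF_inv, normF_pow, hπ, h2, inv_pow, ← pow_mul, mul_comm k, h3, zpow_neg]
          exact_mod_cast le_rfl)
        exact Λ.rad_mul h5 hαi (by ring)
  have hemb : ∀ (x : E) (m : ℤ), nrm nr x ≤ nrm nr t ^ m → ι x ∈ Λ.rad m := by
    obtain ⟨p, hp, hp1, hp2⟩ := hunif
    have hp0 : p ≠ 0 := by rintro rfl; rw [h.nrm_zero] at hp; exact D.t_pos.ne hp
    have hpow : ∀ m : ℤ, ι (p ^ m) ∈ Λ.rad m := by
      intro m
      induction m using Int.induction_on with
      | zero => simpa using Λ.one_mem_rad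
      | succ m ih =>
        rw [zpow_add_one₀ hp0, map_mul]; exact Λ.rad_mul ih hp1 rfl
      | pred m ih =>
        rw [zpow_sub_one₀ hp0, map_mul]; exact Λ.rad_mul ih hp2 rfl
    intro x m hx
    have e : x = p ^ m * (p ^ (-m) * x) := by
      rw [← mul_assoc, ← zpow_add₀ hp0, add_neg_cancel, zpow_zero, one_mul]
    rw [e, map_mul]
    have h1 : nrm nr (p ^ (-m) * x) ≤ 1 := by
      rw [h.nrm_mul, h.nrm_zpow, hp, zpow_neg, inv_mul_le_iff₀ (zpow_pos D.t_pos _), mul_one]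
      exact hx
    exact Λ.rad_mul (hpow m) (hint _ h1) (add_zero m)
  refine ⟨D, dim, det_eq, hemb, ?_, te⟩
  rcases hcase with ⟨h1, -⟩ | ⟨h1, -⟩ <;> omega

end Chain

namespace ChainExt

open scoped Matrix

variable {Λ : LatticeChain F} {ϖ : 𝒪[F]} {ι : E →ₐ[F] M2 F} {tr nr : E → F} {t s : E}

/-- The basis `v, s v` of `F²` as the columns of a matrix. -/
def frame (ι : E →ₐ[F] M2 F) (s : E) (v : Fin 2 → F) : M2 F := (Matrix.of ![v, ι s *ᵥ v])ᵀ

lemma frame_mulVec (s : E) (v : Fin 2 → F) (a b : F) :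
    frame ι s v *ᵥ ![a, b] = ι ε(a, b, s) *ᵥ v := by
  rw [map_add, map_mul, commutes, commutes, Matrix.add_mulVec, ← mulVec_mulVec,
    algebraMap_eq_smul_one, algebraMap_eq_smul_one, smul_mulVec,
    smul_mulVec, one_mulVec, one_mulVec]
  ext i
  fin_cases i <;> simp [frame, Matrix.mulVec, dotProduct, Fin.sum_univ_two] <;> ring

/-- The endomorphism of `F²` with a given matrix in the basis `v, s v`. -/
noncomputable def op (ι : E →ₐ[F] M2 F) (s : E) (v : Fin 2 → F) (M : M2 F) : M2 F :=
  frame ι s v * M * (frame ι s v)⁻¹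

variable {v : Fin 2 → F} (C : ChainExt Λ ι tr nr ϖ t s)
include C

lemma act_eq_zero (hv : v ≠ 0) {x : E} (hx : ι x *ᵥ v = 0) : x = 0 := by
  by_contra h0
  apply hv
  have : ι x⁻¹ *ᵥ (ι x *ᵥ v) = v := by
    rw [mulVec_mulVec, ← map_mul, inv_mul_cancel₀ h0, map_one, one_mulVec]
  rw [← this, hx, Matrix.mulVec_zero]

lemma exists_act (hv : v ≠ 0) (w : Fin 2 → F) : ∃ x : E, ι x *ᵥ v = w := by
  let f : E →ₗ[F] (Fin 2 → F) :=
    { toFun := fun x => ι x *ᵥ v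
      map_add' := fun x y => by rw [map_add, Matrix.add_mulVec]
      map_smul' := fun r x => by rw [map_smul, smul_mulVec]; rfl }
  have hf : Injective f := by
    rw [← LinearMap.ker_eq_bot, LinearMap.ker_eq_bot']
    exact fun x hx => C.act_eq_zero hv hx
  have : FiniteDimensional F E := of_finrank_pos (by rw [C.dim]; norm_num)
  exact (LinearMap.injective_iff_surjective_of_finrank_eq_finrank (by rw [C.dim]; simp)).1 hf w

lemma act_mem_iff {i : ℤ} (h1 : v ∈ Λ.L i) (h2 : v ∉ Λ.L (i + 1)) {x : E} {j : ℤ} :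
    ι x *ᵥ v ∈ Λ.L j ↔ nrm nr x ≤ nrm nr t ^ (j - i) := by
  constructor
  · intro hx
    by_contra! hlt
    have hx0 : x ≠ 0 := by
      rintro rfl; rw [C.quat.nrm_zero] at hlt; exact (zpow_pos C.t_pos _).not_gt hlt
    obtain ⟨l, hl⟩ := C.exists_zpow hx0
    rw [hl, zpow_lt_zpow_iff_right_of_lt_one₀ C.t_pos C.t_lt] at hlt
    have h3 := C.emb x⁻¹ (-l) (by rw [C.quat.nrm_inv, hl, zpow_neg]) _ _ hx
    rw [mulVec_mulVec, ← map_mul, inv_mul_cancel₀ hx0, map_one, one_mulVec] at h3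
    exact h2 (Λ.L_antitone (by omega) h3)
  · intro hx
    have := C.emb x _ hx _ _ h1
    rwa [add_sub_cancel] at this

lemma exists_generator (i : ℤ) : ∃ v ∈ Λ.L i, v ∉ Λ.L (i + 1) := by
  have := Λ.strictAnti (show i < i + 1 by omega)
  exact Set.exists_of_ssubset this

lemma exists_order {w : Fin 2 → F} (hw : w ≠ 0) : ∃ i, w ∈ Λ.L i ∧ w ∉ Λ.L (i + 1) := by
  obtain ⟨v, h1, h2⟩ := C.exists_generator 0
  have hv : v ≠ 0 := fun h => h2 (h ▸ zero_mem _)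
  obtain ⟨x, rfl⟩ := C.exists_act hv w
  have hx0 : x ≠ 0 := by rintro rfl; simp at hw
  obtain ⟨l, hl⟩ := C.exists_zpow hx0
  refine ⟨l, ?_, ?_⟩
  · rw [C.act_mem_iff h1 h2, hl, sub_zero]
  · rw [C.act_mem_iff h1 h2, hl, C.zpow_le]; omega

lemma ne_zero_of {i : ℤ} (h2 : v ∉ Λ.L (i + 1)) : v ≠ 0 := fun h => h2 (h ▸ zero_mem _)

lemma isUnit_frame (hv : v ≠ 0) : IsUnit (frame ι s v).det := by
  rw [isUnit_iff_ne_zero]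
  intro h0
  obtain ⟨c, hc, hc'⟩ := Matrix.exists_mulVec_eq_zero_iff.2 h0
  have e : c = ![c 0, c 1] := by ext i; fin_cases i <;> rfl
  rw [e, frame_mulVec] at hc'
  have h1 := C.act_eq_zero hv hc'
  have h2 := C.le_left (c 0) (c 1)
  have h3 := C.le_right (c 0) (c 1)
  rw [h1, C.quat.nrm_zero] at h2 h3
  have hs : 0 < nrm nr s := (inv_pos.2 (resCard_pos F)).trans_le C.le_s
  rw [C.quat.nrm_algebraMap] at h2
  rw [C.quat.nrm_mul, C.quat.nrm_algebraMap] at h3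
  have h4 : normF F (c 0) = 0 := by
    have := normF_nonneg (c 0); nlinarith
  have h5 : normF F (c 1) = 0 := by
    have h6 := normF_nonneg (c 1)
    by_contra h7
    have : 0 < normF F (c 1) := lt_of_le_of_ne h6 (Ne.symm h7)
    have : 0 < normF F (c 1) ^ 2 * nrm nr s := by positivity
    linarith
  apply hc
  rw [e, normF_eq_zero.1 h4, normF_eq_zero.1 h5]
  ext i; fin_cases i <;> rfl

lemma op_mulVec (hv : v ≠ 0) (M : M2 F) (a b : F) : op ι s v M *ᵥ (ι ε(a, b, s) *ᵥ v) =
      ι (algebraMap F E (M 0 0 * a + M 0 1 * b) + algebraMap F E (M 1 0 * a + M 1 1 * b) * s) *ᵥ v := by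
  rw [← frame_mulVec, ← frame_mulVec, mulVec_mulVec, op,
    Matrix.nonsing_inv_mul_cancel_right _ _ (C.isUnit_frame hv), ← mulVec_mulVec]
  congr 1
  ext i
  fin_cases i <;> simp [Matrix.mulVec, dotProduct, Fin.sum_univ_two]

lemma op_mulVec_left (hv : v ≠ 0) (M : M2 F) :
    op ι s v M *ᵥ v = ι (algebraMap F E (M 0 0) + algebraMap F E (M 1 0) * s) *ᵥ v := by
  have := C.op_mulVec hv M 1 0
  simpa only [map_one, map_zero, zero_mul, mul_one, mul_zero, add_zero, one_mulVec] using this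

lemma op_mulVec_right (hv : v ≠ 0) (M : M2 F) :
    op ι s v M *ᵥ (ι s *ᵥ v) = ι (algebraMap F E (M 0 1) + algebraMap F E (M 1 1) * s) *ᵥ v := by
  have := C.op_mulVec hv M 0 1
  simpa only [map_one, map_zero, one_mul, mul_one, mul_zero, zero_add, one_mulVec] using this

lemma op_trace (hv : v ≠ 0) (M : M2 F) : (op ι s v M).trace = M.trace := by
  rw [op, trace_mul_comm, Matrix.nonsing_inv_mul_cancel_left _ _ (C.isUnit_frame hv)]

lemma op_det (hv : v ≠ 0) (M : M2 F) : (op ι s v M).det = M.det := by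
  rw [op, det_mul, det_mul, mul_comm, ← mul_assoc, ← det_mul,
    Matrix.nonsing_inv_mul _ (C.isUnit_frame hv), Matrix.det_one, one_mul]

/-- Two matrices that agree on the basis `v, s v` are equal. -/
lemma ext_op (hv : v ≠ 0) {A B : M2 F} (h0 : A *ᵥ v = B *ᵥ v)
    (h1 : A *ᵥ (ι s *ᵥ v) = B *ᵥ (ι s *ᵥ v)) : A = B := by
  have : A * frame ι s v = B * frame ι s v := by
    ext i j
    fin_cases j
    · have := congrFun h0 i
      simpa [Matrix.mul_apply, frame, Matrix.mulVec, dotProduct] using this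
    · have := congrFun h1 i
      simpa [Matrix.mul_apply, frame, Matrix.mulVec, dotProduct] using this
  have hu := C.isUnit_frame hv
  have h := congrArg (· * (frame ι s v)⁻¹) this
  simpa only [Matrix.mul_nonsing_inv_cancel_right _ _ hu] using h

/-- Elements of `End (L i)` have integral matrices. -/
lemma exists_integral_matrix {i : ℤ} (h1 : v ∈ Λ.L i) (h2 : v ∉ Λ.L (i + 1))
    {a : M2 F} (ha : ∀ w ∈ Λ.L i, a *ᵥ w ∈ Λ.L i) :
    ∃ M : M2 F, (∀ j l, normF F (M j l) ≤ 1) ∧ a = op ι s v M := by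
  have hv := C.ne_zero_of h2
  have key : ∀ y : E, nrm nr y ≤ 1 → ∃ c d : F, normF F c ≤ 1 ∧ normF F d ≤ 1 ∧
      a *ᵥ (ι y *ᵥ v) = ι ε(c, d, s) *ᵥ v := by
    intro y hy
    have h3 := ha _ ((C.act_mem_iff h1 h2 (x := y) (j := i)).2 (by simpa using hy))
    obtain ⟨x, hx⟩ := C.exists_act hv (a *ᵥ (ι y *ᵥ v))
    obtain ⟨c, d, rfl⟩ := C.coords x
    rw [← hx, C.act_mem_iff h1 h2, sub_self, zpow_zero] at h3
    obtain ⟨h4, h5⟩ := C.coords_int h3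
    exact ⟨c, d, h4, h5, hx.symm⟩
  obtain ⟨c0, d0, hc0, hd0, e0⟩ := key 1 (by rw [C.quat.nrm_one])
  obtain ⟨c1, d1, hc1, hd1, e1⟩ := key s C.s_le
  refine ⟨!![c0, c1; d0, d1], ?_, C.ext_op hv ?_ ?_⟩
  · intro j l; fin_cases j <;> fin_cases l <;> simpa
  · rw [map_one, one_mulVec] at e0
    rw [e0, C.op_mulVec_left hv]; rfl
  · rw [e1, C.op_mulVec_right hv]; rfl

lemma normF_trace_det_le {i : ℤ} {a : M2 F} (ha : ∀ w ∈ Λ.L i, a *ᵥ w ∈ Λ.L i) :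
    normF F a.trace ≤ 1 ∧ normF F a.det ≤ 1 := by
  obtain ⟨v, h1, h2⟩ := C.exists_generator i
  obtain ⟨M, hM, rfl⟩ := C.exists_integral_matrix h1 h2 ha
  have hv := C.ne_zero_of h2
  rw [C.op_trace hv, C.op_det hv, trace_fin_two, det_fin_two]
  have hmul : ∀ a b : F, normF F a ≤ 1 → normF F b ≤ 1 → normF F (a * b) ≤ 1 := by
    intro a b ha hb; rw [normF_mul]; exact mul_le_one₀ ha (normF_nonneg _) hb
  exact ⟨(normF_add_le _ _).trans (max_le (hM _ _) (hM _ _)),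
    (normF_sub_le _ _).trans (max_le (hmul _ _ (hM _ _) (hM _ _)) (hmul _ _ (hM _ _) (hM _ _)))⟩

lemma rad_zero_le {a : M2 F} (ha : a ∈ Λ.rad 0) : normF F a.trace ≤ 1 ∧ normF F a.det ≤ 1 :=
  C.normF_trace_det_le (i := 0) fun w hw => by simpa using ha 0 w hw

lemma smul_mem_rad {a : M2 F} {r : F} {m j : ℤ} (ha : a ∈ Λ.rad m)
    (hr : normF F r ^ 2 ≤ nrm nr t ^ j) : r • a ∈ Λ.rad (m + j) := by
  have := C.emb (algebraMap F E r) j (by rw [C.quat.nrm_algebraMap]; exact hr)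
  rw [commutes] at this
  rw [smul_def]
  exact Λ.rad_mul this ha (add_comm _ _)

lemma mem_rad_iff {a : M2 F} {x : E} {m j : ℤ} (hx : nrm nr x = nrm nr t ^ j) :
    ι x * a ∈ Λ.rad (m + j) ↔ a ∈ Λ.rad m := by
  have hx0 : x ≠ 0 := by rintro rfl; rw [C.quat.nrm_zero] at hx; exact (zpow_pos C.t_pos _).ne hx
  constructor
  · intro h
    have := Λ.rad_mul (C.emb x⁻¹ (-j) (by rw [C.quat.nrm_inv, hx, zpow_neg])) h
      (show -j + (m + j) = m by ring)
    rwa [← mul_assoc, ← map_mul, inv_mul_cancel₀ hx0, map_one, one_mul] at this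
  · intro h
    exact Λ.rad_mul (C.emb x j hx.le) h (add_comm _ _)

lemma rad_one_lt {a : M2 F} (ha : a ∈ Λ.rad 1) : normF F a.trace < 1 ∧ normF F a.det < 1 := by
  have hq := one_lt_resCard F
  have hπ := normF_uniformizer C.irr
  have hπ0 := uniformizer_ne_zero C.irr
  have h2 : a * a ∈ Λ.rad (0 + Λ.e) := by
    have he : (Λ.e : ℤ) ≤ 2 := by exact_mod_cast C.e_le
    exact Λ.rad_antitone (by omega) (Λ.rad_mul ha ha rfl)
  have h3 : (ϖ : F)⁻¹ • (a * a) ∈ Λ.rad 0 := by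
    have := C.smul_mem_rad (r := (ϖ : F)⁻¹) (j := -Λ.e) h2 (by
      rw [zpow_neg, zpow_natCast, C.t_e, normF_inv, hπ]; simp)
    simpa using this
  obtain ⟨ht, hd⟩ := C.rad_zero_le h3
  rw [trace_smul, smul_eq_mul, normF_mul, normF_inv, hπ, inv_inv] at ht
  rw [Matrix.det_smul, Fintype.card_fin, det_mul, normF_mul, normF_pow, normF_inv, hπ,
    inv_inv, normF_mul] at hd
  have hd0 := normF_nonneg a.det
  have hdet : normF F a.det < 1 := by
    by_contra! hlt
    have h1 : 1 ≤ normF F a.det * normF F a.det := one_le_mul_of_one_le_of_one_le hlt hlt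
    have h2 : (1 : ℝ) < resCard F ^ 2 := one_lt_pow₀ hq two_ne_zero
    nlinarith
  refine ⟨?_, hdet⟩
  have e : a.trace ^ 2 = (a * a).trace + 2 * a.det := by
    simp [trace_fin_two, det_fin_two, Matrix.mul_apply, Fin.sum_univ_two]; ring
  have h5 : normF F (a * a).trace < 1 := by
    have := normF_nonneg (a * a).trace
    by_contra! hlt; nlinarith
  have h6 : normF F (2 * a.det) < 1 := by
    rw [normF_mul]
    refine lt_of_le_of_lt (mul_le_of_le_one_left hd0 ?_) hdet
    exact normF_le_one.2 (ofNat_mem _ 2)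
  have h7 : normF F a.trace ^ 2 < 1 := by
    rw [← normF_pow, e]; exact (normF_add_le _ _).trans_lt (max_lt h5 h6)
  have := normF_nonneg a.trace
  by_contra! hlt; nlinarith

/-- The trace dual of the radical is the chain order. -/
lemma mem_rad_zero_of_dual {z : M2 F} (hz : ∀ x ∈ Λ.rad 1, normF F (z * x).trace < 1) :
    z ∈ Λ.rad 0 := by
  by_contra hn
  obtain ⟨i, w, hw, hzw⟩ : ∃ i, ∃ w ∈ Λ.L i, z *ᵥ w ∉ Λ.L (i + 0) := by by_contra! h; exact hn h
  rw [add_zero] at hzw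
  have hv : z *ᵥ w ≠ 0 := fun h => hzw (h ▸ zero_mem _)
  obtain ⟨j, h1, h2⟩ := C.exists_order hv
  have hij : j < i := by by_contra! hle; exact hzw (Λ.L_antitone hle h1)
  obtain ⟨y, hy⟩ := C.exists_act hv w
  obtain ⟨c, d, rfl⟩ := C.coords y
  have hX := C.op_mulVec hv !![c, 0; d, 0]
  have hX' : ∀ a b : F, op ι s (z *ᵥ w) !![c, 0; d, 0] *ᵥ (ι ε(a, b, s) *ᵥ (z *ᵥ w)) = a • w := by
    intro a b
    rw [hX]
    conv_rhs => rw [← hy, ← smul_mulVec, ← map_smul]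
    congr 2
    simp [smul_def]; ring
  have hmem : op ι s (z *ᵥ w) !![c, 0; d, 0] ∈ Λ.rad 1 := by
    intro m u hu
    obtain ⟨x, rfl⟩ := C.exists_act hv u
    rw [C.act_mem_iff h1 h2] at hu
    obtain ⟨a, b, rfl⟩ := C.coords x
    rw [hX']
    have h3 := C.emb (algebraMap F E a) (m - j) ((C.le_left a b).trans hu) _ _ hw
    rw [commutes, algebraMap_eq_smul_one, smul_mulVec, one_mulVec] at h3
    exact Λ.L_antitone (by omega) h3
  have htr : z * op ι s (z *ᵥ w) !![c, 0; d, 0] = op ι s (z *ᵥ w) !![1, 0; 0, 0] := by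
    refine C.ext_op hv ?_ ?_
    · rw [← mulVec_mulVec, C.op_mulVec_left hv, C.op_mulVec_left hv]
      simp only [of_apply, Matrix.cons_val, hy, map_one, map_zero, zero_mul, add_zero, one_mulVec]
    · rw [← mulVec_mulVec, C.op_mulVec_right hv, C.op_mulVec_right hv]
      simp only [of_apply, Matrix.cons_val, map_zero, zero_mul, add_zero, zero_mulVec,
        Matrix.mulVec_zero]
  have := hz _ hmem
  rw [htr, C.op_trace hv] at this
  simp at this

end ChainExt

namespace ChainExt

open scoped Matrix

variable {Λ : LatticeChain F} {ϖ : 𝒪[F]} {ι : E →ₐ[F] M2 F} {tr nr : E → F} {t s : E}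

variable {v : Fin 2 → F} (C : ChainExt Λ ι tr nr ϖ t s)
include C

lemma op_mul (hv : v ≠ 0) (M N : M2 F) : op ι s v M * op ι s v N = op ι s v (M * N) := by
  simp only [op, ← mul_assoc]
  rw [Matrix.nonsing_inv_mul_cancel_right _ _ (C.isUnit_frame hv)]

lemma op_one (hv : v ≠ 0) : op ι s v (1 : M2 F) = 1 := by
  rw [op, mul_one, Matrix.mul_nonsing_inv _ (C.isUnit_frame hv)]

lemma op_smul (v : Fin 2 → F) (r : F) (M : M2 F) : op ι s v (r • M) = r • op ι s v M := by
  rw [op, Matrix.mul_smul, Matrix.smul_mul, op]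

lemma uniformizer_zpow_sq (k : ℤ) : ((resCard F ^ (-k)) ^ 2) = nrm nr t ^ (Λ.e * k) := by
  rw [zpow_mul, zpow_natCast, C.t_e, ← zpow_natCast, ← zpow_natCast, inv_zpow', ← zpow_mul,
    ← zpow_mul]
  congr 1; ring

lemma op_mem_rad (h1 : v ∈ Λ.L 0) (h2 : v ∉ Λ.L (0 + 1)) {M : M2 F} {k m : ℤ}
    (hM : ∀ i j, normF F (M i j) ≤ resCard F ^ (-k)) (hm : m = Λ.e * k - Λ.e + 1) :
    op ι s v M ∈ Λ.rad m := by
  have hv := C.ne_zero_of h2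
  subst hm
  apply Λ.mem_rad_of_zero C.irr
  intro u hu
  obtain ⟨x, rfl⟩ := C.exists_act hv u
  rw [C.act_mem_iff h1 h2, sub_zero, zpow_zero] at hu
  obtain ⟨a, b, rfl⟩ := C.coords x
  obtain ⟨ha, hb⟩ := C.coords_int hu
  rw [C.op_mulVec hv, C.act_mem_iff h1 h2, sub_zero]
  have hq : (0 : ℝ) < resCard F ^ (-k) := zpow_pos (resCard_pos F) _
  have key : ∀ i, normF F (M i 0 * a + M i 1 * b) ≤ resCard F ^ (-k) := by
    intro i
    refine (normF_add_le _ _).trans (max_le ?_ ?_)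
    · rw [normF_mul]
      exact (mul_le_of_le_one_right (normF_nonneg _) ha).trans (hM _ _)
    · rw [normF_mul]
      exact (mul_le_of_le_one_right (normF_nonneg _) hb).trans (hM _ _)
  rw [← C.uniformizer_zpow_sq]
  refine C.quat.nrm_add_le_of ?_ ?_
  · rw [C.quat.nrm_algebraMap]
    exact pow_le_pow_left₀ (normF_nonneg _) (key 0) 2
  · rw [C.quat.nrm_mul, C.quat.nrm_algebraMap]
    exact (mul_le_of_le_one_right (sq_nonneg _) C.s_le).trans
      (pow_le_pow_left₀ (normF_nonneg _) (key 1) 2)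

/-- An Iwasawa decomposition of `GL₂(F)` with respect to the torus `Eˣ`. -/
lemma iwasawa (h2 : v ∉ Λ.L (0 + 1)) {g : M2 F}
    (hg : g.det ≠ 0) : ∃ (x : E) (M : M2 F) (a b : F), x ≠ 0 ∧ normF F a ≤ 1 ∧ normF F b ≤ 1 ∧
      b ≠ 0 ∧ g = ι x * op ι s v M ∧ (M = !![1, a; 0, b] ∨ M = !![a, 1; b, 0]) := by
  have hv := C.ne_zero_of h2
  obtain ⟨x1, hx1⟩ := C.exists_act hv (g *ᵥ v)
  obtain ⟨x2, hx2⟩ := C.exists_act hv (g *ᵥ (ι s *ᵥ v))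
  have hs : s ≠ 0 := by
    rintro hs
    have := C.le_s
    rw [hs, C.quat.nrm_zero] at this
    exact (inv_pos.2 (resCard_pos F)).not_ge this
  have inj : ∀ w : Fin 2 → F, g *ᵥ w = 0 → w = 0 := fun w hw =>
    Matrix.eq_zero_of_mulVec_eq_zero hg hw
  have hx10 : x1 ≠ 0 := by
    rintro rfl
    rw [map_zero, zero_mulVec] at hx1
    exact hv (inj _ hx1.symm)
  have hx20 : x2 ≠ 0 := by
    rintro rfl
    rw [map_zero, zero_mulVec] at hx2
    exact hs (C.act_eq_zero hv (inj _ hx2.symm))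
  have hb0 : ∀ (x : E) (M : M2 F) (a b : F), g = ι x * op ι s v M →
      (M = !![1, a; 0, b] ∨ M = !![a, 1; b, 0]) → b ≠ 0 := by
    rintro x M a b hgM hM rfl
    apply hg
    rw [hgM, det_mul, C.op_det hv]
    rcases hM with rfl | rfl <;> simp [det_fin_two]
  rcases le_total (nrm nr x2) (nrm nr x1) with hle | hle
  · obtain ⟨a, b, hab⟩ := C.coords (x1⁻¹ * x2)
    have hint : nrm nr ε(a, b, s) ≤ 1 := by
      rw [← hab, C.quat.nrm_mul, C.quat.nrm_inv]
      exact inv_mul_le_one_of_le₀ hle (nrm_nonneg nr _)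
    obtain ⟨ha, hb⟩ := C.coords_int hint
    have hgM : g = ι x1 * op ι s v !![1, a; 0, b] := by
      refine C.ext_op hv ?_ ?_
      · rw [← mulVec_mulVec, C.op_mulVec_left hv, ← hx1]
        simp only [of_apply, Matrix.cons_val, map_one, map_zero, zero_mul, add_zero, one_mulVec]
      · rw [← mulVec_mulVec, C.op_mulVec_right hv, ← hx2]
        simp only [of_apply, Matrix.cons_val]
        rw [← hab, mulVec_mulVec, ← map_mul, mul_inv_cancel_left₀ hx10]
    exact ⟨x1, _, a, b, hx10, ha, hb, hb0 _ _ a b hgM (Or.inl rfl), hgM, Or.inl rfl⟩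
  · obtain ⟨a, b, hab⟩ := C.coords (x2⁻¹ * x1)
    have hint : nrm nr ε(a, b, s) ≤ 1 := by
      rw [← hab, C.quat.nrm_mul, C.quat.nrm_inv]
      exact inv_mul_le_one_of_le₀ hle (nrm_nonneg nr _)
    obtain ⟨ha, hb⟩ := C.coords_int hint
    have hgM : g = ι x2 * op ι s v !![a, 1; b, 0] := by
      refine C.ext_op hv ?_ ?_
      · rw [← mulVec_mulVec, C.op_mulVec_left hv, ← hx1]
        simp only [of_apply, Matrix.cons_val]
        rw [← hab, mulVec_mulVec, ← map_mul, mul_inv_cancel_left₀ hx20]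
      · rw [← mulVec_mulVec, C.op_mulVec_right hv, ← hx2]
        simp only [of_apply, Matrix.cons_val, map_one, map_zero, zero_mul, add_zero, one_mulVec]
    exact ⟨x2, _, a, b, hx20, ha, hb, hb0 _ _ a b hgM (Or.inr rfl), hgM, Or.inr rfl⟩

/-- A nilpotent element of the radical whose conjugate under `g` is small. -/
lemma exists_nilpotent {α : E} {n : ℤ} {k : ℕ} (hs : s = (ϖ : F) ^ k • α)
    (hk : n = Λ.e * (k : ℤ) - Λ.e + 1)
    {v : Fin 2 → F} (h1 : v ∈ Λ.L 0) (h2 : v ∉ Λ.L (0 + 1)) {g : M2 F}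
    (hg : g.det ≠ 0) : ∃ X ∈ Λ.rad n, X * X = 0 ∧ (ι α * X).trace = 1 ∧
      ∃ (x : E) (M Y : M2 F) (a b : F), x ≠ 0 ∧ normF F a ≤ 1 ∧ normF F b ≤ 1 ∧
      b ≠ 0 ∧ g = ι x * op ι s v M ∧ (M = !![1, a; 0, b] ∨ M = !![a, 1; b, 0]) ∧
      X * g = g * b • Y ∧ Y ∈ Λ.rad n := by
  have hv := C.ne_zero_of h2
  have hq := one_lt_resCard F
  have hπ := normF_uniformizer C.irr
  have hπ0 := uniformizer_ne_zero C.irr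
  obtain ⟨x, M, a, b, hx, ha, hb, hb0, hgM, hM⟩ := C.iwasawa h2 hg
  have hπk : normF F ((ϖ : F) ^ k) = resCard F ^ (-(k : ℤ)) := by
    rw [normF_pow, hπ, zpow_neg, zpow_natCast, inv_pow]
  set X₀ : M2 F := op ι s v !![0, (ϖ : F) ^ k; 0, 0] with hX₀
  have hX₀r : X₀ ∈ Λ.rad n := by
    refine C.op_mem_rad h1 h2 (k := k) ?_ hk
    intro i j
    fin_cases i <;> fin_cases j <;> simp [hπk, (resCard_pos F).le]
  obtain ⟨l, hl⟩ := C.exists_zpow hx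
  have hxx : ι x⁻¹ * ι x = 1 := by rw [← map_mul, inv_mul_cancel₀ hx, map_one]
  have hα : ι α * X₀ = op ι s v !![0, 0; 0, 1] := by
    have hα' : α = (ϖ : F)⁻¹ ^ k • s := by
      rw [hs, smul_smul, ← mul_pow, inv_mul_cancel₀ hπ0, one_pow, one_smul]
    refine C.ext_op hv ?_ ?_
    · rw [← mulVec_mulVec, C.op_mulVec_left hv, C.op_mulVec_left hv]
      simp only [of_apply, Matrix.cons_val, map_zero, zero_mul, add_zero, zero_mulVec,
        Matrix.mulVec_zero]
    · rw [← mulVec_mulVec, C.op_mulVec_right hv, C.op_mulVec_right hv]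
      simp only [of_apply, Matrix.cons_val, map_zero, zero_mul, add_zero, zero_add, map_one, one_mul]
      rw [mulVec_mulVec, ← map_mul]
      congr 2
      rw [hs, smul_def, mul_comm]
  refine ⟨ι x * X₀ * ι x⁻¹, ?_, ?_, ?_, x, M, ?_⟩
  · have h3 := C.emb x⁻¹ (-l) (by rw [C.quat.nrm_inv, hl, zpow_neg])
    have h4 := (C.mem_rad_iff (a := X₀) (m := n) hl).2 hX₀r
    exact Λ.rad_mul h4 h3 (by ring)
  · have : X₀ * X₀ = 0 := by
      rw [hX₀, C.op_mul hv]
      have : (!![0, (ϖ : F) ^ k; 0, 0] * !![0, (ϖ : F) ^ k; 0, 0] : M2 F) = 0 := by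
        ext i j; fin_cases i <;> fin_cases j <;> simp [Matrix.mul_apply, Fin.sum_univ_two]
      rw [this, op, mul_zero, zero_mul]
    calc ι x * X₀ * ι x⁻¹ * (ι x * X₀ * ι x⁻¹) = ι x * X₀ * (ι x⁻¹ * ι x) * X₀ * ι x⁻¹ := by
          simp only [mul_assoc]
      _ = 0 := by rw [hxx, mul_one, mul_assoc (ι x), this, mul_zero, zero_mul]
  · have : ι α * (ι x * X₀ * ι x⁻¹) = ι x * (ι α * X₀) * ι x⁻¹ := by
      simp only [← mul_assoc, ← map_mul, mul_comm α x]
    rw [this, trace_mul_comm, ← mul_assoc, hxx, one_mul, hα, C.op_trace hv]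
    simp [trace_fin_two]
  · have hconj : ∀ Y' : M2 F, !![0, (ϖ : F) ^ k; 0, 0] * M = M * b • Y' →
        ι x * X₀ * ι x⁻¹ * g = g * b • op ι s v Y' := by
      intro Y' hY'
      calc ι x * X₀ * ι x⁻¹ * g = ι x * X₀ * (ι x⁻¹ * ι x) * op ι s v M := by
            rw [hgM]; simp only [mul_assoc]
        _ = g * b • op ι s v Y' := by
            rw [hxx, mul_one, mul_assoc, hX₀, C.op_mul hv, hY', ← C.op_mul hv, hgM, mul_assoc,
              C.op_smul]
    rcases hM with rfl | rfl
    · refine ⟨op ι s v !![0, (ϖ : F) ^ k; 0, 0], a, b, hx, ha, hb, hb0, hgM, Or.inl rfl,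
        hconj _ ?_, hX₀r⟩
      ext i j; fin_cases i <;> fin_cases j <;> simp [Matrix.mul_apply, Fin.sum_univ_two, mul_comm]
    · refine ⟨op ι s v !![0, 0; (ϖ : F) ^ k, 0], a, b, hx, ha, hb, hb0, hgM, Or.inr rfl,
        hconj _ ?_, C.op_mem_rad h1 h2 (k := k) ?_ hk⟩
      · ext i j; fin_cases i <;> fin_cases j <;> simp [Matrix.mul_apply, Fin.sum_univ_two, mul_comm]
      · intro i j
        fin_cases i <;> fin_cases j <;> simp [hπk, (resCard_pos F).le]

lemma exists_nilpotent_conj {α : E} {n : ℕ} {k : ℕ} (hs : s = (ϖ : F) ^ k • α)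
    (hk : (n : ℤ) = Λ.e * (k : ℤ) - Λ.e + 1) {g : M2 F} (hg : g.det ≠ 0) :
    ∃ X ∈ Λ.rad n, X * X = 0 ∧ (ι α * X).trace = 1 ∧ ∃ Y ∈ Λ.rad n, X * g = g * Y := by
  obtain ⟨v, h1, h2⟩ := C.exists_generator 0
  obtain ⟨X, hX, hXX, hXt, x, M, Y, a, b, hx, ha, hb, hb0, -, -, h3, h4⟩ :=
    C.exists_nilpotent hs hk h1 h2 hg
  refine ⟨X, hX, hXX, hXt, b • Y, ?_, h3⟩
  have := C.smul_mem_rad (r := b) (j := 0) h4 (by rw [zpow_zero]; exact pow_le_one₀ (normF_nonneg _) hb)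
  simpa using this

/-- Either a nilpotent element of the radical with trace one against `α` has a conjugate close
to zero, or `g` is bounded. -/
lemma exists_nilpotent_small_or_bounded {α : E} {n : ℕ} {k : ℕ} (hs : s = (ϖ : F) ^ k • α)
    (hk : (n : ℤ) = Λ.e * (k : ℤ) - Λ.e + 1) (m : ℕ) (d : ℤ) : ∃ j : ℤ, ∀ g : (M2 F)ˣ,
      normF F (g : M2 F).det = resCard F ^ d →
      (∃ X ∈ Λ.rad n, X * X = 0 ∧ (ι α * X).trace = 1 ∧ ∃ (b : F) (Y : M2 F), Y ∈ Λ.rad n ∧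
        normF F b ≤ (resCard F ^ m)⁻¹ ∧ (g : M2 F) * X = b • Y * g) ∨ (g : M2 F) ∈ Λ.rad j := by
  obtain ⟨v, h1, h2⟩ := C.exists_generator 0
  have hv := C.ne_zero_of h2
  refine ⟨(Λ.e * (-m : ℤ) - Λ.e + 1) + Λ.e * (-|d|), fun g hgd => ?_⟩
  have hq := one_lt_resCard F
  have hginv : ((g⁻¹ : (M2 F)ˣ) : M2 F).det ≠ 0 := by
    have : (((g⁻¹ : (M2 F)ˣ) : M2 F) * (g : M2 F)).det = 1 := by simp
    rw [det_mul] at this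
    exact left_ne_zero_of_mul_eq_one this
  obtain ⟨X, hX, hXX, hXt, x, M, Y, a, b, hx, ha, hb, hb0, hgM, hM, h3, h4⟩ :=
    C.exists_nilpotent hs hk h1 h2 hginv
  by_cases hbm : normF F b ≤ (resCard F ^ m)⁻¹
  · refine Or.inl ⟨X, hX, hXX, hXt, b, Y, h4, hbm, ?_⟩
    calc (g : M2 F) * X = g * (X * (g⁻¹ : (M2 F)ˣ)) * g := by simp [mul_assoc]
      _ = _ := by rw [h3]; simp
  · right
    push Not at hbm
    have hbpos : 0 < normF F b := normF_pos hb0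
    have hbi : (normF F b)⁻¹ ≤ resCard F ^ (-(-m : ℤ)) := by
      rw [neg_neg, zpow_natCast]
      exact inv_le_of_inv_le₀ (pow_pos (resCard_pos F) _) hbm.le
    obtain ⟨N, hMN, hN⟩ : ∃ N : M2 F, N * M = 1 ∧ ∀ i j, normF F (N i j) ≤ (normF F b)⁻¹ := by
      have h1b : 1 ≤ (normF F b)⁻¹ := one_le_inv_iff₀.2 ⟨hbpos, hb⟩
      have hab : (normF F b)⁻¹ * normF F a ≤ (normF F b)⁻¹ :=
        mul_le_of_le_one_right (by positivity) ha
      rcases hM with rfl | rfl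
      · refine ⟨!![1, -(b⁻¹ * a); 0, b⁻¹], ?_, ?_⟩
        · ext i j; fin_cases i <;> fin_cases j <;>
            simp [Matrix.mul_apply, Fin.sum_univ_two, hb0]; field_simp; ring
        · intro i j; fin_cases i <;> fin_cases j <;> simp [h1b, hab, hbpos.le]
      · refine ⟨!![0, b⁻¹; 1, -(b⁻¹ * a)], ?_, ?_⟩
        · ext i j; fin_cases i <;> fin_cases j <;>
            simp [Matrix.mul_apply, Fin.sum_univ_two, hb0]; field_simp; ring
        · intro i j; fin_cases i <;> fin_cases j <;> simp [h1b, hab, hbpos.le]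
    have hN' := C.op_mem_rad h1 h2 (k := -(m : ℤ)) (fun i j => (hN i j).trans hbi) rfl
    have hgi : (g : M2 F) = op ι s v N * ι x⁻¹ := by
      have h5 : op ι s v N * ι x⁻¹ * ((g⁻¹ : (M2 F)ˣ) : M2 F) = 1 := by
        rw [hgM, mul_assoc, ← mul_assoc (ι x⁻¹), ← map_mul, inv_mul_cancel₀ hx, map_one, one_mul,
          C.op_mul hv, hMN, C.op_one hv]
      calc (g : M2 F) = op ι s v N * ι x⁻¹ * ((g⁻¹ : (M2 F)ˣ) : M2 F) * g := by rw [h5, one_mul]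
        _ = _ := by simp [mul_assoc]
    have hxn : nrm nr x⁻¹ ≤ nrm nr t ^ (Λ.e * (-|d|)) := by
      rw [← C.uniformizer_zpow_sq, neg_neg]
      have hdet : normF F (g : M2 F).det * (nrm nr x * normF F b) = 1 := by
        have : (g : M2 F).det * ((g⁻¹ : (M2 F)ˣ) : M2 F).det = 1 := by rw [← det_mul]; simp
        have h6 := congrArg (normF F) this
        rw [hgM, det_mul, C.op_det hv, C.det_eq, normF_mul, normF_mul, normF_one] at h6
        have : normF F M.det = normF F b := by rcases hM with rfl | rfl <;> simp [det_fin_two]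
        rwa [this] at h6
      have hxpos : 0 < nrm nr x := C.quat.nrm_pos hx
      have h7 : nrm nr x⁻¹ = resCard F ^ d * normF F b := by
        rw [C.quat.nrm_inv, ← hgd]
        field_simp
        linarith
      rw [h7]
      have h8 : resCard F ^ d ≤ resCard F ^ |d| := zpow_le_zpow_right₀ hq.le (le_abs_self d)
      have h9 : (1 : ℝ) ≤ resCard F ^ |d| := one_le_zpow₀ hq.le (abs_nonneg d)
      calc resCard F ^ d * normF F b ≤ resCard F ^ |d| * 1 := by gcongr
        _ ≤ _ := by nlinarith
    rw [hgi]
    exact Λ.rad_mul hN' (C.emb _ _ hxn) rfl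

end ChainExt

section Perp

variable {F E A : Type*} [Field F] [Field E] [Algebra F E] [Ring A] [Algebra F A]

/-- The orthogonal complement of `E` for the form `(x, y) ↦ tr (x * y)`. -/
def Perp (tr : A → F) (ι : E →ₐ[F] A) : Set A := {c | ∀ x : E, tr (c * ι x) = 0}

/-- The nontrivial automorphism of a quadratic extension in terms of its trace. -/
def conjE (trE : E → F) (x : E) : E := algebraMap F E (trE x) - x

variable {tr nr : A → F} {trE nrE : E → F} {ι : E →ₐ[F] A} {c d : A}

lemma perp_add (h : IsQuat tr nr) (hc : c ∈ Perp tr ι) (hd : d ∈ Perp tr ι) :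
    c + d ∈ Perp tr ι := fun x => by
  rw [add_mul, h.tr_add, hc, hd, add_zero]

lemma perp_neg (h : IsQuat tr nr) (hc : c ∈ Perp tr ι) : -c ∈ Perp tr ι := fun x => by
  rw [neg_mul, h.tr_neg, hc, neg_zero]

lemma perp_sub (h : IsQuat tr nr) (hc : c ∈ Perp tr ι) (hd : d ∈ Perp tr ι) :
    c - d ∈ Perp tr ι := by
  rw [sub_eq_add_neg]; exact perp_add h hc (perp_neg h hd)

lemma perp_zero (h : IsQuat tr nr) : (0 : A) ∈ Perp tr ι := fun x => by rw [zero_mul, h.tr_zero]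

lemma perp_left (h : IsQuat tr nr) (hc : c ∈ Perp tr ι) (y : E) : ι y * c ∈ Perp tr ι := fun x => by
  rw [mul_assoc, h.tr_comm, mul_assoc, ← map_mul, hc]

lemma perp_right (hc : c ∈ Perp tr ι) (y : E) : c * ι y ∈ Perp tr ι := fun x => by
  rw [mul_assoc, ← map_mul, hc]

lemma perp_tr (hc : c ∈ Perp tr ι) : tr c = 0 := by
  have := hc 1; rwa [map_one, mul_one] at this

lemma perp_mul (h : IsQuat tr nr) (htr : ∀ x, tr (ι x) = trE x) (hc : c ∈ Perp tr ι) (x : E) :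
    c * ι x = ι (conjE trE x) * c := by
  have := h.star_anti c (ι x)
  rw [hc x, perp_tr hc, htr, map_zero, zero_sub, zero_sub] at this
  rw [conjE, map_sub, commutes]
  have h2 := congrArg Neg.neg this
  rw [neg_neg] at h2
  rw [h2]
  noncomm_ring

lemma perp_sq (h : IsQuat tr nr) (hc : c ∈ Perp tr ι) : c * c = -algebraMap F A (nr c) := by
  rw [← h.mul_star c, perp_tr hc, map_zero, zero_sub, mul_neg, neg_neg]

lemma nr_add_perp [Nontrivial A] (h : IsQuat tr nr) (htr : ∀ x, tr (ι x) = trE x)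
    (hnr : ∀ x, nr (ι x) = nrE x) (hc : c ∈ Perp tr ι) (x : E) :
    nr (ι x + c) = nrE x + nr c := by
  apply (algebraMap F A).injective
  have h1 : tr (ι x + c) = trE x := by rw [h.tr_add, htr, perp_tr hc, add_zero]
  have h2 := h.mul_star (ι x)
  have h3 := perp_sq h hc
  have h4 := perp_mul h htr hc x
  rw [← h.mul_star, h1, map_add, ← hnr, ← h2, htr]
  rw [conjE, map_sub, commutes, sub_mul] at h4
  have h5 : algebraMap F A (nr c) = -(c * c) := by rw [h3, neg_neg]
  have h6 : (algebraMap F A) (trE x) * c = c * (algebraMap F A) (trE x) := Algebra.commutes _ _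
  rw [h5]
  simp only [mul_sub, mul_add, add_mul]
  rw [h4, ← h6]
  noncomm_ring

/-- The trace form of a quadratic extension with nonzero trace represents all functionals. -/
lemma exists_pr (h : IsQuat tr nr) (hE : IsQuat trE nrE) (htr : ∀ x, tr (ι x) = trE x)
    [FiniteDimensional F E] {x₀ : E} (hx₀ : trE x₀ ≠ 0) :
    ∃ pr : A → E, ∀ a, a - ι (pr a) ∈ Perp tr ι := by
  let T : E →ₗ[F] Module.Dual F E :=
    { toFun := fun x =>
        { toFun := fun y => trE (x * y)
          map_add' := fun y z => by rw [mul_add, hE.tr_add]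
          map_smul' := fun r y => by rw [mul_smul_comm, hE.tr_smul]; rfl }
      map_add' := fun x y => by ext z; simp [add_mul, hE.tr_add]
      map_smul' := fun r x => by ext z; simp [hE.tr_smul] }
  have hT : Injective T := by
    rw [← LinearMap.ker_eq_bot, LinearMap.ker_eq_bot']
    intro x hx
    by_contra h0
    have := LinearMap.congr_fun hx (x⁻¹ * x₀)
    apply hx₀
    simpa [T, mul_inv_cancel_left₀ h0] using this
  have hTs : Function.Surjective T := (LinearMap.injective_iff_surjective_of_finrank_eq_finrank
      Subspace.dual_finrank_eq.symm).1 hT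
  have key : ∀ a : A, ∃ e : E, a - ι e ∈ Perp tr ι := by
    intro a
    obtain ⟨e, he⟩ := hTs
      { toFun := fun y => tr (a * ι y)
        map_add' := fun y z => by rw [map_add, mul_add, h.tr_add]
        map_smul' := fun r y => by rw [map_smul, mul_smul_comm, h.tr_smul]; rfl }
    refine ⟨e, fun x => ?_⟩
    have := LinearMap.congr_fun he x
    rw [sub_mul, h.tr_sub, ← map_mul, htr]
    exact sub_eq_zero.2 this.symm
  choose pr hpr using key
  exact ⟨pr, hpr⟩

end Perp

/-- An order `O` of `A`, one of `M₂(F)` and `B`, together with an embedding of `E` and the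
projection `pr` to `E` along its orthogonal complement. -/
structure Side {A : Type*} [Ring A] [Algebra F A] (tr nr : A → F) (trE nrE : E → F) (ι : E →ₐ[F] A)
    (pr : A → E) (O : Set A) (t : E) (δ : ℤ) : Prop where
  quat : IsQuat tr nr
  quatE : IsQuat trE nrE
  tr_ι : ∀ x, tr (ι x) = trE x
  nr_ι : ∀ x, nr (ι x) = nrE x
  tr_ne : ∃ x, trE x ≠ 0
  conj_ne : ∃ x, conjE trE x ≠ x
  pr_spec : ∀ a, a - ι (pr a) ∈ Perp tr ι
  add_mem : ∀ {a b}, a ∈ O → b ∈ O → a + b ∈ O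
  mul_mem : ∀ {a b}, a ∈ O → b ∈ O → a * b ∈ O
  ι_mem : ∀ {x}, nrm nrE x ≤ 1 → ι x ∈ O
  t_pos : 0 < nrm nrE t
  t_lt : nrm nrE t < 1
  δ_le : δ ≤ 1
  sq_le : ∀ {c c'}, c ∈ Perp tr ι → c ∈ O → c' ∈ Perp tr ι → c' ∈ O →
    ∀ {y}, c * c' = ι y → nrm nrE y ≤ nrm nrE t ^ (1 - δ)

namespace Side

variable {A : Type*} [Ring A] [Algebra F A] [Nontrivial A] {tr nr : A → F} {trE nrE : E → F}
  {ι : E →ₐ[F] A} {pr : A → E} {O : Set A} {t : E} {δ : ℤ}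

/-- The elements of `𝔭_E ^ j (O ∩ C)`, where `C` is the complement of `E`. -/
def V (tr : A → F) (ι : E →ₐ[F] A) (O : Set A) (t : E) (j : ℤ) : Set A :=
  {c | c ∈ Perp tr ι ∧ ι (t ^ (-j)) * c ∈ O}

variable (S : Side tr nr trE nrE ι pr O t δ)
include S

lemma t_ne : t ≠ 0 := by
  rintro rfl
  have := S.t_pos
  rw [S.quatE.nrm_zero] at this
  exact this.false

lemma nrm_conj (x : E) : nrm nrE (conjE trE x) = nrm nrE x := S.quatE.nrm_star x

lemma neg_mem {a : A} (ha : a ∈ O) : -a ∈ O := by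
  have := S.mul_mem (S.ι_mem (x := -1) (by rw [S.quatE.nrm_neg, S.quatE.nrm_one])) ha
  rwa [map_neg, map_one, neg_one_mul] at this

lemma zero_mem : (0 : A) ∈ O := by
  have := S.ι_mem (x := 0) (by rw [S.quatE.nrm_zero]; exact zero_le_one)
  rwa [map_zero] at this

lemma sub_mem {a b : A} (ha : a ∈ O) (hb : b ∈ O) : a - b ∈ O := by
  rw [sub_eq_add_neg]; exact S.add_mem ha (S.neg_mem hb)

lemma eq_zero_of_perp {e : E} (he : ι e ∈ Perp tr ι) : e = 0 := by
  obtain ⟨x₀, hx₀⟩ := S.tr_ne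
  by_contra h0
  apply hx₀
  have := he (e⁻¹ * x₀)
  rwa [← map_mul, mul_inv_cancel_left₀ h0, S.tr_ι] at this

lemma pr_eq {a c : A} {e : E} (ha : a = ι e + c) (hc : c ∈ Perp tr ι) : pr a = e := by
  have h1 := perp_sub S.quat (S.pr_spec a) hc
  rw [ha] at h1
  have h2 : ι e + c - ι (pr (ι e + c)) - c = ι (e - pr (ι e + c)) := by rw [map_sub]; abel
  rw [h2] at h1
  rw [ha]
  exact (sub_eq_zero.1 (S.eq_zero_of_perp h1)).symm

lemma pr_ι (e : E) : pr (ι e) = e := S.pr_eq (c := 0) (by rw [add_zero]) (perp_zero S.quat)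

lemma pr_one : pr 1 = 1 := by
  have := S.pr_ι 1; rwa [map_one] at this

lemma pr_perp {c : A} (hc : c ∈ Perp tr ι) : pr c = 0 := S.pr_eq (by rw [map_zero, zero_add]) hc

lemma decomp (a : A) : ∃ c ∈ Perp tr ι, a = ι (pr a) + c := ⟨a - ι (pr a), S.pr_spec a, by abel⟩

lemma pr_add (a b : A) : pr (a + b) = pr a + pr b := by
  obtain ⟨c, hc, ha⟩ := S.decomp a
  obtain ⟨d, hd, hb⟩ := S.decomp b
  refine S.pr_eq (c := c + d) ?_ (perp_add S.quat hc hd)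
  nth_rewrite 1 [ha, hb]
  rw [map_add]; abel

lemma pr_neg (a : A) : pr (-a) = -pr a := by
  obtain ⟨c, hc, ha⟩ := S.decomp a
  refine S.pr_eq (c := -c) ?_ (perp_neg S.quat hc)
  nth_rewrite 1 [ha]
  rw [map_neg]; abel

lemma pr_sub (a b : A) : pr (a - b) = pr a - pr b := by
  rw [sub_eq_add_neg, S.pr_add, S.pr_neg, sub_eq_add_neg]

lemma pr_left (x : E) (a : A) : pr (ι x * a) = x * pr a := by
  obtain ⟨c, hc, ha⟩ := S.decomp a
  refine S.pr_eq (c := ι x * c) ?_ (perp_left S.quat hc x)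
  nth_rewrite 1 [ha]
  rw [map_mul, mul_add]

lemma pr_right (x : E) (a : A) : pr (a * ι x) = pr a * x := by
  obtain ⟨c, hc, ha⟩ := S.decomp a
  refine S.pr_eq (c := c * ι x) ?_ (perp_right hc x)
  nth_rewrite 1 [ha]
  rw [map_mul, add_mul]

lemma tr_pr (a : A) : tr a = trE (pr a) := by
  obtain ⟨c, hc, ha⟩ := S.decomp a
  nth_rewrite 1 [ha]
  rw [S.quat.tr_add, S.tr_ι, perp_tr hc, add_zero]

/-- The product of two elements of the complement of `E` lies in `E`. -/
lemma perp_mul_perp {c d : A} (hc : c ∈ Perp tr ι) (hd : d ∈ Perp tr ι) :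
    c * d = ι (pr (c * d)) := by
  obtain ⟨x, hx⟩ := S.conj_ne
  obtain ⟨c', hc', h⟩ := S.decomp (c * d)
  have hxx : conjE trE (conjE trE x) = x := by
    have h1 : trE (conjE trE x) = trE x := by
      rw [conjE, S.quatE.tr_sub, S.quatE.tr_algebraMap]; ring
    rw [conjE, h1, conjE]; abel
  have h1 : c * d * ι x = ι x * (c * d) := by
    rw [mul_assoc, perp_mul S.quat S.tr_ι hd, ← mul_assoc, perp_mul S.quat S.tr_ι hc, hxx, mul_assoc]
  rw [h] at h1
  have h2 : c' * ι x = ι x * c' := by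
    rw [add_mul, mul_add, ← map_mul, ← map_mul, mul_comm x] at h1
    exact add_left_cancel h1
  rw [perp_mul S.quat S.tr_ι hc', ← sub_eq_zero, ← sub_mul, ← map_sub] at h2
  have h3 : c' = 0 := by
    have := congrArg (ι (conjE trE x - x)⁻¹ * ·) h2
    simpa only [← mul_assoc, ← map_mul, inv_mul_cancel₀ (sub_ne_zero.2 hx), map_one, one_mul,
      mul_zero] using this
  rw [h3, add_zero] at h
  exact h

lemma V_add {j : ℤ} {c d : A} (hc : c ∈ V tr ι O t j) (hd : d ∈ V tr ι O t j) :
    c + d ∈ V tr ι O t j :=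
  ⟨perp_add S.quat hc.1 hd.1, by rw [mul_add]; exact S.add_mem hc.2 hd.2⟩

lemma V_neg {j : ℤ} {c : A} (hc : c ∈ V tr ι O t j) : -c ∈ V tr ι O t j :=
  ⟨perp_neg S.quat hc.1, by rw [mul_neg]; exact S.neg_mem hc.2⟩

lemma V_zero (j : ℤ) : (0 : A) ∈ V tr ι O t j :=
  ⟨perp_zero S.quat, by rw [mul_zero]; exact S.zero_mem⟩

lemma V_left {j i m : ℤ} {c : A} {x : E} (hx : nrm nrE x ≤ nrm nrE t ^ i) (hc : c ∈ V tr ι O t j)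
    (hm : m = i + j) : ι x * c ∈ V tr ι O t m := by
  refine ⟨perp_left S.quat hc.1 x, ?_⟩
  have h1 : ι (t ^ (-m)) * (ι x * c) = ι (t ^ (-i) * x) * (ι (t ^ (-j)) * c) := by
    simp only [← mul_assoc, ← map_mul]
    congr 2
    rw [hm, neg_add, zpow_add₀ S.t_ne]; ring
  rw [h1]
  refine S.mul_mem (S.ι_mem ?_) hc.2
  rw [S.quatE.nrm_mul, S.quatE.nrm_zpow, zpow_neg]
  exact inv_mul_le_one_of_le₀ hx (zpow_nonneg S.t_pos.le _)

lemma V_right {j i m : ℤ} {c : A} {x : E} (hx : nrm nrE x ≤ nrm nrE t ^ i) (hc : c ∈ V tr ι O t j)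
    (hm : m = i + j) : c * ι x ∈ V tr ι O t m := by
  rw [perp_mul S.quat S.tr_ι hc.1]
  exact S.V_left (by rwa [S.nrm_conj]) hc hm

lemma V_mono {i j : ℤ} (hij : i ≤ j) {c : A} (hc : c ∈ V tr ι O t j) : c ∈ V tr ι O t i := by
  have := S.V_left (x := 1) (i := i - j) (m := i) (by
    rw [S.quatE.nrm_one]
    exact one_le_zpow_of_nonpos₀ S.t_pos S.t_lt.le (by omega)) hc (by ring)
  rwa [map_one, one_mul] at this

lemma mem_V_zero {c : A} : c ∈ V tr ι O t 0 ↔ c ∈ Perp tr ι ∧ c ∈ O := by simp [V]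

lemma mem_O_of_V {j : ℤ} (hj : 0 ≤ j) {c : A} (hc : c ∈ V tr ι O t j) : c ∈ O :=
  (S.mem_V_zero.1 (S.V_mono hj hc)).2

lemma V_mul_V {i j : ℤ} {c d : A} (hc : c ∈ V tr ι O t i) (hd : d ∈ V tr ι O t j) :
    nrm nrE (pr (c * d)) ≤ nrm nrE t ^ (i + j + 1 - δ) := by
  set c' := ι (t ^ (-i)) * c with hc'
  set d' := ι (t ^ (-j)) * d with hd'
  have ht := S.t_ne
  have h1 : ∀ k : ℤ, ∀ a : A, ι (t ^ k) * (ι (t ^ (-k)) * a) = a := by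
    intro k a
    rw [← mul_assoc, ← map_mul, ← zpow_add₀ ht, add_neg_cancel, zpow_zero, map_one, one_mul]
  have hcd : c * d = ι (t ^ i * conjE trE (t ^ j)) * (c' * d') := by
    have h2 : c = ι (t ^ i) * c' := (h1 i c).symm
    have h3 : d = ι (t ^ j) * d' := (h1 j d).symm
    have hcp : c' ∈ Perp tr ι := perp_left S.quat hc.1 _
    rw [map_mul, h2, h3, mul_assoc, ← mul_assoc c', perp_mul S.quat S.tr_ι hcp]
    simp only [mul_assoc]
  rw [hcd, S.pr_left, S.quatE.nrm_mul, S.quatE.nrm_mul, S.nrm_conj, S.quatE.nrm_zpow,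
    S.quatE.nrm_zpow]
  have h4 := S.sq_le (perp_left S.quat hc.1 _) hc.2 (perp_left S.quat hd.1 _) hd.2
    (S.perp_mul_perp (perp_left S.quat hc.1 _) (perp_left S.quat hd.1 _))
  rw [show i + j + 1 - δ = i + j + (1 - δ) by ring, zpow_add₀ S.t_pos.ne', zpow_add₀ S.t_pos.ne']
  have h5 : 0 < nrm nrE t ^ i * nrm nrE t ^ j := mul_pos (zpow_pos S.t_pos _) (zpow_pos S.t_pos _)
  exact mul_le_mul_of_nonneg_left h4 h5.le

end Side

namespace Side

variable {A : Type*} [Ring A] [Algebra F A] [Nontrivial A] {tr nr : A → F} {trE nrE : E → F}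
  {ι : E →ₐ[F] A} {pr : A → E} {O : Set A} {t : E} {δ : ℤ}

variable (S : Side tr nr trE nrE ι pr O t δ)
include S

lemma pr_mul (a b : A) : pr (a * b) = pr a * pr b + pr ((a - ι (pr a)) * (b - ι (pr b))) := by
  have h : a * b = ι (pr a * pr b) + ι (pr a) * (b - ι (pr b)) + (a - ι (pr a)) * ι (pr b) +
      (a - ι (pr a)) * (b - ι (pr b)) := by
    rw [map_mul]; noncomm_ring
  nth_rewrite 1 [h]
  rw [S.pr_add, S.pr_add, S.pr_add, S.pr_ι, S.pr_perp (perp_left S.quat (S.pr_spec b) _),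
    S.pr_perp (perp_right (S.pr_spec a) _), add_zero, add_zero]

lemma compl_mul (a b : A) :
    a * b - ι (pr (a * b)) = ι (pr a) * (b - ι (pr b)) + (a - ι (pr a)) * ι (pr b) := by
  rw [S.pr_mul, map_add, ← S.perp_mul_perp (S.pr_spec a) (S.pr_spec b), map_mul]
  noncomm_ring

lemma star_eq (a : A) : algebraMap F A (tr a) - a = ι (conjE trE (pr a)) + -(a - ι (pr a)) := by
  rw [conjE, map_sub, commutes, ← S.tr_pr]; abel

lemma pr_star (a : A) : pr (algebraMap F A (tr a) - a) = conjE trE (pr a) :=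
  S.pr_eq (S.star_eq a) (perp_neg S.quat (S.pr_spec a))

lemma nr_eq (a : A) : nr a = nrE (pr a) + nr (a - ι (pr a)) := by
  rw [← nr_add_perp S.quat S.tr_ι S.nr_ι (S.pr_spec a), add_sub_cancel]

lemma nrm_nr_of_V {j : ℤ} {c : A} (hc : c ∈ V tr ι O t j) :
    normF F (nr c) ^ 2 ≤ nrm nrE t ^ (j + j + 1 - δ) := by
  have h := S.V_mul_V hc hc
  rwa [perp_sq S.quat hc.1, S.pr_neg, S.quatE.nrm_neg, ← ι.commutes, S.pr_ι,
    S.quatE.nrm_algebraMap] at h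

end Side

open StratumData

/-- The linking order attached to a simple stratum, with `𝔭_E` generated by `t`. -/
structure Link (S : StratumData F E B) (trE nrE : E → F) (t : E) (p₁ : M2 F → E) (p₂ : B → E)
    (δ : ℕ) :
    Prop where
  side₁ : Side Matrix.trace Matrix.det trE nrE S.ι₁ p₁ (S.chain.rad 0) t 1
  side₂ : Side redTrace redNorm trE nrE S.ι₂ p₂ (radB F B 0) t δ
  n_pos : 1 ≤ S.n
  α_nrm : nrm nrE S.α = nrm nrE t ^ (-(S.n : ℤ))
  mem_pE : ∀ {x m}, x ∈ pE F E m ↔ nrm nrE x ≤ nrm nrE t ^ m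
  V₁_eq : ∀ m, (S.V₁ m : Set (M2 F)) =
    Side.V Matrix.trace S.ι₁ (S.chain.rad 0) t (((m + 1) / 2 : ℕ))
  V₂_eq : ∀ m, (S.V₂ m : Set B) = Side.V redTrace S.ι₂ (radB F B 0) t (((m + δ) / 2 : ℕ))

namespace Link

variable {S : StratumData F E B} {trE nrE : E → F} {t : E} {p₁ : M2 F → E} {p₂ : B → E} {δ : ℕ}

/-- The lattice of all `(e₁ + v₁, e₂ + v₂)` with `eᵢ ∈ 𝔭_E ^ i`, `e₁ - e₂ ∈ 𝔭_E ^ j` and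
`vᵢ ∈ Vᵢᵐ`. -/
def cell (_ : Link S trE nrE t p₁ p₂ δ) (i j m : ℕ) : Set (AA F B) :=
  {x | nrm nrE (p₁ x.1) ≤ nrm nrE t ^ i ∧ nrm nrE (p₁ x.1 - p₂ x.2) ≤ nrm nrE t ^ j ∧
    x.1 - S.ι₁ (p₁ x.1) ∈ Side.V Matrix.trace S.ι₁ (S.chain.rad 0) t (((m + 1) / 2 : ℕ)) ∧
    x.2 - S.ι₂ (p₂ x.2) ∈ Side.V redTrace S.ι₂ (radB F B 0) t (((m + δ) / 2 : ℕ))}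

variable {x : AA F B} (L : Link S trE nrE t p₁ p₂ δ)
include L

lemma δ_le : δ ≤ 1 := by exact_mod_cast L.side₂.δ_le

lemma t_pos : 0 < nrm nrE t := L.side₁.t_pos

lemma t_lt : nrm nrE t < 1 := L.side₁.t_lt

lemma quatE : IsQuat trE nrE := L.side₁.quatE

lemma tpow_anti {i j : ℕ} (h : i ≤ j) : nrm nrE t ^ j ≤ nrm nrE t ^ i :=
  pow_le_pow_of_le_one L.t_pos.le L.t_lt.le h

lemma nrm_p₂ {i j m : ℕ} (hij : i ≤ j) (hx : x ∈ L.cell i j m) :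
    nrm nrE (p₂ x.2) ≤ nrm nrE t ^ i := by
  have h1 := L.quatE.nrm_sub_le_of hx.1 (hx.2.1.trans (L.tpow_anti hij))
  rwa [sub_sub_cancel] at h1

lemma cell_eq_linkSet {i m : ℕ} (him : i ≤ m) : L.cell i m m = S.linkSet i m := by
  ext x
  constructor
  · rintro ⟨h1, h2, h3, h4⟩
    refine ⟨p₁ x.1, L.mem_pE.2 h1, 0, L.mem_pE.2 ?_, p₂ x.2 - p₁ x.1, L.mem_pE.2 ?_,
      x.1 - S.ι₁ (p₁ x.1), ?_, x.2 - S.ι₂ (p₂ x.2), ?_, ?_⟩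
    · rw [L.quatE.nrm_zero]; exact pow_nonneg L.t_pos.le _
    · rw [← L.quatE.nrm_neg, neg_sub]; exact h2
    · rw [← SetLike.mem_coe, L.V₁_eq]; exact h3
    · rw [← SetLike.mem_coe, L.V₂_eq]; exact h4
    · ext1
      · simp
      · simp
  · rintro ⟨a, ha, b₁, hb₁, b₂, hb₂, v₁, hv₁, v₂, hv₂, rfl⟩
    rw [← SetLike.mem_coe, L.V₁_eq] at hv₁
    rw [← SetLike.mem_coe, L.V₂_eq] at hv₂
    rw [L.mem_pE] at ha hb₁ hb₂
    have e1 : p₁ (S.ι₁ a + S.ι₁ b₁ + v₁) = a + b₁ := L.side₁.pr_eq (by rw [map_add]) hv₁.1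
    have e2 : p₂ (S.ι₂ a + S.ι₂ b₂ + v₂) = a + b₂ := L.side₂.pr_eq (by rw [map_add]) hv₂.1
    refine ⟨?_, ?_, ?_, ?_⟩
    · simp only [e1]
      exact L.quatE.nrm_add_le_of ha (hb₁.trans (L.tpow_anti him))
    · simp only [e1, e2, add_sub_add_left_eq_sub]
      exact L.quatE.nrm_sub_le_of hb₁ hb₂
    · simpa only [e1, map_add, add_sub_cancel_left] using hv₁
    · simpa only [e2, map_add, add_sub_cancel_left] using hv₂

lemma cell_mono {i j m i' j' m' : ℕ} (hi : i' ≤ i) (hj : j' ≤ j) (hm : m' ≤ m) :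
    L.cell i j m ⊆ L.cell i' j' m' := fun _ ⟨h1, h2, h3, h4⟩ =>
  ⟨h1.trans (L.tpow_anti hi), h2.trans (L.tpow_anti hj), L.side₁.V_mono (by omega) h3,
    L.side₂.V_mono (by omega) h4⟩

lemma cell_add {i j m : ℕ} {x y : AA F B} (hx : x ∈ L.cell i j m) (hy : y ∈ L.cell i j m) :
    x + y ∈ L.cell i j m := by
  obtain ⟨h1, h2, h3, h4⟩ := hx
  obtain ⟨k1, k2, k3, k4⟩ := hy
  refine ⟨?_, ?_, ?_, ?_⟩
  · rw [Prod.fst_add, L.side₁.pr_add]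
    exact L.quatE.nrm_add_le_of h1 k1
  · rw [Prod.fst_add, Prod.snd_add, L.side₁.pr_add, L.side₂.pr_add, add_sub_add_comm]
    exact L.quatE.nrm_add_le_of h2 k2
  · rw [Prod.fst_add, L.side₁.pr_add, map_add, add_sub_add_comm]
    exact L.side₁.V_add h3 k3
  · rw [Prod.snd_add, L.side₂.pr_add, map_add, add_sub_add_comm]
    exact L.side₂.V_add h4 k4

lemma cell_neg {i j m : ℕ} (hx : x ∈ L.cell i j m) : -x ∈ L.cell i j m := by
  obtain ⟨h1, h2, h3, h4⟩ := hx
  refine ⟨?_, ?_, ?_, ?_⟩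
  · rw [fst_neg, L.side₁.pr_neg, L.quatE.nrm_neg]; exact h1
  · rw [fst_neg, snd_neg, L.side₁.pr_neg, L.side₂.pr_neg, ← neg_sub', L.quatE.nrm_neg]
    exact h2
  · rw [fst_neg, L.side₁.pr_neg, map_neg, ← neg_sub']
    exact L.side₁.V_neg h3
  · rw [snd_neg, L.side₂.pr_neg, map_neg, ← neg_sub']
    exact L.side₂.V_neg h4

lemma cell_sub {i j m : ℕ} {x y : AA F B} (hx : x ∈ L.cell i j m) (hy : y ∈ L.cell i j m) :
    x - y ∈ L.cell i j m := by
  rw [sub_eq_add_neg]; exact L.cell_add hx (L.cell_neg hy)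

lemma cell_mem_iff₁ {i j m : ℕ} {a : M2 F} (hij : i ≤ j) : (a, (0 : B)) ∈ L.cell i j m ↔
    nrm nrE (p₁ a) ≤ nrm nrE t ^ j ∧
    a - S.ι₁ (p₁ a) ∈ Side.V Matrix.trace S.ι₁ (S.chain.rad 0) t (((m + 1) / 2 : ℕ)) := by
  have h0 : p₂ (0 : B) = 0 := L.side₂.pr_perp (perp_zero L.side₂.quat)
  constructor
  · rintro ⟨h1, h2, h3, h4⟩
    simp only [h0, sub_zero] at h2
    exact ⟨h2, h3⟩
  · rintro ⟨h1, h2⟩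
    refine ⟨h1.trans (L.tpow_anti hij), ?_, h2, ?_⟩
    · simpa only [h0, sub_zero] using h1
    · simpa only [h0, map_zero, sub_zero] using L.side₂.V_zero _

lemma cell_mem_iff₂ {i j m : ℕ} {a : B} : ((0 : M2 F), a) ∈ L.cell i j m ↔
    nrm nrE (p₂ a) ≤ nrm nrE t ^ j ∧
    a - S.ι₂ (p₂ a) ∈ Side.V redTrace S.ι₂ (radB F B 0) t (((m + δ) / 2 : ℕ)) := by
  have h0 : p₁ (0 : M2 F) = 0 := L.side₁.pr_perp (perp_zero L.side₁.quat)
  constructor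
  · rintro ⟨h1, h2, h3, h4⟩
    simp only [h0, zero_sub, L.quatE.nrm_neg] at h2
    exact ⟨h2, h4⟩
  · rintro ⟨h1, h2⟩
    refine ⟨?_, ?_, ?_, h2⟩
    · simp only [h0, L.quatE.nrm_zero]; exact pow_nonneg L.t_pos.le _
    · simpa only [h0, zero_sub, L.quatE.nrm_neg] using h1
    · simpa only [h0, map_zero, sub_zero] using L.side₁.V_zero _

lemma diag_mem_cell {i j m : ℕ} {e : E} (he : nrm nrE e ≤ nrm nrE t ^ i) :
    (S.ι₁ e, S.ι₂ e) ∈ L.cell i j m := by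
  refine ⟨?_, ?_, ?_, ?_⟩
  · simpa only [L.side₁.pr_ι] using he
  · simp only [L.side₁.pr_ι, L.side₂.pr_ι, sub_self, L.quatE.nrm_zero]
    exact pow_nonneg L.t_pos.le _
  · simpa only [L.side₁.pr_ι, sub_self] using L.side₁.V_zero _
  · simpa only [L.side₂.pr_ι, sub_self] using L.side₂.V_zero _

lemma one_mem_cell : (1 : AA F B) ∈ L.cell 0 S.n S.n := by
  have := L.diag_mem_cell (i := 0) (j := S.n) (m := S.n) (e := 1)
    (by rw [L.quatE.nrm_one, pow_zero])
  rwa [map_one, map_one] at this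

lemma mem_orders {i j m : ℕ} (hij : i ≤ j) (hx : x ∈ L.cell i j m) :
    x.1 ∈ S.chain.rad 0 ∧ x.2 ∈ radB F B 0 := by
  have h2 := L.nrm_p₂ hij hx
  obtain ⟨h1, -, h3, h4⟩ := hx
  constructor
  · have := L.side₁.add_mem (L.side₁.ι_mem (h1.trans (pow_le_one₀ L.t_pos.le L.t_lt.le)))
      (L.side₁.mem_O_of_V (by positivity) h3)
    rwa [add_sub_cancel] at this
  · have := L.side₂.add_mem (L.side₂.ι_mem (h2.trans (pow_le_one₀ L.t_pos.le L.t_lt.le)))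
      (L.side₂.mem_O_of_V (by positivity) h4)
    rwa [add_sub_cancel] at this

lemma zpow_le_pow {k : ℤ} {j : ℕ} (h : (j : ℤ) ≤ k) {r : ℝ} (hr : r ≤ nrm nrE t ^ k) :
    r ≤ nrm nrE t ^ j := by
  refine hr.trans ?_
  rw [← zpow_natCast]
  exact zpow_le_zpow_right_of_le_one₀ L.t_pos L.t_lt.le h

lemma cell_mul_left {i j m : ℕ} (hij : i ≤ j) (hjm : j ≤ m) (hm : m ≤ S.n + i) (hm' : m ≤ S.n + 1)
    (hn : S.n ≤ m) {x y : AA F B} (hx : x ∈ L.cell 0 S.n S.n) (hy : y ∈ L.cell i j m) :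
    x * y ∈ L.cell i j m := by
  have hδ := L.δ_le
  have hy2 := L.nrm_p₂ hij hy
  obtain ⟨h1, h2, h3, h4⟩ := hx
  obtain ⟨k1, k2, k3, k4⟩ := hy
  rw [pow_zero] at h1
  have hprod₁ := L.zpow_le_pow (j := j) (by push_cast; omega) (L.side₁.V_mul_V h3 k3)
  have hprod₂ := L.zpow_le_pow (j := j) (by push_cast; omega) (L.side₂.V_mul_V h4 k4)
  have ht := L.t_pos
  refine ⟨?_, ?_, ?_, ?_⟩
  · rw [fst_mul, L.side₁.pr_mul]
    refine L.quatE.nrm_add_le_of ?_ (hprod₁.trans (L.tpow_anti hij))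
    rw [L.quatE.nrm_mul]
    exact (mul_le_of_le_one_left (nrm_nonneg _ _) h1).trans k1
  · rw [fst_mul, snd_mul, L.side₁.pr_mul, L.side₂.pr_mul, add_sub_add_comm]
    refine L.quatE.nrm_add_le_of ?_ (L.quatE.nrm_sub_le_of hprod₁ hprod₂)
    have e : p₁ x.1 * p₁ y.1 - p₂ x.2 * p₂ y.2 =
        p₁ x.1 * (p₁ y.1 - p₂ y.2) + (p₁ x.1 - p₂ x.2) * p₂ y.2 := by ring
    rw [e]
    refine L.quatE.nrm_add_le_of ?_ ?_
    · rw [L.quatE.nrm_mul]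
      exact (mul_le_of_le_one_left (nrm_nonneg _ _) h1).trans k2
    · rw [L.quatE.nrm_mul]
      refine (mul_le_mul h2 hy2 (nrm_nonneg _ _) (by positivity)).trans ?_
      rw [← pow_add]
      exact L.tpow_anti (by omega)
  · rw [fst_mul, L.side₁.compl_mul]
    refine L.side₁.V_add (L.side₁.V_left (i := 0) (by rwa [zpow_zero]) k3 (zero_add _).symm) ?_
    exact L.side₁.V_mono (by push_cast; omega)
      (L.side₁.V_right (i := i) (by rwa [zpow_natCast]) h3 rfl)
  · rw [snd_mul, L.side₂.compl_mul]
    have h5 := L.nrm_p₂ (Nat.zero_le _) ⟨by rwa [pow_zero], h2, h3, h4⟩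
    refine L.side₂.V_add (L.side₂.V_left (i := 0) (by rwa [pow_zero] at h5) k4 (zero_add _).symm) ?_
    exact L.side₂.V_mono (by push_cast; omega)
      (L.side₂.V_right (i := i) (by rwa [zpow_natCast]) h4 rfl)

/-- The canonical involution, componentwise. -/
noncomputable def _root_.LinkingOrder.starA {F B : Type*} [Field F] [DivisionRing B] [Algebra F B] (x : AA F B) :
    AA F B :=
  (algebraMap F (M2 F) x.1.trace - x.1, algebraMap F B (redTrace x.2) - x.2)

lemma cell_star {i j m : ℕ} (hx : x ∈ L.cell i j m) : starA x ∈ L.cell i j m := by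
  obtain ⟨h1, h2, h3, h4⟩ := hx
  have e : ∀ a b : E, conjE trE a - conjE trE b = conjE trE (a - b) := by
    intro a b
    rw [conjE, conjE, conjE, L.quatE.tr_sub, map_sub]; ring
  refine ⟨?_, ?_, ?_, ?_⟩
  · simp only [starA, L.side₁.pr_star, L.side₁.nrm_conj]; exact h1
  · simp only [starA, L.side₁.pr_star, L.side₂.pr_star, e, L.side₁.nrm_conj]; exact h2
  · have h5 := L.side₁.star_eq x.1
    simp only [starA, L.side₁.pr_star]
    rw [h5, add_sub_cancel_left]
    exact L.side₁.V_neg h3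
  · have h5 := L.side₂.star_eq x.2
    simp only [starA, L.side₂.pr_star]
    rw [h5, add_sub_cancel_left]
    exact L.side₂.V_neg h4

lemma starA_mul (x y : AA F B) : starA (x * y) = starA y * starA x := by
  ext1
  · exact L.side₁.quat.star_anti _ _
  · exact L.side₂.quat.star_anti _ _

lemma starA_starA (x : AA F B) : starA (starA x) = x := by
  have h1 := L.side₁.quat
  have h2 := L.side₂.quat
  ext1
  · simp only [starA, h1.tr_sub, h1.tr_algebraMap]
    rw [two_mul, map_sub, map_add]; abel
  · simp only [starA, h2.tr_sub, h2.tr_algebraMap]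
    rw [two_mul, map_sub, map_add]; abel

lemma cell_mul_right {i j m : ℕ} (hij : i ≤ j) (hjm : j ≤ m) (hm : m ≤ S.n + i) (hm' : m ≤ S.n + 1)
    (hn : S.n ≤ m) {x y : AA F B} (hx : x ∈ L.cell 0 S.n S.n) (hy : y ∈ L.cell i j m) :
    y * x ∈ L.cell i j m := by
  have := L.cell_star (L.cell_mul_left hij hjm hm hm' hn (L.cell_star hx) (L.cell_star hy))
  rwa [L.starA_mul, L.starA_starA, L.starA_starA] at this

lemma order_mul {x y : AA F B} (hx : x ∈ L.cell 0 S.n S.n) (hy : y ∈ L.cell 0 S.n S.n) :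
    x * y ∈ L.cell 0 S.n S.n :=
  L.cell_mul_left (Nat.zero_le _) le_rfl (by omega) (by omega) le_rfl hx hy

/-- Reduced norms of the components of an element of the order. -/
lemma norm_of_order (hx : x ∈ L.cell 0 S.n S.n) :
    normF F (x.1.det - nrE (p₁ x.1)) ^ 2 ≤ nrm nrE t ^ S.n ∧
    normF F (redNorm x.2 - nrE (p₂ x.2)) ^ 2 ≤ nrm nrE t ^ S.n := by
  have hδ := L.δ_le
  obtain ⟨h1, h2, h3, h4⟩ := hx
  constructor
  · rw [L.side₁.nr_eq x.1, add_sub_cancel_left]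
    exact L.zpow_le_pow (by push_cast; omega) (L.side₁.nrm_nr_of_V h3)
  · rw [L.side₂.nr_eq x.2, add_sub_cancel_left]
    exact L.zpow_le_pow (by push_cast; omega) (L.side₂.nrm_nr_of_V h4)

lemma tn_lt : nrm nrE t ^ S.n < 1 := pow_lt_one₀ L.t_pos.le L.t_lt (by have := L.n_pos; omega)

lemma nrE_conj (x : E) : algebraMap F E (nrE x) = x * conjE trE x := (L.quatE.mul_star x).symm

/-- Elements of the order outside its Jacobson radical have unit norms. -/
lemma norm_eq_one (hx : x ∈ L.cell 0 S.n S.n) (h1 : nrm nrE (p₁ x.1) = 1) :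
    normF F x.1.det = 1 ∧ normF F (redNorm x.2) = 1 ∧ nrm nrE (p₂ x.2) = 1 ∧
    normF F (x.1.det - redNorm x.2) ^ 2 ≤ nrm nrE t ^ S.n := by
  obtain ⟨h3, h4⟩ := L.norm_of_order hx
  have htn := L.tn_lt
  have h2 : nrm nrE (p₂ x.2) = 1 := by
    have := L.quatE.nrm_eq_of_lt (a := -(p₁ x.1 - p₂ x.2)) (b := p₁ x.1)
      (by rw [L.quatE.nrm_neg, h1]; exact hx.2.1.trans_lt htn)
    rwa [neg_sub, sub_add_cancel, h1] at this
  have key : ∀ a b : F, normF F (a - b) ^ 2 ≤ nrm nrE t ^ S.n → normF F b = 1 → normF F a = 1 := by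
    intro a b hab hb
    have hab' : normF F (a - b) < 1 := by
      by_contra! hlt
      nlinarith
    apply le_antisymm
    · have := normF_add_le (a - b) b
      rw [sub_add_cancel] at this
      exact this.trans (max_le hab'.le hb.le)
    · have := normF_sub_le a (a - b)
      rw [sub_sub_cancel, hb] at this
      rcases le_max_iff.1 this with h | h
      · exact h
      · exact absurd hab' h.not_gt
  refine ⟨key _ _ h3 h1, key _ _ h4 h2, h2, ?_⟩
  have h5 : normF F (nrE (p₁ x.1) - nrE (p₂ x.2)) ^ 2 ≤ nrm nrE t ^ S.n := by
    rw [← L.quatE.nrm_algebraMap, map_sub, L.nrE_conj, L.nrE_conj]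
    have e : p₁ x.1 * conjE trE (p₁ x.1) - p₂ x.2 * conjE trE (p₂ x.2) =
      p₁ x.1 * conjE trE (p₁ x.1 - p₂ x.2) + (p₁ x.1 - p₂ x.2) * conjE trE (p₂ x.2) := by
      rw [conjE, conjE, conjE, L.quatE.tr_sub, map_sub]; ring
    rw [e]
    refine L.quatE.nrm_add_le_of ?_ ?_
    · rw [L.quatE.nrm_mul, h1, one_mul, L.side₁.nrm_conj]; exact hx.2.1
    · rw [L.quatE.nrm_mul, L.side₁.nrm_conj, h2, mul_one]; exact hx.2.1
  have e : x.1.det - redNorm x.2 = (x.1.det - nrE (p₁ x.1)) + (nrE (p₁ x.1) - nrE (p₂ x.2)) -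
      (redNorm x.2 - nrE (p₂ x.2)) := by ring
  rw [e]
  have hm : ∀ a b : F, ∀ r : ℝ, normF F a ^ 2 ≤ r → normF F b ^ 2 ≤ r → normF F (a + b) ^ 2 ≤ r := by
    intro a b r ha hb
    rcases le_max_iff.1 (normF_add_le a b) with h | h
    · exact (pow_le_pow_left₀ (normF_nonneg _) h 2).trans ha
    · exact (pow_le_pow_left₀ (normF_nonneg _) h 2).trans hb
  rw [sub_eq_add_neg]
  exact hm _ _ _ (hm _ _ _ h3 h5) (by rwa [normF_neg])

/-- The underlying set of the unit group: the complement of the radical. -/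
lemma inv_mem {g : GG F B} (hg : toA g ∈ L.cell 0 S.n S.n) (h1 : nrm nrE (p₁ g.1.1) = 1) :
    toA g⁻¹ ∈ L.cell 0 S.n S.n := by
  obtain ⟨h2, h3, h4, h5⟩ := L.norm_eq_one hg h1
  change normF F g.1.1.det = 1 at h2
  change normF F (redNorm g.2.1) = 1 at h3
  change normF F (g.1.1.det - redNorm g.2.1) ^ 2 ≤ _ at h5
  set N₁ := g.1.1.det
  set N₂ := redNorm (F := F) g.2.1
  have hN₁ : N₁ ≠ 0 := by rintro h; rw [h] at h2; simp [normF] at h2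
  have hN₂ : N₂ ≠ 0 := by rintro h; rw [h] at h3; simp [normF] at h3
  have hs : (algebraMap F (M2 F) N₁⁻¹, algebraMap F B N₂⁻¹) ∈ L.cell 0 S.n S.n := by
    have e1 : p₁ (algebraMap F (M2 F) N₁⁻¹) = algebraMap F E N₁⁻¹ := by
      rw [← S.ι₁.commutes, L.side₁.pr_ι]
    have e2 : p₂ (algebraMap F B N₂⁻¹) = algebraMap F E N₂⁻¹ := by
      rw [← S.ι₂.commutes, L.side₂.pr_ι]
    refine ⟨?_, ?_, ?_, ?_⟩
    · simp only [e1]; rw [L.quatE.nrm_algebraMap, normF_inv, h2]; simp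
    · simp only [e1, e2]
      rw [← map_sub, L.quatE.nrm_algebraMap, inv_sub_inv hN₁ hN₂, normF_div, normF_mul, h2, h3,
        mul_one, div_one, ← neg_sub, normF_neg]
      exact h5
    · simp only [e1, commutes, sub_self]; exact L.side₁.V_zero _
    · simp only [e2, commutes, sub_self]; exact L.side₂.V_zero _
  have := L.order_mul (L.cell_star hg) hs
  convert this using 1
  ext1
  · change ((g.1⁻¹ : (M2 F)ˣ) : M2 F) = _
    rw [Units.inv_eq_of_mul_eq_one_right]
    change g.1.1 * ((algebraMap F (M2 F) g.1.1.trace - g.1) * _) = 1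
    rw [← mul_assoc, L.side₁.quat.mul_star, ← map_mul, mul_inv_cancel₀ hN₁, map_one]
  · change ((g.2⁻¹ : Bˣ) : B) = _
    rw [Units.inv_eq_of_mul_eq_one_right]
    change g.2.1 * ((algebraMap F B (redTrace g.2.1) - g.2) * _) = 1
    rw [← mul_assoc, L.side₂.quat.mul_star, ← map_mul, mul_inv_cancel₀ hN₂, map_one]

lemma linkingOrder_eq : S.linkingOrder = L.cell 0 S.n S.n := (L.cell_eq_linkSet (Nat.zero_le _)).symm

lemma linkingIdeal_eq : S.linkingIdeal = L.cell 1 (S.n + 1) (S.n + 1) :=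
  (L.cell_eq_linkSet (by omega)).symm

lemma pr_mul_lt {x y : AA F B} (hx : x ∈ L.cell 0 S.n S.n) (hy : y ∈ L.cell 0 S.n S.n) :
    nrm nrE (p₁ (x * y).1 - p₁ x.1 * p₁ y.1) < 1 := by
  rw [fst_mul, L.side₁.pr_mul, add_sub_cancel_left]
  refine lt_of_le_of_lt ?_ L.tn_lt
  exact L.zpow_le_pow (by push_cast; omega) (L.side₁.V_mul_V hx.2.2.1 hy.2.2.1)

lemma nrm_p₁_mul {x y : AA F B} (hx : x ∈ L.cell 0 S.n S.n) (hy : y ∈ L.cell 0 S.n S.n)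
    (hx1 : nrm nrE (p₁ x.1) = 1) (hy1 : nrm nrE (p₁ y.1) = 1) : nrm nrE (p₁ (x * y).1) = 1 := by
  have := L.quatE.nrm_eq_of_lt (a := p₁ (x * y).1 - p₁ x.1 * p₁ y.1) (b := p₁ x.1 * p₁ y.1)
    (by rw [L.quatE.nrm_mul, hx1, hy1, one_mul]; exact L.pr_mul_lt hx hy)
  rwa [sub_add_cancel, L.quatE.nrm_mul, hx1, hy1, one_mul] at this

lemma nrm_p₁_of_mul_eq_one {x y : AA F B} (hx : x ∈ L.cell 0 S.n S.n)
    (hy : y ∈ L.cell 0 S.n S.n) (hxy : x * y = 1) : nrm nrE (p₁ x.1) = 1 := by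
  have hx1 : nrm nrE (p₁ x.1) ≤ 1 := by have := hx.1; rwa [pow_zero] at this
  have hy1 : nrm nrE (p₁ y.1) ≤ 1 := by have := hy.1; rwa [pow_zero] at this
  refine le_antisymm hx1 ?_
  by_contra! hlt
  have h1 := L.pr_mul_lt hx hy
  rw [hxy, fst_one, L.side₁.pr_one] at h1
  have h2 := L.quatE.nrm_add_le (1 - p₁ x.1 * p₁ y.1) (p₁ x.1 * p₁ y.1)
  rw [sub_add_cancel, L.quatE.nrm_one, L.quatE.nrm_mul] at h2
  have h3 : nrm nrE (p₁ x.1) * nrm nrE (p₁ y.1) < 1 :=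
    (mul_le_of_le_one_right (nrm_nonneg _ _) hy1).trans_lt hlt
  exact absurd h2 (not_le.2 (max_lt h1 h3))

omit L in
lemma _root_.LinkingOrder.toA_mul (g h : GG F B) : toA (g * h) = toA g * toA h := rfl

omit L in
lemma _root_.LinkingOrder.toA_one : toA (1 : GG F B) = 1 := rfl

lemma mem_linkingUnits_iff {g : GG F B} : g ∈ S.linkingUnits ↔
    toA g ∈ L.cell 0 S.n S.n ∧ nrm nrE (p₁ g.1.1) = 1 := by
  constructor
  · intro hg
    induction hg using Subgroup.closure_induction with
    | mem x hx =>
      obtain ⟨h1, h2⟩ := hx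
      rw [L.linkingOrder_eq] at h1 h2
      exact ⟨h1, L.nrm_p₁_of_mul_eq_one h1 h2 (by rw [← toA_mul, mul_inv_cancel]; rfl)⟩
    | one => exact ⟨L.one_mem_cell, by
        change nrm nrE (p₁ 1) = 1; rw [L.side₁.pr_one, L.quatE.nrm_one]⟩
    | mul x y _ _ hx hy => exact ⟨L.order_mul hx.1 hy.1, L.nrm_p₁_mul hx.1 hy.1 hx.2 hy.2⟩
    | inv x _ hx =>
      have h1 := L.inv_mem hx.1 hx.2
      exact ⟨h1, L.nrm_p₁_of_mul_eq_one h1 hx.1 (by rw [← toA_mul, inv_mul_cancel]; rfl)⟩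
  · rintro ⟨h1, h2⟩
    apply Subgroup.subset_closure
    refine ⟨?_, ?_⟩
    · rwa [L.linkingOrder_eq]
    · rw [L.linkingOrder_eq]; exact L.inv_mem h1 h2

/-- Every element of the order outside the radical comes from a unit. -/
lemma exists_unit (hx : x ∈ L.cell 0 S.n S.n) (h1 : nrm nrE (p₁ x.1) = 1) :
    ∃ g ∈ S.linkingUnits, toA g = x := by
  obtain ⟨h2, h3, h4, h5⟩ := L.norm_eq_one hx h1
  have hN₁ : x.1.det ≠ 0 := by rintro h; rw [h] at h2; simp [normF] at h2
  have hN₂ : x.2 ≠ 0 := by rintro h; rw [h, L.side₂.quat.nr_zero] at h3; simp [normF] at h3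
  let g : GG F B := ((isUnit_iff_isUnit_det _).2 (isUnit_iff_ne_zero.2 hN₁) |>.unit, mk0 x.2 hN₂)
  exact ⟨g, L.mem_linkingUnits_iff.2 ⟨hx, h1⟩, rfl⟩

end Link

section Residual

variable {trE nrE : E → F} {ϖ : 𝒪[F]} {t s : E}

lemma residue_eq_iff {x y : 𝒪[F]} : residue 𝒪[F] x = residue 𝒪[F] y ↔
    normF F ((x : F) - y) < 1 := by
  rw [← sub_eq_zero, ← map_sub, IsLocalRing.residue_eq_zero_iff, ← normF_lt_one_iff]
  rfl

lemma exists_residue_lift (c : 𝓀[F]) : ∃ x : 𝒪[F], residue 𝒪[F] x = c := residue_surjective c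

lemma residue_two_eq_zero_iff : (2 : 𝓀[F]) = 0 ↔ normF F (2 : F) < 1 := by
  have h := residue_eq_iff (F := F) (x := 2) (y := 0)
  have e : ((2 : 𝒪[F]) : F) - ((0 : 𝒪[F]) : F) = 2 := sub_zero (2 : F)
  rw [e, map_zero, map_ofNat] at h
  exact h

/-- In residue characteristic two every integer is a square modulo the maximal ideal. -/
lemma exists_sq_sub_lt (h2 : normF F (2 : F) < 1) (u : 𝒪[F]) :
    ∃ a : 𝒪[F], normF F ((a : F) ^ 2 - u) < 1 := by
  have hr : (2 : 𝓀[F]) = 0 := residue_two_eq_zero_iff.2 h2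
  have := ofFinite 𝓀[F]
  have hc : ringChar 𝓀[F] = 2 := by
    have h3 : ringChar 𝓀[F] ∣ 2 := ringChar.dvd (by exact_mod_cast hr)
    exact ((Nat.dvd_prime Nat.prime_two).1 h3).resolve_left (CharP.ringChar_ne_one)
  obtain ⟨b, hb⟩ := FiniteField.isSquare_of_char_two hc (residue 𝒪[F] u)
  obtain ⟨a, rfl⟩ := exists_residue_lift b
  refine ⟨a, ?_⟩
  rw [← map_mul, eq_comm, residue_eq_iff] at hb
  simpa [pow_two] using hb

lemma QuadExt.nrm_s (Q : QuadExt trE nrE ϖ t s) (ht : nrm nrE t = (resCard F)⁻¹ ^ 2) :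
    nrm nrE s = 1 := by
  have hq := one_lt_resCard F
  have hs0 : s ≠ 0 := by
    rintro rfl
    have := Q.le_s
    rw [Q.quat.nrm_zero] at this
    exact (inv_pos.2 (resCard_pos F)).not_ge this
  obtain ⟨j, hj⟩ := Q.exists_zpow hs0
  have h1 := Q.s_le
  have h2 := Q.le_s
  refine le_antisymm h1 ?_
  by_contra! hlt
  have h3 := Q.gen s hlt
  rw [ht] at h3
  have : (resCard F)⁻¹ ^ 2 < (resCard F)⁻¹ := by
    rw [pow_two]
    exact mul_lt_of_lt_one_left (inv_pos.2 (resCard_pos F)) (inv_lt_one_of_one_lt₀ hq)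
  linarith

lemma QuadExt.nr_coords (Q : QuadExt trE nrE ϖ t s) (a b : F) :
    nrE ε(a, b, s) = a ^ 2 + a * b * trE s + b ^ 2 * nrE s := by
  apply (algebraMap F E).injective
  have h1 := Q.quat.quad ε(a, b, s)
  have h2 := Q.quat.quad s
  rw [Q.quat.tr_add, Q.quat.tr_algebraMap_mul, Q.quat.tr_algebraMap] at h1
  simp only [map_add, map_mul, map_pow, map_ofNat] at h1 ⊢
  linear_combination h1 - (algebraMap F E b) ^ 2 * h2

/-- An unramified quadratic extension is residually separable. -/
lemma QuadExt.nrm_conj_sub (Q : QuadExt trE nrE ϖ t s) (ht : nrm nrE t = (resCard F)⁻¹ ^ 2) :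
    nrm nrE (conjE trE s - s) = 1 := by
  have hs := Q.nrm_s ht
  have hT : normF F (trE s) ≤ 1 := Q.quat.normF_tr_le_one hs.le
  have h2 : normF F (2 : F) ≤ 1 := normF_le_one.2 (ofNat_mem _ 2)
  have e : conjE trE s - s = algebraMap F E (trE s) + algebraMap F E (-2) * s := by
    rw [conjE, map_neg, map_ofNat]; ring
  have hle : nrm nrE (conjE trE s - s) ≤ 1 := by
    refine Q.quat.nrm_sub_le_of ?_ hs.le
    rw [conjE, Q.quat.nrm_star, hs]
  refine le_antisymm hle ?_
  rw [e]
  rcases h2.lt_or_eq with h2 | h2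
  · -- residue characteristic two
    have hT1 : normF F (trE s) = 1 := by
      refine le_antisymm hT ?_
      by_contra! hlt
      obtain ⟨a, ha⟩ := exists_sq_sub_lt h2 (⟨-nrE s, normF_le_one.1 (by rw [normF_neg]; exact hs.le)⟩)
      have h3 := Q.le_right (a : F) 1
      rw [map_one, one_mul, hs] at h3
      have h4 := Q.nr_coords (a : F) 1
      rw [map_one, one_mul] at h4
      rw [nrm, h4] at h3
      simp only [sub_neg_eq_add] at ha
      have h5 : (a : F) ^ 2 + a * 1 * trE s + 1 ^ 2 * nrE s = ((a : F) ^ 2 + nrE s) + a * trE s := by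
        ring
      rw [h5] at h3
      have h6 : normF F ((a : F) * trE s) < 1 := by
        rw [normF_mul]
        exact (mul_le_of_le_one_left (normF_nonneg _) (normF_le_one.2 a.2)).trans_lt hlt
      exact h3.not_gt ((normF_add_le _ _).trans_lt (max_lt ha h6))
    have := Q.le_left (trE s) (-2)
    rw [Q.quat.nrm_algebraMap, hT1, one_pow] at this
    exact this
  · have := Q.le_right (trE s) (-2)
    rw [Q.quat.nrm_mul, Q.quat.nrm_algebraMap, hs, normF_neg, h2] at this
    simpa using this

/-- The norm of an unramified quadratic extension is surjective on residue fields. -/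
lemma QuadExt.exists_norm_sub_lt (Q : QuadExt trE nrE ϖ t s)
    (ht : nrm nrE t = (resCard F)⁻¹ ^ 2) {u : F} (hu : normF F u ≤ 1) :
    ∃ x : E, nrm nrE x ≤ 1 ∧ normF F (nrE x - u) < 1 := by
  have hs := Q.nrm_s ht
  have hT : normF F (trE s) ≤ 1 := Q.quat.normF_tr_le_one hs.le
  have h2 : normF F (2 : F) ≤ 1 := normF_le_one.2 (ofNat_mem _ 2)
  have hint : ∀ a b : 𝒪[F], nrm nrE ε(a, b, s) ≤ 1 := by
    intro a b
    refine Q.quat.nrm_add_le_of ?_ ?_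
    · rw [Q.quat.nrm_algebraMap]
      exact pow_le_one₀ (normF_nonneg _) (normF_le_one.2 a.2)
    · rw [Q.quat.nrm_mul, Q.quat.nrm_algebraMap, hs, mul_one]
      exact pow_le_one₀ (normF_nonneg _) (normF_le_one.2 b.2)
  rcases h2.lt_or_eq with h2 | h2
  · obtain ⟨a, ha⟩ := exists_sq_sub_lt h2 (⟨u, normF_le_one.1 hu⟩)
    refine ⟨algebraMap F E a, ?_, ?_⟩
    · have := hint a 0
      simpa using this
    · rw [Q.quat.nr_algebraMap]; exact ha
  · have := ofFinite 𝓀[F]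
    set T : 𝒪[F] := ⟨trE s, normF_le_one.1 hT⟩ with hTdef
    set N : 𝒪[F] := ⟨nrE s, normF_le_one.1 hs.le⟩ with hNdef
    set U : 𝒪[F] := ⟨u, normF_le_one.1 hu⟩ with hUdef
    set r := residue 𝒪[F] with hr
    have h2r : (2 : 𝓀[F]) ≠ 0 := fun h0 => h2.not_lt (residue_two_eq_zero_iff.1 h0)
    have hodd : Fintype.card 𝓀[F] % 2 = 1 := by
      apply FiniteField.odd_card_of_char_ne_two
      intro hc
      apply h2r
      have := ringChar.Nat.cast_ringChar (R := 𝓀[F])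
      rw [hc] at this
      exact_mod_cast this
    have hD : r (N * 4 - T ^ 2) ≠ 0 := by
      intro h0
      rw [← map_zero r, hr, residue_eq_iff] at h0
      have h3 := Q.nrm_conj_sub ht
      have e : conjE trE s - s = algebraMap F E (trE s) + algebraMap F E (-2) * s := by
        rw [conjE, map_neg, map_ofNat]; ring
      rw [e, nrm, Q.nr_coords] at h3
      have e2 : trE s ^ 2 + trE s * -2 * trE s + (-2) ^ 2 * nrE s =
          ((N * 4 - T ^ 2 : 𝒪[F]) : F) - ((0 : 𝒪[F]) : F) := by
        have e4 : ((4 : 𝒪[F]) : F) = 4 := rfl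
        push_cast
        rw [hNdef, hTdef, e4]; ring
      rw [e2] at h3
      exact h0.ne h3
    -- `(2 a + b T) ^ 2 + b ^ 2 (4 N - T ^ 2) = 4 u`
    obtain ⟨x, y, hxy⟩ := FiniteField.exists_root_sum_quadratic
      (f := (Polynomial.X ^ 2 : Polynomial 𝓀[F]))
      (g := Polynomial.C (r (N * 4 - T ^ 2)) * Polynomial.X ^ 2 - Polynomial.C (r (U * 4)))
      (by simp) (by compute_degree!) hodd
    simp only [Polynomial.eval_pow, Polynomial.eval_X, Polynomial.eval_sub, Polynomial.eval_mul,
      Polynomial.eval_C] at hxy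
    obtain ⟨a, ha⟩ := exists_residue_lift ((x - y * r T) / 2)
    obtain ⟨b, hb⟩ := exists_residue_lift y
    refine ⟨ε(a, b, s), hint a b, ?_⟩
    rw [Q.nr_coords]
    have h5 : r (a ^ 2 + a * b * T + b ^ 2 * N) = r U := by
      simp only [map_add, map_mul, map_pow]
      rw [hr, ha, hb, ← hr]
      have h4 : (4 : 𝓀[F]) ≠ 0 := by
        have : (4 : 𝓀[F]) = 2 * 2 := by norm_num
        rw [this]; exact mul_ne_zero h2r h2r
      have e4 : r (4 : 𝒪[F]) = 4 := map_ofNat r 4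
      simp only [map_sub, map_mul, map_pow, e4] at hxy
      apply mul_left_cancel₀ h4
      field_simp
      linear_combination hxy
    rw [hr, residue_eq_iff] at h5
    exact h5

end Residual

lemma IsQuat.comp {F E A : Type*} [Field F] [Field E] [Algebra F E] [Ring A] [Nontrivial A]
    [Algebra F A] {tr nr : A → F} (h : IsQuat tr nr) (ι : E →ₐ[F] A) :
    IsQuat (fun x => tr (ι x)) (fun x => nr (ι x)) where
  tr_add a b := by rw [map_add, h.tr_add]
  tr_smul r a := by rw [map_smul, h.tr_smul]
  tr_comm a b := by rw [mul_comm]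
  tr_one := by rw [map_one, h.tr_one]
  nr_mul a b := by rw [map_mul, h.nr_mul]
  mul_star a := by
    apply (ι : E →+* A).injective
    have := h.mul_star (ι a)
    simpa using this
  star_anti a b := by
    apply (ι : E →+* A).injective
    have := h.star_anti (ι a) (ι b)
    simpa using this

section Separable

variable {F E : Type*} [Field F] [Field E] [Algebra F E] {trE nrE : E → F} (h : IsQuat trE nrE)
  (hE : finrank F E = 2)

include hE in
lemma not_mem_range_of_adjoin {α : E} (hα : IntermediateField.adjoin F {α} = ⊤) (a : F) :
    algebraMap F E a ≠ α := by
  rintro rfl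
  have h1 : IntermediateField.adjoin F {algebraMap F E a} = ⊥ :=
    IntermediateField.adjoin_simple_eq_bot_iff.2 (IntermediateField.algebraMap_mem _ a)
  rw [h1] at hα
  have := IntermediateField.finrank_bot (F := F) (E := E)
  rw [hα, IntermediateField.finrank_top', hE] at this
  omega

include h hE in
lemma exists_trace_ne_zero [Algebra.IsSeparable F E] {α : E} (hα : ∀ a : F, algebraMap F E a ≠ α) :
    ∃ x, trE x ≠ 0 := by
  by_contra! h0
  have h2 : (2 : F) = 0 := by rw [← h.tr_one]; exact h0 1
  set p : Polynomial F := Polynomial.X ^ 2 + Polynomial.C (nrE α) with hp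
  have hpm : p.Monic := by rw [hp]; monicity!
  have hpd : p.natDegree = 2 := by rw [hp]; compute_degree!
  have hev : aeval α p = 0 := by
    have := h.quad α
    rw [h0, map_zero, zero_mul, sub_zero] at this
    simpa [hp, pow_two] using this
  have : FiniteDimensional F E := of_finrank_pos (by omega)
  have hint : IsIntegral F α := IsIntegral.of_finite F α
  have hdeg : 2 ≤ (minpoly F α).natDegree := by
    rw [minpoly.two_le_natDegree_iff hint]
    rintro ⟨a, ha⟩
    exact hα a ha
  have e := Polynomial.eq_of_monic_of_dvd_of_natDegree_le (minpoly.monic hint) hpm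
    (minpoly.dvd F α hev) (by omega)
  have hsep := Algebra.IsSeparable.isSeparable F α
  rw [IsSeparable, ← e, Polynomial.separable_def] at hsep
  have hd : Polynomial.derivative p = 0 := by
    rw [hp]
    simp only [Polynomial.derivative_add, Polynomial.derivative_X_pow, Polynomial.derivative_C]
    simp [h2]
  rw [hd, isCoprime_zero_right, Polynomial.isUnit_iff_degree_eq_zero] at hsep
  rw [Polynomial.degree_eq_natDegree hpm.ne_zero, hpd] at hsep
  norm_num at hsep

include h hE in
lemma exists_conj_ne [Algebra.IsSeparable F E] {α : E} (hα : ∀ a : F, algebraMap F E a ≠ α) :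
    ∃ x, conjE trE x ≠ x := by
  by_contra! h0
  obtain ⟨x, hx⟩ := exists_trace_ne_zero h hE hα
  by_cases h2 : (2 : F) = 0
  · have h3 := h0 x
    have h2E : (2 : E) = 0 := by rw [← map_ofNat (algebraMap F E) 2, h2, map_zero]
    apply hx
    apply (algebraMap F E).injective
    rw [conjE] at h3
    rw [map_zero]
    linear_combination h3 + x * h2E
  · have h3 := h0 α
    rw [conjE] at h3
    apply hα (trE α / 2)
    have h2E : (2 : E) ≠ 0 := by
      intro h4; apply h2
      apply (algebraMap F E).injective
      rw [map_ofNat, map_zero]; exact h4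
    rw [map_div₀, map_ofNat, div_eq_iff h2E]
    linear_combination h3

end Separable

section PCompl

variable {A : Type*} [Ring A] [Algebra F A] [Nontrivial A] {tr nr : A → F} {trE nrE : E → F}
  {ι : E →ₐ[F] A} {pr : A → E} {O : Set A} {t : E} {δ : ℤ}

lemma Side.pCompl_eq (S : Side tr nr trE nrE ι pr O t δ)
    (hpE : ∀ {x m}, x ∈ pE F E m ↔ nrm nrE x ≤ nrm nrE t ^ m) (m : ℕ) :
    (pCompl F tr ι O m : Set A) = Side.V tr ι O t m := by
  ext c
  constructor
  · intro hc
    induction hc using AddSubgroup.closure_induction with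
    | mem x hx =>
      obtain ⟨b, hb, c, hc, rfl⟩ := hx
      exact S.V_left (i := m) (by rw [zpow_natCast]; exact hpE.1 hb)
        (S.mem_V_zero.2 ⟨hc.2, hc.1⟩) (by simp)
    | zero => exact S.V_zero _
    | add x y _ _ hx hy => exact S.V_add hx hy
    | neg x _ hx => exact S.V_neg hx
  · intro hc
    apply AddSubgroup.subset_closure
    refine ⟨t ^ m, hpE.2 (by rw [S.quatE.nrm_pow]), ι (t ^ (-(m : ℤ))) * c,
      ⟨hc.2, perp_left S.quat hc.1 _⟩, ?_⟩
    rw [← mul_assoc, ← map_mul, ← zpow_natCast, ← zpow_add₀ S.t_ne, add_neg_cancel, zpow_zero,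
      map_one, one_mul]

end PCompl

local notation "nrmB" => nrm (redNorm (F := F))

/-- A simple stratum with its linking order and coordinates on the quadratic extension; the
projections to `E` preserve integrality. -/
structure Setup (S : StratumData F E B) (ϖ : 𝒪[F]) (trE nrE : E → F) (t s : E) (p₁ : M2 F → E)
    (p₂ : B → E) (δ : ℕ) : Prop extends Link S trE nrE t p₁ p₂ δ where
  chain : ChainExt S.chain S.ι₁ trE nrE ϖ t s
  s_eq : ∃ k : ℕ, s = (ϖ : F) ^ k • S.α ∧ (S.n : ℤ) = S.chain.e * (k : ℤ) - S.chain.e + 1 ∧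
    (Unramified F E → k = S.n)
  cases : (δ = 0 ∧ Unramified F E ∧ nrm nrE t = (resCard F)⁻¹ ^ 2) ∨
    (δ = 1 ∧ ¬ Unramified F E ∧ nrm nrE t = (resCard F)⁻¹ ∧ Odd S.n)
  mem_radB : ∀ {b m}, b ∈ radB F B m ↔ nrmB b ≤ (resCard F ^ m)⁻¹
  pr_le₁ : ∀ {a}, a ∈ S.chain.rad 0 → nrm nrE (p₁ a) ≤ 1
  pr_le₂ : ∀ {b}, b ∈ radB F B 0 → nrm nrE (p₂ b) ≤ 1
  mem_maxE : ∀ {x : OE F E}, x ∈ maxE F E ↔ nrm nrE (x : E) < 1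
  exists_unit_OE : ∀ {x : E}, nrm nrE x = 1 → ∃ u : (OE F E)ˣ, ((u : OE F E) : E) = x
  nrm_unit : ∀ u : (OE F E)ˣ, nrm nrE ((u : OE F E) : E) = 1

section Exists

/-- Elements of the complement of an unramified `E` in `B` that are integral are not units. -/
lemma nrm_perp_lt_one {trE nrE : E → F} {ϖ : 𝒪[F]} {t s : E} (Q : QuadExt trE nrE ϖ t s)
    (ht : nrm nrE t = (resCard F)⁻¹ ^ 2) {tr nr : B → F} (h : IsQuat tr nr) {ι : E →ₐ[F] B}
    (htr : ∀ x, tr (ι x) = trE x) (hnr : ∀ x, nr (ι x) = nrE x) {c : B} (hc : c ∈ Perp tr ι)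
    (hc1 : nrm nr c ≤ 1) : nrm nr c < 1 := by
  refine lt_of_le_of_ne hc1 fun h1 => ?_
  have hnu : nr c ≠ 0 := by intro h0; rw [nrm, h0] at h1; simp [normF] at h1
  obtain ⟨x, hx, hx'⟩ := Q.exists_norm_sub_lt ht (u := -(nr c)⁻¹) (by
    rw [normF_neg, normF_inv]; change (nrm nr c)⁻¹ ≤ 1; rw [h1, inv_one])
  -- `w = x c - 1` is topologically nilpotent
  set w := ι (-1) + ι x * c with hw
  have hxc : ι x * c ∈ Perp tr ι := perp_left h hc x
  have hwn : nr w = 1 + nrE x * nr c := by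
    rw [hw, nr_add_perp h htr hnr hxc, h.nr_mul, hnr, Q.quat.nr_neg, Q.quat.nr_one]
  have hw1 : nrm nr w < 1 := by
    rw [nrm, hwn]
    have : 1 + nrE x * nr c = (nrE x - -(nr c)⁻¹) * nr c := by field_simp; ring
    rw [this, normF_mul]
    change _ * nrm nr c < 1
    rw [h1, mul_one]; exact hx'
  have e : ι (conjE trE s) * w - w * ι s = ι (s - conjE trE s) := by
    have h2 := perp_mul h htr hxc s
    rw [hw, mul_add, add_mul, h2, ← map_mul, ← map_mul, map_sub]
    have e1 : conjE trE s * -1 = - conjE trE s := by ring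
    have e2 : -1 * s = -s := by ring
    rw [e1, e2, map_neg, map_neg]; abel
  have h3 : nrm nr (ι (s - conjE trE s)) < 1 := by
    rw [← e]
    refine (h.nrm_sub_le _ _).trans_lt (max_lt ?_ ?_)
    · rw [h.nrm_mul]
      refine (mul_le_of_le_one_left (nrm_nonneg _ _) ?_).trans_lt hw1
      rw [nrm, hnr]; change nrm nrE _ ≤ 1
      rw [conjE, Q.quat.nrm_star]; exact Q.s_le
    · rw [h.nrm_mul]
      refine (mul_le_of_le_one_right (nrm_nonneg _ _) ?_).trans_lt hw1
      rw [nrm, hnr]; exact Q.s_le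
  have h4 : nrm nr (ι (s - conjE trE s)) = nrm nrE (conjE trE s - s) := by
    rw [nrm, hnr, ← neg_sub, Q.quat.nr_neg]; rfl
  rw [h4, Q.nrm_conj_sub ht] at h3
  exact h3.false

variable [Algebra.IsSeparable F E] [Algebra.IsCentral F B]

lemma exists_setup (hB : finrank F B = 4) {ϖ : 𝒪[F]} (hϖ : Irreducible ϖ)
    {S : StratumData F E B} (hn : 1 ≤ S.n) (hS : S.IsSimple ϖ)
    (hstr : ∀ g : GG F B, g.1.1 - 1 ∈ S.chain.rad S.n → g.2.1 - 1 ∈ radB F B S.n' →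
      g ∈ S.linkingUnits) :
    ∃ (trE nrE : E → F) (t s : E) (p₁ : M2 F → E) (p₂ : B → E) (δ : ℕ),
      Setup S ϖ trE nrE t s p₁ p₂ δ := by
  obtain ⟨hE, hadj, hαr, hord, hcase⟩ := hS
  have hq := one_lt_resCard F
  have hq0 := resCard_pos F
  have hQ := isQuat_B hB hE S.ι₂
  have hM := isQuat_M2 F
  set trE : E → F := fun x => redTrace (S.ι₂ x) with htrE
  set nrE : E → F := fun x => redNorm (S.ι₂ x) with hnrE
  have hQE : IsQuat trE nrE := hQ.comp S.ι₂
  have hMe := trace_det_eq hB S.ι₂ S.ι₁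
  have : FiniteDimensional F E := of_finrank_pos (by omega)
  obtain ⟨u0, t0, ht0, -⟩ := id hord
  set t : E := (t0 : E) with ht
  have hαF := not_mem_range_of_adjoin hE hadj
  have hαn : nrm nrE S.α = nrm nrE t ^ (-(S.n : ℤ)) := nrm_of_hasOrd hQE hϖ ht0 hord
  obtain ⟨k, Q, hku, hkr⟩ := exists_quadExt hE hQE hϖ ht0 hαF hαn (by
    rcases hcase with ⟨h1, h2, h3⟩ | ⟨h1, h2, h3⟩
    · exact Or.inl ⟨h1, h3⟩
    · exact Or.inr ⟨h1, h3⟩)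
  set s : E := (ϖ : F) ^ k • S.α with hs
  have hc : (S.chain.e = 1 ∧ nrm nrE t = (resCard F)⁻¹ ^ 2 ∧ k = S.n) ∨
      (S.chain.e = 2 ∧ nrm nrE t = (resCard F)⁻¹ ∧ 2 * k = S.n + 1) := by
    rcases hcase with ⟨h1, h2, h3⟩ | ⟨h1, h2, h3⟩
    · exact Or.inr ⟨h2, gen_nrm_of_ramified hQE hϖ ht0 h1, hkr h1⟩
    · exact Or.inl ⟨h2, gen_nrm_of_unramified hQE hϖ ht0 h1, hku h1⟩
  have C : ChainExt S.chain S.ι₁ trE nrE ϖ t s :=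
    exists_chainExt S.chain hϖ Q hE (fun x => (hMe x).1) (fun x => (hMe x).2) hαr hαn hc
  obtain ⟨x₀, hx₀⟩ := exists_trace_ne_zero hQE hE hαF
  obtain ⟨p₁, hp₁⟩ := exists_pr (ι := S.ι₁) hM hQE (fun x => (hMe x).1) hx₀
  obtain ⟨p₂, hp₂⟩ := exists_pr (ι := S.ι₂) hQ hQE (fun x => rfl) hx₀
  have hradB : ∀ {b : B} {m : ℕ}, b ∈ radB F B m ↔ nrmB b ≤ (resCard F ^ m)⁻¹ := by
    intro b m
    constructor
    · rintro ⟨c, hc, hcb⟩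
      rw [mem_max_pow hϖ, hcb] at hc
      exact hc
    · intro hb
      have hb1 : normF F (redNorm b) ≤ 1 := hb.trans (inv_le_one_of_one_le₀ (one_le_pow₀ hq.le))
      exact ⟨⟨redNorm b, normF_le_one.1 hb1⟩, (mem_max_pow hϖ).2 hb, rfl⟩
  have hradB0 : ∀ {b : B}, b ∈ radB F B 0 ↔ nrmB b ≤ 1 := by intro b; rw [hradB]; simp
  have hpE : ∀ {x : E} {m : ℕ}, x ∈ pE F E m ↔ nrm nrE x ≤ nrm nrE t ^ m := mem_pE_iff hQE hϖ ht0
  have hemb0 : ∀ {x : E}, nrm nrE x ≤ 1 → S.ι₁ x ∈ S.chain.rad 0 := fun {x} hx =>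
    C.emb x 0 (by rwa [zpow_zero])
  have S₁ : Side Matrix.trace Matrix.det trE nrE S.ι₁ p₁ (S.chain.rad 0) t 1 :=
    { quat := hM
      quatE := hQE
      tr_ι := fun x => (hMe x).1
      nr_ι := fun x => (hMe x).2
      tr_ne := ⟨x₀, hx₀⟩
      conj_ne := exists_conj_ne hQE hE hαF
      pr_spec := hp₁
      add_mem := S.chain.rad_add
      mul_mem := fun ha hb => S.chain.rad_mul ha hb (by norm_num)
      ι_mem := hemb0
      t_pos := Q.t_pos
      t_lt := Q.t_lt
      δ_le := le_rfl
      sq_le := fun {c c'} _ hc _ hc' {y} hy => by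
        rw [sub_self, zpow_zero]
        have h1 : S.ι₁ y ∈ S.chain.rad 0 := hy ▸ S.chain.rad_mul hc hc' (by norm_num)
        have := (C.rad_zero_le h1).2
        rwa [(hMe y).2] at this }
  obtain ⟨δ, hδ⟩ : ∃ δ : ℕ, (δ = 0 ∧ Unramified F E ∧ nrm nrE t = (resCard F)⁻¹ ^ 2) ∨
    (δ = 1 ∧ ¬ Unramified F E ∧ nrm nrE t = (resCard F)⁻¹ ∧ Odd S.n) := by
    rcases hcase with ⟨h1, h2, h3⟩ | ⟨h1, h2, h3⟩
    · exact ⟨1, Or.inr ⟨rfl, h1, gen_nrm_of_ramified hQE hϖ ht0 h1, h3⟩⟩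
    · exact ⟨0, Or.inl ⟨rfl, h1, gen_nrm_of_unramified hQE hϖ ht0 h1⟩⟩
  have S₂ : Side redTrace redNorm trE nrE S.ι₂ p₂ (radB F B 0) t δ :=
    { quat := hQ
      quatE := hQE
      tr_ι := fun x => rfl
      nr_ι := fun x => rfl
      tr_ne := ⟨x₀, hx₀⟩
      conj_ne := exists_conj_ne hQE hE hαF
      pr_spec := hp₂
      add_mem := fun ha hb => hradB0.2 (hQ.nrm_add_le_of (hradB0.1 ha) (hradB0.1 hb))
      mul_mem := fun ha hb => hradB0.2 (by
        rw [hQ.nrm_mul]; exact mul_le_one₀ (hradB0.1 ha) (nrm_nonneg _ _) (hradB0.1 hb))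
      ι_mem := fun hx => hradB0.2 hx
      t_pos := Q.t_pos
      t_lt := Q.t_lt
      δ_le := by rcases hδ with h | h <;> simp [h.1]
      sq_le := fun {c c'} hcp hc hcp' hc' {y} hy => by
        have h1 : nrm nrE y = nrmB c * nrmB c' := by rw [← hQ.nrm_mul, hy]; rfl
        rw [h1]
        rw [hradB0] at hc hc'
        rcases hδ with ⟨h2, h3, h4⟩ | ⟨h2, h3, h4⟩
        · rw [h2, Nat.cast_zero, sub_zero, zpow_one, ← h1]
          apply Q.gen
          rw [h1]
          exact (mul_le_of_le_one_right (nrm_nonneg _ _) hc').trans_lt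
            (nrm_perp_lt_one Q h4 hQ (fun _ => rfl) (fun _ => rfl) hcp hc)
        · rw [h2, Nat.cast_one, sub_self, zpow_zero]
          exact mul_le_one₀ hc (nrm_nonneg _ _) hc' }
  have L : Link S trE nrE t p₁ p₂ δ :=
    { side₁ := S₁
      side₂ := S₂
      n_pos := hn
      α_nrm := hαn
      mem_pE := hpE
      V₁_eq := fun m => S₁.pCompl_eq hpE _
      V₂_eq := fun m => by
        rw [← S₂.pCompl_eq hpE, StratumData.V₂]
        congr 2
        rcases hδ with ⟨h2, h3, h4⟩ | ⟨h2, h3, h4⟩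
        · rw [if_pos h3, h2, add_zero]
        · rw [if_neg h3, h2] }
  have hn' : ∀ {b : B}, nrmB b ≤ nrm nrE t ^ S.n → b ∈ radB F B S.n' := by
    intro b hb
    rw [hradB]
    refine hb.trans (le_of_eq ?_)
    rcases hδ with ⟨h2, h3, h4⟩ | ⟨h2, h3, h4⟩
    · rw [StratumData.n', if_pos h3, h4, ← pow_mul, inv_pow]
    · rw [StratumData.n', if_neg h3, h4.1, inv_pow]
  have htn0 : t ^ S.n ≠ 0 := pow_ne_zero _ S₁.t_ne
  have hdiv : ∀ e : E, nrm nrE (t ^ S.n * e) ≤ nrm nrE t ^ S.n → nrm nrE e ≤ 1 := by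
    intro e he
    rw [hQE.nrm_mul, hQE.nrm_pow] at he
    exact (mul_le_iff_le_one_right (pow_pos Q.t_pos _)).1 he
  refine ⟨trE, nrE, t, s, p₁, p₂, δ, { L with
    chain := C
    s_eq := ⟨k, rfl, ?_, hku⟩
    cases := hδ
    mem_radB := hradB
    pr_le₁ := ?_
    pr_le₂ := ?_
    mem_maxE := mem_maxE_iff hQE
    exists_unit_OE := exists_unit_OE hQE
    nrm_unit := fun u => (isUnit_OE_iff hQE).1 u.isUnit }⟩
  · rcases hc with ⟨h1, h2, h3⟩ | ⟨h1, h2, h3⟩ <;> rw [h1] <;> push_cast <;> omega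
  · intro a ha
    set x := S.ι₁ (t ^ S.n) * a with hx
    have hxr : x ∈ S.chain.rad S.n :=
      S.chain.rad_mul (C.emb _ S.n (by rw [hQE.nrm_pow, zpow_natCast])) ha (add_zero _)
    have hx1 : x ∈ S.chain.rad 1 := S.chain.rad_antitone (by exact_mod_cast hn) hxr
    have hdet : (1 + x).det ≠ 0 := by
      intro h0
      have h1 := hM.nr_add_one x
      rw [add_comm x, h0] at h1
      obtain ⟨h2, h3⟩ := C.rad_one_lt hx1
      have h4 : normF F (x.det + x.trace) < 1 := (normF_add_le _ _).trans_lt (max_lt h3 h2)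
      have h5 : (1 : F) = -(x.det + x.trace) := by linear_combination -h1
      have h6 := congrArg (normF F) h5
      rw [normF_neg, normF_one] at h6
      exact h4.ne h6.symm
    let g : GG F B := (((isUnit_iff_isUnit_det _).2 (isUnit_iff_ne_zero.2 hdet)).unit, 1)
    have hg : g ∈ S.linkingUnits := hstr g (by
        change 1 + x - 1 ∈ _
        rwa [add_sub_cancel_left]) (by
        change (1 : B) - 1 ∈ _
        rw [sub_self, hradB, hQ.nrm_zero]; positivity)
    have h1 := L.cell_sub (L.mem_linkingUnits_iff.1 hg).1 L.one_mem_cell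
    have h2 : toA g - 1 = (x, (0 : B)) := by
      ext1
      · change 1 + x - 1 = x
        rw [add_sub_cancel_left]
      · change (1 : B) - 1 = 0
        rw [sub_self]
    rw [h2, L.cell_mem_iff₁ (Nat.zero_le _), hx, S₁.pr_left] at h1
    exact hdiv _ h1.1
  · intro a ha
    set x := S.ι₂ (t ^ S.n) * a with hx
    have hxr : nrmB x ≤ nrm nrE t ^ S.n := by
      rw [hx, hQ.nrm_mul, ← hQE.nrm_pow]
      exact mul_le_of_le_one_right (nrm_nonneg _ _) (hradB0.1 ha)
    have hne : 1 + x ≠ 0 := by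
      intro h0
      have h1 : x = -1 := by rw [eq_neg_iff_add_eq_zero, add_comm]; exact h0
      rw [h1, hQ.nrm_neg, hQ.nrm_one] at hxr
      exact hxr.not_gt L.tn_lt
    let g : GG F B := (1, mk0 (1 + x) hne)
    have hg : g ∈ S.linkingUnits := hstr g (by
        change (1 : M2 F) - 1 ∈ _
        rw [sub_self]; exact S.chain.zero_mem_rad) (by
        change 1 + x - 1 ∈ _
        rw [add_sub_cancel_left]; exact hn' hxr)
    have h1 := L.cell_sub (L.mem_linkingUnits_iff.1 hg).1 L.one_mem_cell
    have h2 : toA g - 1 = ((0 : M2 F), x) := by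
      ext1
      · change (1 : M2 F) - 1 = 0
        rw [sub_self]
      · change 1 + x - 1 = x
        rw [add_sub_cancel_left]
    rw [h2, L.cell_mem_iff₂, hx, S₂.pr_left] at h1
    exact hdiv _ h1.1

end Exists

namespace Side

variable {A : Type*} [Ring A] [Algebra F A] [Nontrivial A] {tr nr : A → F} {trE nrE : E → F}
  {ι : E →ₐ[F] A} {pr : A → E} {O : Set A} {t : E} {δ : ℤ}

variable (S : Side tr nr trE nrE ι pr O t δ)
include S

lemma mem_V_of_dual (hpr : ∀ {a}, a ∈ O → nrm nrE (pr a) ≤ 1)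
    (hdual : ∀ z : A, (∀ y ∈ O, normF F (tr (z * y)) < 1) → ι (t ^ (-δ)) * z ∈ O)
    {β : E} {n : ℤ} (hβ : nrm nrE β = nrm nrE t ^ (-n)) {w : A} (hw : w ∈ Perp tr ι) {j i : ℤ}
    (h : ∀ c ∈ V tr ι O t j, normF F (tr (ι β * w * c)) < 1) (hi : i = n + δ - j) :
    w ∈ V tr ι O t i := by
  set y : E := β * conjE trE (t ^ j) with hy
  have hyn : nrm nrE y = nrm nrE t ^ (j - n) := by
    rw [hy, S.quatE.nrm_mul, S.nrm_conj, S.quatE.nrm_zpow, hβ, ← zpow_add₀ S.t_pos.ne']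
    congr 1; ring
  have hy0 : y ≠ 0 := by
    intro h0; rw [h0, S.quatE.nrm_zero] at hyn; exact (zpow_pos S.t_pos _).ne hyn
  have h1 : ι y * w ∈ V tr ι O t δ := by
    refine ⟨perp_left S.quat hw y, hdual _ fun a ha => ?_⟩
    have hc : a - ι (pr a) ∈ V tr ι O t 0 :=
      S.mem_V_zero.2 ⟨S.pr_spec a, S.sub_mem ha (S.ι_mem (hpr ha))⟩
    have hc' : ι (t ^ j) * (a - ι (pr a)) ∈ V tr ι O t j :=
      S.V_left (i := j) (by rw [S.quatE.nrm_zpow]) hc (by ring)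
    have h2 := h _ hc'
    have e : ι y * w * a = ι β * w * (ι (t ^ j) * (a - ι (pr a))) + ι y * w * ι (pr a) := by
      rw [hy, map_mul, mul_assoc (ι β) w, ← mul_assoc w, perp_mul S.quat S.tr_ι hw]
      noncomm_ring
    rw [e, S.quat.tr_add, perp_left S.quat hw y, add_zero]
    exact h2
  have h3 := S.V_left (x := y⁻¹) (i := n - j) (m := i)
    (by rw [S.quatE.nrm_inv, hyn, ← zpow_neg, neg_sub]) h1 (by rw [hi]; ring)
  rwa [← mul_assoc, ← map_mul, inv_mul_cancel₀ hy0, map_one, one_mul] at h3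

end Side

variable {S : StratumData F E B} {ϖ : 𝒪[F]} {trE nrE : E → F} {t s : E} {p₁ : M2 F → E} {p₂ : B → E}
  {δ : ℕ} (D : Setup S ϖ trE nrE t s p₁ p₂ δ)

local notation "𝓛" => StratumData.linkingUnits S

local notation "𝓙" => Link.cell (Setup.toLink D) 1 (StratumData.n S + 1) (StratumData.n S + 1)

local notation "𝓞" => Link.cell (Setup.toLink D) 0 (StratumData.n S) (StratumData.n S)

local notation "𝓥₁" => Side.V Matrix.trace (StratumData.ι₁ S) (LatticeChain.rad (StratumData.chain S) 0) t

local notation "𝓥₂" => Side.V redTrace (StratumData.ι₂ S) (radB F B 0) t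

namespace Setup

/-- The linear form `x ↦ tr (α x₁) - tr (α x₂)`. -/
noncomputable def _root_.LinkingOrder.formT (S : StratumData F E B) (x : AA F B) : F :=
  Matrix.trace (S.ι₁ S.α * x.1) - redTrace (S.ι₂ S.α * x.2)

include D

lemma quatB : IsQuat (F := F) (A := B) redTrace redNorm := D.side₂.quat

lemma exists_trace_one : ∃ e : E, nrm nrE e ≤ 1 ∧ normF F (trE e) = 1 := by
  obtain ⟨k, hk1, hk2, -⟩ := D.s_eq
  obtain ⟨X, hX, -, hX1, -⟩ := D.chain.exists_nilpotent_conj hk1 hk2 (g := 1) (by simp)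
  have h1 : S.ι₁ S.α * X ∈ S.chain.rad 0 :=
    S.chain.rad_mul (D.chain.emb S.α (-S.n) D.α_nrm.le) hX (by ring)
  refine ⟨p₁ (S.ι₁ S.α * X), D.pr_le₁ h1, ?_⟩
  rw [← D.side₁.tr_pr, hX1, normF_one]

lemma nrm_le_of_dual {x : E} {j i : ℤ}
    (h : ∀ y, nrm nrE y ≤ nrm nrE t ^ j → normF F (trE (x * y)) < 1) (hi : i = 1 - j) :
    nrm nrE x ≤ nrm nrE t ^ i := by
  obtain ⟨e, he, he1⟩ := D.exists_trace_one
  by_contra! hlt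
  have hx0 : x ≠ 0 := by
    rintro rfl; rw [D.quatE.nrm_zero] at hlt; exact (zpow_pos D.t_pos _).not_gt hlt
  obtain ⟨l, hl⟩ := D.chain.exists_zpow hx0
  rw [hl, zpow_lt_zpow_iff_right_of_lt_one₀ D.t_pos D.t_lt] at hlt
  have := h (x⁻¹ * e) (by
    rw [D.quatE.nrm_mul, D.quatE.nrm_inv, hl, ← zpow_neg]
    refine (mul_le_of_le_one_right (zpow_nonneg D.t_pos.le _) he).trans ?_
    exact zpow_le_zpow_right_of_le_one₀ D.t_pos D.t_lt.le (by omega))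
  grind

lemma dual₁ (z : M2 F) (hz : ∀ y ∈ S.chain.rad 0, normF F (z * y).trace < 1) :
    S.ι₁ (t ^ (-1 : ℤ)) * z ∈ S.chain.rad 0 := by
  refine D.chain.mem_rad_zero_of_dual fun x hx => ?_
  rw [mul_assoc, trace_mul_comm, mul_assoc]
  exact hz _ (S.chain.rad_mul hx (D.chain.emb _ (-1) (by rw [D.quatE.nrm_zpow])) (by norm_num))

lemma dual₂ (z : B) (hz : ∀ y ∈ radB F B 0, normF F (redTrace (z * y)) < 1) :
    S.ι₂ (t ^ (-(δ : ℤ))) * z ∈ radB F B 0 := by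
  obtain ⟨e, he, he1⟩ := D.exists_trace_one
  have hQ := D.quatB
  have hlt : nrmB z ≤ nrm nrE t ^ δ := by
    have hmain : nrmB z < 1 := by
      by_contra! hlt
      have hz0 : z ≠ 0 := by rintro rfl; rw [hQ.nrm_zero] at hlt; linarith
      have := hz (z⁻¹ * S.ι₂ e) (by
        rw [D.mem_radB, hQ.nrm_mul, hQ.nrm_inv, pow_zero, inv_one]
        refine mul_le_one₀ (inv_le_one_of_one_le₀ hlt) (nrm_nonneg _ _) ?_
        rw [nrm, D.side₂.nr_ι]; exact he)
      rw [mul_inv_cancel_left₀ hz0, D.side₂.tr_ι, he1] at this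
      exact this.false
    rcases D.cases with ⟨h1, -, h2⟩ | ⟨h1, -, h2, -⟩
    · rw [h1, pow_zero]; exact hmain.le
    · rw [h1, pow_one, h2]; exact normF_lt_one_le hmain
  rw [D.mem_radB, hQ.nrm_mul, pow_zero, inv_one, nrm, D.side₂.nr_ι]
  change nrm nrE _ * _ ≤ 1
  rw [D.quatE.nrm_zpow, zpow_neg, zpow_natCast]
  exact inv_mul_le_one_of_le₀ hlt (pow_nonneg D.t_pos.le _)

lemma formT_eq (x : AA F B) : formT S x = trE (S.α * (p₁ x.1 - p₂ x.2)) := by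
  rw [formT, D.side₁.tr_pr, D.side₂.tr_pr, D.side₁.pr_left, D.side₂.pr_left, mul_sub,
    D.quatE.tr_sub]

lemma formT_add (x y : AA F B) : formT S (x + y) = formT S x + formT S y := by
  simp only [formT, Prod.fst_add, Prod.snd_add, mul_add, Matrix.trace_add, D.quatB.tr_add]; ring

lemma formT_neg (x : AA F B) : formT S (-x) = -formT S x := by
  simp only [formT, fst_neg, snd_neg, mul_neg, Matrix.trace_neg, D.quatB.tr_neg]; ring

lemma formT_sub (x y : AA F B) : formT S (x - y) = formT S x - formT S y := by
  rw [sub_eq_add_neg, D.formT_add, D.formT_neg, sub_eq_add_neg]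

lemma formT_smul (r : F) (x : AA F B) : formT S (r • x) = r * formT S x := by
  simp only [formT, Prod.smul_fst, Prod.smul_snd, mul_smul_comm, trace_smul,
    D.quatB.tr_smul, smul_eq_mul]; ring

lemma normF_formT_le {i m : ℕ} {x : AA F B} (hx : x ∈ D.cell i S.n m) : normF F (formT S x) ≤ 1 := by
  rw [D.formT_eq]
  apply D.quatE.normF_tr_le_one
  rw [D.quatE.nrm_mul, D.α_nrm, zpow_neg, zpow_natCast]
  exact inv_mul_le_one_of_le₀ hx.2.1 (pow_nonneg D.t_pos.le _)

lemma normF_formT_lt {i m : ℕ} {x : AA F B} (hx : x ∈ D.cell i (S.n + 1) m) :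
    normF F (formT S x) < 1 := by
  rw [D.formT_eq]
  apply D.quatE.normF_tr_lt_one
  rw [D.quatE.nrm_mul, D.α_nrm, zpow_neg, zpow_natCast]
  have h1 := hx.2.1
  have h2 := pow_pos D.t_pos S.n
  have h3 := D.t_lt
  rw [pow_succ] at h1
  calc _ ≤ (nrm nrE t ^ S.n)⁻¹ * (nrm nrE t ^ S.n * nrm nrE t) := by gcongr
    _ = nrm nrE t := by field_simp
    _ < 1 := h3

lemma k₁ : (S.n : ℤ) + 1 - (((S.n + 1 + 1) / 2 : ℕ) : ℤ) = (((S.n + 1) / 2 : ℕ) : ℤ) := by omega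

lemma k₂ : (S.n : ℤ) + δ - (((S.n + 1 + δ) / 2 : ℕ) : ℤ) = (((S.n + δ) / 2 : ℕ) : ℤ) := by
  have := D.δ_le; omega

/-- The dual of the radical of the linking order is the linking order. -/
lemma mem_order_of_dual {z : AA F B} (h : ∀ l ∈ 𝓙, normF F (formT S (z * l)) < 1) : z ∈ 𝓞 := by
  have ht := D.t_pos
  have key : ∀ {x : E} {j : ℤ}, nrm nrE (S.α * x) ≤ nrm nrE t ^ (j - S.n) →
      nrm nrE x ≤ nrm nrE t ^ j := by
    intro x j hx
    rw [D.quatE.nrm_mul, D.α_nrm, zpow_sub₀ ht.ne', zpow_neg, div_eq_inv_mul] at hx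
    exact le_of_mul_le_mul_left hx (inv_pos.2 (zpow_pos ht _))
  have h0₂ : p₂ (0 : B) = 0 := D.side₂.pr_perp (perp_zero D.quatB)
  refine ⟨?_, ?_, ?_, ?_⟩
  · rw [pow_zero, ← zpow_zero (nrm nrE t)]
    apply key
    refine D.nrm_le_of_dual (j := S.n + 1) (fun y hy => ?_) (by ring)
    have hl : (S.ι₁ y, (0 : B)) ∈ 𝓙 := by
      rw [D.cell_mem_iff₁ (by omega), D.side₁.pr_ι, sub_self]
      exact ⟨by exact_mod_cast hy, D.side₁.V_zero _⟩
    have := h _ hl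
    rwa [D.formT_eq, fst_mul, snd_mul, mul_zero, h0₂, sub_zero, D.side₁.pr_right,
      ← mul_assoc] at this
  · rw [← zpow_natCast]
    apply key
    refine D.nrm_le_of_dual (j := 1) (fun y hy => ?_) (by ring)
    have hl : (S.ι₁ y, S.ι₂ y) ∈ 𝓙 := D.diag_mem_cell (by rw [pow_one]; rwa [zpow_one] at hy)
    have := h _ hl
    rwa [D.formT_eq, fst_mul, snd_mul, D.side₁.pr_right, D.side₂.pr_right, ← sub_mul,
      ← mul_assoc] at this
  · refine D.side₁.mem_V_of_dual D.pr_le₁ D.dual₁ D.α_nrm (D.side₁.pr_spec _)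
      (j := (((S.n + 1 + 1) / 2 : ℕ) : ℤ)) (fun c hc => ?_) D.k₁.symm
    have hl : (c, (0 : B)) ∈ 𝓙 := by
      rw [D.cell_mem_iff₁ (by omega), D.side₁.pr_perp hc.1, map_zero, sub_zero, D.quatE.nrm_zero]
      exact ⟨by positivity, hc⟩
    have := h _ hl
    rw [formT, fst_mul, snd_mul, mul_zero, mul_zero, D.quatB.tr_zero, sub_zero] at this
    have e : S.ι₁ S.α * (z.1 - S.ι₁ (p₁ z.1)) * c =
        S.ι₁ S.α * (z.1 * c) - S.ι₁ (S.α * p₁ z.1) * c := by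
      rw [map_mul]; noncomm_ring
    rw [e, Matrix.trace_sub, perp_tr (perp_left D.side₁.quat hc.1 _), sub_zero]
    exact this
  · refine D.side₂.mem_V_of_dual D.pr_le₂ D.dual₂ D.α_nrm (D.side₂.pr_spec _)
      (j := (((S.n + 1 + δ) / 2 : ℕ) : ℤ)) (fun c hc => ?_) D.k₂.symm
    have hl : ((0 : M2 F), c) ∈ 𝓙 := by
      rw [D.cell_mem_iff₂, D.side₂.pr_perp hc.1, map_zero, sub_zero, D.quatE.nrm_zero]
      exact ⟨by positivity, hc⟩
    have := h _ hl
    rw [formT, fst_mul, snd_mul, mul_zero, mul_zero, Matrix.trace_zero, zero_sub, normF_neg] at this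
    have e : S.ι₂ S.α * (z.2 - S.ι₂ (p₂ z.2)) * c =
        S.ι₂ S.α * (z.2 * c) - S.ι₂ (S.α * p₂ z.2) * c := by
      rw [map_mul]; noncomm_ring
    rw [e, D.quatB.tr_sub, perp_tr (perp_left D.quatB hc.1 _), sub_zero]
    exact this

lemma normF_formT_mul_lt {l z : AA F B} (hl : l ∈ 𝓙) (hz : z ∈ 𝓞) : normF F (formT S (z * l)) < 1 :=
  D.normF_formT_lt (D.cell_mul_left (by omega) le_rfl le_rfl le_rfl (by omega) hz hl)

/-- The subgroup `1 + 𝔓ⁿ × 𝔓_Bⁿ'` minus one. -/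
def _root_.LinkingOrder.depthSet (S : StratumData F E B) : Set (AA F B) :=
  {x | x.1 ∈ S.chain.rad S.n ∧ x.2 ∈ radB F B S.n'}

lemma mem_radB_n' {b : B} : b ∈ radB F B S.n' ↔ nrmB b ≤ nrm nrE t ^ S.n := by
  rw [D.mem_radB, StratumData.n']
  rcases D.cases with ⟨-, h3, h4⟩ | ⟨-, h3, h4, -⟩
  · rw [if_pos h3, h4, ← pow_mul, inv_pow]
  · rw [if_neg h3, h4, inv_pow]

lemma nrm_redNorm_ι (x : E) : nrmB (S.ι₂ x) = nrm nrE x := by rw [nrm, D.side₂.nr_ι]; rfl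

lemma depth_mul_left {h x : AA F B} (hh : h ∈ 𝓞) (hx : x ∈ depthSet S) : h * x ∈ depthSet S := by
  obtain ⟨h1, h2⟩ := D.mem_orders (Nat.zero_le _) hh
  refine ⟨S.chain.rad_mul h1 hx.1 (zero_add _), ?_⟩
  rw [D.mem_radB_n', snd_mul, D.quatB.nrm_mul]
  rw [D.mem_radB, pow_zero, inv_one] at h2
  exact (mul_le_of_le_one_left (nrm_nonneg _ _) h2).trans (D.mem_radB_n'.1 hx.2)

lemma depth_of_E {x : AA F B} {a b : E} (ha : nrm nrE a ≤ nrm nrE t ^ S.n)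
    (hb : nrm nrE b ≤ nrm nrE t ^ S.n) (hx : x = (S.ι₁ a, S.ι₂ b)) : x ∈ depthSet S := by
  subst hx
  exact ⟨D.chain.emb _ _ (by rwa [zpow_natCast]), by rwa [D.mem_radB_n', D.nrm_redNorm_ι]⟩

lemma nrm_conj_sub_α (h : δ = 0) : nrm nrE (conjE trE S.α - S.α) = nrm nrE t ^ (-(S.n : ℤ)) := by
  rcases D.cases with ⟨-, h3, h4⟩ | ⟨h1, -⟩
  · obtain ⟨k, hk1, -, hk3⟩ := D.s_eq
    have h5 := D.chain.nrm_conj_sub h4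
    have h6 : conjE trE s - s = algebraMap F E ((ϖ : F) ^ k) * (conjE trE S.α - S.α) := by
      rw [hk1, conjE, D.quatE.tr_smul, conjE, smul_def, map_mul]; ring
    rw [h6, D.quatE.nrm_mul, D.quatE.nrm_algebraMap, normF_pow, normF_uniformizer D.chain.irr,
      hk3 h3, ← pow_mul, mul_comm S.n, pow_mul, ← h4] at h5
    rw [zpow_neg, zpow_natCast]
    grind
  · omega

end Setup

variable {V : Type*} [AddCommGroup V] [Module ℂ V] {ψF : AddChar F Circle}
  {σ : Representation ℂ S.linkingUnits V}

namespace Setup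

include D

lemma depth_subset_cell {x : AA F B} (hx : x ∈ depthSet S) : x ∈ D.cell S.n S.n S.n := by
  have hn := D.n_pos
  have hδ := D.δ_le
  have ht := D.t_pos
  have h1 : S.ι₁ (t ^ (-(S.n : ℤ))) * x.1 ∈ S.chain.rad 0 :=
    S.chain.rad_mul (D.chain.emb _ (-S.n) (by rw [D.quatE.nrm_zpow])) hx.1 (by ring)
  have h2 : S.ι₂ (t ^ (-(S.n : ℤ))) * x.2 ∈ radB F B 0 := by
    rw [D.mem_radB, D.quatB.nrm_mul, pow_zero, inv_one, D.nrm_redNorm_ι, D.quatE.nrm_zpow,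
      zpow_neg, zpow_natCast]
    exact inv_mul_le_one_of_le₀ (D.mem_radB_n'.1 hx.2) (pow_nonneg ht.le _)
  have key : ∀ {y : E}, nrm nrE (t ^ (-(S.n : ℤ)) * y) ≤ 1 → nrm nrE y ≤ nrm nrE t ^ S.n := by
    intro y hy
    rw [D.quatE.nrm_mul, D.quatE.nrm_zpow, zpow_neg, zpow_natCast,
      inv_mul_le_one₀ (pow_pos ht _)] at hy
    exact hy
  have h3 : nrm nrE (p₁ x.1) ≤ nrm nrE t ^ S.n := key (by rw [← D.side₁.pr_left]; exact D.pr_le₁ h1)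
  have h4 : nrm nrE (p₂ x.2) ≤ nrm nrE t ^ S.n := key (by rw [← D.side₂.pr_left]; exact D.pr_le₂ h2)
  refine ⟨h3, D.quatE.nrm_sub_le_of h3 h4, ?_, ?_⟩
  · refine D.side₁.V_mono (j := S.n) (by omega) ⟨D.side₁.pr_spec _, ?_⟩
    rw [mul_sub, ← map_mul, ← D.side₁.pr_left]
    exact D.side₁.sub_mem h1 (D.side₁.ι_mem (D.pr_le₁ h1))
  · refine D.side₂.V_mono (j := S.n) (by omega) ⟨D.side₂.pr_spec _, ?_⟩
    rw [mul_sub, ← map_mul, ← D.side₂.pr_left]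
    exact D.side₂.sub_mem h2 (D.side₂.ι_mem (D.pr_le₂ h2))

lemma nrm_p₁_add {x y : AA F B} (hx : nrm nrE (p₁ x.1) = 1) (hy : nrm nrE (p₁ y.1) < 1) :
    nrm nrE (p₁ (x + y).1) = 1 := by
  rw [Prod.fst_add, D.side₁.pr_add, add_comm, D.quatE.nrm_eq_of_lt (by rwa [hx]), hx]

lemma cell_lt {i j m : ℕ} (hi : 1 ≤ i) {x : AA F B} (hx : x ∈ D.cell i j m) :
    nrm nrE (p₁ x.1) < 1 :=
  hx.1.trans_lt (pow_lt_one₀ D.t_pos.le D.t_lt (by omega))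

lemma order_of_unit (h : 𝓛) : toA h.1 ∈ 𝓞 := (D.mem_linkingUnits_iff.1 h.2).1

lemma nrm_of_unit (h : 𝓛) : nrm nrE (p₁ (toA h.1).1) = 1 := (D.mem_linkingUnits_iff.1 h.2).2

/-- Adding an element of the radical of the linking order to a unit. -/
lemma exists_add_radical (h : 𝓛) {x : AA F B} (hx : x ∈ D.cell 1 S.n S.n) :
    ∃ h' : 𝓛, toA h'.1 = toA h.1 + x := by
  obtain ⟨g, hg, hg'⟩ := D.exists_unit (D.cell_add (D.order_of_unit h)
    (D.cell_mono (Nat.zero_le _) le_rfl le_rfl hx)) (D.nrm_p₁_add (D.nrm_of_unit h)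
    (D.cell_lt le_rfl hx))
  exact ⟨⟨g, hg⟩, hg'⟩

omit D in
lemma toA_inv_mul (h : GG F B) (x : AA F B) : toA h * (toA h⁻¹ * x) = x := by
  rw [← mul_assoc, ← toA_mul, mul_inv_cancel, toA_one, one_mul]

omit D in
lemma toA_injective : Injective (toA : GG F B → AA F B) := by
  intro g h hgh
  ext1
  · exact Units.ext (congrArg Prod.fst hgh)
  · exact Units.ext (congrArg Prod.snd hgh)

variable (hσ : S.IsRhoS ψF σ)
include hσ

lemma exists_add_ideal (h : 𝓛) {l : AA F B} (hl : l ∈ 𝓙) :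
    ∃ h' : 𝓛, toA h'.1 = toA h.1 + l ∧ σ h' = σ h := by
  obtain ⟨h', hh'⟩ := D.exists_add_radical h (D.cell_mono le_rfl (by omega) (by omega) hl)
  refine ⟨h', hh', ?_⟩
  have h1 : σ (h⁻¹ * h') = 1 := by
    apply hσ.inflated
    rw [D.linkingIdeal_eq]
    have e : toA ((h⁻¹ * h' : 𝓛) : GG F B) - 1 = toA (h⁻¹).1 * l := by
      rw [coe_mul, toA_mul, hh', mul_add, ← toA_mul, ← coe_mul,
        inv_mul_cancel, coe_one, toA_one, add_sub_cancel_left]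
    rw [e]
    exact D.cell_mul_left (by omega) le_rfl le_rfl le_rfl (by omega) (D.order_of_unit _) hl
  calc σ h' = σ (h * (h⁻¹ * h')) := by rw [mul_inv_cancel_left]
    _ = σ h := by rw [map_mul, h1, mul_one]

lemma exists_mul_depth (h : 𝓛) {x : AA F B} (hx : x ∈ depthSet S) :
    ∃ h' : 𝓛, toA h'.1 = toA h.1 * (1 + x) ∧ σ h' = (ψF (formT S x) : ℂ) • σ h := by
  have hxc := D.depth_subset_cell hx
  obtain ⟨g, hg⟩ := D.exists_add_radical 1 (D.cell_mono D.n_pos le_rfl le_rfl hxc)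
  rw [coe_one, toA_one] at hg
  refine ⟨h * g, by rw [coe_mul, toA_mul, hg], ?_⟩
  have hg1 : ((g : GG F B).1 : M2 F) - 1 = x.1 := by
    have := congrArg Prod.fst hg
    change ((g : GG F B).1 : M2 F) = 1 + x.1 at this
    rw [this, add_sub_cancel_left]
  have hg2 : ((g : GG F B).2 : B) - 1 = x.2 := by
    have := congrArg Prod.snd hg
    change ((g : GG F B).2 : B) = 1 + x.2 at this
    rw [this, add_sub_cancel_left]
  obtain ⟨hgm, h1⟩ := hσ.stratum g (by rw [hg1]; exact hx.1) (by rw [hg2]; exact hx.2)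
  rw [hg1, hg2] at h1
  have h2 : σ g = (ψF (formT S x) : ℂ) • (1 : End ℂ V) := by
    have : σ g = σ ⟨g, hgm⟩ := rfl
    rw [this, h1, formT, AddChar.map_sub_eq_div, Circle.coe_div, div_eq_mul_inv]
  rw [map_mul, h2, mul_smul_comm, mul_one]

/-- Translating a principal unit by elements of `𝔭_E ^ n × 𝔭_E ^ n`. -/
lemma exists_add_depth (hψF : TrivialOnMax ψF) (u : 𝓛) (hu : toA u.1 - 1 ∈ D.cell 1 S.n S.n)
    {a b : E} (ha : nrm nrE a ≤ nrm nrE t ^ S.n) (hb : nrm nrE b ≤ nrm nrE t ^ S.n) :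
    ∃ h' : 𝓛, toA h'.1 = toA u.1 + (S.ι₁ a, S.ι₂ b) ∧
      σ h' = (ψF (formT S (S.ι₁ a, S.ι₂ b)) : ℂ) • σ u := by
  set x : AA F B := (S.ι₁ a, S.ι₂ b) with hx
  have hxd : x ∈ depthSet S := D.depth_of_E ha hb rfl
  set y : AA F B := toA u.1⁻¹ * x with hy
  have hyd : y ∈ depthSet S := D.depth_mul_left (D.order_of_unit u⁻¹) hxd
  obtain ⟨h', h1, h2⟩ := D.exists_mul_depth hσ u hyd
  refine ⟨h', ?_, ?_⟩
  · rw [h1, mul_add, mul_one, hy, toA_inv_mul]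
  · rw [h2]
    congr 2
    have h3 : toA u.1⁻¹ - 1 ∈ D.cell 1 S.n S.n := by
      have := D.cell_neg (D.cell_mul_left (by have := D.n_pos; omega) le_rfl (by omega) (by omega)
        le_rfl (D.order_of_unit u⁻¹) hu)
      rwa [mul_sub, mul_one, Subgroup.coe_inv, ← toA_mul, inv_mul_cancel, toA_one, neg_sub] at this
    have h4 : normF F (formT S (y - x)) < 1 := by
      have e : y - x = (toA u.1⁻¹ - 1) * x := by rw [sub_mul, one_mul]
      rw [e, D.formT_eq]
      apply D.quatE.normF_tr_lt_one
      rw [fst_mul, snd_mul, hx, D.side₁.pr_right, D.side₂.pr_right, D.quatE.nrm_mul,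
        D.α_nrm, zpow_neg, zpow_natCast]
      have h5 := D.cell_lt le_rfl h3
      have h6 := D.nrm_p₂ (by have := D.n_pos; omega) h3
      have h7 : nrm nrE (p₂ (toA u.1⁻¹ - 1).2) < 1 :=
        h6.trans_lt (pow_lt_one₀ D.t_pos.le D.t_lt (by omega))
      have htn := pow_pos D.t_pos S.n
      have key : ∀ c d : E, nrm nrE c < 1 → nrm nrE d ≤ nrm nrE t ^ S.n →
          nrm nrE (c * d) < nrm nrE t ^ S.n := by
        intro c d hc hd
        rw [D.quatE.nrm_mul]
        calc _ ≤ nrm nrE c * nrm nrE t ^ S.n := mul_le_mul_of_nonneg_left hd (nrm_nonneg _ _)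
          _ < 1 * nrm nrE t ^ S.n := mul_lt_mul_of_pos_right hc htn
          _ = _ := one_mul _
      rw [inv_mul_lt_one₀ htn]
      exact (D.quatE.nrm_sub_le _ _).trans_lt (max_lt (key _ _ h5 ha) (key _ _ h7 hb))
    have h8 : formT S y = formT S (y - x) + formT S x := by rw [← D.formT_add, sub_add_cancel]
    rw [h8, map_add_eq_mul]
    have h9 := hψF ⟨formT S (y - x), normF_le_one.1 h4.le⟩ (normF_lt_one_iff.1 h4)
    rw [h9, one_mul]

/-- The diagonal elements of `1 + 𝔭_E` act trivially, and the torus part of a principal unit can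
be split off. -/
lemma exists_perp_part (hψF : TrivialOnMax ψF) (h : 𝓛) (hh : toA h.1 - 1 ∈ D.cell 1 S.n S.n) :
    ∃ (d h' : 𝓛) (w : AA F B), h = d * h' ∧ toA h'.1 = 1 + w ∧
      p₁ w.1 = 0 ∧ p₂ w.2 = 0 ∧ w ∈ D.cell 1 S.n S.n ∧
      σ d = (ψF (formT S (toA h.1)) : ℂ) • (1 : End ℂ V) ∧
      (w ∈ 𝓙 ↔ toA h.1 - 1 ∈ D.cell 1 S.n (S.n + 1)) := by
  have hn := D.n_pos
  set e₁ := p₁ (toA h.1).1 with he₁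
  set e₂ := p₂ (toA h.1).2 with he₂
  have hp₁1 : p₁ (1 : AA F B).1 = 1 := D.side₁.pr_one
  have hp₂1 : p₂ (1 : AA F B).2 = 1 := D.side₂.pr_one
  have h1 : nrm nrE (e₁ - 1) ≤ nrm nrE t ^ 1 := by
    have := hh.1
    rwa [fst_sub, D.side₁.pr_sub, hp₁1] at this
  have h2 : nrm nrE (e₂ - e₁) ≤ nrm nrE t ^ S.n := by
    have := hh.2.1
    rwa [fst_sub, D.side₁.pr_sub, hp₁1, snd_sub, D.side₂.pr_sub, hp₂1,
      sub_sub_sub_cancel_right, ← D.quatE.nrm_neg, neg_sub] at this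
  have he₁n : nrm nrE e₁ = 1 := D.nrm_of_unit h
  have he₂n : nrm nrE e₂ = 1 := (D.norm_eq_one (D.order_of_unit h) he₁n).2.2.1
  have he₁0 : e₁ ≠ 0 := by rintro h0; rw [h0, D.quatE.nrm_zero] at he₁n; exact zero_ne_one he₁n
  have he₂0 : e₂ ≠ 0 := by rintro h0; rw [h0, D.quatE.nrm_zero] at he₂n; exact zero_ne_one he₂n
  -- the diagonal part
  obtain ⟨d₀, hd₀, hd₀σ⟩ := D.exists_add_ideal hσ 1
    (D.diag_mem_cell (i := 1) (j := S.n + 1) (m := S.n + 1) h1)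
  have hd₀' : toA d₀.1 = (S.ι₁ e₁, S.ι₂ e₁) := by
    rw [hd₀, coe_one, toA_one]
    ext1
    · change 1 + S.ι₁ (e₁ - 1) = S.ι₁ e₁
      rw [map_sub, map_one, add_sub_cancel]
    · change 1 + S.ι₂ (e₁ - 1) = S.ι₂ e₁
      rw [map_sub, map_one, add_sub_cancel]
  have hd₀1 : toA d₀.1 - 1 ∈ D.cell 1 S.n S.n := by
    rw [hd₀, coe_one, toA_one, add_sub_cancel_left]
    exact D.diag_mem_cell h1
  obtain ⟨d, hd, hdσ⟩ := D.exists_add_depth hσ hψF d₀ hd₀1 (a := 0) (b := e₂ - e₁)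
    (by rw [D.quatE.nrm_zero]; exact pow_nonneg D.t_pos.le _) h2
  rw [hd₀σ, map_one] at hdσ
  have hd' : toA d.1 = (S.ι₁ e₁, S.ι₂ e₂) := by
    rw [hd, hd₀']
    ext1
    · change S.ι₁ e₁ + S.ι₁ 0 = S.ι₁ e₁
      rw [map_zero, add_zero]
    · change S.ι₂ e₁ + S.ι₂ (e₂ - e₁) = S.ι₂ e₂
      rw [map_sub, add_sub_cancel]
  have hTd : formT S (S.ι₁ 0, S.ι₂ (e₂ - e₁)) = formT S (toA h.1) := by
    rw [D.formT_eq, D.formT_eq, D.side₁.pr_ι, D.side₂.pr_ι, zero_sub, neg_sub]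
  rw [hTd] at hdσ
  set w : AA F B := (S.ι₁ e₁⁻¹ * ((toA h.1).1 - S.ι₁ e₁),
    S.ι₂ e₂⁻¹ * ((toA h.1).2 - S.ι₂ e₂)) with hw
  have hh' : toA ((d⁻¹ * h : 𝓛) : GG F B) = 1 + w := by
    have h3 : toA d.1 * (1 + w) = toA h.1 := by
      rw [hd', hw]
      ext1
      · change S.ι₁ e₁ * (1 + S.ι₁ e₁⁻¹ * ((toA h.1).1 - S.ι₁ e₁)) = _
        rw [mul_add, mul_one, ← mul_assoc, ← map_mul, mul_inv_cancel₀ he₁0, map_one, one_mul,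
          add_sub_cancel]
      · change S.ι₂ e₂ * (1 + S.ι₂ e₂⁻¹ * ((toA h.1).2 - S.ι₂ e₂)) = _
        rw [mul_add, mul_one, ← mul_assoc, ← map_mul, mul_inv_cancel₀ he₂0, map_one, one_mul,
          add_sub_cancel]
    rw [coe_mul, toA_mul, ← h3, ← mul_assoc, ← toA_mul, ← coe_mul,
      inv_mul_cancel, coe_one, toA_one, one_mul]
  have hc₁ : ∀ {i : ℤ}, S.ι₁ e₁⁻¹ * ((toA h.1).1 - S.ι₁ e₁) ∈ 𝓥₁ i ↔ (toA h.1).1 - S.ι₁ e₁ ∈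
      𝓥₁ i := by
    intro i
    constructor
    · intro h3
      have := D.side₁.V_left (x := e₁) (i := 0) (m := i) (by rw [he₁n, zpow_zero]) h3 (by ring)
      rwa [← mul_assoc, ← map_mul, mul_inv_cancel₀ he₁0, map_one, one_mul] at this
    · intro h3
      exact D.side₁.V_left (i := 0) (by rw [D.quatE.nrm_inv, he₁n, zpow_zero, inv_one]) h3 (by ring)
  have hc₂ : ∀ {i : ℤ}, S.ι₂ e₂⁻¹ * ((toA h.1).2 - S.ι₂ e₂) ∈ 𝓥₂ i ↔ (toA h.1).2 - S.ι₂ e₂ ∈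
      𝓥₂ i := by
    intro i
    constructor
    · intro h3
      have := D.side₂.V_left (x := e₂) (i := 0) (m := i) (by rw [he₂n, zpow_zero]) h3 (by ring)
      rwa [← mul_assoc, ← map_mul, mul_inv_cancel₀ he₂0, map_one, one_mul] at this
    · intro h3
      exact D.side₂.V_left (i := 0) (by rw [D.quatE.nrm_inv, he₂n, zpow_zero, inv_one]) h3 (by ring)
  have hw1 : p₁ w.1 = 0 := D.side₁.pr_perp (perp_left D.side₁.quat (D.side₁.pr_spec _) _)
  have hw2 : p₂ w.2 = 0 := D.side₂.pr_perp (perp_left D.quatB (D.side₂.pr_spec _) _)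
  have hz : ∀ i : ℕ, nrm nrE 0 ≤ nrm nrE t ^ i := fun i => by
    rw [D.quatE.nrm_zero]; exact pow_nonneg D.t_pos.le _
  have hcell : ∀ {j m : ℕ}, w ∈ D.cell 1 j m ↔ (toA h.1).1 - S.ι₁ e₁ ∈ 𝓥₁ (((m + 1) / 2 : ℕ)) ∧
      (toA h.1).2 - S.ι₂ e₂ ∈ 𝓥₂ (((m + δ) / 2 : ℕ)) := by
    intro j m
    rw [← hc₁, ← hc₂]
    constructor
    · rintro ⟨-, -, h3, h4⟩
      rw [hw1, map_zero, sub_zero] at h3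
      rw [hw2, map_zero, sub_zero] at h4
      exact ⟨h3, h4⟩
    · rintro ⟨h3, h4⟩
      refine ⟨by rw [hw1]; exact hz _, by rw [hw1, hw2, sub_zero]; exact hz _, ?_, ?_⟩
      · rw [hw1, map_zero, sub_zero]; exact h3
      · rw [hw2, map_zero, sub_zero]; exact h4
  have e3 : (toA h.1 - 1).1 - S.ι₁ (p₁ (toA h.1 - 1).1) = (toA h.1).1 - S.ι₁ e₁ := by
    rw [fst_sub, D.side₁.pr_sub, hp₁1, map_sub, map_one, fst_one]; abel
  have e4 : (toA h.1 - 1).2 - S.ι₂ (p₂ (toA h.1 - 1).2) = (toA h.1).2 - S.ι₂ e₂ := by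
    rw [snd_sub, D.side₂.pr_sub, hp₂1, map_sub, map_one, Prod.snd_one]; abel
  refine ⟨d, d⁻¹ * h, w, (mul_inv_cancel_left _ _).symm, hh', hw1, hw2, ?_, hdσ, ?_⟩
  · rw [hcell, ← e3, ← e4]
    exact hh.2.2
  · rw [hcell, ← e3, ← e4]
    exact ⟨fun h3 => ⟨hh.1, hh.2.1, h3⟩, fun h3 => h3.2.2⟩

/-- A commutator that acts by a nontrivial scalar. -/
lemma exists_commutator (hψF : TrivialOnMax ψF) (hψF' : NontrivialOnInt ψF)
    (h : 𝓛) {w : AA F B} (hw : toA h.1 = 1 + w) (hw₁ : p₁ w.1 = 0)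
    (hw₂ : p₂ w.2 = 0) (hwc : w ∈ D.cell 1 S.n S.n)
    (hwn : w ∉ 𝓙) :
    ∃ (k : 𝓛) (z : ℂ), z ≠ 1 ∧ σ (k * h) = z • σ (h * k) := by
  have hn := D.n_pos
  obtain ⟨x₀, hx₀⟩ := hψF'
  obtain ⟨-, -, hw3, hw4⟩ := id hwc
  rw [hw₁, map_zero, sub_zero] at hw3
  rw [hw₂, map_zero, sub_zero] at hw4
  have hδ : δ = 0 := by
    rcases D.cases with h1 | ⟨h1, -, -, h2⟩
    · exact h1.1
    · exfalso
      apply hwn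
      obtain ⟨r, hr⟩ := h2
      refine ⟨hwc.1, ?_, ?_, ?_⟩
      · rw [hw₁, hw₂, sub_zero, D.quatE.nrm_zero]; exact pow_nonneg D.t_pos.le _
      · rw [hw₁, map_zero, sub_zero]
        exact D.side₁.V_mono (by omega) hw3
      · rw [hw₂, map_zero, sub_zero]
        exact D.side₂.V_mono (by omega) hw4
  have hβ := D.nrm_conj_sub_α hδ
  -- conclusion from an element of the complement
  have concl : ∀ c : AA F B, p₁ c.1 = 0 → p₂ c.2 = 0 → c ∈ D.cell 1 S.n S.n →
      ψF (formT S (c * w - w * c)) ≠ 1 →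
      ∃ (k : 𝓛) (z : ℂ), z ≠ 1 ∧ σ (k * h) = z • σ (h * k) := by
    intro c hc1 hc2 hc hcψ
    obtain ⟨k, hk⟩ := D.exists_add_radical 1 hc
    rw [coe_one, toA_one] at hk
    have hprod : ∀ x y : AA F B, p₁ x.1 = 0 → p₂ x.2 = 0 → p₁ y.1 = 0 → p₂ y.2 = 0 →
        x ∈ D.cell 1 S.n S.n → y ∈ D.cell 1 S.n S.n →
        x * y = (S.ι₁ (p₁ (x.1 * y.1)), S.ι₂ (p₂ (x.2 * y.2))) ∧
        nrm nrE (p₁ (x.1 * y.1)) ≤ nrm nrE t ^ S.n ∧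
        nrm nrE (p₂ (x.2 * y.2)) ≤ nrm nrE t ^ S.n := by
      intro x y hx1 hx2 hy1 hy2 hx hy
      have hx3 := hx.2.2
      have hy3 := hy.2.2
      rw [hx1, hx2, map_zero, map_zero, sub_zero, sub_zero] at hx3
      rw [hy1, hy2, map_zero, map_zero, sub_zero, sub_zero] at hy3
      have hδ' := D.δ_le
      refine ⟨?_, D.zpow_le_pow (by push_cast; omega) (D.side₁.V_mul_V hx3.1 hy3.1),
        D.zpow_le_pow (by push_cast; omega) (D.side₂.V_mul_V hx3.2 hy3.2)⟩
      ext1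
      · exact D.side₁.perp_mul_perp hx3.1.1 hy3.1.1
      · exact D.side₂.perp_mul_perp hx3.2.1 hy3.2.1
    obtain ⟨e1, a1, b1⟩ := hprod c w hc1 hc2 hw₁ hw₂ hc hwc
    obtain ⟨e2, a2, b2⟩ := hprod w c hw₁ hw₂ hc1 hc2 hwc hc
    have e3 : c * w - w * c = (S.ι₁ (p₁ (c.1 * w.1) - p₁ (w.1 * c.1)),
        S.ι₂ (p₂ (c.2 * w.2) - p₂ (w.2 * c.2))) := by
      rw [e1, e2, map_sub, map_sub]; rfl
    have hhk : toA (h * k).1 - 1 ∈ D.cell 1 S.n S.n := by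
      rw [coe_mul, toA_mul, hw, hk]
      have e4 : (1 + w) * (1 + c) - 1 = w + (1 + w) * c := by noncomm_ring
      rw [e4]
      refine D.cell_add hwc (D.cell_mul_left (by omega) le_rfl (by omega) (by omega) le_rfl ?_ hc)
      rw [← hw]; exact D.order_of_unit h
    obtain ⟨g, hg, hgσ⟩ := D.exists_add_depth hσ hψF (h * k) hhk
      (a := p₁ (c.1 * w.1) - p₁ (w.1 * c.1)) (b := p₂ (c.2 * w.2) - p₂ (w.2 * c.2))
      (D.quatE.nrm_sub_le_of a1 a2) (D.quatE.nrm_sub_le_of b1 b2)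
    rw [← e3] at hg hgσ
    have hgk : g = k * h := by
      apply Subtype.ext
      apply toA_injective
      rw [hg, coe_mul, coe_mul, toA_mul, toA_mul, hw, hk]
      noncomm_ring
    refine ⟨k, _, ?_, hgk ▸ hgσ⟩
    intro h1
    exact hcψ (Circle.ext h1)
  have scale : ∀ y : F, 1 ≤ normF F y → ∃ r : F, normF F r ≤ 1 ∧ r * y = x₀ := by
    intro y hy
    have hy0 : y ≠ 0 := by rintro rfl; simp [normF] at hy; linarith
    refine ⟨x₀ / y, ?_, div_mul_cancel₀ _ hy0⟩
    rw [normF_div]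
    exact div_le_one_of_le₀ ((normF_le_one.2 x₀.2).trans hy) (normF_nonneg _)
  by_cases h1 : w.1 ∈ 𝓥₁ (((S.n + 1 + 1) / 2 : ℕ))
  · have h2 : w.2 ∉ 𝓥₂ (((S.n + 1 + δ) / 2 : ℕ)) := by
      intro h2
      apply hwn
      refine ⟨hwc.1, ?_, ?_, ?_⟩
      · rw [hw₁, hw₂, sub_zero, D.quatE.nrm_zero]; exact pow_nonneg D.t_pos.le _
      · rw [hw₁, map_zero, sub_zero]; exact h1
      · rw [hw₂, map_zero, sub_zero]; exact h2
    have h3 : ∃ c ∈ 𝓥₂ (((S.n + δ) / 2 : ℕ)),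
        1 ≤ normF F (redTrace (S.ι₂ (conjE trE S.α - S.α) * w.2 * c)) := by
      by_contra! h4
      exact h2 (D.side₂.mem_V_of_dual D.pr_le₂ D.dual₂ hβ hw4.1 h4 (by rw [hδ]; push_cast; omega))
    obtain ⟨c, hc, hc1⟩ := h3
    obtain ⟨r, hr, hr1⟩ := scale _ hc1
    have hrc : r • c ∈ 𝓥₂ (((S.n + δ) / 2 : ℕ)) := by
      rw [smul_def, ← S.ι₂.commutes]
      exact D.side₂.V_left (i := 0) (by
        rw [D.quatE.nrm_algebraMap, zpow_zero]; exact pow_le_one₀ (normF_nonneg _) hr) hc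
        (by ring)
    have hz₁ : p₁ (0 : M2 F) = 0 := D.side₁.pr_perp (perp_zero D.side₁.quat)
    have hz₂ : p₂ (r • c) = 0 := D.side₂.pr_perp hrc.1
    refine concl (0, r • c) hz₁ hz₂ ?_ ?_
    · rw [D.cell_mem_iff₂, hz₂, map_zero, sub_zero, D.quatE.nrm_zero]
      exact ⟨pow_nonneg D.t_pos.le _, hrc⟩
    · have e : formT S (((0, r • c) : AA F B) * w - w * (0, r • c)) = -x₀ := by
        rw [formT]
        simp only [fst_sub, snd_sub, fst_mul, snd_mul, zero_mul, mul_zero,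
          sub_zero, Matrix.trace_zero, zero_sub]
        have e2 : redTrace (S.ι₂ S.α * (r • c * w.2 - w.2 * r • c)) =
            r * redTrace (S.ι₂ (conjE trE S.α - S.α) * w.2 * c) := by
          have hQ := D.quatB
          rw [mul_sub, hQ.tr_sub, smul_mul_assoc, mul_smul_comm, mul_smul_comm, mul_smul_comm,
            hQ.tr_smul, hQ.tr_smul, ← mul_sub, ← mul_assoc, hQ.tr_comm, ← mul_assoc,
            perp_mul hQ D.side₂.tr_ι hw4.1, map_sub, sub_mul, sub_mul, hQ.tr_sub, ← mul_assoc]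
        rw [e2, hr1]
      rw [e, AddChar.map_neg_eq_inv]
      exact inv_ne_one.2 hx₀
  · have h3 : ∃ c ∈ 𝓥₁ (((S.n + 1) / 2 : ℕ)),
        1 ≤ normF F (Matrix.trace (S.ι₁ (conjE trE S.α - S.α) * w.1 * c)) := by
      by_contra! h4
      exact h1 (D.side₁.mem_V_of_dual D.pr_le₁ D.dual₁ hβ hw3.1 h4 (by push_cast; omega))
    obtain ⟨c, hc, hc1⟩ := h3
    obtain ⟨r, hr, hr1⟩ := scale _ hc1
    have hrc : r • c ∈ 𝓥₁ (((S.n + 1) / 2 : ℕ)) := by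
      rw [smul_def, ← S.ι₁.commutes]
      exact D.side₁.V_left (i := 0) (by
        rw [D.quatE.nrm_algebraMap, zpow_zero]; exact pow_le_one₀ (normF_nonneg _) hr) hc
        (by ring)
    have hz₁ : p₁ (r • c) = 0 := D.side₁.pr_perp hrc.1
    have hz₂ : p₂ (0 : B) = 0 := D.side₂.pr_perp (perp_zero D.quatB)
    refine concl (r • c, 0) hz₁ hz₂ ?_ ?_
    · rw [D.cell_mem_iff₁ (by omega), hz₁, map_zero, sub_zero, D.quatE.nrm_zero]
      exact ⟨pow_nonneg D.t_pos.le _, hrc⟩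
    · have e : formT S (((r • c, 0) : AA F B) * w - w * (r • c, 0)) = x₀ := by
        rw [formT]
        simp only [fst_sub, snd_sub, fst_mul, snd_mul, zero_mul, mul_zero,
          sub_zero, D.quatB.tr_zero]
        have hQ := D.side₁.quat
        rw [mul_sub, hQ.tr_sub, smul_mul_assoc, mul_smul_comm, mul_smul_comm, mul_smul_comm,
          hQ.tr_smul, hQ.tr_smul, ← mul_sub, ← mul_assoc, hQ.tr_comm, ← mul_assoc,
          perp_mul hQ D.side₁.tr_ι hw3.1, ← mul_assoc, ← hQ.tr_sub, ← sub_mul, ← sub_mul, ← map_sub,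
          hr1]
      rw [e]
      exact hx₀

variable [FiniteDimensional ℂ V]

/-- On principal units, `σ` is scalar or has vanishing trace. -/
lemma scalar_or_trace_eq_zero (hψF : TrivialOnMax ψF) (hψF' : NontrivialOnInt ψF) (h : 𝓛)
    (hh : toA h.1 - 1 ∈ D.cell 1 S.n S.n) :
    (toA h.1 - 1 ∈ D.cell 1 S.n (S.n + 1) → σ h = (ψF (formT S (toA h.1)) : ℂ) • (1 : End ℂ V)) ∧
    (toA h.1 - 1 ∉ D.cell 1 S.n (S.n + 1) → trace ℂ V (σ h) = 0 ∧ trace ℂ V (σ h⁻¹) = 0) := by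
  obtain ⟨d, h', w, hdh, hh', hw₁, hw₂, hwc, hdσ, hiff⟩ := D.exists_perp_part hσ hψF h hh
  rw [← hiff]
  constructor
  · intro hw
    obtain ⟨g, hg, hgσ⟩ := D.exists_add_ideal hσ 1 hw
    have : g = h' := Subtype.ext (toA_injective (by rw [hg, hh']; rfl))
    have e : σ h = σ d := by rw [hdh, map_mul, ← this, hgσ, map_one, mul_one]
    rw [e, hdσ]
  · intro hw
    obtain ⟨k, z, hz, hk⟩ := D.exists_commutator hσ hψF hψF' h' hh' hw₁ hw₂ hwc hw
    have hk1 : σ k * σ h' = z • (σ h' * σ k) := by rw [← map_mul, hk, map_mul]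
    have hkk : σ k * σ k⁻¹ = 1 := by rw [← map_mul, mul_inv_cancel, map_one]
    have hkk' : σ k⁻¹ * σ k = 1 := by rw [← map_mul, inv_mul_cancel, map_one]
    have hhh : σ h' * σ h'⁻¹ = 1 := by rw [← map_mul, mul_inv_cancel, map_one]
    have hhh' : σ h'⁻¹ * σ h' = 1 := by rw [← map_mul, inv_mul_cancel, map_one]
    have aux : ∀ x : ℂ, x = z * x → x = 0 := by
      intro x hx
      have : (1 - z) * x = 0 := by linear_combination hx
      exact (mul_eq_zero.1 this).resolve_left (sub_ne_zero.2 hz.symm)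
    have t1 : trace ℂ V (σ h') = 0 := by
      apply aux
      calc trace ℂ V (σ h') = trace ℂ V (σ k⁻¹ * (σ k * σ h')) := by
            rw [← mul_assoc, hkk', one_mul]
        _ = z * trace ℂ V (σ h' * σ k * σ k⁻¹) := by
            rw [hk1, mul_smul_comm, map_smul, smul_eq_mul, LinearMap.trace_mul_comm]
        _ = _ := by rw [mul_assoc, hkk, mul_one]
    have hk2 : σ h'⁻¹ * σ k = z • (σ k * σ h'⁻¹) := by
      calc σ h'⁻¹ * σ k = σ h'⁻¹ * (σ k * σ h') * σ h'⁻¹ := by simp only [mul_assoc, hhh, mul_one]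
        _ = z • (σ k * σ h'⁻¹) := by
          rw [hk1, mul_smul_comm, smul_mul_assoc, ← mul_assoc, hhh', one_mul]
    have t2 : trace ℂ V (σ h'⁻¹) = 0 := by
      apply aux
      calc trace ℂ V (σ h'⁻¹) = trace ℂ V (σ h'⁻¹ * σ k * σ k⁻¹) := by
            rw [mul_assoc, hkk, mul_one]
        _ = z * trace ℂ V (σ k⁻¹ * (σ k * σ h'⁻¹)) := by
            rw [hk2, smul_mul_assoc, map_smul, smul_eq_mul, LinearMap.trace_mul_comm]
        _ = _ := by rw [← mul_assoc, hkk', one_mul]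
    have hd : σ d * σ d⁻¹ = 1 := by rw [← map_mul, mul_inv_cancel, map_one]
    rw [hdσ, smul_mul_assoc, one_mul] at hd
    have hd' : σ d⁻¹ = (ψF (formT S (toA h.1)) : ℂ)⁻¹ • (1 : End ℂ V) := by
      rw [← hd, smul_smul, inv_mul_cancel₀ (Circle.coe_ne_zero _), one_smul]
    constructor
    · rw [hdh, map_mul, hdσ, smul_mul_assoc, one_mul, map_smul, t1, smul_zero]
    · rw [hdh, mul_inv_rev, map_mul, hd', mul_smul_comm, mul_one, map_smul, t2, smul_zero]

end Setup

section FiniteAbelian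

variable {Q V : Type*} [CommGroup Q] [Finite Q] [AddCommGroup V] [Module ℂ V]
  [FiniteDimensional ℂ V]

/-- The eigenspace of a character in a representation. -/
def charEigenspace (τ : Representation ℂ Q V) (χ : AddChar (Additive Q) ℂ) : Submodule ℂ V where
  carrier := {v | ∀ x : Q, τ x v = χ (ofMul x) • v}
  zero_mem' := by simp
  add_mem' := by
    intro v w hv hw x
    rw [map_add, hv x, hw x, smul_add]
  smul_mem' := by
    intro a v hv x
    rw [map_smul, hv x, smul_comm]

/-- The trace of a representation of a finite abelian group in terms of its characters. -/
lemma trace_eq_sum_finrank (τ : Representation ℂ Q V) (g : Q) :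
    trace ℂ V (τ g) = ∑ χ : AddChar (Additive Q) ℂ,
      χ (ofMul g) * (finrank ℂ (charEigenspace τ χ) : ℂ) := by
  classical
  have := ofFinite Q
  set N : ℂ := (Fintype.card Q : ℂ) with hN
  have hN0 : N ≠ 0 := by rw [hN]; exact_mod_cast Fintype.card_ne_zero
  let P : AddChar (Additive Q) ℂ → End ℂ V := fun χ => N⁻¹ • ∑ x : Q, χ (-ofMul x) • τ x
  have hχ : ∀ (χ : AddChar (Additive Q) ℂ) (x : Q), χ (ofMul x) * χ (-ofMul x) = 1 := by
    intro χ x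
    rw [← map_add_eq_mul, add_neg_cancel, map_zero_eq_one]
  have hP : ∀ χ, LinearMap.IsProj (charEigenspace τ χ) (P χ) := by
    intro χ
    constructor
    · intro v x
      simp only [P, LinearMap.smul_apply, LinearMap.sum_apply, map_smul, map_sum]
      rw [smul_comm]
      congr 1
      rw [Finset.smul_sum, ← Equiv.sum_comp (Equiv.mulLeft x)
        (fun y => χ (ofMul x) • χ (-ofMul y) • τ y v)]
      refine sum_congr rfl fun y _ => ?_
      have h1 : -ofMul (x * y) = -ofMul x + -ofMul y := by rw [ofMul_mul, neg_add]
      change χ (-ofMul y) • τ x (τ y v) = χ (ofMul x) • χ (-ofMul (x * y)) • τ (x * y) v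
      rw [h1, map_add_eq_mul, ← mul_smul, ← mul_assoc, hχ, one_mul, map_mul]
      rfl
    · intro v hv
      simp only [P, LinearMap.smul_apply, LinearMap.sum_apply]
      have : ∀ x : Q, χ (-ofMul x) • τ x v = v := by
        intro x
        rw [hv x, ← mul_smul, mul_comm, hχ, one_smul]
      rw [sum_congr rfl fun x _ => this x, Finset.sum_const, Finset.card_univ,
        ← Nat.cast_smul_eq_nsmul ℂ, ← mul_smul, inv_mul_cancel₀ hN0, one_smul]
  have hsum : τ g = ∑ χ : AddChar (Additive Q) ℂ, χ (ofMul g) • P χ := by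
    simp only [P, smul_comm _ N⁻¹, ← Finset.smul_sum]
    simp only [Finset.smul_sum]
    rw [Finset.sum_comm]
    have : ∀ x : Q, ∑ χ : AddChar (Additive Q) ℂ,
        N⁻¹ • χ (ofMul g) • χ (-ofMul x) • τ x = if x = g then τ g else 0 := by
      intro x
      have h1 : ∀ χ : AddChar (Additive Q) ℂ, N⁻¹ • χ (ofMul g) • χ (-ofMul x) • τ x =
          χ (ofMul g - ofMul x) • (N⁻¹ • τ x) := by
        intro χ
        rw [sub_eq_add_neg, map_add_eq_mul, mul_smul, smul_comm N⁻¹, smul_comm N⁻¹]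
      rw [sum_congr rfl fun χ _ => h1 χ, ← Finset.sum_smul, AddChar.sum_apply_eq_ite]
      by_cases hxg : x = g
      · rw [if_pos (by rw [hxg, sub_self]), if_pos hxg, ← mul_smul, hxg]
        have : (Fintype.card (Additive Q) : ℂ) = N := by
          rw [hN]; exact congrArg _ (Fintype.card_congr Additive.toMul)
        rw [this, mul_inv_cancel₀ hN0, one_smul]
      · rw [if_neg, if_neg hxg, zero_smul]
        intro h
        exact hxg (ofMul.injective (sub_eq_zero.1 h)).symm
    rw [sum_congr rfl fun x _ => this x, Finset.sum_ite_eq' Finset.univ g]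
    simp
  rw [hsum, map_sum]
  refine sum_congr rfl fun χ _ => ?_
  rw [map_smul, smul_eq_mul, (hP χ).trace]

open Classical in
/-- The trace of the sum of the nontrivial characters. -/
lemma trace_eq_neg_one (τ : Representation ℂ Q V) (hfin : ∀ χ : AddChar (Additive Q) ℂ,
      (finrank ℂ (charEigenspace τ χ) : ℂ) = if χ = 0 then 0 else 1)
    {g : Q} (hg : g ≠ 1) : trace ℂ V (τ g) = -1 := by
  have := ofFinite Q
  have hsum := AddChar.sum_apply_eq_ite (ofMul g)
  have hg0 : ofMul g ≠ 0 := fun h0 => hg (ofMul.injective h0)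
  rw [if_neg hg0] at hsum
  rw [trace_eq_sum_finrank]
  rw [← Finset.add_sum_erase _ _ (mem_univ (0 : AddChar _ ℂ))] at hsum ⊢
  rw [AddChar.zero_apply] at hsum
  rw [hfin, if_pos rfl, mul_zero, zero_add]
  have h2 : ∀ χ ∈ Finset.univ.erase (0 : AddChar (Additive Q) ℂ),
      χ (ofMul g) * (finrank ℂ (charEigenspace τ χ) : ℂ) =
      χ (ofMul g) := by
    intro χ hχ
    rw [hfin, if_neg (Finset.ne_of_mem_erase hχ), mul_one]
  rw [sum_congr rfl h2]
  linear_combination hsum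

end FiniteAbelian

namespace Setup

variable [FiniteDimensional ℂ V]

/-- The subgroup of `𝒪_Eˣ` generated by `𝒪_Fˣ` and `1 + 𝔭_E`. -/
def scalarUnits : Subgroup (OE F E)ˣ where
  carrier := {u | ∃ a : 𝒪[F]ˣ, nrm nrE (((u : OE F E) : E) - algebraMap F E ((a : 𝒪[F]) : F)) < 1}
  one_mem' := ⟨1, by simp [D.quatE.nrm_zero]⟩
  mul_mem' := by
    rintro u v ⟨a, ha⟩ ⟨b, hb⟩
    refine ⟨a * b, ?_⟩
    have e : (((u * v : (OE F E)ˣ) : OE F E) : E) - algebraMap F E (((a * b : 𝒪[F]ˣ) : 𝒪[F]) : F) =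
        ((u : OE F E) : E) * (((v : OE F E) : E) - algebraMap F E ((b : 𝒪[F]) : F)) +
        (((u : OE F E) : E) - algebraMap F E ((a : 𝒪[F]) : F)) *
          algebraMap F E ((b : 𝒪[F]) : F) := by
      simp only [Units.val_mul, MulMemClass.coe_mul, map_mul]
      ring
    rw [e]
    refine (D.quatE.nrm_add_le _ _).trans_lt (max_lt ?_ ?_)
    · rw [D.quatE.nrm_mul, D.nrm_unit, one_mul]; exact hb
    · rw [D.quatE.nrm_mul, D.quatE.nrm_algebraMap]
      have : normF F ((b : 𝒪[F]) : F) ≤ 1 := normF_le_one.2 b.1.2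
      exact (mul_le_of_le_one_right (nrm_nonneg _ _) (pow_le_one₀ (normF_nonneg _) this)).trans_lt ha
  inv_mem' := by
    rintro u ⟨a, ha⟩
    refine ⟨a⁻¹, ?_⟩
    set x : E := ((u : OE F E) : E) with hx
    set y : E := (((u⁻¹ : (OE F E)ˣ) : OE F E) : E) with hy
    have hxy : x * y = 1 := by rw [hx, hy, ← MulMemClass.coe_mul, Units.mul_inv]; rfl
    set b : F := ((a : 𝒪[F]) : F) with hb
    set c : F := (((a⁻¹ : 𝒪[F]ˣ) : 𝒪[F]) : F) with hc
    have hbc : b * c = 1 := by rw [hb, hc, ← MulMemClass.coe_mul, Units.mul_inv]; rfl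
    have hbc' : algebraMap F E b * algebraMap F E c = 1 := by rw [← map_mul, hbc, map_one]
    have e : y - algebraMap F E c = -(y * algebraMap F E c) * (x - algebraMap F E b) := by
      linear_combination (algebraMap F E c) * hxy - y * hbc'
    rw [e, D.quatE.nrm_mul, D.quatE.nrm_neg, D.quatE.nrm_mul, D.nrm_unit, one_mul,
      D.quatE.nrm_algebraMap]
    have : normF F c ≤ 1 := normF_le_one.2 (a⁻¹).1.2
    exact (mul_le_of_le_one_left (nrm_nonneg _ _) (pow_le_one₀ (normF_nonneg _) this)).trans_lt ha

include D

lemma finite_quotient : Finite ((OE F E)ˣ ⧸ D.scalarUnits) := by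
  have hc : ∀ u : (OE F E)ˣ, ∃ a b : 𝒪[F], ((u : OE F E) : E) = ε(a, b, s) := by
    intro u
    obtain ⟨a, b, hab⟩ := D.chain.coords ((u : OE F E) : E)
    have h1 := D.nrm_unit u
    rw [hab] at h1
    obtain ⟨ha, hb⟩ := D.chain.coords_int h1.le
    exact ⟨⟨a, normF_le_one.1 ha⟩, ⟨b, normF_le_one.1 hb⟩, hab⟩
  choose a b hab using hc
  let f : ((OE F E)ˣ ⧸ D.scalarUnits) → 𝓀[F] × 𝓀[F] := fun q =>
    (residue _ (a q.out), residue _ (b q.out))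
  apply Finite.of_injective f
  intro q q' hqq
  obtain ⟨h1, h2⟩ := Prod.mk.injEq .. ▸ hqq
  rw [residue_eq_iff] at h1 h2
  rw [← Quotient.out_eq' q, ← Quotient.out_eq' q']
  apply QuotientGroup.eq.2
  refine ⟨1, ?_⟩
  set u := q.out
  set u' := q'.out
  have h3 : nrm nrE (((u' : OE F E) : E) - ((u : OE F E) : E)) < 1 := by
    have e : ((u' : OE F E) : E) - ((u : OE F E) : E) =
        -(algebraMap F E ((a u : F) - a u') + algebraMap F E ((b u : F) - b u') * s) := by
      rw [hab u, hab u', map_sub, map_sub]; ring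
    rw [e, D.quatE.nrm_neg]
    refine (D.quatE.nrm_add_le _ _).trans_lt (max_lt ?_ ?_)
    · rw [D.quatE.nrm_algebraMap]; exact pow_lt_one₀ (normF_nonneg _) h1 two_ne_zero
    · rw [D.quatE.nrm_mul, D.quatE.nrm_algebraMap]
      exact (mul_le_of_le_one_right (sq_nonneg _) D.chain.s_le).trans_lt
        (pow_lt_one₀ (normF_nonneg _) h2 two_ne_zero)
  have e : (((u⁻¹ * u' : (OE F E)ˣ) : OE F E) : E) - algebraMap F E (((1 : 𝒪[F]ˣ) : 𝒪[F]) : F) =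
      (((u⁻¹ : (OE F E)ˣ) : OE F E) : E) * (((u' : OE F E) : E) - ((u : OE F E) : E)) := by
    have h4 : (((u⁻¹ : (OE F E)ˣ) : OE F E) : E) * ((u : OE F E) : E) = 1 := by
      rw [← MulMemClass.coe_mul, inv_mul]; rfl
    rw [mul_sub, h4]
    push_cast
    rfl
  rw [e, D.quatE.nrm_mul, D.nrm_unit, one_mul]
  exact h3

lemma toA_diagO (u : (OE F E)ˣ) :
    toA (S.diagO u) = (S.ι₁ ((u : OE F E) : E), S.ι₂ ((u : OE F E) : E)) := rfl

lemma diagO_mem (u : (OE F E)ˣ) : S.diagO u ∈ 𝓛 := by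
  rw [D.mem_linkingUnits_iff]
  refine ⟨D.diag_mem_cell (by rw [pow_zero]; exact (D.nrm_unit u).le), ?_⟩
  change nrm nrE (p₁ (S.ι₁ ((u : OE F E) : E))) = 1
  rw [D.side₁.pr_ι, D.nrm_unit]

/-- The trace of `σ` on regular elements of the torus. -/
lemma trace_diagO (hσ : S.IsRhoS ψF σ) (hu : Unramified F E) {u : (OE F E)ˣ}
    (h : u ∉ D.scalarUnits) (hm : S.diagO u ∈ 𝓛) :
    trace ℂ V (σ ⟨S.diagO u, hm⟩) = -1 := by
  have := D.finite_quotient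
  let j : (OE F E)ˣ →* 𝓛 := S.diagO.codRestrict 𝓛 D.diagO_mem
  have hone : ∀ u : (OE F E)ˣ, nrm nrE (((u : OE F E) : E) - 1) < 1 → σ (j u) = 1 := by
    intro u hu1
    apply hσ.inflated
    rw [D.linkingIdeal_eq]
    have e : toA ((j u : 𝓛) : GG F B) - 1 =
        (S.ι₁ (((u : OE F E) : E) - 1), S.ι₂ (((u : OE F E) : E) - 1)) := by
      rw [map_sub, map_sub, map_one, map_one]; rfl
    rw [e]
    exact D.diag_mem_cell (by rw [pow_one]; exact D.chain.gen _ hu1)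
  have hker : D.scalarUnits ≤ (σ.comp j).ker := by
    rintro u ⟨a, ha⟩
    set a' : (OE F E)ˣ := Units.map (algebraMap 𝒪[F] (OE F E) : 𝒪[F] →* OE F E) a with ha'
    have h1 : σ (j a') = 1 := hσ.trivial_k (j a') a rfl
    have h2 : σ (j (a'⁻¹ * u)) = 1 := by
      apply hone
      have h4 : (((a'⁻¹ : (OE F E)ˣ) : OE F E) : E) * ((a' : OE F E) : E) = 1 := by
        rw [← MulMemClass.coe_mul, inv_mul]; rfl
      have h5 : ((a' : OE F E) : E) = algebraMap F E ((a : 𝒪[F]) : F) := rfl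
      have e : (((a'⁻¹ * u : (OE F E)ˣ) : OE F E) : E) - 1 =
          (((a'⁻¹ : (OE F E)ˣ) : OE F E) : E) *
            (((u : OE F E) : E) - algebraMap F E ((a : 𝒪[F]) : F)) := by
        rw [mul_sub, ← h5, h4]; rfl
      rw [e, D.quatE.nrm_mul, D.nrm_unit, one_mul]
      exact ha
    rw [MonoidHom.mem_ker]
    change σ (j u) = 1
    rw [← mul_inv_cancel_left a' u, map_mul, map_mul, h1, h2, one_mul]
  let τ : Representation ℂ ((OE F E)ˣ ⧸ D.scalarUnits) V := QuotientGroup.lift _ (σ.comp j) hker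
  have hτ : ∀ u : (OE F E)ˣ, τ (u : (OE F E)ˣ ⧸ D.scalarUnits) = σ (j u) := fun u => rfl
  have hfin : ∀ χ : AddChar (Additive ((OE F E)ˣ ⧸ D.scalarUnits)) ℂ,
      (finrank ℂ (charEigenspace (Q := (OE F E)ˣ ⧸ D.scalarUnits) τ χ) : ℂ) = if χ = 0 then 0 else 1 := by
    intro χ
    let χ' : (OE F E)ˣ →* ℂˣ := (χ.toMonoidHom.comp (MonoidHom.mk' (fun u : (OE F E)ˣ =>
        Multiplicative.ofAdd (ofMul (u : (OE F E)ˣ ⧸ D.scalarUnits)))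
        (fun _ _ => rfl))).toHomUnits
    have hχ' : ∀ u : (OE F E)ˣ, (χ' u : ℂ) =
        χ (ofMul (u : (OE F E)ˣ ⧸ D.scalarUnits)) := fun u => rfl
    have hN : ∀ u ∈ D.scalarUnits, χ' u = 1 := by
      intro u hu
      apply Units.ext
      rw [hχ', (QuotientGroup.eq_one_iff u).2 hu, ofMul_one, map_zero_eq_one, Units.val_one]
    have heig : charEigenspace (Q := (OE F E)ˣ ⧸ D.scalarUnits) τ χ = S.torusEigenspace σ χ' := by
      ext v
      constructor
      · intro hv u g hg
        have hgj : g = j u := Subtype.ext hg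
        have := hv (u : (OE F E)ˣ ⧸ D.scalarUnits)
        rw [hτ] at this
        rw [hgj, this, hχ']
      · intro hv x
        induction x using QuotientGroup.induction_on with
        | H u =>
          rw [hτ, ← hχ']
          exact hv u (j u) rfl
    have h1 : χ' = 1 ↔ χ = 0 := by
      constructor
      · intro h2
        apply AddChar.ext
        intro x
        obtain ⟨u, rfl⟩ := QuotientGroup.mk_surjective (Additive.toMul x)
        have h3 := hχ' u
        rw [h2] at h3
        exact h3.symm
      · intro h2
        ext u
        rw [hχ', h2]; rfl
    rw [heig, hσ.torus hu χ' ?_ ?_]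
    · by_cases h2 : χ = 0
      · rw [if_pos (h1.2 h2), if_pos h2, Nat.cast_zero]
      · rw [if_neg (fun h3 => h2 (h1.1 h3)), if_neg h2, Nat.cast_one]
    · intro u hu
      apply hN
      refine ⟨1, ?_⟩
      have := D.mem_maxE.1 hu
      simpa using this
    · intro a
      apply hN
      refine ⟨a, ?_⟩
      change nrm nrE (algebraMap F E ((a : 𝒪[F]) : F) - algebraMap F E ((a : 𝒪[F]) : F)) < 1
      rw [sub_self, D.quatE.nrm_zero]; exact zero_lt_one
  have e : σ ⟨S.diagO u, hm⟩ = τ (u : (OE F E)ˣ ⧸ D.scalarUnits) := rfl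
  rw [e]
  exact trace_eq_neg_one (Q := (OE F E)ˣ ⧸ D.scalarUnits) τ hfin
    (fun h0 => h ((QuotientGroup.eq_one_iff u).1 h0))

/-- The traces of `ρ` at `α` and its inverse are equal and negative. -/
lemma trace_diag_α [Nontrivial V] (hσ : S.IsRhoS ψF σ) {ω : Fˣ →* ℂˣ}
    {ρ : Representation ℂ S.K V} (hρ : S.IsRhoExt ω σ ρ) (hα : HasOrd F S.α (-S.n))
    (k : S.K) (a : Eˣ) (ha : (a : E) = S.α) (hk : k.1 = S.diag a) :
    ∃ r : ℝ, 0 < r ∧ trace ℂ V (ρ k) = -r ∧ trace ℂ V (ρ k⁻¹) = -r := by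
  rcases D.cases with ⟨-, hu, ht⟩ | ⟨-, hu, -, hodd⟩
  · refine ⟨1, one_pos, ?_⟩
    obtain ⟨m, hm, -, hm'⟩ := D.s_eq
    obtain ⟨u, hus⟩ := D.exists_unit_OE (D.chain.nrm_s ht)
    have hns : u ∉ D.scalarUnits := by
      rintro ⟨a, ha⟩
      have := D.chain.le_right (-((a : 𝒪[F]) : F)) 1
      rw [map_one, one_mul, D.chain.nrm_s ht, map_neg, neg_add_eq_sub, ← hus] at this
      exact this.not_gt ha
    have hns' : u⁻¹ ∉ D.scalarUnits := fun h => hns (by simpa using D.scalarUnits.inv_mem h)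
    have hϖ0 : (ϖ : F) ^ m ≠ 0 := pow_ne_zero _ (uniformizer_ne_zero D.chain.irr)
    let z : Fˣ × Fˣ := (mk0 _ hϖ0, mk0 _ hϖ0)
    have hzk : centerHom F B z ∈ S.K :=
      (le_sup_left.trans le_sup_left : (centerHom F B).range ≤ S.K) ⟨z, rfl⟩
    have hz : ρ ⟨_, hzk⟩ = 1 := by
      rw [hρ.central ⟨_, hzk⟩ z rfl]
      have : z.1 * z.2⁻¹ = 1 := mul_inv_cancel _
      rw [this, map_one, Units.val_one, one_smul]
    have e : (⟨_, hzk⟩ : S.K) * k = inclusion S.linkingUnits_le_K ⟨S.diagO u, D.diagO_mem u⟩ := by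
      apply Subtype.ext
      apply toA_injective
      change toA (centerHom F B z * k.1) = toA (S.diagO u)
      rw [hk, toA_mul, D.toA_diagO, hus, hm]
      ext1
      · change algebraMap F (M2 F) ((ϖ : F) ^ m) * S.ι₁ (a : E) = _
        rw [ha, ← smul_def, map_smul]
      · change algebraMap F B ((ϖ : F) ^ m) * S.ι₂ (a : E) = _
        rw [ha, ← smul_def, ← map_smul]
    have h1 : ρ k = σ ⟨S.diagO u, D.diagO_mem u⟩ := by
      rw [← hρ.extends_σ, ← e, map_mul, hz, one_mul]
    have h2 : ρ k⁻¹ = σ ⟨S.diagO u⁻¹, D.diagO_mem u⁻¹⟩ := by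
      rw [← hρ.extends_σ]
      have h3 : (inclusion S.linkingUnits_le_K ⟨S.diagO u⁻¹, D.diagO_mem u⁻¹⟩) =
          k⁻¹ * (⟨_, hzk⟩ : S.K)⁻¹ := by
        rw [← mul_inv_rev, e]
        apply Subtype.ext
        exact map_inv S.diagO u
      have h4 : ρ (⟨_, hzk⟩ : S.K)⁻¹ = 1 := by
        have := congrArg (· * ρ (⟨_, hzk⟩ : S.K)⁻¹) hz
        simp only [← map_mul, mul_inv_cancel, map_one, one_mul] at this
        exact this.symm
      rw [h3, map_mul, h4, mul_one]
    rw [h1, h2, D.trace_diagO hσ hu hns, D.trace_diagO hσ hu hns']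
    simp
  · refine ⟨finrank ℂ V, by exact_mod_cast Module.finrank_pos, ?_⟩
    have h1 : ρ k = (-1 : ℂ) • (1 : End ℂ V) := by
      rw [hρ.sign hu k a (-S.n) hk (by rw [ha]; exact hα), zpow_neg, zpow_natCast, hodd.neg_one_pow]
      norm_num
    have h2 : ρ k⁻¹ = (-1 : ℂ) • (1 : End ℂ V) := by
      have h3 : ρ k⁻¹ * ρ k = 1 := by rw [← map_mul, inv_mul_cancel, map_one]
      rw [h1, mul_smul_comm, mul_one] at h3
      rw [← h3, smul_smul]; norm_num
    rw [h1, h2]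
    simp

end Setup

variable [TopologicalSpace B] [IsTopologicalRing B] [IsModuleTopology F B] [FiniteDimensional F B]

section Size

lemma exists_zpow_iff {r : ℝ} (hr : 0 < r) :
    ∃ m : ℤ, ∀ x : F, normF F x ≤ r ↔ normF F x ≤ resCard F ^ m := by
  have hq := one_lt_resCard F
  obtain ⟨m, hm, hm'⟩ := exists_mem_Ico_zpow hr hq
  refine ⟨m, fun x => ⟨fun h => ?_, fun h => h.trans hm⟩⟩
  by_cases hx : x = 0
  · rw [hx, normF_eq_zero.2 rfl]; positivity
  · rw [normF_of_ne hx] at h ⊢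
    have := (zpow_lt_zpow_iff_right₀ hq).1 (h.trans_lt hm')
    exact zpow_le_zpow_right₀ hq.le (by omega)

lemma isOpen_normF_le' {r : ℝ} (hr : 0 < r) : IsOpen {x : F | normF F x ≤ r} := by
  obtain ⟨m, hm⟩ := exists_zpow_iff (F := F) hr
  simpa only [hm] using isOpen_normF_le (F := F) m

lemma isCompact_normF_le' {r : ℝ} (hr : 0 < r) : IsCompact {x : F | normF F x ≤ r} := by
  obtain ⟨m, hm⟩ := exists_zpow_iff (F := F) hr
  simpa only [hm] using isCompact_normF_le (F := F) m

/-- The maximum norm of the entries of a matrix, squared. -/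
noncomputable def size₁ (x : M2 F) : ℝ :=
  (max (max (normF F (x 0 0)) (normF F (x 0 1))) (max (normF F (x 1 0)) (normF F (x 1 1)))) ^ 2

lemma size₁_nonneg (x : M2 F) : 0 ≤ size₁ x := sq_nonneg _

lemma size₁_le_sq {x : M2 F} {r : ℝ} (hr : 0 ≤ r) :
    size₁ x ≤ r ^ 2 ↔ ∀ i j, normF F (x i j) ≤ r := by
  rw [size₁, sq_le_sq₀ (by simp [normF_nonneg]) hr]
  simp [Fin.forall_fin_two, and_assoc]

lemma size₁_le {x : M2 F} {r : ℝ} (hr : 0 ≤ r) : size₁ x ≤ r ↔ ∀ i j, normF F (x i j) ^ 2 ≤ r := by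
  have := size₁_le_sq (x := x) (Real.sqrt_nonneg r)
  rw [Real.sq_sqrt hr] at this
  rw [this]
  exact forall₂_congr fun i j => Real.le_sqrt (normF_nonneg _) hr

lemma sq_le_size₁ (x : M2 F) (i j : Fin 2) : normF F (x i j) ^ 2 ≤ size₁ x :=
  (size₁_le (size₁_nonneg x)).1 le_rfl i j

lemma size₁_add_le (x y : M2 F) : size₁ (x + y) ≤ max (size₁ x) (size₁ y) := by
  rw [size₁_le (le_max_of_le_left (size₁_nonneg x))]
  intro i j
  have h := normF_add_le (x i j) (y i j)
  have h1 := sq_le_size₁ x i j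
  have h2 := sq_le_size₁ y i j
  rcases le_max_iff.1 h with h | h
  · exact (pow_le_pow_left₀ (normF_nonneg _) h 2).trans (h1.trans (le_max_left _ _))
  · exact (pow_le_pow_left₀ (normF_nonneg _) h 2).trans (h2.trans (le_max_right _ _))

lemma size₁_smul (r : F) (x : M2 F) : size₁ (r • x) = normF F r ^ 2 * size₁ x := by
  simp only [size₁, Matrix.smul_apply, smul_eq_mul, normF_mul]
  rw [← mul_max_of_nonneg _ _ (normF_nonneg _), ← mul_max_of_nonneg _ _ (normF_nonneg _),
    ← mul_max_of_nonneg _ _ (normF_nonneg _), mul_pow]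

lemma size₁_neg (x : M2 F) : size₁ (-x) = size₁ x := by simp [size₁, normF_neg]

lemma size₁_mul_le (x y : M2 F) : size₁ (x * y) ≤ size₁ x * size₁ y := by
  rw [size₁_le (mul_nonneg (size₁_nonneg x) (size₁_nonneg y))]
  intro i j
  rw [Matrix.mul_apply, Fin.sum_univ_two]
  have h : ∀ l, normF F (x i l * y l j) ^ 2 ≤ size₁ x * size₁ y := by
    intro l
    rw [normF_mul, mul_pow]
    exact mul_le_mul (sq_le_size₁ _ _ _) (sq_le_size₁ _ _ _) (sq_nonneg _) (size₁_nonneg _)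
  rcases le_max_iff.1 (normF_add_le (x i 0 * y 0 j) (x i 1 * y 1 j)) with h1 | h1
  · exact (pow_le_pow_left₀ (normF_nonneg _) h1 2).trans (h 0)
  · exact (pow_le_pow_left₀ (normF_nonneg _) h1 2).trans (h 1)

lemma size₁_one : size₁ (1 : M2 F) = 1 := by simp [size₁, normF_one, normF_eq_zero.2]

lemma size₁_zero : size₁ (0 : M2 F) = 0 := by simp [size₁, normF_eq_zero.2]

lemma normF_trace_sq_le (x : M2 F) : normF F x.trace ^ 2 ≤ size₁ x := by
  rw [trace_fin_two]
  rcases le_max_iff.1 (normF_add_le (x 0 0) (x 1 1)) with h1 | h1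
  · exact (pow_le_pow_left₀ (normF_nonneg _) h1 2).trans (sq_le_size₁ _ _ _)
  · exact (pow_le_pow_left₀ (normF_nonneg _) h1 2).trans (sq_le_size₁ _ _ _)

lemma size₁_inv (x : M2 F) : size₁ x⁻¹ = size₁ x / normF F x.det ^ 2 := by
  rw [Matrix.inv_def, size₁_smul, Ring.inverse_eq_inv', normF_inv]
  have : size₁ x.adjugate = size₁ x := by
    rw [Matrix.adjugate_fin_two]
    simp only [size₁, of_apply, Matrix.cons_val, normF_neg]
    congr 1
    rw [max_comm (max (normF F (x 1 1)) _), max_comm (normF F (x 1 0)), max_comm (normF F (x 0 0)),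
      max_assoc, max_max_max_comm]
    ac_rfl
  rw [this]; ring

lemma isOpen_size₁_le {r : ℝ} (hr : 0 < r) : IsOpen {x : M2 F | size₁ x ≤ r} := by
  have : {x : M2 F | size₁ x ≤ r} = ⋂ i, ⋂ j, (fun x : M2 F => x i j) ⁻¹'
      {x : F | normF F x ≤ Real.sqrt r} := by
    ext x
    simp only [Set.mem_iInter]
    exact (size₁_le hr.le).trans
      (forall₂_congr fun i j => (Real.le_sqrt (normF_nonneg _) hr.le).symm)
  rw [this]
  refine isOpen_iInter_of_finite fun i => isOpen_iInter_of_finite fun j => ?_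
  exact (isOpen_normF_le' (Real.sqrt_pos.2 hr)).preimage
    ((continuous_apply j).comp (continuous_apply i))

lemma isCompact_size₁_le {r : ℝ} (hr : 0 < r) : IsCompact {x : M2 F | size₁ x ≤ r} := by
  have : {x : M2 F | size₁ x ≤ r} = Set.univ.pi fun _ => Set.univ.pi fun _ =>
      {x : F | normF F x ≤ Real.sqrt r} := by
    ext x
    refine (size₁_le hr.le).trans ⟨fun h i _ j _ => ?_, fun h i j => ?_⟩
    · exact (Real.le_sqrt (normF_nonneg _) hr.le).2 (h i j)
    · exact (Real.le_sqrt (normF_nonneg _) hr.le).1 (h i trivial j trivial)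
  rw [this]
  exact isCompact_univ_pi fun _ => isCompact_univ_pi fun _ =>
    isCompact_normF_le' (Real.sqrt_pos.2 hr)

lemma exists_normF_le_subset' {U : Set F} (hU : U ∈ nhds (0 : F)) :
    ∃ r > 0, {x : F | normF F x ≤ r} ⊆ U := by
  obtain ⟨m, hm⟩ := exists_normF_le_subset hU
  exact ⟨_, inv_pos.2 (pow_pos (resCard_pos F) m), hm⟩

lemma exists_pi_subset {κ : Type*} [Finite κ] {U : Set (κ → F)} (hU : U ∈ nhds (0 : κ → F)) :
    ∃ r > 0, {x : κ → F | ∀ i, normF F (x i) ≤ r} ⊆ U := by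
  have := ofFinite κ
  rw [nhds_pi, Filter.mem_pi'] at hU
  obtain ⟨I, t, ht, hsub⟩ := hU
  choose r hr hrt using fun i => exists_normF_le_subset' (ht i)
  obtain ⟨R, hR, hRr⟩ : ∃ R > 0, ∀ i, R ≤ r i := by
    by_cases hne : Nonempty κ
    · obtain ⟨i, hi⟩ := Finite.exists_min r
      exact ⟨r i, hr i, hi⟩
    · exact ⟨1, one_pos, fun i => (hne ⟨i⟩).elim⟩
  exact ⟨R, hR, fun x hx => hsub fun i _ => hrt i ((hx i).trans (hRr i))⟩

lemma exists_size₁_subset {U : Set (M2 F)} (hU : U ∈ nhds (0 : M2 F)) :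
    ∃ r > 0, {x : M2 F | size₁ x ≤ r} ⊆ U := by
  let e : (Fin 2 × Fin 2 → F) → M2 F := fun f i j => f (i, j)
  have he : Continuous e := by fun_prop
  obtain ⟨r, hr, h⟩ := exists_pi_subset (he.continuousAt.preimage_mem_nhds (x := 0) hU)
  refine ⟨r ^ 2, by positivity, fun x hx => ?_⟩
  have hx' := (size₁_le_sq hr.le).1 hx
  exact h (a := fun p => x p.1 p.2) fun p => hx' p.1 p.2

section Quaternion

variable (hQ : IsQuat (F := F) (A := B) redTrace redNorm) (hT : ∃ b : B, redTrace (F := F) b ≠ 0)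
include hQ hT

lemma exists_coordinates : ∃ (κ : Type) (_ : Fintype κ) (e : B ≃L[F] (κ → F)) (C : ℝ), 0 < C ∧
    (∀ b i, normF F (e b i) ^ 2 ≤ C * nrmB b) ∧
    ∀ (r : ℝ) b, 0 ≤ r → (∀ i, normF F (e b i) ≤ r) → nrmB b ≤ C * r ^ 2 := by
  let T : LinearMap.BilinForm F B := LinearMap.mk₂ F (fun x y => redTrace (x * y))
    (fun x y z => by rw [add_mul, hQ.tr_add]) (fun a x y => by rw [smul_mul_assoc, hQ.tr_smul]; rfl)
    (fun x y z => by rw [mul_add, hQ.tr_add]) (fun a x y => by rw [mul_smul_comm, hQ.tr_smul]; rfl)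
  have hTn : T.Nondegenerate := by
    obtain ⟨b, hb⟩ := hT
    constructor
    · intro x hx
      by_contra h0
      apply hb
      have := hx (x⁻¹ * b)
      change redTrace (x * (x⁻¹ * b)) = 0 at this
      rwa [mul_inv_cancel_left₀ h0] at this
    · intro x hx
      by_contra h0
      apply hb
      have := hx (b * x⁻¹)
      change redTrace (b * x⁻¹ * x) = 0 at this
      rwa [inv_mul_cancel_right₀ h0] at this
  let b := Module.finBasis F B
  let b' := T.dualBasis hTn b
  let e₀ : B ≃ₗ[F] (Fin (finrank F B) → F) := b'.equivFun
  let e : B ≃L[F] (Fin (finrank F B) → F) :=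
    { e₀ with
      continuous_toFun := IsModuleTopology.continuous_of_linearMap e₀.toLinearMap
      continuous_invFun := IsModuleTopology.continuous_of_linearMap e₀.symm.toLinearMap }
  have he : ∀ x i, e x i = redTrace (x * b i) := by
    intro x i
    exact LinearMap.BilinForm.dualBasis_repr_apply hTn b x i
  have hsum : ∀ x, x = ∑ i, e x i • b' i := fun x => (b'.sum_equivFun x).symm
  let C : ℝ := 1 + ∑ i, nrmB (b i) + ∑ i, nrmB (b' i)
  have h1 : ∀ i, nrmB (b i) ≤ ∑ i, nrmB (b i) := fun i =>
    Finset.single_le_sum (fun i _ => nrm_nonneg _ (b i)) (mem_univ i)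
  have h2 : ∀ i, nrmB (b' i) ≤ ∑ i, nrmB (b' i) := fun i =>
    Finset.single_le_sum (fun i _ => nrm_nonneg _ (b' i)) (mem_univ i)
  have h3 : 0 ≤ ∑ i, nrmB (b i) := Finset.sum_nonneg fun i _ => nrm_nonneg _ _
  have h4 : 0 ≤ ∑ i, nrmB (b' i) := Finset.sum_nonneg fun i _ => nrm_nonneg _ _
  refine ⟨_, inferInstance, e, C, by positivity, fun x i => ?_, fun r x hr hx => ?_⟩
  · rw [he]
    refine (hQ.norm_tr_sq_le _).trans ?_
    rw [hQ.nrm_mul, mul_comm]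
    exact mul_le_mul_of_nonneg_right (by have := h1 i; simp only [C]; linarith) (nrm_nonneg _ _)
  · rw [hsum x]
    refine hQ.nrm_sum_le _ _ (by positivity) fun i _ => ?_
    rw [smul_def, hQ.nrm_mul, hQ.nrm_algebraMap, mul_comm]
    exact mul_le_mul (by have := h2 i; simp only [C]; linarith)
      (pow_le_pow_left₀ (normF_nonneg _) (hx i) 2) (sq_nonneg _) (by positivity)

lemma isOpen_nrm_le {r : ℝ} (hr : 0 < r) : IsOpen {b : B | nrmB b ≤ r} := by
  obtain ⟨κ, _, e, C, hC, -, h2⟩ := exists_coordinates hQ hT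
  let G : AddSubgroup B :=
    { carrier := {b : B | nrmB b ≤ r}
      add_mem' := fun ha hb => hQ.nrm_add_le_of ha hb
      zero_mem' := by change nrm _ _ ≤ r; rw [hQ.nrm_zero]; exact hr.le
      neg_mem' := fun {a} ha => by change nrm _ _ ≤ r; rw [hQ.nrm_neg]; exact ha }
  apply AddSubgroup.isOpen_of_mem_nhds G (g := 0)
  have hU : {x : κ → F | ∀ i, normF F (x i) ≤ Real.sqrt (r / C)} ∈ nhds (0 : κ → F) := by
    refine IsOpen.mem_nhds ?_ fun i => ?_
    · rw [Set.ofPred_forall]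
      exact isOpen_iInter_of_finite fun i => (isOpen_normF_le' (Real.sqrt_pos.2 (by positivity))
        ).preimage (continuous_apply i)
    · rw [Pi.zero_apply, normF_eq_zero.2 rfl]; positivity
  have hV := e.continuous.continuousAt.preimage_mem_nhds (x := 0) (by rw [map_zero]; exact hU)
  refine mem_of_superset hV fun b hb => ?_
  have := h2 _ b (Real.sqrt_nonneg _) hb
  rw [Real.sq_sqrt (by positivity)] at this
  change nrm _ b ≤ r
  rwa [mul_div_cancel₀ _ hC.ne'] at this

lemma exists_nrm_subset {U : Set B} (hU : U ∈ nhds (0 : B)) :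
    ∃ r > 0, {b : B | nrmB b ≤ r} ⊆ U := by
  obtain ⟨κ, _, e, C, hC, h1, -⟩ := exists_coordinates hQ hT
  obtain ⟨r, hr, h⟩ := exists_pi_subset (e.symm.continuous.continuousAt.preimage_mem_nhds (x := 0)
    (by rw [map_zero]; exact hU))
  refine ⟨r ^ 2 / C, by positivity, fun b hb => ?_⟩
  have : e b ∈ {x : κ → F | ∀ i, normF F (x i) ≤ r} := fun i => by
    have h3 := (h1 b i).trans (mul_le_mul_of_nonneg_left hb hC.le)
    rw [mul_div_cancel₀ _ hC.ne'] at h3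
    exact (pow_le_pow_iff_left₀ (normF_nonneg _) hr.le two_ne_zero).1 h3
  have := h this
  rwa [Set.mem_preimage, e.symm_apply_apply] at this

lemma isCompact_nrm_le {r : ℝ} (hr : 0 < r) : IsCompact {b : B | nrmB b ≤ r} := by
  obtain ⟨κ, _, e, C, hC, h1, -⟩ := exists_coordinates hQ hT
  have hK : IsCompact (e.symm '' Set.univ.pi fun _ => {x : F | normF F x ≤ Real.sqrt (C * r)}) :=
    (isCompact_univ_pi fun _ => isCompact_normF_le' (Real.sqrt_pos.2 (by positivity))).image
      e.symm.continuous
  let G : AddSubgroup B :=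
    { carrier := {b : B | nrmB b ≤ r}
      add_mem' := fun ha hb => hQ.nrm_add_le_of ha hb
      zero_mem' := by change nrm _ _ ≤ r; rw [hQ.nrm_zero]; exact hr.le
      neg_mem' := fun {a} ha => by change nrm _ _ ≤ r; rw [hQ.nrm_neg]; exact ha }
  refine hK.of_isClosed_subset (AddSubgroup.isClosed_of_isOpen G (isOpen_nrm_le hQ hT hr)) ?_
  intro b hb
  refine ⟨e b, fun i _ => ?_, e.symm_apply_apply b⟩
  exact (Real.le_sqrt (normF_nonneg _) (by positivity)).2 ((h1 b i).trans (mul_le_mul_of_nonneg_left hb hC.le))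

lemma continuous_redTrace [IsModuleTopology F B] : Continuous (redTrace (F := F) (B := B)) := by
  let T : B →ₗ[F] F :=
    { toFun := redTrace
      map_add' := hQ.tr_add
      map_smul' := fun a x => by rw [hQ.tr_smul]; rfl }
  exact IsModuleTopology.continuous_of_linearMap T

end Quaternion

end Size

section Homs

/-- A `2 × 2` matrix is conjugate to its adjugate by an involution. -/
lemma exists_involution_mul (u : M2 F) :
    ∃ v : M2 F, v * v = 1 ∧ u * (v * u * v) = algebraMap F (M2 F) u.det := by
  obtain ⟨v, h⟩ : ∃ v : M2 F, (v = !![1, 0; (u 1 1 - u 0 0) / u 0 1, -1] ∧ u 0 1 ≠ 0) ∨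
      (v = !![1, (u 1 1 - u 0 0) / u 1 0; 0, -1] ∧ u 0 1 = 0 ∧ u 1 0 ≠ 0) ∨
      (v = !![0, 1; 1, 0] ∧ u 0 1 = 0 ∧ u 1 0 = 0) := by
    by_cases h : u 0 1 = 0
    · by_cases h' : u 1 0 = 0
      · exact ⟨_, .inr (.inr ⟨rfl, h, h'⟩)⟩
      · exact ⟨_, .inr (.inl ⟨rfl, h, h'⟩)⟩
    · exact ⟨_, .inl ⟨rfl, h⟩⟩
  refine ⟨v, ?_⟩
  rw [Matrix.eta_fin_two u, Matrix.algebraMap_eq_diagonal, Matrix.det_fin_two_of]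
  rcases h with ⟨rfl, h⟩ | ⟨rfl, h, h'⟩ | ⟨rfl, h, h'⟩ <;> constructor <;> ext a b <;>
    fin_cases a <;> fin_cases b <;> simp [*] <;> field_simp <;> ring_nf <;> simp

/-- A positive character of `𝐆` that is trivial on some integral elements and on the uniformizers
of the centre is trivial. -/
lemma eq_one_of_hom (hQ : IsQuat (F := F) (A := B) redTrace redNorm) (θ : GG F B →* ℝ)
    (hpos : ∀ g, 0 < θ g)
    (hint : ∀ (u : Fˣ) (b : Bˣ), normF F (u : F) = 1 → nrmB (b : B) = 1 →
      θ (Units.map (algebraMap F (M2 F) : F →* M2 F) u, b) = 1)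
    {ϖ : Fˣ} (hϖ : normF F (ϖ : F) = (resCard F)⁻¹)
    (h₁ : θ (centerHom F B (ϖ, 1)) = 1)
    (h₂ : θ (centerHom F B (1, ϖ)) = 1) (g : GG F B) : θ g = 1 := by
  have hsq : ∀ g, θ g * θ g = 1 → θ g = 1 := fun g h => by nlinarith [hpos g]
  have hscal : ∀ a : Fˣ, ∃ (k : ℤ) (u : Fˣ), normF F (u : F) = 1 ∧ a = ϖ ^ k * u := by
    intro a
    refine ⟨-logF (a : F), ϖ ^ logF (a : F) * a, ?_, by simp⟩
    push_cast
    rw [normF_mul, normF_zpow, hϖ, normF_of_ne a.ne_zero, inv_zpow,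
      inv_mul_cancel₀ (zpow_pos (resCard_pos F) _).ne']
  have hc : ∀ z, θ (centerHom F B z) = 1 := by
    rintro ⟨a, b⟩
    obtain ⟨k, u, hu, rfl⟩ := hscal a
    obtain ⟨l, v, hv, rfl⟩ := hscal b
    have e : (ϖ ^ k * u, ϖ ^ l * v) = (ϖ, 1) ^ k * (1, ϖ) ^ l * (u, v) := by ext <;> simp
    simp only [e, map_mul, map_zpow, h₁, h₂, one_zpow, one_mul]
    exact hint u _ hu ((hQ.nrm_algebraMap (v : F)).trans (by rw [hv, one_pow]))
  have hM : ∀ u : (M2 F)ˣ, θ (u, 1) = 1 := by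
    intro u
    obtain ⟨v, hv, h⟩ := exists_involution_mul (u : M2 F)
    let w : (M2 F)ˣ := ⟨v, v, hv, hv⟩
    have hw : θ (w, 1) = 1 := hsq _ (by
      rw [← map_mul, ← map_one θ]; congr 1; exact Prod.ext (Units.ext hv) (one_mul 1))
    let d : Fˣ := mk0 _ ((isUnit_iff_isUnit_det _).1 u.isUnit).ne_zero
    have h2 := hc (d, 1)
    rw [show centerHom F B (d, 1) = (u, 1) * ((w, 1) * (u, 1) * (w, 1)) from
      Prod.ext (Units.ext h.symm) (by change Units.map _ 1 = _; simp)] at h2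
    simp only [map_mul, hw, one_mul, mul_one] at h2
    exact hsq _ h2
  have hBB : ∀ b : Bˣ, θ (1, b) = 1 := by
    intro b
    have hN : redNorm (F := F) (b : B) ≠ 0 := hQ.nr_ne_zero b.ne_zero
    let a : Fˣ := mk0 _ hN
    have h := hint 1 (b * b * Units.map (algebraMap F B : F →* B) a⁻¹) normF_one ?_
    · rw [show (Units.map (algebraMap F (M2 F) : F →* M2 F) 1,
        b * b * Units.map (algebraMap F B : F →* B) a⁻¹) =
        (1, b) * (1, b) * centerHom F B (1, a⁻¹) from
        Prod.ext (by simp [centerHom]) rfl,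
        map_mul, hc, mul_one, map_mul] at h
      exact hsq _ h
    · change nrm redNorm ((b : B) * b * algebraMap F B (a⁻¹ : Fˣ)) = 1
      rw [hQ.nrm_mul, hQ.nrm_mul, hQ.nrm_algebraMap, Units.val_inv_eq_inv_val, normF_inv]
      have := normF_pos hN
      simp only [nrm, a, Units.val_mk0]
      field_simp
  rw [show g = (g.1, 1) * (1, g.2) by ext1 <;> simp, map_mul, hM, hBB, one_mul]

end Homs

variable [MeasurableSpace (AA F B)] [BorelSpace (AA F B)]

open MeasureTheory Measure ChainExt

section ScaleIndex

/-- Scaling some of the coordinates by a uniformizer. -/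
lemma addEquivAddHaarChar_of_scale {A : Type*} [AddCommGroup A] [TopologicalSpace A]
    [IsTopologicalAddGroup A] [LocallyCompactSpace A] [MeasurableSpace A] [BorelSpace A]
    {κ κ' : Type*} [Fintype κ] [Fintype κ'] (e : A ≃ₜ+ (κ → F) × (κ' → F)) (φ : A ≃ₜ+ A) {c : F}
    (hc : normF F c = (resCard F)⁻¹) (h : ∀ x, e (φ x) = (c • (e x).1, (e x).2)) :
    (addEquivAddHaarChar φ : ℝ) = (resCard F)⁻¹ ^ Fintype.card κ := by
  classical
  have hq := resCard_pos F
  let X : Set A := e ⁻¹' ((Set.univ.pi fun _ => {x | normF F x ≤ 1}) ×ˢ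
    Set.univ.pi fun _ => {x | normF F x ≤ 1})
  have hX : ∀ x, x ∈ X ↔ (∀ i, normF F ((e x).1 i) ≤ 1) ∧ ∀ i, normF F ((e x).2 i) ≤ 1 :=
    fun x => by simp [X]
  have hO : IsOpen X := ((isOpen_set_pi Set.finite_univ fun _ _ => isOpen_normF_le' one_pos).prod
    (isOpen_set_pi Set.finite_univ fun _ _ => isOpen_normF_le' one_pos)).preimage e.continuous
  have hC : IsCompact X := e.toHomeomorph.isCompact_preimage.2
    ((isCompact_univ_pi fun _ => isCompact_normF_le' one_pos).prod
      (isCompact_univ_pi fun _ => isCompact_normF_le' one_pos))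
  have hφ : ∀ x, x ∈ φ '' X ↔ x ∈ X ∧ ∀ i, normF F ((e x).1 i) < 1 := by
    intro x
    obtain ⟨x, rfl⟩ := φ.surjective x
    rw [φ.injective.mem_set_image, hX, hX, h]
    simp only [Pi.smul_apply, smul_eq_mul, normF_mul, hc]
    have hlt : ∀ i, (resCard F)⁻¹ * normF F ((e x).1 i) < 1 ↔ normF F ((e x).1 i) ≤ 1 := by
      intro i
      refine ⟨fun hi => ?_, fun hi => (mul_le_of_le_one_right (inv_pos.2 hq).le hi).trans_lt
        (inv_lt_one_of_one_lt₀ (one_lt_resCard F))⟩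
      rw [← hc, ← normF_mul] at hi
      have := normF_lt_one_le hi
      rwa [normF_mul, hc, mul_le_iff_le_one_right (inv_pos.2 hq)] at this
    grind
  have : Fintype 𝓀[F] := ofFinite _
  choose l hl using fun x : 𝓀[F] => residue_surjective (R := 𝒪[F]) x
  let d : (κ → 𝓀[F]) → A := fun r => e.symm (fun i => (l (r i) : F), 0)
  have hd : ∀ r a, a ∈ (fun a => -d r + a) ⁻¹' (φ '' X) ↔
      a ∈ X ∧ ∀ i, normF F ((e a).1 i - l (r i)) < 1 := by
    intro r a
    have e1 : e (-d r + a) = (fun i => (e a).1 i - l (r i), (e a).2) := by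
      rw [map_add, map_neg, e.apply_symm_apply]
      ext <;> simp; ring
    rw [Set.mem_preimage, hφ, hX, hX, e1]
    refine ⟨fun ⟨⟨_, h2⟩, h3⟩ => ⟨⟨fun i => ?_, h2⟩, h3⟩, fun ⟨⟨_, h2⟩, h3⟩ =>
      ⟨⟨fun i => (h3 i).le, h2⟩, h3⟩⟩
    rw [← sub_add_cancel ((e a).1 i) (l (r i))]
    exact (normF_add_le _ _).trans (max_le (h3 i).le (normF_coe_le _))
  have hU : X = ⋃ r : κ → 𝓀[F], (fun a => -d r + a) ⁻¹' (φ '' X) := by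
    ext a
    simp only [Set.mem_iUnion, hd]
    refine ⟨fun ha => ?_, fun ⟨r, h1, _⟩ => h1⟩
    let o : κ → 𝒪[F] := fun i => ⟨(e a).1 i, normF_le_one.1 (((hX a).1 ha).1 i)⟩
    exact ⟨fun i => residue _ (o i), ha, fun i => residue_eq_iff.1 (hl (residue _ (o i))).symm⟩
  have hdis : Pairwise (onFun Disjoint fun r => (fun a => -d r + a) ⁻¹' (φ '' X)) := by
    intro r r' hrr
    rw [onFun, Set.disjoint_left]
    intro a h1 h2
    refine hrr (funext fun i => ?_)
    rw [← hl (r i), ← hl (r' i), residue_eq_iff, ← sub_sub_sub_cancel_left _ _ ((e a).1 i)]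
    exact (normF_sub_le _ _).trans_lt (max_lt (((hd _ _).1 h2).2 i) (((hd _ _).1 h1).2 i))
  let μ : Measure A := addHaar
  have hm := (φ.toHomeomorph.isOpenMap _ hO).measurableSet
  have h1 := measure_iUnion (μ := μ) hdis fun r => hm.preimage (measurable_const_add (-d r))
  rw [← hU, tsum_fintype] at h1
  simp only [measure_preimage_add] at h1
  have h2 := addEquivAddHaarChar_smul_preimage μ (X := φ '' X) φ
  rw [Set.preimage_image_eq _ φ.injective] at h2
  rw [Finset.sum_const, Finset.card_univ, Fintype.card_fun, nsmul_eq_mul,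
    ← Nat.card_eq_fintype_card (α := 𝓀[F]), ← h2] at h1
  have h3 := congrArg ENNReal.toReal h1
  rw [ENNReal.toReal_mul, ENNReal.smul_def, smul_eq_mul, ENNReal.toReal_mul] at h3
  have h0 : (μ X).toReal ≠ 0 := (ENNReal.toReal_pos (hO.measure_pos μ
    ⟨0, (hX 0).2 (by simp)⟩).ne' hC.measure_lt_top.ne).ne'
  rw [inv_pow]
  refine eq_inv_of_mul_eq_one_right (mul_right_cancel₀ h0 ?_)
  rw [one_mul, mul_assoc]
  simpa [resCard] using h3.symm

end ScaleIndex

section Modulus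

lemma toA_cancel_left {a b : GG F B} (h : a * b = 1) (x : AA F B) : toA a * (toA b * x) = x := by
  rw [← mul_assoc, ← toA_mul, h, toA_one, one_mul]

lemma toA_cancel_right {a b : GG F B} (h : a * b = 1) (x : AA F B) : x * toA a * toA b = x := by
  rw [mul_assoc, ← toA_mul, h, toA_one, mul_one]

variable (F B) in
/-- The balls of `𝐀` around zero. -/
def ball (r : ℝ) : Set (AA F B) := {x | size₁ x.1 ≤ r ∧ nrmB x.2 ≤ r}

lemma ball_mono {r r' : ℝ} (h : r ≤ r') : ball F B r ⊆ ball F B r' :=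
  fun _ hx => ⟨hx.1.trans h, hx.2.trans h⟩

/-- The modulus of an element of `𝐆`. -/
noncomputable def modulus (g : GG F B) : ℝ := norm₁ g ^ 2 * norm₂ g ^ 2

lemma norm₁_pos (g : GG F B) : 0 < norm₁ g :=
  normF_pos ((isUnit_iff_isUnit_det _).1 g.1.isUnit).ne_zero

lemma norm₁_mul (g h : GG F B) : norm₁ (g * h) = norm₁ g * norm₁ h := by
  rw [norm₁, norm₁, norm₁, ← normF_mul, ← det_mul]; rfl

lemma norm₁_inv (g : GG F B) : norm₁ g⁻¹ = (norm₁ g)⁻¹ :=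
  eq_inv_of_mul_eq_one_left (by rw [← norm₁_mul, inv_mul_cancel]; simp [norm₁])

variable (hQ : IsQuat (F := F) (A := B) redTrace redNorm)
include hQ

lemma norm₂_pos (g : GG F B) : 0 < norm₂ g := hQ.nrm_pos g.2.ne_zero

lemma norm₂_mul (g h : GG F B) : norm₂ (g * h) = norm₂ g * norm₂ h := hQ.nrm_mul _ _

lemma norm₂_inv (g : GG F B) : norm₂ g⁻¹ = (norm₂ g)⁻¹ :=
  eq_inv_of_mul_eq_one_left (by rw [← norm₂_mul hQ, inv_mul_cancel]; exact hQ.nrm_one)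

lemma modulus_pos (g : GG F B) : 0 < modulus g :=
  mul_pos (pow_pos (norm₁_pos g) 2) (pow_pos (norm₂_pos hQ g) 2)

lemma ball_add {r : ℝ} {x y : AA F B} (hx : x ∈ ball F B r) (hy : y ∈ ball F B r) :
    x + y ∈ ball F B r :=
  ⟨(size₁_add_le _ _).trans (max_le hx.1 hy.1), hQ.nrm_add_le_of hx.2 hy.2⟩

lemma ball_neg {r : ℝ} {x : AA F B} (hx : x ∈ ball F B r) : -x ∈ ball F B r :=
  ⟨by rw [fst_neg, size₁_neg]; exact hx.1, by rw [snd_neg, hQ.nrm_neg]; exact hx.2⟩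

lemma zero_mem_ball {r : ℝ} (hr : 0 ≤ r) : (0 : AA F B) ∈ ball F B r :=
  ⟨by rw [Prod.fst_zero, size₁_zero]; exact hr, by rw [Prod.snd_zero, hQ.nrm_zero]; exact hr⟩

lemma ball_mul {r r' : ℝ} (hr : 0 ≤ r) {x y : AA F B} (hx : x ∈ ball F B r)
    (hy : y ∈ ball F B r') : x * y ∈ ball F B (r * r') :=
  ⟨(size₁_mul_le _ _).trans (mul_le_mul hx.1 hy.1 (size₁_nonneg _) hr), by
    rw [snd_mul, hQ.nrm_mul]; exact mul_le_mul hx.2 hy.2 (nrm_nonneg _ _) hr⟩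

variable (hT : ∃ b : B, redTrace (F := F) b ≠ 0)

include hT

lemma isOpen_ball {r : ℝ} (hr : 0 < r) : IsOpen (ball F B r) :=
  ((isOpen_size₁_le hr).preimage continuous_fst).inter
    ((isOpen_nrm_le hQ hT hr).preimage continuous_snd)

lemma isCompact_ball {r : ℝ} (hr : 0 < r) : IsCompact (ball F B r) := by
  have : ball F B r = {x : M2 F | size₁ x ≤ r} ×ˢ {b : B | nrmB b ≤ r} := rfl
  rw [this]
  exact (isCompact_size₁_le hr).prod (isCompact_nrm_le hQ hT hr)

lemma exists_ball_subset {U : Set (AA F B)} (hU : U ∈ nhds 0) : ∃ r > 0, ball F B r ⊆ U := by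
  rw [Prod.zero_eq_mk, mem_nhds_prod_iff] at hU
  obtain ⟨u, hu, v, hv, huv⟩ := hU
  obtain ⟨r, hr, hru⟩ := exists_size₁_subset hu
  obtain ⟨r', hr', hrv⟩ := exists_nrm_subset hQ hT hv
  exact ⟨min r r', lt_min hr hr', fun x hx => huv ⟨hru (hx.1.trans (min_le_left _ _)),
    hrv (hx.2.trans (min_le_right _ _))⟩⟩

lemma locallyCompactSpace_AA : LocallyCompactSpace (AA F B) :=
  (isCompact_ball hQ hT one_pos).locallyCompactSpace_of_mem_nhds_of_addGroup
    ((isOpen_ball hQ hT one_pos).mem_nhds (zero_mem_ball hQ zero_le_one))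

lemma secondCountable_AA : SecondCountableTopology (AA F B) := by
  have h1 : (nhds (0 : AA F B)).IsCountablyGenerated := by
    refine Filter.HasBasis.isCountablyGenerated (ι := ℕ) (p := fun _ => True)
      (s := fun k => ball F B ((1 : ℝ) / (k + 1))) ⟨fun U => ⟨fun hU => ?_, ?_⟩⟩
    · obtain ⟨r, hr, h⟩ := exists_ball_subset hQ hT hU
      obtain ⟨k, hk⟩ := exists_nat_one_div_lt hr
      exact ⟨k, trivial, (ball_mono hk.le).trans h⟩
    · rintro ⟨k, -, h⟩
      exact mem_of_superset ((isOpen_ball hQ hT (by positivity)).mem_nhds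
        (zero_mem_ball hQ (by positivity))) h
  letI := IsTopologicalAddGroup.rightUniformSpace (AA F B)
  haveI := isUniformAddGroup_of_addCommGroup (G := AA F B)
  haveI := IsUniformAddGroup.uniformity_countably_generated (α := AA F B)
  haveI : SigmaCompactSpace (AA F B) := by
    refine ⟨⟨fun k => ball F B ((k : ℝ) + 1), fun k => isCompact_ball hQ hT (by positivity), ?_⟩⟩
    rw [Set.eq_univ_iff_forall]
    intro x
    obtain ⟨k, hk⟩ := exists_nat_ge (max (size₁ x.1) (nrmB x.2))
    rw [Set.mem_iUnion]
    refine ⟨k, ?_, ?_⟩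
    · have := (le_max_left _ _).trans hk; linarith
    · have := (le_max_right _ _).trans hk; linarith
  letI := TopologicalSpace.pseudoMetrizableSpacePseudoMetric (AA F B)
  exact EMetric.secondCountable_of_sigmaCompact (AA F B)

omit hQ hT in
/-- Left multiplication by an element of `𝐆`. -/
noncomputable def lmul (g : GG F B) : AA F B ≃ₜ+ AA F B where
  toFun x := toA g * x
  invFun x := toA g⁻¹ * x
  left_inv := toA_cancel_left (inv_mul_cancel g)
  right_inv := toA_cancel_left (mul_inv_cancel g)
  map_add' x y := mul_add _ _ _
  continuous_toFun := continuous_const.mul continuous_id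
  continuous_invFun := continuous_const.mul continuous_id

omit hQ hT in
/-- Right multiplication by an element of `𝐆`. -/
noncomputable def rmul (g : GG F B) : AA F B ≃ₜ+ AA F B where
  toFun x := x * toA g
  invFun x := x * toA g⁻¹
  left_inv := toA_cancel_right (mul_inv_cancel g)
  right_inv := toA_cancel_right (inv_mul_cancel g)
  map_add' x y := add_mul _ _ _
  continuous_toFun := continuous_id.mul continuous_const
  continuous_invFun := continuous_id.mul continuous_const

omit hQ hT in
lemma lmul_mul (g h : GG F B) : lmul (g * h) = (lmul h).trans (lmul g) := by
  ext1 x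
  exact mul_assoc (toA g) (toA h) x

omit hQ hT in
lemma rmul_mul (g h : GG F B) : rmul (g * h) = (rmul g).trans (rmul h) := by
  ext1 x
  exact (mul_assoc x (toA g) (toA h)).symm

omit hQ hT in
lemma rmul_centerHom (z : Fˣ × Fˣ) : rmul (centerHom F B z) = lmul (centerHom F B z) := by
  ext1 x
  exact Prod.ext (Algebra.commutes (z.1 : F) x.1).symm (Algebra.commutes (z.2 : F) x.2).symm

variable (hB : finrank F B = 4)
include hB

/-- Two multiplicative families of automorphisms of `𝐀` scale the Haar measure by the modulus. -/
lemma addEquivAddHaarChar_family [LocallyCompactSpace (AA F B)] (m : GG F B → (AA F B ≃ₜ+ AA F B))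
    (hm : ∀ g h, addEquivAddHaarChar (m (g * h)) =
      addEquivAddHaarChar (m g) * addEquivAddHaarChar (m h))
    (hb' : ∀ g : GG F B, toA g ∈ ball F B 1 → ∀ x ∈ ball F B 1, m g x ∈ ball F B 1)
    (hinv : ∀ g x, m g⁻¹ (m g x) = x)
    (hc : ∀ z, m (centerHom F B z) = lmul (centerHom F B z))
    (g : GG F B) : (addEquivAddHaarChar (m g) : ℝ) = modulus g := by
  haveI := secondCountable_AA hQ hT
  have hpos : ∀ g, 0 < (addEquivAddHaarChar (m g) : ℝ) := fun g => addEquivAddHaarChar_pos _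
  let χ : GG F B →* ℝ :=
    { toFun := fun g => addEquivAddHaarChar (m g) / modulus g
      map_one' := by
        have h := congrArg (fun r : NNReal => (r : ℝ)) (hm 1 1)
        rw [mul_one, NNReal.coe_mul] at h
        rw [mul_left_cancel₀ (hpos 1).ne' (h.symm.trans (mul_one _).symm)]
        simp [modulus, norm₁, norm₂, hQ.nr_one]
      map_mul' := fun g h => by
        rw [hm, modulus, norm₁_mul, norm₂_mul hQ, modulus, modulus, NNReal.coe_mul]
        ring }
  obtain ⟨ϖ₀, hϖ₀0, hϖ₀⟩ := exists_normF_eq_zpow (F := F) (-1)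
  rw [zpow_neg_one] at hϖ₀
  have hq := resCard_pos F
  obtain ⟨κ, _, e₂, -⟩ := exists_coordinates hQ hT
  have hκ : Fintype.card κ = 4 := by
    rw [← hB, e₂.toLinearEquiv.finrank_eq, Module.finrank_fintype_fun_eq_card]
  let e : AA F B ≃ₜ+ (Fin 2 × Fin 2 → F) × (κ → F) :=
    { toFun := fun x => (fun i => x.1 i.1 i.2, e₂ x.2)
      invFun := fun x => (Matrix.of fun i j => x.1 (i, j), e₂.symm x.2)
      left_inv := fun x => Prod.ext rfl (e₂.symm_apply_apply _)
      right_inv := fun x => Prod.ext rfl (e₂.apply_symm_apply _)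
      map_add' := fun x y => Prod.ext rfl (map_add e₂ _ _)
      continuous_toFun := by fun_prop
      continuous_invFun := by fun_prop }
  let e' : AA F B ≃ₜ+ (κ → F) × (Fin 2 × Fin 2 → F) :=
    e.trans ⟨AddEquiv.prodComm, continuous_swap, continuous_swap⟩
  have hl : ∀ z x, lmul (centerHom F B z) x = ((z.1 : F) • x.1, (z.2 : F) • x.2) :=
    fun z x => Prod.ext (smul_def _ _).symm (smul_def _ _).symm
  have hmod : ∀ z, modulus (centerHom F B z) = normF F (z.1 : F) ^ 4 * normF F (z.2 : F) ^ 4 := by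
    intro z
    change normF F (algebraMap F (M2 F) (z.1 : F)).det ^ 2 *
      (nrm redNorm (algebraMap F B (z.2 : F))) ^ 2 = _
    rw [hQ.nrm_algebraMap, Matrix.algebraMap_eq_diagonal, Matrix.det_diagonal]
    simp
    ring
  refine (div_eq_one_iff_eq (modulus_pos hQ g).ne').1 (eq_one_of_hom hQ χ
    (fun g => div_pos (hpos g) (modulus_pos hQ g)) (fun u b hu hb => ?_)
    (ϖ := mk0 ϖ₀ hϖ₀0) hϖ₀ ?_ ?_ g)
  · set g : GG F B := (Units.map (algebraMap F (M2 F) : F →* M2 F) u, b)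
    have hs : ∀ a : F, normF F a = 1 → size₁ (algebraMap F (M2 F) a) ≤ 1 := fun a ha => by
      rw [algebraMap_eq_smul_one, size₁_smul, ha, size₁_one]; norm_num
    have hg : toA g ∈ ball F B 1 := ⟨hs _ hu, hb.le⟩
    have hg' : toA g⁻¹ ∈ ball F B 1 := by
      refine ⟨hs (u⁻¹ : Fˣ) (by simp [hu]), ?_⟩
      change nrm redNorm ((b⁻¹ : Bˣ) : B) ≤ 1
      rw [Units.val_inv_eq_inv_val, hQ.nrm_inv, hb, inv_one]
    have hpre : m g '' ball F B 1 = ball F B 1 := by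
      refine Set.Subset.antisymm (Set.image_subset_iff.2 (hb' g hg)) fun x hx =>
        ⟨m g⁻¹ x, hb' _ hg' x hx, ?_⟩
      have := hinv g⁻¹ x
      rwa [inv_inv] at this
    have h := addEquivAddHaarChar_smul_preimage (addHaar : Measure (AA F B))
      (X := m g '' ball F B 1) (m g)
    rw [Set.preimage_image_eq _ (m g).injective, hpre, ENNReal.smul_def, smul_eq_mul] at h
    have h0 := ((isOpen_ball hQ hT one_pos).measure_pos addHaar ⟨0, zero_mem_ball hQ zero_le_one⟩).ne'
    rw [ENNReal.mul_eq_right h0 (isCompact_ball hQ hT one_pos).measure_lt_top.ne] at h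
    change (addEquivAddHaarChar (m g) : ℝ) / _ = 1
    rw [ENNReal.coe_eq_one.1 h, modulus, norm₁, norm₂]
    change 1 / (normF F (algebraMap F (M2 F) (u : F)).det ^ 2 * nrm redNorm (b : B) ^ 2) = 1
    rw [hb, Matrix.algebraMap_eq_diagonal, Matrix.det_diagonal]
    simp [hu]
  · change (addEquivAddHaarChar (m _) : ℝ) / _ = 1
    rw [hc, hmod, addEquivAddHaarChar_of_scale e _ hϖ₀ fun x => by
      rw [hl]; exact Prod.ext rfl (congrArg e₂ (one_smul F x.2))]
    simp [hϖ₀, hq.ne']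
  · change (addEquivAddHaarChar (m _) : ℝ) / _ = 1
    rw [hc, hmod, addEquivAddHaarChar_of_scale e' _ hϖ₀ fun x => by
      rw [hl]; exact Prod.ext (map_smul e₂ _ _) (funext fun i => one_mul _)]
    simp [hϖ₀, hq.ne', hκ]

lemma addEquivAddHaarChar_lmul [LocallyCompactSpace (AA F B)] (g : GG F B) :
    (addEquivAddHaarChar (lmul g) : ℝ) = modulus g := by
  refine addEquivAddHaarChar_family hQ hT hB lmul (fun g h => ?_) (fun g hg x hx => ?_) (fun g x => ?_)
    (fun _ => rfl) g
  · rw [lmul_mul, addEquivAddHaarChar_trans, mul_comm]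
  · have := ball_mul hQ zero_le_one hg hx
    rwa [mul_one] at this
  · exact (lmul g).symm_apply_apply x

lemma addEquivAddHaarChar_rmul [LocallyCompactSpace (AA F B)] (g : GG F B) :
    (addEquivAddHaarChar (rmul g) : ℝ) = modulus g := by
  refine addEquivAddHaarChar_family hQ hT hB rmul (fun g h => ?_) (fun g hg x hx => ?_) (fun g x => ?_)
    rmul_centerHom g
  · rw [rmul_mul, addEquivAddHaarChar_trans]
  · have := ball_mul hQ zero_le_one hx hg
    rwa [mul_one] at this
  · exact (rmul g).symm_apply_apply x

variable (μ : Measure (AA F B)) [μ.IsAddHaarMeasure]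

lemma map_eq_of_char [LocallyCompactSpace (AA F B)] {φ : AA F B ≃ₜ+ AA F B} {g : GG F B}
    (h : (addEquivAddHaarChar φ : ℝ) = modulus g) :
    μ = ENNReal.ofReal (modulus g) • μ.map φ := by
  haveI := secondCountable_AA hQ hT
  conv_lhs => rw [← addEquivAddHaarChar_smul_map μ φ]
  rw [← h, ENNReal.ofReal_coe_nnreal]; rfl

lemma map_lmul (g : GG F B) : μ = ENNReal.ofReal (modulus g) • μ.map (lmul g) := by
  haveI := locallyCompactSpace_AA hQ hT
  exact map_eq_of_char hQ hT hB μ (addEquivAddHaarChar_lmul hQ hT hB g)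

lemma map_rmul (g : GG F B) : μ = ENNReal.ofReal (modulus g) • μ.map (rmul g) := by
  haveI := locallyCompactSpace_AA hQ hT
  exact map_eq_of_char hQ hT hB μ (addEquivAddHaarChar_rmul hQ hT hB g)

lemma integral_lmul (g : GG F B) (f : AA F B → ℂ) :
    ∫ x, f x ∂μ = modulus g * ∫ x, f (toA g * x) ∂μ := by
  conv_lhs => rw [map_lmul hQ hT hB μ g]
  rw [integral_smul_measure, ENNReal.toReal_ofReal (modulus_pos hQ g).le,
    show μ.map (lmul g) = μ.map (lmul g).toHomeomorph.toMeasurableEquiv from rfl,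
    integral_map_equiv, Complex.real_smul]
  rfl

lemma integral_rmul (g : GG F B) (f : AA F B → ℂ) :
    ∫ x, f x ∂μ = modulus g * ∫ x, f (x * toA g) ∂μ := by
  conv_lhs => rw [map_rmul hQ hT hB μ g]
  rw [integral_smul_measure, ENNReal.toReal_ofReal (modulus_pos hQ g).le,
    show μ.map (rmul g) = μ.map (rmul g).toHomeomorph.toMeasurableEquiv from rfl,
    integral_map_equiv, Complex.real_smul]
  rfl

lemma measure_lmul (g : GG F B) (X : Set (AA F B)) :
    μ (lmul g '' X) = ENNReal.ofReal (modulus g) * μ X := by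
  have h := map_lmul hQ hT hB μ g
  conv_lhs => rw [h]
  rw [Measure.smul_apply, smul_eq_mul,
    show μ.map (lmul g) = μ.map (lmul g).toHomeomorph.toMeasurableEquiv from rfl,
    MeasurableEquiv.map_apply]
  congr 2
  exact Set.preimage_image_eq _ (lmul g).injective

end Modulus

lemma exists_nhds_units {R : Type*} [Ring R] [TopologicalSpace R] {U : Set Rˣ}
    (hU : U ∈ nhds (1 : Rˣ)) :
    ∃ W ∈ nhds (1 : R), ∀ u : Rˣ, (u : R) ∈ W → ((u⁻¹ : Rˣ) : R) ∈ W → u ∈ U := by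
  rw [Units.isInducing_embedProduct.nhds_eq_comap, Filter.mem_comap] at hU
  obtain ⟨T, hT, hTU⟩ := hU
  have : Units.embedProduct R 1 = (1, 1) := rfl
  rw [this, mem_nhds_prod_iff] at hT
  obtain ⟨u, hu, v, hv, huv⟩ := hT
  have hv' : MulOpposite.op ⁻¹' v ∈ nhds (1 : R) :=
    MulOpposite.continuous_op.continuousAt.preimage_mem_nhds hv
  exact ⟨u ∩ MulOpposite.op ⁻¹' v, Filter.inter_mem hu hv', fun w h1 h2 => hTU (huv ⟨h1.1, h2.2⟩)⟩

section Congruence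

variable (hQ : IsQuat (F := F) (A := B) redTrace redNorm)

lemma normF_det_one_add {l : M2 F} {ε : ℝ} (hε : ε < 1) (hl : size₁ l ≤ ε) :
    normF F (1 + l).det = 1 := by
  have h1 : ∀ i j, normF F (l i j) < 1 := by
    intro i j
    have := (sq_le_size₁ l i j).trans hl
    by_contra! h
    nlinarith
  have e : (1 + l).det = 1 + (l 0 0 + l 1 1 + (l 0 0 * l 1 1 - l 0 1 * l 1 0)) := by
    simp [det_fin_two]; ring
  have h2 : normF F (l 0 0 + l 1 1 + (l 0 0 * l 1 1 - l 0 1 * l 1 0)) < 1 := by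
    refine (normF_add_le _ _).trans_lt (max_lt ((normF_add_le _ _).trans_lt (max_lt (h1 _ _) (h1 _ _)))
      ((normF_sub_le _ _).trans_lt (max_lt ?_ ?_)))
    · rw [normF_mul]; exact mul_lt_one_of_nonneg_of_lt_one_left (normF_nonneg _) (h1 _ _) (h1 _ _).le
    · rw [normF_mul]; exact mul_lt_one_of_nonneg_of_lt_one_left (normF_nonneg _) (h1 _ _) (h1 _ _).le
  rw [e]
  refine le_antisymm ((normF_add_le _ _).trans (max_le normF_one.le h2.le)) ?_
  by_contra! h3
  have h4 := normF_sub_le (1 + (l 0 0 + l 1 1 + (l 0 0 * l 1 1 - l 0 1 * l 1 0)))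
    (l 0 0 + l 1 1 + (l 0 0 * l 1 1 - l 0 1 * l 1 0))
  rw [add_sub_cancel_right, normF_one] at h4
  exact h4.not_gt (max_lt h3 h2)

include hQ

lemma exists_toA_one_add {l : AA F B} {ε : ℝ} (hε : ε < 1) (hl : l ∈ ball F B ε) :
    ∃ u : GG F B, toA u = 1 + l ∧ toA u⁻¹ - 1 ∈ ball F B ε := by
  have h1 := normF_det_one_add hε hl.1
  have h2 : nrmB (1 + l.2) = 1 := by
    rw [add_comm, hQ.nrm_eq_of_lt (by rw [hQ.nrm_one]; exact hl.2.trans_lt hε), hQ.nrm_one]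
  have h20 : 1 + l.2 ≠ 0 := fun h0 => by rw [h0, hQ.nrm_zero] at h2; exact zero_ne_one h2
  have h10 : IsUnit (1 + l.1) := by
    rw [isUnit_iff_isUnit_det, isUnit_iff_ne_zero]
    intro h0
    rw [h0, normF_eq_zero.2 rfl] at h1
    exact zero_ne_one h1
  obtain ⟨u₁, hu₁⟩ := h10
  refine ⟨(u₁, mk0 _ h20), Prod.ext hu₁ rfl, ?_, ?_⟩
  · change size₁ (((u₁⁻¹ : (M2 F)ˣ) : M2 F) - 1) ≤ ε
    have e : ((u₁⁻¹ : (M2 F)ˣ) : M2 F) - 1 = -(((u₁⁻¹ : (M2 F)ˣ) : M2 F) * l.1) := by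
      have h3 : ((u₁⁻¹ : (M2 F)ˣ) : M2 F) * (1 + l.1) = 1 := by rw [← hu₁, inv_mul]
      rw [mul_add, mul_one] at h3
      rw [← h3]; abel
    have h4 : size₁ ((u₁⁻¹ : (M2 F)ˣ) : M2 F) ≤ 1 := by
      rw [Matrix.coe_units_inv, hu₁, size₁_inv, h1, one_pow, div_one]
      exact (size₁_add_le _ _).trans (max_le size₁_one.le (hl.1.trans hε.le))
    rw [e, size₁_neg]
    exact (size₁_mul_le _ _).trans ((mul_le_of_le_one_left (size₁_nonneg _) h4).trans hl.1)
  · change nrm redNorm ((1 + l.2)⁻¹ - 1) ≤ ε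
    have e : (1 + l.2)⁻¹ - 1 = -((1 + l.2)⁻¹ * l.2) := by
      have h3 : (1 + l.2)⁻¹ * (1 + l.2) = 1 := inv_mul_cancel₀ h20
      rw [mul_add, mul_one] at h3
      nth_rw 2 [← h3]; abel
    rw [e, hQ.nrm_neg, hQ.nrm_mul, hQ.nrm_inv, h2, inv_one, one_mul]
    exact hl.2

variable (hT : ∃ b : B, redTrace (F := F) b ≠ 0)

omit hQ in
lemma continuous_toA : Continuous (toA : GG F B → AA F B) :=
  (Units.continuous_val.comp continuous_fst).prodMk (Units.continuous_val.comp continuous_snd)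

include hT

/-- Open subgroups of `𝐆` contain congruence subgroups. -/
lemma exists_congruence {U : Subgroup (GG F B)} (hU : IsOpen (U : Set (GG F B))) :
    ∃ ε > 0, ε < 1 ∧ ∀ l ∈ ball F B ε, ∃ u ∈ U, toA u = 1 + l := by
  have h1 := hU.mem_nhds U.one_mem
  rw [Prod.one_eq_mk, mem_nhds_prod_iff] at h1
  obtain ⟨U₁, hU₁, U₂, hU₂, h12⟩ := h1
  obtain ⟨W₁, hW₁, h1⟩ := exists_nhds_units hU₁
  obtain ⟨W₂, hW₂, h2⟩ := exists_nhds_units hU₂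
  have hW : (fun x : AA F B => 1 + x) ⁻¹' (W₁ ×ˢ W₂) ∈ nhds (0 : AA F B) := by
    refine (continuous_const.add continuous_id).continuousAt.preimage_mem_nhds ?_
    change W₁ ×ˢ W₂ ∈ nhds ((1 : AA F B) + 0)
    rw [add_zero, Prod.one_eq_mk]
    exact prod_mem_nhds hW₁ hW₂
  obtain ⟨r, hr, hrW⟩ := exists_ball_subset hQ hT hW
  refine ⟨min r (1 / 2), lt_min hr (by norm_num), (min_le_right _ _).trans_lt (by norm_num),
    fun l hl => ?_⟩
  obtain ⟨u, hu, hu'⟩ := exists_toA_one_add hQ ((min_le_right _ _).trans_lt (by norm_num)) hl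
  have h3 : toA u ∈ W₁ ×ˢ W₂ := by rw [hu]; exact hrW (ball_mono (min_le_left _ _) hl)
  have h4 : toA u⁻¹ ∈ W₁ ×ˢ W₂ := by
    have := hrW (ball_mono (min_le_left _ _) hu')
    rwa [Set.mem_preimage, add_sub_cancel] at this
  exact ⟨u, h12 ⟨h1 _ h3.1 h4.1, h2 _ h3.2 h4.2⟩, hu⟩

lemma isOpen_of_congruence {U : Subgroup (GG F B)} {ε : ℝ} (hε : 0 < ε)
    (h : ∀ u : GG F B, toA u - 1 ∈ ball F B ε → u ∈ U) : IsOpen (U : Set (GG F B)) := by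
  apply Subgroup.isOpen_of_mem_nhds U (g := 1)
  have hO : IsOpen {u : GG F B | toA u - 1 ∈ ball F B ε} :=
    (isOpen_ball hQ hT hε).preimage (continuous_toA.sub continuous_const)
  refine mem_of_superset (hO.mem_nhds ?_) h
  change toA 1 - 1 ∈ ball F B ε
  rw [toA_one, sub_self]
  exact zero_mem_ball hQ hε.le

variable (hB : finrank F B = 4)
include hB

/-- A bounded part of `𝐆` meets only finitely many cosets of an open subgroup. -/
lemma finite_cosets {U : Subgroup (GG F B)} (hU : IsOpen (U : Set (GG F B))) (R : ℝ) {κ : ℝ}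
    (hκ : 0 < κ) :
    {c : GG F B ⧸ U | ∃ g : GG F B, (g : GG F B ⧸ U) = c ∧ toA g ∈ ball F B R ∧
      κ ≤ modulus g}.Finite := by
  haveI := locallyCompactSpace_AA hQ hT
  let μ : Measure (AA F B) := addHaar
  obtain ⟨ε, hε, hε1, h⟩ := exists_congruence hQ hT hU
  set T := {c : GG F B ⧸ U | ∃ g : GG F B, (g : GG F B ⧸ U) = c ∧
    toA g ∈ ball F B R ∧ κ ≤ modulus g}
  choose g hg hgR hgκ using fun c : T => c.2
  let X : Set (AA F B) := (fun x => -1 + x) ⁻¹' ball F B ε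
  have hX : IsOpen X := (isOpen_ball hQ hT hε).preimage (continuous_const.add continuous_id)
  have hμX : μ X = μ (ball F B ε) := measure_preimage_add μ (-1) _
  have hpos : 0 < μ (ball F B ε) := (isOpen_ball hQ hT hε).measure_pos μ ⟨0, zero_mem_ball hQ hε.le⟩
  let S : T → Set (AA F B) := fun c => lmul (g c) '' X
  have hS : ∀ c, IsOpen (S c) := fun c => (lmul (g c)).toHomeomorph.isOpenMap _ hX
  have hunit : ∀ x ∈ X, ∃ u ∈ U, toA u = x := by
    intro x hx
    obtain ⟨u, hu, e⟩ := h _ hx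
    exact ⟨u, hu, by rw [e, add_neg_cancel_left]⟩
  have hd : Pairwise (onFun Disjoint S) := by
    intro c c' hcc
    rw [onFun, Set.disjoint_left]
    rintro _ ⟨x, hx, rfl⟩ ⟨x', hx', e⟩
    apply hcc
    obtain ⟨u, hu, rfl⟩ := hunit x hx
    obtain ⟨u', hu', rfl⟩ := hunit x' hx'
    have e' : g c' * u' = g c * u := Setup.toA_injective e
    apply Subtype.ext
    rw [← hg c, ← hg c', QuotientGroup.eq]
    have : (g c)⁻¹ * g c' = u * u'⁻¹ := by
      rw [eq_mul_inv_iff_mul_eq, mul_assoc, e', inv_mul_cancel_left]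
    rw [this]
    exact U.mul_mem hu (U.inv_mem hu')
  have hsub : (⋃ c, S c) ⊆ ball F B (max R 1) := by
    refine Set.iUnion_subset fun c => ?_
    rintro _ ⟨x, hx, rfl⟩
    have h1 : (1 : AA F B) ∈ ball F B 1 := ⟨size₁_one.le, hQ.nrm_one.le⟩
    have h2 : x ∈ ball F B 1 := by
      have := ball_add hQ h1 (ball_mono hε1.le hx)
      rwa [add_neg_cancel_left] at this
    have h3 := ball_mul hQ (zero_le_one.trans (le_max_right _ _)) (ball_mono (le_max_left R 1) (hgR c)) h2
    rwa [mul_one] at h3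
  have hfin : μ (⋃ c, S c) ≠ ⊤ := ((measure_mono hsub).trans_lt
    (isCompact_ball hQ hT (zero_lt_one.trans_le (le_max_right _ _))).measure_lt_top).ne
  have hmain := finite_const_le_meas_of_disjoint_iUnion μ (ε := ENNReal.ofReal κ * μ (ball F B ε))
    (ENNReal.mul_pos (by simpa using hκ) hpos.ne') (fun c => (hS c).measurableSet) hd hfin
  have huniv : {c | ENNReal.ofReal κ * μ (ball F B ε) ≤ μ (S c)} = Set.univ := by
    rw [Set.eq_univ_iff_forall]
    intro c
    change _ ≤ μ (lmul (g c) '' X)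
    rw [measure_lmul hQ hT hB, hμX]
    exact mul_le_mul_left (ENNReal.ofReal_le_ofReal (hgκ c)) _
  rw [huniv, Set.finite_univ_iff] at hmain
  exact T.toFinite

end Congruence

namespace Setup

include D

lemma redTrace_ne : ∃ b : B, redTrace (F := F) b ≠ 0 := by
  obtain ⟨e, -, he⟩ := D.exists_trace_one
  refine ⟨S.ι₂ e, fun h => ?_⟩
  rw [D.side₂.tr_ι] at h
  rw [h, normF_eq_zero.2 rfl] at he
  exact zero_ne_one he

lemma exists_size₁_le_rad (k : ℤ) : ∃ ε > 0, ∀ x : M2 F, size₁ x ≤ ε → x ∈ S.chain.rad k := by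
  obtain ⟨v, h1, h2⟩ := D.chain.exists_generator 0
  have hv := D.chain.ne_zero_of h2
  set P := frame S.ι₁ s v
  have hq := one_lt_resCard F
  obtain ⟨j, hj⟩ : ∃ j : ℤ, k ≤ S.chain.e * j - S.chain.e + 1 := by
    refine ⟨|k| + 1, ?_⟩
    have he : (1 : ℤ) ≤ S.chain.e := by exact_mod_cast S.chain.e_pos
    have := le_abs_self k
    nlinarith [abs_nonneg k]
  have hpos : 0 < (resCard F ^ (-j)) ^ 2 := by
    have := zpow_pos (resCard_pos F) (-j); positivity
  set c := size₁ P⁻¹ * size₁ P + 1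
  have hc : 0 < c := by have := size₁_nonneg P; have := size₁_nonneg P⁻¹; positivity
  refine ⟨(resCard F ^ (-j)) ^ 2 / c, by positivity, fun x hx => ?_⟩
  have e : x = op S.ι₁ s v (P⁻¹ * x * P) := by
    rw [op, mul_assoc P⁻¹, Matrix.mul_nonsing_inv_cancel_left _ _ (D.chain.isUnit_frame hv),
      Matrix.mul_nonsing_inv_cancel_right _ _ (D.chain.isUnit_frame hv)]
  rw [e]
  refine S.chain.rad_antitone hj (D.chain.op_mem_rad h1 h2 (k := j) ?_ rfl)
  rw [← size₁_le_sq (zpow_pos (resCard_pos F) _).le]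
  have h3 : size₁ (P⁻¹ * x * P) ≤ c * size₁ x := by
    refine (size₁_mul_le _ _).trans ((mul_le_mul_of_nonneg_right (size₁_mul_le _ _)
      (size₁_nonneg _)).trans ?_)
    have := size₁_nonneg x
    simp only [c]; nlinarith
  refine h3.trans ((mul_le_mul_of_nonneg_left hx hc.le).trans_eq ?_)
  rw [mul_div_cancel₀ _ hc.ne']

lemma exists_size₁_bound (k : ℤ) : ∃ R > 0, ∀ x ∈ S.chain.rad k, size₁ x ≤ R := by
  obtain ⟨v, h1, h2⟩ := D.chain.exists_generator 0
  have hv := D.chain.ne_zero_of h2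
  set P := frame S.ι₁ s v
  refine ⟨size₁ (S.ι₁ (t ^ k)) * (size₁ P * size₁ P⁻¹) + 1, ?_, fun x hx => ?_⟩
  · have := size₁_nonneg P; have := size₁_nonneg P⁻¹; have := size₁_nonneg (S.ι₁ (t ^ k)); positivity
  have h3 : S.ι₁ (t ^ (-k)) * x ∈ S.chain.rad 0 :=
    S.chain.rad_mul (D.chain.emb _ (-k) (by rw [D.quatE.nrm_zpow])) hx (by ring)
  obtain ⟨M, hM, e⟩ := D.chain.exists_integral_matrix h1 h2 (i := 0)
    (fun w hw => by simpa using h3 0 w hw)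
  have h4 : x = S.ι₁ (t ^ k) * op S.ι₁ s v M := by
    rw [← e, ← mul_assoc, ← map_mul, mul_inv_cancel₀ (zpow_ne_zero _ D.side₁.t_ne), map_one,
      one_mul]
  have h5 : size₁ M ≤ 1 := by rw [← one_pow (M := ℝ) 2, size₁_le_sq zero_le_one]; exact hM
  rw [h4]
  refine ((size₁_mul_le _ _).trans (mul_le_mul_of_nonneg_left ?_ (size₁_nonneg _))).trans
    (le_add_of_nonneg_right zero_le_one)
  refine (size₁_mul_le _ _).trans (mul_le_mul_of_nonneg_right ?_ (size₁_nonneg _))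
  exact (size₁_mul_le _ _).trans (mul_le_of_le_one_right (size₁_nonneg _) h5)

lemma cell_diag_mul {i j m : ℕ} {x : AA F B} (hx : x ∈ D.cell i j m) :
    ((S.ι₁ t, S.ι₂ t) : AA F B) * x ∈ D.cell (i + 1) (j + 1) (m + 1) := by
  obtain ⟨h1, h2, h3, h4⟩ := hx
  have ht := D.t_pos
  have hδ := D.δ_le
  refine ⟨?_, ?_, ?_, ?_⟩
  · rw [fst_mul, D.side₁.pr_left, D.quatE.nrm_mul, pow_succ']
    exact mul_le_mul_of_nonneg_left h1 ht.le
  · rw [fst_mul, snd_mul, D.side₁.pr_left, D.side₂.pr_left, ← mul_sub, D.quatE.nrm_mul, pow_succ']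
    exact mul_le_mul_of_nonneg_left h2 ht.le
  · rw [fst_mul, D.side₁.pr_left, map_mul, ← mul_sub]
    exact D.side₁.V_mono (by omega) (D.side₁.V_left (i := 1) (by rw [zpow_one]) h3 rfl)
  · rw [snd_mul, D.side₂.pr_left, map_mul, ← mul_sub]
    exact D.side₂.V_mono (by omega) (D.side₂.V_left (i := 1) (by rw [zpow_one]) h4 rfl)

lemma exists_ball_subset_ideal : ∃ ε > 0, ball F B ε ⊆ 𝓙 := by
  obtain ⟨ε₁, hε₁, h1⟩ := D.exists_size₁_le_rad ((S.n : ℤ) + 1)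
  have ht := D.t_pos
  refine ⟨min ε₁ (nrm nrE t ^ (S.n + 1)), lt_min hε₁ (pow_pos ht _), fun x hx => ?_⟩
  have h2 : ((S.ι₁ t⁻¹, S.ι₂ t⁻¹) : AA F B) * x ∈ depthSet S := by
    constructor
    · exact S.chain.rad_mul (D.chain.emb t⁻¹ (-1) (by rw [D.quatE.nrm_inv, zpow_neg_one]))
        (h1 _ (hx.1.trans (min_le_left _ _))) (by ring)
    · rw [D.mem_radB_n', snd_mul, D.quatB.nrm_mul, D.nrm_redNorm_ι, D.quatE.nrm_inv,
        inv_mul_le_iff₀ ht, ← pow_succ']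
      exact hx.2.trans (min_le_right _ _)
  have h3 := D.cell_diag_mul (D.depth_subset_cell h2)
  have h4 : ((S.ι₁ t, S.ι₂ t) : AA F B) * ((S.ι₁ t⁻¹, S.ι₂ t⁻¹) * x) = x := by
    have h5 : ((S.ι₁ t, S.ι₂ t) : AA F B) * (S.ι₁ t⁻¹, S.ι₂ t⁻¹) = 1 := by
      rw [Prod.mk_mul_mk, ← map_mul, ← map_mul, mul_inv_cancel₀ D.side₁.t_ne, map_one, map_one]
      rfl
    rw [← mul_assoc, h5, one_mul]
  rw [h4] at h3
  exact D.cell_mono (by omega) le_rfl le_rfl h3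

lemma exists_order_bound : ∃ R > 0, 𝓞 ⊆ ball F B R := by
  obtain ⟨R, hR, h⟩ := D.exists_size₁_bound 0
  refine ⟨max R 1, hR.trans_le (le_max_left _ _), fun x hx => ?_⟩
  obtain ⟨h1, h2⟩ := D.mem_orders (Nat.zero_le _) hx
  rw [D.mem_radB, pow_zero, inv_one] at h2
  exact ⟨(h _ h1).trans (le_max_left _ _), h2.trans (le_max_right _ _)⟩

/-- The linking units as a subset of `𝐀`. -/
def _root_.LinkingOrder.unitSet (S : StratumData F E B) : Set (AA F B) :=
  {x | ∃ g ∈ S.linkingUnits, toA g = x}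

lemma mem_unitSet {x : AA F B} : x ∈ unitSet S ↔ x ∈ 𝓞 ∧ nrm nrE (p₁ x.1) = 1 := by
  constructor
  · rintro ⟨g, hg, rfl⟩
    exact D.mem_linkingUnits_iff.1 hg
  · rintro ⟨h1, h2⟩
    exact D.exists_unit h1 h2

lemma unitSet_add {x l : AA F B} (hl : l ∈ D.cell 1 S.n S.n) :
    x + l ∈ unitSet S ↔ x ∈ unitSet S := by
  have key : ∀ {x l : AA F B}, l ∈ D.cell 1 S.n S.n → x ∈ unitSet S → x + l ∈ unitSet S := by
    rintro x l hl ⟨g, hg, rfl⟩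
    obtain ⟨h', hh'⟩ := D.exists_add_radical ⟨g, hg⟩ hl
    exact ⟨h', h'.2, hh'⟩
  refine ⟨fun h => ?_, key hl⟩
  have := key (D.cell_neg hl) h
  rwa [add_neg_cancel_right] at this

lemma ideal_subset : 𝓙 ⊆ D.cell 1 S.n S.n := D.cell_mono le_rfl (by omega) (by omega)

lemma norms_of_unit (h : 𝓛) : norm₁ h.1 = 1 ∧ norm₂ h.1 = 1 := by
  obtain ⟨h1, h2, -⟩ := D.norm_eq_one (D.order_of_unit h) (D.nrm_of_unit h)
  exact ⟨h1, h2⟩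

lemma modulus_of_unit (h : 𝓛) : modulus h.1 = 1 := by
  rw [modulus, (D.norms_of_unit h).1, (D.norms_of_unit h).2]; norm_num

lemma zero_mem_ideal : (0 : AA F B) ∈ 𝓙 := by
  have := D.diag_mem_cell (i := 1) (j := S.n + 1) (m := S.n + 1) (e := 0)
    (by rw [D.quatE.nrm_zero, pow_one]; exact D.t_pos.le)
  rwa [map_zero, map_zero] at this

/-- The kernel of reduction modulo the radical of the linking order. -/
def redKer : Subgroup 𝓛 where
  carrier := {h | toA h.1 - 1 ∈ 𝓙}
  one_mem' := by
    change toA 1 - 1 ∈ 𝓙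
    rw [toA_one, sub_self]
    exact D.zero_mem_ideal
  mul_mem' := by
    intro a b ha hb
    change toA (a.1 * b.1) - 1 ∈ 𝓙
    have e : toA (a.1 * b.1) - 1 = toA a.1 * (toA b.1 - 1) +
        (toA a.1 - 1) := by rw [toA_mul, mul_sub, mul_one]; abel
    rw [e]
    exact D.cell_add (D.cell_mul_left (by omega) le_rfl (by omega) le_rfl (by omega)
      (D.order_of_unit a) hb) ha
  inv_mem' := by
    intro a ha
    change toA (a⁻¹).1 - 1 ∈ 𝓙
    have e : toA (a⁻¹).1 - 1 = -(toA (a⁻¹).1 * (toA a.1 - 1)) := by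
      rw [mul_sub, mul_one, ← toA_mul, ← coe_mul, inv_mul_cancel, coe_one, toA_one, neg_sub]
    rw [e]
    exact D.cell_neg (D.cell_mul_left (by omega) le_rfl (by omega) le_rfl (by omega)
      (D.order_of_unit a⁻¹) ha)

lemma mem_redKer {h : 𝓛} : h ∈ D.redKer ↔ toA h.1 - 1 ∈ 𝓙 := Iff.rfl

lemma redKer_normal : D.redKer.Normal := by
  refine ⟨fun a ha g => ?_⟩
  rw [mem_redKer]
  have e : toA ((g * a * g⁻¹ : 𝓛) : GG F B) - 1 = toA g.1 * ((toA a.1 - 1) * toA (g⁻¹).1) := by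
    rw [sub_mul, one_mul, mul_sub, ← toA_mul, ← toA_mul, ← toA_mul]
    simp [mul_assoc, toA_one]
  rw [e]
  exact D.cell_mul_left (by omega) le_rfl (by omega) le_rfl (by omega) (D.order_of_unit g)
    (D.cell_mul_right (by omega) le_rfl (by omega) le_rfl (by omega) (D.order_of_unit g⁻¹) ha)

lemma isOpen_cell {i j m : ℕ} (h : 𝓙 ⊆ D.cell i j m) : IsOpen (D.cell i j m) := by
  obtain ⟨ε, hε, hsub⟩ := D.exists_ball_subset_ideal
  have h0 : (0 : AA F B) ∈ D.cell i j m := h (hsub (zero_mem_ball D.quatB hε.le))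
  let G : AddSubgroup (AA F B) :=
    { carrier := D.cell i j m
      add_mem' := D.cell_add
      zero_mem' := h0
      neg_mem' := D.cell_neg }
  exact AddSubgroup.isOpen_of_mem_nhds G (g := 0) (mem_of_superset
    ((isOpen_ball D.quatB D.redTrace_ne hε).mem_nhds
      (zero_mem_ball D.quatB hε.le)) (hsub.trans h))

lemma isOpen_unitSet : IsOpen (unitSet S : Set (AA F B)) := by
  rw [isOpen_iff_mem_nhds]
  intro x hx
  have h1 := (D.isOpen_cell subset_rfl).preimage (f := fun y : AA F B => y - x) (by fun_prop)
  refine mem_of_superset (h1.mem_nhds ?_) fun y hy => ?_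
  · change x - x ∈ 𝓙
    rw [sub_self]
    exact D.zero_mem_ideal
  · have := (D.unitSet_add (D.ideal_subset hy)).2 hx
    rwa [add_sub_cancel] at this

lemma isCompact_unitSet : IsCompact (unitSet S : Set (AA F B)) := by
  obtain ⟨R, hR, h⟩ := D.exists_order_bound
  refine (isCompact_ball D.quatB D.redTrace_ne hR).of_isClosed_subset ?_
    fun x hx => h (D.mem_unitSet.1 hx).1
  rw [← isOpen_compl_iff, isOpen_iff_mem_nhds]
  intro x hx
  have h1 := (D.isOpen_cell subset_rfl).preimage (f := fun y : AA F B => y - x) (by fun_prop)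
  refine mem_of_superset (h1.mem_nhds ?_) fun y hy hyU => hx ?_
  · change x - x ∈ 𝓙
    rw [sub_self]
    exact D.zero_mem_ideal
  · rw [← D.unitSet_add (D.ideal_subset hy), add_sub_cancel]
    exact hyU

lemma isOpen_map_redKer :
    IsOpen ((D.redKer.map S.linkingUnits.subtype : Subgroup (GG F B)) : Set (GG F B)) := by
  obtain ⟨ε, hε, hsub⟩ := D.exists_ball_subset_ideal
  refine isOpen_of_congruence D.quatB D.redTrace_ne hε fun u hu => ?_
  obtain ⟨h, hh⟩ := D.exists_add_radical 1 (D.ideal_subset (hsub hu))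
  rw [coe_one, toA_one, add_sub_cancel] at hh
  refine ⟨h, ?_, toA_injective hh⟩
  change toA h.1 - 1 ∈ 𝓙
  rw [hh]
  exact hsub hu

lemma isOpen_linkingUnits : IsOpen (𝓛 : Set (GG F B)) := Subgroup.isOpen_mono (by
    rintro _ ⟨h, -, rfl⟩
    exact h.2) D.isOpen_map_redKer

lemma finite_reduction (hB : finrank F B = 4) : Finite (𝓛 ⧸ D.redKer) := by
  obtain ⟨R, hR, h⟩ := D.exists_order_bound
  have hfin := finite_cosets D.quatB D.redTrace_ne hB D.isOpen_map_redKer R one_pos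
  let f : 𝓛 ⧸ D.redKer → GG F B ⧸ (D.redKer.map S.linkingUnits.subtype : Subgroup (GG F B)) :=
    fun q => QuotientGroup.mk (q.out : GG F B)
  refine Set.finite_univ_iff.1 (Set.Finite.of_finite_image (f := f) (hfin.subset ?_) ?_)
  · rintro _ ⟨q, -, rfl⟩
    exact ⟨_, rfl, h (D.order_of_unit _), (D.modulus_of_unit _).ge⟩
  · intro q _ q' _ hqq
    obtain ⟨k, hk, hk'⟩ := QuotientGroup.eq.1 hqq
    rw [← q.out_eq', ← q'.out_eq', QuotientGroup.eq]
    have : q.out⁻¹ * q'.out = k := Subtype.ext hk'.symm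
    rw [this]
    exact hk

end Setup

lemma exists_eq_smul_one {G V : Type*} [Group G] [AddCommGroup V] [Module ℂ V]
    [FiniteDimensional ℂ V] {σ : Representation ℂ G V} (hσ : σ.IsIrreducible) (A : End ℂ V)
    (h : ∀ g, A * σ g = σ g * A) : ∃ c : ℂ, A = c • (1 : End ℂ V) := by
  let f : Representation.IntertwiningMap σ σ := ⟨A, h⟩
  haveI := hσ
  obtain ⟨c, hc⟩ :=
    (Representation.IsIrreducible.algebraMap_intertwiningMap_bijective_of_isAlgClosed (ρ := σ)).2 f
  refine ⟨c, ?_⟩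
  have := congrArg Representation.IntertwiningMap.toLinearMap hc
  exact this.symm

section CosetSum

variable {H M : Type*} [Group H] {N : Subgroup H} {f : H → M} (hf : ∀ h, ∀ k ∈ N, f (h * k) = f h)
include hf

lemma apply_out (h : H) : f (h : H ⧸ N).out = f h := by
  obtain ⟨k, hk⟩ := QuotientGroup.mk_out_eq_mul N h
  rw [hk, hf _ _ k.2]

variable [Fintype (H ⧸ N)] [AddCommMonoid M]

lemma sum_out_mul_left (g : H) : ∑ q : H ⧸ N, f (g * q.out) = ∑ q : H ⧸ N, f q.out := by
  rw [← Equiv.sum_comp (MulAction.toPerm g) fun q : H ⧸ N => f q.out]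
  refine sum_congr rfl fun q _ => ?_
  rw [← apply_out hf (g * q.out)]
  congr 2
  exact congrArg (fun x : H ⧸ N => g • x) (QuotientGroup.out_eq' q)

lemma sum_out_mul_right [N.Normal] (g : H) : ∑ q : H ⧸ N, f (q.out * g) = ∑ q : H ⧸ N, f q.out := by
  rw [← Equiv.sum_comp (Equiv.mulRight (g : H ⧸ N)) fun q : H ⧸ N => f q.out]
  refine sum_congr rfl fun q _ => ?_
  rw [← apply_out hf (q.out * g)]
  congr 2
  exact congrArg (· * (g : H ⧸ N)) q.out_eq'

end CosetSum

lemma sum_eq_zero_of_classes {X κ : Type*} [Fintype X] (c : X → κ) (f : X → ℂ)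
    (h : ∀ x, f x ≠ 0 → ∃ (e : X ≃ X) (z : ℂ), z ≠ 1 ∧
      ∀ y, (c (e y) = c x ↔ c y = c x) ∧ (c y = c x → f (e y) = z * f y)) : ∑ x, f x = 0 := by
  classical
  rw [← Finset.sum_fiberwise_of_maps_to (t := Finset.univ.image c) (g := c)
    fun x _ => Finset.mem_image_of_mem c (mem_univ x)]
  refine Finset.sum_eq_zero fun j _ => ?_
  by_contra hne
  obtain ⟨x, hx, hfx⟩ := Finset.exists_ne_zero_of_sum_ne_zero hne
  obtain ⟨-, rfl⟩ := Finset.mem_filter.1 hx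
  obtain ⟨e, z, hz, he⟩ := h x hfx
  refine hz (mul_right_cancel₀ hne ?_)
  rw [one_mul, mul_sum]
  refine Finset.sum_equiv e (fun y => ?_) fun y hy => ?_
  · simp [(he y).1]
  · exact ((he y).2 (Finset.mem_filter.1 hy).2).symm

namespace Setup

include D

lemma formT_mul_mem (h k : 𝓛) (hk : k ∈ D.redKer) :
    normF F (formT S (toA (h * k).1) - formT S (toA h.1)) < 1 := by
  rw [← D.formT_sub, coe_mul, toA_mul]
  have := D.normF_formT_mul_lt hk (D.order_of_unit h)
  rwa [mul_sub, mul_one] at this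

lemma formT_conj {a : Eˣ} (ha : (a : E) = S.α) {h₀ h₁ : GG F B}
    (h01 : S.diag a * h₁ = h₀ * S.diag a) (x : AA F B) :
    formT S (x * toA h₀) = formT S (toA h₁ * x) := by
  have e : toA (S.diag a) * toA h₁ = toA h₀ * toA (S.diag a) := by rw [← toA_mul, ← toA_mul, h01]
  have e1 : S.ι₁ S.α * (toA h₁).1 = (toA h₀).1 * S.ι₁ S.α := by rw [← ha]; exact congrArg Prod.fst e
  have e2 : S.ι₂ S.α * (toA h₁).2 = (toA h₀).2 * S.ι₂ S.α := by rw [← ha]; exact congrArg Prod.snd e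
  rw [formT, formT, fst_mul, snd_mul, fst_mul, snd_mul, ← mul_assoc,
    ← mul_assoc, D.side₁.quat.tr_comm, D.quatB.tr_comm, ← mul_assoc, ← mul_assoc, ← e1, ← e2,
    mul_assoc, mul_assoc]

lemma nrm_p₁_mul_sub {x u : AA F B} (hx : x ∈ 𝓞) (hu : u ∈ 𝓞)
    (h : nrm nrE (p₁ u.1 - 1) < 1) : nrm nrE (p₁ (x * u).1 - p₁ x.1) < 1 := by
  have e : p₁ (x * u).1 - p₁ x.1 = (p₁ (x * u).1 - p₁ x.1 * p₁ u.1) + p₁ x.1 * (p₁ u.1 - 1) := by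
    ring
  rw [e]
  refine (D.quatE.nrm_add_le _ _).trans_lt (max_lt (D.pr_mul_lt hx hu) ?_)
  rw [D.quatE.nrm_mul]
  exact (mul_le_of_le_one_left (nrm_nonneg _ _) (by simpa using hx.1)).trans_lt h

lemma exists_trace_mul {γ : E} (hγ : nrm nrE γ = 1) {x : F} (hx : normF F x ≤ 1) :
    ∃ y, nrm nrE y ≤ 1 ∧ trE (γ * y) = x := by
  obtain ⟨e, he, he'⟩ := D.exists_trace_one
  have hγ0 : γ ≠ 0 := fun h => by rw [h, D.quatE.nrm_zero] at hγ; exact zero_ne_one hγ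
  have he0 : trE e ≠ 0 := fun h => by rw [h, normF_eq_zero.2 rfl] at he'; exact zero_ne_one he'
  refine ⟨γ⁻¹ * (algebraMap F E (x / trE e) * e), ?_, ?_⟩
  · rw [D.quatE.nrm_mul, D.quatE.nrm_mul, D.quatE.nrm_inv, hγ, inv_one, one_mul,
      D.quatE.nrm_algebraMap, normF_div, he', div_one]
    exact mul_le_one₀ (pow_le_one₀ (normF_nonneg _) hx) (nrm_nonneg _ _) he
  · rw [mul_inv_cancel_left₀ hγ0, D.quatE.tr_algebraMap_mul, div_mul_cancel₀ _ he0]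

lemma formT_mul_left_E (x : AA F B) (y : E) : formT S (x * (S.ι₁ y, 0)) = trE (S.α * y * p₁ x.1) := by
  rw [D.formT_eq, fst_mul, snd_mul, D.side₁.pr_right, mul_zero]
  have : p₂ 0 = 0 := by simpa using D.side₂.pr_right 0 0
  rw [this, sub_zero]
  congr 1; ring

lemma depth_left_E {y : E} (hy : nrm nrE y ≤ 1) :
    ((S.ι₁ (t ^ S.n * y), 0) : AA F B) ∈ depthSet S := by
  refine D.depth_of_E (a := t ^ S.n * y) (b := 0) ?_ ?_ (by rw [map_zero])
  · rw [D.quatE.nrm_mul, D.quatE.nrm_pow]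
    exact mul_le_of_le_one_right (pow_nonneg D.t_pos.le _) hy
  · rw [D.quatE.nrm_zero]; exact pow_nonneg D.t_pos.le _

lemma nrm_α_mul (x : E) : nrm nrE (S.α * t ^ S.n * x) = nrm nrE x := by
  rw [D.quatE.nrm_mul, D.quatE.nrm_mul, D.α_nrm, D.quatE.nrm_pow, zpow_neg, zpow_natCast,
    inv_mul_cancel₀ (pow_ne_zero _ D.t_pos.ne'), one_mul]

open Classical in
/-- The trace of a Gauss sum over the reductions of the linking units. -/
lemma sum_char_mul [Fintype (𝓛 ⧸ D.redKer)] {χ : AddChar F Circle}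
    (hχ : ∀ x, normF F x < 1 → χ x = 1) (hχ' : ∃ x, normF F x ≤ 1 ∧ χ x ≠ 1)
    {θ : 𝓛 → ℂ} {d : ℂ} (hθ : ∀ h, ∀ k ∈ D.redKer, θ (h * k) = θ h)
    (h1 : ∀ h : 𝓛, ∀ x ∈ depthSet S, ∃ h' : 𝓛,
      toA h'.1 = toA h.1 * (1 + x) ∧ θ h' = χ (formT S x) * θ h)
    (h2 : ∀ h : 𝓛, toA h.1 - 1 ∈ D.cell 1 S.n S.n → (toA h.1 - 1 ∈ D.cell 1 S.n (S.n + 1) →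
        θ h = χ (formT S (toA h.1)) * d) ∧
      (toA h.1 - 1 ∉ D.cell 1 S.n (S.n + 1) → θ h = 0)) :
    ∑ q : 𝓛 ⧸ D.redKer, (χ (-formT S (toA q.out.1)) : ℂ) * θ q.out =
    ∑ q : 𝓛 ⧸ D.redKer, if toA q.out.1 - 1 ∈ D.cell 1 S.n (S.n + 1) then d else 0 := by
  haveI := D.redKer_normal
  have hχ2 : ∀ x y, normF F (x - y) < 1 → χ x = χ y := fun x y hxy => by
    rw [← sub_add_cancel x y, map_add_eq_mul, hχ _ hxy, one_mul]
  let c : 𝓛 → Set E := fun h => {e | nrm nrE (e - p₁ (toA h.1).1) < 1}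
  have hc_iff : ∀ h h', c h = c h' ↔ nrm nrE (p₁ (toA h.1).1 - p₁ (toA h'.1).1) < 1 := by
    intro h h'
    constructor
    · intro e
      have : p₁ (toA h.1).1 ∈ c h := by
        change nrm nrE (_ - _) < 1; rw [sub_self, D.quatE.nrm_zero]; exact one_pos
      rw [e] at this; exact this
    · intro e
      ext z
      change nrm nrE _ < 1 ↔ nrm nrE _ < 1
      refine ⟨fun hz => ?_, fun hz => ?_⟩
      · rw [← sub_add_sub_cancel z (p₁ (toA h.1).1)]
        exact (D.quatE.nrm_add_le _ _).trans_lt (max_lt hz e)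
      · rw [← sub_sub_sub_cancel_right z _ (p₁ (toA h'.1).1)]
        exact (D.quatE.nrm_sub_le _ _).trans_lt (max_lt hz e)
  have hc_mul : ∀ h u : 𝓛, nrm nrE (p₁ (toA u.1).1 - 1) < 1 → c (h * u) = c h := by
    intro h u hu
    rw [hc_iff, coe_mul, toA_mul]
    exact D.nrm_p₁_mul_sub (D.order_of_unit h) (D.order_of_unit u) hu
  have hp1 : ∀ x : AA F B, p₁ (x - 1).1 = p₁ x.1 - 1 := fun x => by
    rw [fst_sub, fst_one, D.side₁.pr_sub, D.side₁.pr_one]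
  have hc : ∀ h, ∀ k ∈ D.redKer, c (h * k) = c h := fun h k hk => hc_mul h k <| by
    rw [← hp1]; exact D.cell_lt le_rfl hk
  set g : 𝓛 → ℂ := fun h => (χ (-formT S (toA h.1)) : ℂ) * θ h
  have hg : ∀ h, ∀ k ∈ D.redKer, g (h * k) = g h := fun h k hk => by
    simp only [g]
    have e : χ (-formT S (toA (h * k).1)) = χ (-formT S (toA h.1)) := hχ2 _ _ <| by
      rw [neg_sub_neg, ← neg_sub, normF_neg]; exact D.formT_mul_mem h k hk
    rw [hθ h k hk, e]
  set P : 𝓛 → Prop := fun h => (1 : E) ∈ c h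
  set f : 𝓛 ⧸ D.redKer → ℂ := fun q => if P q.out then 0 else g q.out
  have hP : ∀ h : 𝓛, P h → toA h.1 - 1 ∈ D.cell 1 S.n S.n := by
    intro h hh
    obtain ⟨-, i2, i3, i4⟩ : toA h.1 - 1 ∈ 𝓞 := by
      rw [sub_eq_add_neg]
      exact D.cell_add (D.order_of_unit h) (D.cell_neg (by
        have := D.order_of_unit 1; rwa [coe_one, toA_one] at this))
    refine ⟨?_, i2, i3, i4⟩
    have : nrm nrE (p₁ (toA h.1 - 1).1) < 1 := by rw [hp1, ← neg_sub, D.quatE.nrm_neg]; exact hh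
    rw [← zpow_zero (nrm nrE t), D.chain.lt_iff_le] at this
    simpa using this
  have key : ∑ q, f q = 0 := by
    refine sum_eq_zero_of_classes (fun q => c q.out) f fun q hq => ?_
    have hq' : ¬ P q.out := fun h => hq (if_pos h)
    obtain ⟨x, hx, hχx⟩ := hχ'
    have hle : nrm nrE (1 - p₁ (toA q.out.1).1) = 1 := by
      refine le_antisymm (D.quatE.nrm_sub_le_of D.quatE.nrm_one.le ?_) (not_lt.1 hq')
      exact (D.nrm_of_unit q.out).le
    obtain ⟨y, hy, hxy⟩ := D.exists_trace_mul (γ := S.α * t ^ S.n * (1 - p₁ (toA q.out.1).1))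
      (by rw [D.nrm_α_mul, hle]) hx
    have hd := D.depth_left_E hy
    obtain ⟨u, hu, -⟩ := h1 1 _ hd
    rw [coe_one, toA_one, one_mul] at hu
    have hu1 : nrm nrE (p₁ (toA u.1).1 - 1) < 1 := by
      rw [hu, ← hp1, add_sub_cancel_left]
      exact D.cell_lt D.n_pos (D.depth_subset_cell hd)
    have e1 : ∀ r : 𝓛 ⧸ D.redKer,
        c (Equiv.mulRight (QuotientGroup.mk u) r).out = c r.out := fun r => by
      rw [← hc_mul r.out u hu1, ← apply_out hc (r.out * u)]
      congr 2
      exact congrArg (· * (QuotientGroup.mk u : _ ⧸ D.redKer)) r.out_eq'.symm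
    have e2 : ∀ r : 𝓛 ⧸ D.redKer,
        g (Equiv.mulRight (QuotientGroup.mk u) r).out = g (r.out * u) := fun r => by
      rw [← apply_out hg (r.out * u)]
      congr 2
      exact congrArg (· * (QuotientGroup.mk u : _ ⧸ D.redKer)) r.out_eq'.symm
    refine ⟨Equiv.mulRight (QuotientGroup.mk u), χ x, fun h => hχx (Subtype.ext h), fun r =>
      ⟨by rw [e1], fun hr => ?_⟩⟩
    have hP' : ∀ h, c h = c q.out → ¬ P h := fun h hh hp => hq' (by change 1 ∈ c q.out; rwa [← hh])
    simp only [f]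
    rw [if_neg (hP' _ ((e1 r).trans hr)), if_neg (hP' _ hr), e2]
    obtain ⟨h', hh', hθ'⟩ := h1 r.out _ hd
    have hh2 : h' = r.out * u := Subtype.ext (toA_injective (by rw [hh', coe_mul, toA_mul, hu]))
    simp only [g]
    rw [← hh2, hθ', hh', ← mul_assoc, ← mul_assoc]
    congr 1
    rw [← Circle.coe_mul, ← Circle.coe_mul, ← map_add_eq_mul, ← map_add_eq_mul]
    congr 1
    refine hχ2 _ _ ?_
    rw [mul_add, mul_one, D.formT_add, D.formT_mul_left_E, ← hxy]
    have e3 : formT S ((S.ι₁ (t ^ S.n * y), 0) : AA F B) = trE (S.α * (t ^ S.n * y)) := by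
      have := D.formT_mul_left_E 1 (t ^ S.n * y)
      rwa [one_mul, fst_one, D.side₁.pr_one, mul_one] at this
    rw [e3]
    set X := p₁ (toA r.out.1).1
    set Y := p₁ (toA q.out.1).1
    have e4 : trE (S.α * (t ^ S.n * y)) = trE (S.α * t ^ S.n * (1 - Y) * y) +
        trE (S.α * (t ^ S.n * y) * X) + trE (S.α * t ^ S.n * ((Y - X) * y)) := by
      rw [← D.quatE.tr_add, ← D.quatE.tr_add]; congr 1; ring
    have e5 : ∀ a b c d : F, -(a + b) + (c + b + d) - (c + -a) = d := fun a b c d => by ring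
    rw [e4, e5]
    refine D.quatE.normF_tr_lt_one ?_
    rw [D.nrm_α_mul, D.quatE.nrm_mul]
    refine (mul_le_of_le_one_right (nrm_nonneg _ _) hy).trans_lt ?_
    rw [← neg_sub, D.quatE.nrm_neg]
    exact (hc_iff _ _).1 hr
  refine (sub_zero _).symm.trans ?_
  nth_rw 1 [← key]
  rw [← Finset.sum_sub_distrib]
  refine sum_congr rfl fun q _ => ?_
  change g q.out - f q = _
  by_cases hq : P q.out
  · obtain ⟨i1, i2⟩ := h2 _ (hP _ hq)
    simp only [f, if_pos hq, sub_zero, g]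
    split_ifs with hi
    · rw [i1 hi, ← mul_assoc, ← Circle.coe_mul, ← map_add_eq_mul, neg_add_cancel,
        map_zero_eq_one, Circle.coe_one, one_mul]
    · rw [i2 hi, mul_zero]
  · simp only [f, if_neg hq, sub_self]
    rw [if_neg fun hi => hq ?_]
    change nrm nrE (1 - _) < 1
    rw [← neg_sub, D.quatE.nrm_neg, ← hp1]
    exact D.cell_lt le_rfl hi

end Setup

namespace Setup

include D

lemma exists_conj_unit {a : Eˣ} (ha : (a : E) = S.α) (h₀ : 𝓛) :
    ∃ h₁ : 𝓛, S.diag a * h₁.1 = h₀ * S.diag a := by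
  have hα : nrm nrE ((a⁻¹ : Eˣ) : E) = nrm nrE t ^ (S.n : ℤ) := by
    rw [Units.val_inv_eq_inv_val, ha, D.quatE.nrm_inv, D.α_nrm, zpow_neg, inv_inv]
  have ha0 : S.α ≠ 0 := ha ▸ a.ne_zero
  refine ⟨⟨(S.diag a)⁻¹ * h₀.1 * S.diag a, D.mem_linkingUnits_iff.2 ?_⟩, by
    simp only [mul_assoc, mul_inv_cancel_left]⟩
  obtain ⟨h1, h2, h3, h4⟩ := D.order_of_unit h₀
  set x := toA h₀.1
  have e1 : (toA ((S.diag a)⁻¹ * h₀.1 * S.diag a)).1 = S.ι₁ ((a⁻¹ : Eˣ) : E) * x.1 * S.ι₁ S.α := by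
    rw [← ha]; rfl
  have e2 : (toA ((S.diag a)⁻¹ * h₀.1 * S.diag a)).2 = S.ι₂ ((a⁻¹ : Eˣ) : E) * x.2 * S.ι₂ S.α := by
    rw [← ha]; rfl
  have e3 : ∀ y : E, ((a⁻¹ : Eˣ) : E) * y * S.α = y := fun y => by
    rw [mul_right_comm, ← ha, inv_mul, one_mul]
  have q1 : p₁ (toA ((S.diag a)⁻¹ * h₀.1 * S.diag a)).1 = p₁ x.1 := by
    rw [e1, D.side₁.pr_right, D.side₁.pr_left, e3]
  have q2 : p₂ (toA ((S.diag a)⁻¹ * h₀.1 * S.diag a)).2 = p₂ x.2 := by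
    rw [e2, D.side₂.pr_right, D.side₂.pr_left, e3]
  refine ⟨⟨?_, ?_, ?_, ?_⟩, ?_⟩
  · rwa [q1]
  · rwa [q1, q2]
  · rw [q1, e1, ← e3 (p₁ x.1), map_mul, map_mul, ← sub_mul, ← mul_sub]
    exact D.side₁.V_right (i := -S.n) D.α_nrm.le (D.side₁.V_left hα.le h3 rfl) (by ring)
  · rw [q2, e2, ← e3 (p₂ x.2), map_mul, map_mul, ← sub_mul, ← mul_sub]
    exact D.side₂.V_right (i := -S.n) D.α_nrm.le (D.side₂.V_left hα.le h4 rfl) (by ring)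
  · change nrm nrE (p₁ (toA ((S.diag a)⁻¹ * h₀.1 * S.diag a)).1) = 1
    rw [q1]; exact D.nrm_of_unit h₀

lemma apply_redKer (hσ : S.IsRhoS ψF σ) {k : 𝓛} (hk : k ∈ D.redKer) : σ k = 1 :=
  hσ.inflated k (by rw [D.linkingIdeal_eq]; exact hk)

lemma char_eq (hψF : TrivialOnMax ψF) {x : F} (hx : normF F x < 1) : ψF x = 1 :=
  hψF ⟨x, normF_le_one.1 hx.le⟩ (normF_lt_one_iff.1 hx)

lemma exists_char_ne (hψF' : NontrivialOnInt ψF) : ∃ x, normF F x ≤ 1 ∧ ψF x ≠ 1 := by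
  obtain ⟨x, hx⟩ := hψF'
  exact ⟨x, normF_le_one.2 x.2, hx⟩

lemma char_congr (hψF : TrivialOnMax ψF) {x y : F} (h : normF F (x - y) < 1) : ψF x = ψF y := by
  rw [← sub_add_cancel x y, map_add_eq_mul, D.char_eq hψF h, one_mul]

variable [Fintype (S.linkingUnits ⧸ D.redKer)]

variable (ψF σ) in
/-- The Gauss sum of the representation `σ`. -/
noncomputable def gauss : End ℂ V := ∑ q : 𝓛 ⧸ D.redKer, (ψF (-formT S (toA q.out.1)) : ℂ) • σ q.out

variable (ψF σ) in
/-- The dual Gauss sum of the representation `σ`. -/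
noncomputable def dualGauss : End ℂ V :=
  ∑ q : 𝓛 ⧸ D.redKer, (ψF (formT S (toA q.out.1)) : ℂ) • σ q.out⁻¹

lemma trace_sum (c : 𝓛 ⧸ D.redKer → ℂ) (A : 𝓛 ⧸ D.redKer → End ℂ V) :
    trace ℂ V (∑ q, c q • A q) = ∑ q, c q * trace ℂ V (A q) := by
  rw [_root_.map_sum]
  exact sum_congr rfl fun q _ => by rw [map_smul, smul_eq_mul]

variable (hσ : S.IsRhoS ψF σ)
include hσ

lemma gauss_mul (hψF : TrivialOnMax ψF) {a : Eˣ} (ha : (a : E) = S.α)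
    {h₀ h₁ : 𝓛} (h01 : S.diag a * h₁.1 = h₀ * S.diag a) :
    D.gauss ψF σ * σ h₀ = σ h₁ * D.gauss ψF σ := by
  haveI := D.redKer_normal
  set f : 𝓛 → End ℂ V := fun h => (ψF (-formT S (toA ((h₁⁻¹ * h : 𝓛) : GG F B))) : ℂ) • σ h
  have hf : ∀ h, ∀ k ∈ D.redKer, f (h * k) = f h := fun h k hk => by
    simp only [f]
    have e : ψF (-formT S (toA ((h₁⁻¹ * (h * k) : 𝓛) : GG F B))) =
        ψF (-formT S (toA ((h₁⁻¹ * h : 𝓛) : GG F B))) := by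
      refine D.char_congr hψF ?_
      rw [neg_sub_neg, ← neg_sub, normF_neg, ← mul_assoc]
      exact D.formT_mul_mem _ k hk
    rw [e, map_mul, D.apply_redKer hσ hk, mul_one]
  have e1 : D.gauss ψF σ * σ h₀ = ∑ q : 𝓛 ⧸ D.redKer, f (q.out * h₀) := by
    rw [gauss, Finset.sum_mul]
    refine sum_congr rfl fun q _ => ?_
    simp only [f]
    rw [smul_mul_assoc, map_mul]
    congr 4
    rw [← mul_assoc, coe_mul, toA_mul, D.formT_conj ha h01, ← toA_mul,
      ← coe_mul, mul_inv_cancel_left]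
  have e2 : σ h₁ * D.gauss ψF σ = ∑ q : 𝓛 ⧸ D.redKer, f (h₁ * q.out) := by
    rw [gauss, mul_sum]
    refine sum_congr rfl fun q _ => ?_
    simp only [f]
    rw [mul_smul_comm, map_mul, inv_mul_cancel_left]
  rw [e1, e2, sum_out_mul_right hf, sum_out_mul_left hf]

variable [FiniteDimensional ℂ V]

lemma exists_trace_gauss [Nontrivial V] (hψF : TrivialOnMax ψF)
    (hψF' : NontrivialOnInt ψF) : ∃ m : ℝ, 0 < m ∧
      trace ℂ V (D.gauss ψF σ) = m ∧ trace ℂ V (D.dualGauss ψF σ) = m := by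
  classical
  set d : ℝ := (finrank ℂ V : ℝ)
  have hd : 0 < d := Nat.cast_pos.2 (Module.finrank_pos (R := ℂ) (M := V))
  have hker := fun k hk => D.apply_redKer hσ (k := k) hk
  obtain ⟨x, hx, hx'⟩ := D.exists_char_ne hψF'
  refine ⟨∑ q : 𝓛 ⧸ D.redKer, if toA q.out.1 - 1 ∈ D.cell 1 S.n (S.n + 1) then d else 0, ?_, ?_, ?_⟩
  · refine Finset.sum_pos' (fun q _ => by split_ifs <;> simp [hd.le])
      ⟨QuotientGroup.mk 1, mem_univ _, ?_⟩
    obtain ⟨k, hk⟩ := QuotientGroup.mk_out_eq_mul D.redKer 1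
    rw [if_pos]
    · exact hd
    · rw [hk, one_mul]
      exact D.cell_mono le_rfl (by omega) le_rfl k.2
  · rw [gauss, D.trace_sum, D.sum_char_mul (θ := fun h => trace ℂ V (σ h)) (d := d)
      (fun x hx => D.char_eq hψF hx) ⟨x, hx, hx'⟩]
    · push_cast
      exact sum_congr rfl fun q _ => by split_ifs <;> simp
    · intro h k hk
      simp only [map_mul, hker k hk, mul_one]
    · intro h y hy
      obtain ⟨h', e1, e2⟩ := D.exists_mul_depth hσ h hy
      exact ⟨h', e1, by rw [e2, map_smul, smul_eq_mul]⟩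
    · intro h hh
      obtain ⟨i1, i2⟩ := D.scalar_or_trace_eq_zero hσ hψF hψF' h hh
      exact ⟨fun hi => by rw [i1 hi, map_smul, smul_eq_mul, LinearMap.trace_one]; simp [d],
        fun hi => (i2 hi).1⟩
  · have e0 : ∀ y, ψF⁻¹ y = ψF (-y) := fun y => AddChar.inv_apply _ _
    have e : ∀ y, (ψF y : ℂ) = (ψF⁻¹ (-y) : ℂ) := fun y => by rw [e0, neg_neg]
    have einv : ∀ (y : F) (h h' : 𝓛), σ h' = (ψF y : ℂ) • σ h → σ h'⁻¹ = (ψF⁻¹ y : ℂ) • σ h⁻¹ := by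
      intro y h h' hy
      have i1 : σ h'⁻¹ * σ h' = 1 := by rw [← map_mul, inv_mul_cancel, map_one]
      have i2 : σ h * σ h⁻¹ = 1 := by rw [← map_mul, mul_inv_cancel, map_one]
      calc σ h'⁻¹ = (ψF⁻¹ y : ℂ) • (σ h'⁻¹ * ((ψF y : ℂ) • σ h) * σ h⁻¹) := by
            rw [mul_smul_comm, smul_mul_assoc, mul_assoc, i2, mul_one, smul_smul, ← Circle.coe_mul,
              e0, ← map_add_eq_mul, neg_add_cancel, map_zero_eq_one, Circle.coe_one,
              one_smul]
        _ = _ := by rw [← hy, i1, one_mul]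
    rw [dualGauss, D.trace_sum]
    simp only [e]
    rw [D.sum_char_mul (χ := ψF⁻¹) (θ := fun h => trace ℂ V (σ h⁻¹)) (d := d)
      (fun x hx => by rw [e0]; exact D.char_eq hψF (by rwa [normF_neg]))
      ⟨-x, by rwa [normF_neg], by rwa [e0, neg_neg]⟩]
    · push_cast
      exact sum_congr rfl fun q _ => by split_ifs <;> simp
    · intro h k hk
      simp only [mul_inv_rev, map_mul, hker _ (inv_mem hk), one_mul]
    · intro h y hy
      obtain ⟨h', e1, e2⟩ := D.exists_mul_depth hσ h hy
      exact ⟨h', e1, by rw [einv _ _ _ e2, map_smul, smul_eq_mul]⟩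
    · intro h hh
      obtain ⟨i1, i2⟩ := D.scalar_or_trace_eq_zero hσ hψF hψF' h hh
      refine ⟨fun hi => ?_, fun hi => (i2 hi).2⟩
      rw [einv _ 1 h (by rw [i1 hi, map_one σ]), inv_one, map_one σ, map_smul, smul_eq_mul,
        LinearMap.trace_one]
      simp [d]

/-- The Gauss sum of `σ`, given its absolute value. -/
lemma gauss_eq (hψF : TrivialOnMax ψF) (hψF' : NontrivialOnInt ψF)
    {ω : Fˣ →* ℂˣ} {ρ : Representation ℂ S.K V} (hρ : S.IsRhoExt ω σ ρ)
    (hα : HasOrd F S.α (-S.n)) {k : S.K} {a : Eˣ} (ha : (a : E) = S.α)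
    (hk : k.1 = S.diag a) {C : ℝ} (hC : 0 < C)
    (h : D.dualGauss ψF σ * D.gauss ψF σ = ((C ^ 2 : ℝ) : ℂ) • (1 : End ℂ V)) :
    D.gauss ψF σ = -(C : ℂ) • ρ k⁻¹ := by
  have hkk : ρ k⁻¹ * ρ k = 1 := by rw [← map_mul, inv_mul_cancel, map_one]
  haveI : Nontrivial V := by
    by_contra hV
    rw [not_nontrivial_iff_subsingleton] at hV
    obtain ⟨X, Y, hXY⟩ := hσ.irreducible.toNontrivial
    exact hXY (Subrepresentation.toSubmodule_injective (Subsingleton.elim _ _))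
  obtain ⟨y, hy⟩ := exists_eq_smul_one hσ.irreducible (ρ k * D.gauss ψF σ) fun h₀ => by
    obtain ⟨h₁, h01⟩ := D.exists_conj_unit ha h₀
    rw [mul_assoc, D.gauss_mul hσ hψF ha h01, ← mul_assoc, ← mul_assoc, ← hρ.extends_σ,
      ← hρ.extends_σ, ← map_mul, ← map_mul]
    congr 2
    exact Subtype.ext (by rw [coe_mul, coe_mul, hk]; exact h01)
  have hT : D.gauss ψF σ = y • ρ k⁻¹ := by
    calc D.gauss ψF σ = ρ k⁻¹ * (ρ k * D.gauss ψF σ) := by rw [← mul_assoc, hkk, one_mul]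
      _ = _ := by rw [hy, mul_smul_comm, mul_one]
  obtain ⟨r, hr, hr1, hr2⟩ := D.trace_diag_α hσ hρ hα k a ha hk
  obtain ⟨m, hm, hm1, hm2⟩ := D.exists_trace_gauss hσ hψF hψF'
  have hT' : y • D.dualGauss ψF σ = ((C ^ 2 : ℝ) : ℂ) • ρ k := by
    rw [hT, mul_smul_comm] at h
    calc y • D.dualGauss ψF σ = (y • (D.dualGauss ψF σ * ρ k⁻¹)) * ρ k := by
          rw [smul_mul_assoc, mul_assoc, hkk, mul_one]
      _ = _ := by rw [h, smul_mul_assoc, one_mul]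
  rw [hT, map_smul, hr2, smul_eq_mul] at hm1
  have h3 := congrArg (trace ℂ V) hT'
  rw [map_smul, map_smul, hm2, hr1, smul_eq_mul, smul_eq_mul] at h3
  have hy1 : y = ((-(m / r) : ℝ) : ℂ) := by
    have hr' : (r : ℂ) ≠ 0 := by exact_mod_cast hr.ne'
    push_cast
    field_simp
    linear_combination -hm1
  rw [hy1] at h3 hT
  have h4 : -(m / r) * m = C ^ 2 * -r := by exact_mod_cast h3
  have h5 : (m / r) ^ 2 = C ^ 2 := by
    rw [div_pow, div_eq_iff (by positivity)]
    field_simp at h4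
    linarith
  have h6 : m / r = C := (pow_left_inj₀ (by positivity) hC.le two_ne_zero).1 h5
  rw [hT, h6]
  push_cast
  rfl

end Setup

lemma eq_zero_of_eq_mul {x z : ℂ} (hz : z ≠ 1) (h : x = z * x) : x = 0 := by
  have : (1 - z) * x = 0 := by linear_combination h
  exact (mul_eq_zero.1 this).resolve_left (sub_ne_zero.2 hz.symm)

lemma psiA_add (hQ : IsQuat (F := F) (A := B) redTrace redNorm) (ψ : AddChar F Circle)
    (x y : AA F B) :
    psiA ψ (x + y) = psiA ψ x * psiA ψ y := by
  rw [psiA, psiA, psiA, Prod.fst_add, Prod.snd_add, Matrix.trace_add, hQ.tr_add, neg_add,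
    map_add_eq_mul, map_add_eq_mul, Circle.coe_mul, Circle.coe_mul]
  ring

namespace Setup

variable (S) in
/-- Extension by zero of a function on the linking units to `𝐀`. -/
noncomputable def _root_.LinkingOrder.unitExt (θ : 𝓛 → ℂ) : AA F B → ℂ :=
  Function.extend (fun h : 𝓛 => toA h.1) θ 0

lemma unitExt_apply (θ : 𝓛 → ℂ) (h : 𝓛) : unitExt S θ (toA h.1) = θ h :=
  Injective.extend_apply (fun _ _ e => Subtype.ext (toA_injective e)) _ _ _

lemma unitExt_of_notMem (θ : 𝓛 → ℂ) {x : AA F B} (hx : x ∉ unitSet S) : unitExt S θ x = 0 :=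
  Function.extend_apply' _ _ _ fun ⟨h, hh⟩ => hx ⟨h, h.2, hh⟩

include D

lemma toA_sub_mem_iff (h h' : 𝓛) : toA h.1 - toA h'.1 ∈ 𝓙 ↔ h'⁻¹ * h ∈ D.redKer := by
  have key : ∀ (g : 𝓛) {l : AA F B}, l ∈ 𝓙 → toA g.1 * l ∈ 𝓙 := fun g l hl =>
    D.cell_mul_left (by omega) le_rfl (by omega) le_rfl (by omega) (D.order_of_unit g) hl
  rw [mem_redKer]
  constructor
  · intro hh
    have := key h'⁻¹ hh
    rwa [mul_sub, ← toA_mul, ← toA_mul, ← coe_mul, ← coe_mul,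
      inv_mul_cancel, coe_one, toA_one] at this
  · intro hh
    have := key h' hh
    rwa [mul_sub, mul_one, ← toA_mul, ← coe_mul, mul_inv_cancel_left] at this

lemma unitExt_add {θ : 𝓛 → ℂ} (hθ : ∀ h, ∀ k ∈ D.redKer, θ (h * k) = θ h)
    (x : AA F B) {l : AA F B} (hl : l ∈ 𝓙) :
    unitExt S θ (x + l) = unitExt S θ x := by
  have hiff := D.unitSet_add (x := x) (D.ideal_subset hl)
  by_cases hx : x ∈ unitSet S
  · obtain ⟨g, hg, rfl⟩ := hx
    obtain ⟨g', hg', e⟩ := hiff.2 ⟨g, hg, rfl⟩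
    have h1 := unitExt_apply (S := S) θ ⟨g, hg⟩
    have h2 := unitExt_apply (S := S) θ ⟨g', hg'⟩
    have h3 := (D.toA_sub_mem_iff ⟨g', hg'⟩ ⟨g, hg⟩).1 (by
      change toA g' - toA g ∈ _; rwa [e, add_sub_cancel_left])
    rw [← e]
    have h4 := hθ ⟨g, hg⟩ _ h3
    rw [mul_inv_cancel_left] at h4
    exact h2.trans (h4.trans h1.symm)
  · rw [unitExt_of_notMem _ hx, unitExt_of_notMem _ fun h => hx (hiff.1 h)]

section Measure

variable (μ : Measure (AA F B)) [μ.IsAddHaarMeasure]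

lemma measure_ideal_lt_top : μ (𝓙) < ⊤ := by
  obtain ⟨R, hR, h⟩ := D.exists_order_bound
  exact (measure_mono ((D.cell_mono (Nat.zero_le _) (by omega) (by omega)).trans h)).trans_lt
    (isCompact_ball D.quatB D.redTrace_ne hR).measure_lt_top

lemma measure_ideal_pos : 0 < μ.real (𝓙) :=
  ENNReal.toReal_pos ((D.isOpen_cell subset_rfl).measure_pos μ ⟨0, D.zero_mem_ideal⟩).ne'
    (D.measure_ideal_lt_top μ).ne

variable [Fintype (S.linkingUnits ⧸ D.redKer)]

lemma integral_unitExt {θ : 𝓛 → ℂ} (hθ : ∀ h, ∀ k ∈ D.redKer, θ (h * k) = θ h) :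
    ∫ x, unitExt S θ x ∂μ = μ.real (𝓙) * ∑ q : 𝓛 ⧸ D.redKer, θ q.out := by
  classical
  set X : 𝓛 ⧸ D.redKer → Set (AA F B) := fun q => (fun x => x + -toA q.out.1) ⁻¹' 𝓙
  have hX : ∀ q, MeasurableSet (X q) := fun q =>
    ((D.isOpen_cell subset_rfl).preimage (by fun_prop)).measurableSet
  have hμX : ∀ q, μ (X q) = μ (𝓙) := fun q => measure_preimage_add_right μ _ _
  have e : unitExt S θ = fun x => ∑ q, (X q).indicator (fun _ => θ q.out) x := by
    funext x
    by_cases hx : x ∈ unitSet S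
    · obtain ⟨g, hg, rfl⟩ := hx
      have hmem : ∀ q, toA g ∈ X q ↔ q = QuotientGroup.mk ⟨g, hg⟩ := fun q => by
        change toA g + -toA q.out.1 ∈ 𝓙 ↔ _
        rw [← sub_eq_add_neg]
        refine (D.toA_sub_mem_iff ⟨g, hg⟩ q.out).trans ?_
        rw [← QuotientGroup.eq, QuotientGroup.out_eq']
      rw [Finset.sum_eq_single (QuotientGroup.mk ⟨g, hg⟩)]
      · rw [Set.indicator_of_mem ((hmem _).2 rfl), apply_out hθ]
        exact unitExt_apply (S := S) θ ⟨g, hg⟩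
      · intro q _ hq
        exact Set.indicator_of_notMem (fun h => hq ((hmem q).1 h)) _
      · exact fun h => absurd (mem_univ _) h
    · rw [unitExt_of_notMem _ hx, Finset.sum_eq_zero]
      intro q _
      refine Set.indicator_of_notMem (fun h => hx ?_) _
      rw [← add_sub_cancel (toA q.out.1) x, sub_eq_add_neg]
      exact (D.unitSet_add (D.ideal_subset h)).2 ⟨_, q.out.2, rfl⟩
  rw [e, integral_finsetSum _ fun q _ => ?_, mul_sum]
  · refine sum_congr rfl fun q _ => ?_
    rw [integral_indicator_const _ (hX q), measureReal_def, hμX]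
    rfl
  · exact (integrable_indicator_iff (hX q)).2
      (integrableOn_const (by rw [hμX]; exact (D.measure_ideal_lt_top μ).ne))

end Measure

lemma psiA_mul_comm (ψ : AddChar F Circle) (x y : AA F B) : psiA ψ (x * y) = psiA ψ (y * x) := by
  rw [psiA, psiA, fst_mul, snd_mul, fst_mul, snd_mul, trace_mul_comm, D.quatB.tr_comm]

lemma psiA_mul_center_diag (ψ : AddChar F Circle) {a : Eˣ} (ha : (a : E) = S.α) (c : Fˣ)
    (x l : AA F B) :
    psiA ψ (x * (toA (centerHom F B (c, c) * S.diag a) * l)) = ψ (c * formT S (l * x)) := by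
  have e1 : (toA (centerHom F B (c, c) * S.diag a)).1 = (c : F) • S.ι₁ S.α := by
    rw [smul_def, ← ha]; rfl
  have e2 : (toA (centerHom F B (c, c) * S.diag a)).2 = (c : F) • S.ι₂ S.α := by
    rw [smul_def, ← ha]; rfl
  rw [D.psiA_mul_comm, psiA, fst_mul, snd_mul, fst_mul, snd_mul, e1, e2,
    smul_mul_assoc, smul_mul_assoc, smul_mul_assoc, smul_mul_assoc, trace_smul,
    D.quatB.tr_smul, ← Circle.coe_mul, ← map_add_eq_mul, formT, mul_sub, smul_eq_mul,
    sub_eq_add_neg, fst_mul, snd_mul, mul_assoc, mul_assoc]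

lemma smul_mem_ideal {r : F} (hr : normF F r ≤ 1) {l : AA F B} (hl : l ∈ 𝓙) : r • l ∈ 𝓙 := by
  have h1 := D.diag_mem_cell (i := 0) (j := S.n) (m := S.n) (e := algebraMap F E r) (by
    rw [D.quatE.nrm_algebraMap, pow_zero]; exact pow_le_one₀ (normF_nonneg _) hr)
  have e : r • l = (S.ι₁ (algebraMap F E r), S.ι₂ (algebraMap F E r)) * l := by
    rw [commutes, commutes]
    exact Prod.ext (smul_def _ _) (smul_def _ _)
  rw [e]
  exact D.cell_mul_left (by omega) le_rfl (by omega) le_rfl (by omega) h1 hl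

variable (μ : Measure (AA F B)) [μ.IsAddHaarMeasure]

variable (hψF : TrivialOnMax ψF) {ψ : AddChar F Circle} {c : Fˣ}
  (hc : ∀ x : F, normF F x ≤ 1 → ψ (c * x) = ψF (-x)) {a : Eˣ} (ha : (a : E) = S.α)
include hψF hc ha

lemma psiA_mul_eq {x l : AA F B} (hlx : l * x ∈ 𝓞) :
    psiA ψ (x * (toA (centerHom F B (c, c) * S.diag a) * l)) = ψF (-formT S (l * x)) := by
  rw [D.psiA_mul_center_diag ψ ha, hc _ (D.normF_formT_le hlx)]

variable (hB : finrank F B = 4) (hψF' : NontrivialOnInt ψF) {θ : S.linkingUnits → ℂ}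
  (hθ : ∀ h, ∀ k ∈ D.redKer, θ (h * k) = θ h)
  (hθ' : ∀ h : S.linkingUnits, ∀ x ∈ depthSet S, ∃ h' : S.linkingUnits, toA h'.1 = toA h.1 * (1 + x) ∧ θ h' = ψF (formT S x) * θ h)
include hB hψF' hθ hθ'

/-- The Fourier transform of a function on the linking units is supported on a coset. -/
lemma fourier_unitExt_eq_zero {z : AA F B}
    (hz : ∀ h : 𝓛, z ≠ toA (centerHom F B (c, c) * S.diag a * h.1)) :
    ∫ x, unitExt S θ x * psiA ψ (x * z) ∂μ = 0 := by
  set w := centerHom F B (c, c) * S.diag a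
  obtain ⟨x₀, hx₀, hψx₀⟩ := D.exists_char_ne hψF'
  have hψx₀' : (ψF x₀ : ℂ) ≠ 1 := fun h => hψx₀ (Subtype.ext h)
  obtain ⟨l, rfl⟩ : ∃ l, z = toA w * l := ⟨toA w⁻¹ * z, (toA_inv_mul w z).symm⟩
  by_cases hl : l ∈ 𝓞
  · have hl1 : nrm nrE (p₁ l.1) < 1 := by
      by_contra hlt
      obtain ⟨g, hg, rfl⟩ := D.exists_unit hl (le_antisymm (by simpa using hl.1) (not_lt.1 hlt))
      exact hz ⟨g, hg⟩ (toA_mul w g).symm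
    obtain ⟨y, hy, hxy⟩ := D.exists_trace_mul (γ := S.α * t ^ S.n * 1)
      (by rw [D.nrm_α_mul, D.quatE.nrm_one]) hx₀
    rw [mul_one] at hxy
    have hd := D.depth_left_E hy
    set d : AA F B := (S.ι₁ (t ^ S.n * y), 0)
    have hfd : formT S d = x₀ := by
      have := D.formT_mul_left_E 1 (t ^ S.n * y)
      rw [one_mul, fst_one, D.side₁.pr_one, mul_one, ← mul_assoc, hxy] at this
      exact this
    obtain ⟨u, hu, -⟩ := hθ' 1 d hd
    rw [coe_one, toA_one, one_mul] at hu
    refine eq_zero_of_eq_mul hψx₀' ?_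
    rw [← integral_const_mul]
    rw [integral_rmul D.quatB D.redTrace_ne hB μ u.1, D.modulus_of_unit,
      Complex.ofReal_one, one_mul]
    congr 1
    funext x
    by_cases hx : x ∈ unitSet S
    · obtain ⟨g, hg, rfl⟩ := hx
      lift g to 𝓛 using hg
      obtain ⟨h', hh', hθh⟩ := hθ' g d hd
      have hh2 : h' = g * u := Subtype.ext (toA_injective (by rw [hh', coe_mul, toA_mul, hu]))
      have hlg : l * toA g.1 ∈ 𝓞 :=
        D.cell_mul_left (Nat.zero_le _) le_rfl (by omega) (by omega) le_rfl hl (D.order_of_unit g)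
      have hlgu : l * toA (g * u).1 ∈ 𝓞 :=
        D.cell_mul_left (Nat.zero_le _) le_rfl (by omega) (by omega) le_rfl hl (D.order_of_unit _)
      rw [← toA_mul, ← coe_mul, unitExt_apply, unitExt_apply, ← hh2, hθh, hfd, hh2,
        D.psiA_mul_eq hψF hc ha hlg, D.psiA_mul_eq hψF hc ha hlgu, mul_assoc]
      have e : ψF (-formT S (l * toA (g * u).1)) = ψF (-formT S (l * toA g.1)) := by
        refine D.char_congr hψF ?_
        rw [neg_sub_neg, ← D.formT_sub, ← neg_sub, D.formT_neg, normF_neg, coe_mul,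
          toA_mul, ← mul_sub, hu]
        rw [← mul_sub_one, add_sub_cancel_left, ← mul_assoc, D.formT_mul_left_E, ← mul_assoc,
          mul_assoc _ y, mul_comm y]
        refine D.quatE.normF_tr_lt_one ?_
        rw [← mul_assoc, mul_assoc, D.nrm_α_mul, D.quatE.nrm_mul]
        refine (mul_le_of_le_one_right (nrm_nonneg _ _) hy).trans_lt ?_
        rw [← sub_add_cancel (p₁ (l * toA g.1).1) (p₁ l.1 * p₁ (toA g.1).1)]
        refine (D.quatE.nrm_add_le _ _).trans_lt (max_lt (D.pr_mul_lt hl (D.order_of_unit g)) ?_)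
        rw [D.quatE.nrm_mul, D.nrm_of_unit, mul_one]
        exact hl1
      rw [e]
    · have hxu : x * toA u.1 ∉ unitSet S := fun ⟨g, hg, e⟩ => hx
        ⟨g * u.1⁻¹, mul_mem hg (inv_mem u.2), by
          rw [toA_mul, e, mul_assoc, ← toA_mul, mul_inv_cancel, toA_one, mul_one]⟩
      rw [unitExt_of_notMem _ hx, unitExt_of_notMem _ hxu, zero_mul, zero_mul, mul_zero]
  · have hl' : ∃ l₀ ∈ 𝓙, 1 ≤ normF F (formT S (l * l₀)) := by
      by_contra! h
      exact hl (D.mem_order_of_dual h)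
    obtain ⟨l₀, hl₀, h1⟩ := hl'
    have h0 : formT S (l * l₀) ≠ 0 := fun h => by
      rw [h, normF_eq_zero.2 rfl] at h1; exact absurd h1 (by norm_num)
    set r := -x₀ / formT S (l * l₀)
    have hr : normF F r ≤ 1 := by
      rw [normF_div, normF_neg]
      exact div_le_one_of_le₀ (hx₀.trans h1) (normF_nonneg _)
    have hrl := D.smul_mem_ideal hr hl₀
    have hT : formT S (l * (r • l₀)) = -x₀ := by
      rw [mul_smul_comm, D.formT_smul, div_mul_cancel₀ _ h0]
    refine eq_zero_of_eq_mul hψx₀' ?_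
    rw [← integral_const_mul]
    rw [← integral_add_right_eq_self _ (r • l₀)]
    congr 1
    funext x
    rw [D.unitExt_add hθ x hrl, add_mul, psiA_add D.quatB,
      D.psiA_mul_center_diag ψ ha c (r • l₀), hT, hc _ (by rwa [normF_neg]), neg_neg]
    ring

lemma fourier_unitExt (h₀ : 𝓛) [Fintype (𝓛 ⧸ D.redKer)] :
    ∫ x, unitExt S θ x * psiA ψ (x * toA (centerHom F B (c, c) * S.diag a * h₀.1)) ∂μ =
      μ.real (𝓙) * ∑ q : 𝓛 ⧸ D.redKer,
        θ q.out * ψF (-formT S (toA ((h₀ * q.out : 𝓛) : GG F B))) := by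
  set θ' : 𝓛 → ℂ := fun h => θ h * ψF (-formT S (toA (h₀ * h).1))
  rw [← D.integral_unitExt μ (θ := θ')]
  · congr 1
    funext x
    by_cases hx : x ∈ unitSet S
    · obtain ⟨g, hg, rfl⟩ := hx
      lift g to 𝓛 using hg
      rw [unitExt_apply, unitExt_apply, toA_mul, D.psiA_mul_eq hψF hc ha]
      · rw [← toA_mul, ← coe_mul]
      · rw [← toA_mul, ← coe_mul]
        exact D.order_of_unit _
    · rw [unitExt_of_notMem _ hx, unitExt_of_notMem _ hx, zero_mul]
  · intro h k hk
    have e : ψF (-formT S (toA ((h₀ * (h * k) : 𝓛) : GG F B))) =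
        ψF (-formT S (toA (h₀ * h).1)) := by
      refine D.char_congr hψF ?_
      rw [neg_sub_neg, ← neg_sub, normF_neg, ← mul_assoc]
      exact D.formT_mul_mem _ k hk
    simp only [θ']
    rw [hθ h k hk, e]

end Setup

namespace Setup

include D

lemma centerHom_eq_diag (c : Fˣ) :
    centerHom F B (c, c) = S.diag (Units.map (algebraMap F E : F →* E) c) :=
  Prod.ext (Units.ext (S.ι₁.commutes _).symm) (Units.ext (S.ι₂.commutes _).symm)

lemma norms_diag (e : Eˣ) :
    norm₁ (S.diag e) = nrm nrE (e : E) ∧ norm₂ (S.diag e) = nrm nrE (e : E) :=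
  ⟨congrArg (normF F) (D.side₁.nr_ι _), congrArg (normF F) (D.side₂.nr_ι _)⟩

variable (hσ : S.IsRhoS ψF σ)
include hσ

lemma coeff_mul_ker (l : V →ₗ[ℂ] ℂ) (v : V) (h : 𝓛) :
    ∀ k ∈ D.redKer, l (σ (h * k) v) = l (σ h v) := fun k hk => by
  rw [map_mul, D.apply_redKer hσ hk, mul_one]

lemma coeff_mul_depth (l : V →ₗ[ℂ] ℂ) (v : V) (h : 𝓛) : ∀ x ∈ depthSet S, ∃ h' : 𝓛,
      toA h'.1 = toA h.1 * (1 + x) ∧ l (σ h' v) = ψF (formT S x) * l (σ h v) := fun x hx => by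
  obtain ⟨h', e1, e2⟩ := D.exists_mul_depth hσ h hx
  exact ⟨h', e1, by rw [e2, LinearMap.smul_apply, map_smul, smul_eq_mul]⟩

variable (μ : Measure (AA F B)) [μ.IsAddHaarMeasure] (hψF : TrivialOnMax ψF)
  {ψ : AddChar F Circle} {c : Fˣ} (hc : ∀ x : F, normF F x ≤ 1 → ψ (c * x) = ψF (-x)) {a : Eˣ}
  (ha : (a : E) = S.α) (hB : finrank F B = 4) (hψF' : NontrivialOnInt ψF)
include hψF hc ha hB hψF'

lemma fourier_coeff (l : V →ₗ[ℂ] ℂ) (v : V) (h₀ : 𝓛) [Fintype (𝓛 ⧸ D.redKer)] :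
    ∫ x, unitExt S (fun h => l (σ h v)) x *
        psiA ψ (x * toA (centerHom F B (c, c) * S.diag a * h₀.1)) ∂μ =
      μ.real (𝓙) * l (σ h₀⁻¹ (D.gauss ψF σ v)) := by
  rw [D.fourier_unitExt μ hψF hc ha hB hψF' (D.coeff_mul_ker hσ l v) (D.coeff_mul_depth hσ l v)]
  congr 1
  set f : 𝓛 → ℂ := fun h => (ψF (-formT S (toA h.1)) : ℂ) * l (σ (h₀⁻¹ * h) v)
  have hf : ∀ h, ∀ k ∈ D.redKer, f (h * k) = f h := fun h k hk => by
    have e : ψF (-formT S (toA (h * k).1)) = ψF (-formT S (toA h.1)) := by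
      refine D.char_congr hψF ?_
      rw [neg_sub_neg, ← neg_sub, normF_neg]
      exact D.formT_mul_mem _ k hk
    simp only [f]
    rw [e, ← mul_assoc, D.coeff_mul_ker hσ l v _ k hk]
  trans ∑ q : 𝓛 ⧸ D.redKer, f (h₀ * q.out)
  · refine sum_congr rfl fun q _ => ?_
    simp only [f]
    rw [inv_mul_cancel_left, mul_comm]
  · rw [sum_out_mul_left hf, gauss, LinearMap.sum_apply, _root_.map_sum, _root_.map_sum]
    refine sum_congr rfl fun q _ => ?_
    simp only [f]
    rw [LinearMap.smul_apply, map_smul, map_smul, smul_eq_mul, map_mul]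
    rfl

lemma dualGauss_mul_gauss (hμ : IsSelfDual ψ μ) [FiniteDimensional ℂ V] [Fintype (𝓛 ⧸ D.redKer)] :
    ((μ.real (𝓙) ^ 2 *
      modulus (centerHom F B (c, c) * S.diag a) : ℝ) : ℂ) •
      (D.dualGauss ψF σ * D.gauss ψF σ) = 1 := by
  set w := centerHom F B (c, c) * S.diag a
  set κ := μ.real (𝓙)
  refine LinearMap.ext fun v => sub_eq_zero.1
    ((Module.forall_dual_apply_eq_zero_iff ℂ _).1 fun l => ?_)
  rw [map_sub, sub_eq_zero]
  set Φ := unitExt S (fun h => l (σ h v))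
  have hper : ∀ x, ∀ y ∈ 𝓙, Φ (x + y) = Φ x := fun x y hy =>
    D.unitExt_add (D.coeff_mul_ker hσ l v) x hy
  have hloc : IsLocallyConstant Φ := (IsLocallyConstant.iff_eventually_eq Φ).2 fun x => by
    filter_upwards [((D.isOpen_cell subset_rfl).preimage
      (f := fun y : AA F B => y - x) (by fun_prop)).mem_nhds (by
        change x - x ∈ 𝓙; rw [sub_self]; exact D.zero_mem_ideal)] with y hy
    have := hper x _ hy
    rwa [add_sub_cancel] at this
  have h := hμ Φ hloc (HasCompactSupport.intro D.isCompact_unitSet fun x hx =>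
    unitExt_of_notMem _ hx) (-1)
  have h1 : Φ (- -1) = l v := by
    rw [neg_neg, ← toA_one, ← coe_one 𝓛]
    refine (unitExt_apply _ _).trans ?_
    rw [map_one]; rfl
  have e : (fun y => (∫ z, Φ z * psiA ψ (z * (toA w * y)) ∂μ) * psiA ψ (toA w * y * -1)) =
      unitExt S fun h => κ * l (σ h⁻¹ (D.gauss ψF σ v)) * ψF (formT S (toA h.1)) := by
    funext y
    by_cases hy : y ∈ unitSet S
    · obtain ⟨g, hg, rfl⟩ := hy
      lift g to 𝓛 using hg
      have hg : toA g.1 * -1 ∈ 𝓞 := by rw [mul_neg, mul_one]; exact D.cell_neg (D.order_of_unit g)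
      rw [unitExt_apply, ← toA_mul, D.fourier_coeff hσ μ hψF hc ha hB hψF',
        D.psiA_mul_comm, toA_mul, D.psiA_mul_eq hψF hc ha hg, mul_neg, mul_one, D.formT_neg,
        neg_neg]
    · rw [unitExt_of_notMem _ hy, D.fourier_unitExt_eq_zero μ hψF hc ha hB hψF'
        (D.coeff_mul_ker hσ l v) (D.coeff_mul_depth hσ l v), zero_mul]
      intro h hh
      refine hy ⟨h, h.2, ?_⟩
      rw [toA_mul w] at hh
      rw [← one_mul (toA h.1), ← one_mul y, ← toA_one, ← inv_mul_cancel w,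
        toA_mul w⁻¹ w, mul_assoc, mul_assoc, hh]
  rw [integral_lmul D.quatB D.redTrace_ne hB μ w, e, h1, D.integral_unitExt μ] at h
  · rw [LinearMap.smul_apply, map_smul, End.mul_apply, dualGauss, LinearMap.sum_apply,
      _root_.map_sum, End.one_apply, ← h, smul_eq_mul]
    push_cast
    rw [mul_sum, mul_sum, mul_sum]
    refine sum_congr rfl fun q _ => ?_
    rw [LinearMap.smul_apply, map_smul, smul_eq_mul]
    ring
  · intro h k hk
    have e1 : ψF (formT S (toA (h * k).1)) =
        ψF (formT S (toA h.1)) := D.char_congr hψF (D.formT_mul_mem h k hk)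
    rw [e1, mul_inv_rev, map_mul, D.apply_redKer hσ (inv_mem hk), one_mul]

/-- The Fourier transform of the coefficients of `σ`. -/
lemma exists_fourier_coeff (hμ : IsSelfDual ψ μ) [FiniteDimensional ℂ V]
    {ω : Fˣ →* ℂˣ} {ρ : Representation ℂ S.K V} (hρ : S.IsRhoExt ω σ ρ)
    (hα : HasOrd F S.α (-S.n)) :
    ∃ (w : S.K) (A : ℝ), 0 < A ∧ norm₁ w.1 = A ∧ norm₂ w.1 = A ∧ ∀ (l : V →ₗ[ℂ] ℂ) (v : V),
      (∀ z : AA F B, (∀ h : 𝓛, z ≠ toA (w.1 * h.1)) →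
        ∫ x, unitExt S (fun h => l (σ h v)) x * psiA ψ (x * z) ∂μ = 0) ∧
      ∀ h : 𝓛, ∫ x, unitExt S (fun h => l (σ h v)) x * psiA ψ (x * toA (w.1 * h.1)) ∂μ =
          -((A ^ 2)⁻¹ : ℝ) * l (σ h⁻¹ (ρ w⁻¹ v)) := by
  haveI := D.finite_reduction hB
  letI := ofFinite (𝓛 ⧸ D.redKer)
  have hk : S.diag a ∈ S.K := mem_sup_left (Subgroup.mem_sup_right ⟨a, rfl⟩)
  have hz : centerHom F B (c, c) ∈ S.K := mem_sup_left (mem_sup_left ⟨_, rfl⟩)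
  set A : ℝ := nrm nrE ((Units.map (algebraMap F E : F →* E) c * a : Eˣ) : E)
  have hA : 0 < A := D.quatE.nrm_pos (Units.ne_zero _)
  have hn := D.norms_diag (Units.map (algebraMap F E : F →* E) c * a)
  rw [map_mul, ← D.centerHom_eq_diag] at hn
  set κ := μ.real (𝓙)
  have hκ : 0 < κ := D.measure_ideal_pos μ
  have hρz : ρ (⟨_, hz⟩ : S.K)⁻¹ = 1 := by
    rw [hρ.central _ (c⁻¹, c⁻¹) (by rw [Subgroup.coe_inv, ← map_inv]; rfl), inv_inv,
      inv_mul_cancel, map_one, Units.val_one, one_smul]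
  have hρw : ρ (⟨_, mul_mem hz hk⟩ : S.K)⁻¹ = ρ (⟨_, hk⟩ : S.K)⁻¹ := by
    have e : (⟨_, mul_mem hz hk⟩ : S.K) = ⟨_, hz⟩ * ⟨_, hk⟩ := rfl
    rw [e, mul_inv_rev, map_mul, hρz, mul_one]
  refine ⟨⟨_, mul_mem hz hk⟩, A, hA, hn.1, hn.2, fun l v => ⟨fun z hzz =>
    D.fourier_unitExt_eq_zero μ hψF hc ha hB hψF' (D.coeff_mul_ker hσ l v)
      (D.coeff_mul_depth hσ l v) hzz, fun h => ?_⟩⟩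
  rw [hρw]
  refine (D.fourier_coeff hσ μ hψF hc ha hB hψF' l v h).trans ?_
  have h1 := D.dualGauss_mul_gauss hσ μ hψF hc ha hB hψF' hμ
  have hm : modulus (centerHom F B (c, c) * S.diag a) = A ^ 4 := by rw [modulus, hn.1, hn.2]; ring
  have hC : (κ ^ 2 * A ^ 4 : ℝ) = (((κ * A ^ 2)⁻¹ : ℝ) ^ 2)⁻¹ := by rw [inv_pow, inv_inv]; ring
  have hC0 : (κ * A ^ 2)⁻¹ ≠ 0 := by positivity
  rw [hm, hC] at h1
  have h2 : D.dualGauss ψF σ * D.gauss ψF σ =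
      ((((κ * A ^ 2)⁻¹ : ℝ) ^ 2 : ℝ) : ℂ) • (1 : End ℂ V) := by
    rw [← h1, smul_smul, ← Complex.ofReal_mul, mul_inv_cancel₀ (pow_ne_zero 2 hC0),
      Complex.ofReal_one, one_smul]
  have h3 := D.gauss_eq hσ hψF hψF' hρ hα (k := ⟨_, hk⟩) ha rfl (inv_pos.2 (by positivity)) h2
  rw [h3, LinearMap.smul_apply, map_smul, map_smul, smul_eq_mul, ← mul_assoc]
  congr 1
  rw [mul_neg, ← Complex.ofReal_mul, mul_inv, mul_inv_cancel_left₀ hκ.ne']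

end Setup

section Induction

variable {G V : Type*} [Group G] [TopologicalSpace G] [IsTopologicalGroup G] [AddCommGroup V]
  [Module ℂ V] {K : Subgroup G} {ρ : Representation ℂ K V}
  (hρ : ∃ U : Subgroup G, IsOpen (U : Set G) ∧ ∀ k : K, (k : G) ∈ U → ρ k = 1)

open Classical in
/-- The functions in the compact induction of `ρ` that are supported on `K`. -/
noncomputable def cIndOf (hK : IsOpen (K : Set G)) : V →ₗ[ℂ] cIndSpace K ρ where
  toFun v := ⟨fun x => if h : x ∈ K then ρ ⟨x, h⟩ v else 0, by
    obtain ⟨U, hU, hUρ⟩ := hρ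
    refine ⟨fun k x => ?_, ⟨U ⊓ K, hU.inter hK, fun u hu x => ?_⟩,
      ⟨{1}, isCompact_singleton, fun x hx => ⟨x, ?_, 1, rfl, (mul_one x).symm⟩⟩⟩
    · beta_reduce
      by_cases hx : x ∈ K
      · rw [dif_pos hx, dif_pos (mul_mem k.2 hx), ← End.mul_apply, ← map_mul]; rfl
      · rw [dif_neg hx, dif_neg fun h => hx ((Subgroup.mul_mem_cancel_left K k.2).1 h), map_zero]
    · beta_reduce
      by_cases hx : x ∈ K
      · have e : (⟨x * u, mul_mem hx hu.2⟩ : K) = ⟨x, hx⟩ * ⟨u, hu.2⟩ := rfl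
        rw [dif_pos hx, dif_pos (mul_mem hx hu.2), e, map_mul, hUρ ⟨u, hu.2⟩ hu.1, mul_one]
      · rw [dif_neg hx, dif_neg fun h => hx ((Subgroup.mul_mem_cancel_right K hu.2).1 h)]
    · by_contra h
      exact hx (dif_neg h)⟩
  map_add' _ _ := Subtype.ext (funext fun x => by by_cases hx : x ∈ K <;> simp [hx])
  map_smul' _ _ := Subtype.ext (funext fun x => by by_cases hx : x ∈ K <;> simp [hx])

variable (hK : IsOpen (K : Set G))

lemma cIndOf_apply_of_mem (v : V) {x : G} (hx : x ∈ K) :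
    (cIndOf hρ hK v).1 x = ρ ⟨x, hx⟩ v := dif_pos hx

lemma cIndOf_apply_of_notMem (v : V) {x : G} (hx : x ∉ K) : (cIndOf hρ hK v).1 x = 0 := dif_neg hx

lemma cInd_cIndOf (k : K) (v : V) : cInd K ρ k (cIndOf hρ hK v) = cIndOf hρ hK (ρ k v) := by
  ext x
  change (cIndOf hρ hK v).1 (x * k) = _
  by_cases hx : x ∈ K
  · rw [cIndOf_apply_of_mem hρ hK v (mul_mem hx k.2), cIndOf_apply_of_mem hρ hK _ hx,
      ← End.mul_apply, ← map_mul]; rfl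
  · rw [cIndOf_apply_of_notMem hρ hK v fun h => hx ((Subgroup.mul_mem_cancel_right K k.2).1 h),
      cIndOf_apply_of_notMem hρ hK _ hx]

lemma exists_eq_sum_cInd (φ : cIndSpace K ρ) : ∃ Q : Finset (G ⧸ K),
    φ = ∑ q ∈ Q, cInd K ρ q.out (cIndOf hρ hK (φ.1 q.out⁻¹)) := by
  classical
  obtain ⟨h1, -, ⟨C, hC, h3⟩⟩ := φ.2
  haveI := QuotientGroup.discreteTopology hK
  have hfin : ((fun c : G => (QuotientGroup.mk c⁻¹ : G ⧸ K)) '' C).Finite :=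
    (hC.image (continuous_quotient_mk'.comp continuous_inv)).finite_of_discrete
  refine ⟨hfin.toFinset, Subtype.ext (funext fun x => ?_)⟩
  have e : (∑ q ∈ hfin.toFinset, cInd K ρ q.out (cIndOf hρ hK (φ.1 q.out⁻¹))).1 x =
      ∑ q ∈ hfin.toFinset, (cIndOf hρ hK (φ.1 q.out⁻¹)).1 (x * q.out) := by
    rw [AddSubmonoidClass.coe_finsetSum, Finset.sum_apply]; rfl
  rw [e]
  have hterm : ∀ q : G ⧸ K, (cIndOf hρ hK (φ.1 q.out⁻¹)).1 (x * q.out) =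
      if q = QuotientGroup.mk x⁻¹ then φ.1 x else 0 := fun q => by
    have hiff : q = QuotientGroup.mk x⁻¹ ↔ x * q.out ∈ K := by
      conv_lhs => rw [← QuotientGroup.out_eq' q, eq_comm, QuotientGroup.eq, inv_inv]
    split_ifs with hq
    · rw [cIndOf_apply_of_mem hρ hK _ (hiff.1 hq), ← h1 ⟨_, hiff.1 hq⟩, mul_inv_cancel_right]
    · exact cIndOf_apply_of_notMem hρ hK _ fun h => hq (hiff.2 h)
  simp only [hterm, Finset.sum_ite_eq']
  split_ifs with hx
  · rfl
  · by_contra hne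
    obtain ⟨k, hk, c, hc, e⟩ := h3 x hne
    refine hx (hfin.mem_toFinset.2 ⟨c, hc, ?_⟩)
    rw [QuotientGroup.eq, e]
    simpa using hk

/-- Functions `g ↦ lam (g * a) v`, where `lam` transforms under `K` on the right through `ρ` and
is invariant on the left under an open subgroup. -/
structure IsShift (K : Subgroup G) (ρ : Representation ℂ K V) (lam : G → V →ₗ[ℂ] ℂ) : Prop where
  mul_right : ∀ g (k : K), lam (g * k) = lam g ∘ₗ ρ k
  smooth : ∃ U : Subgroup G, IsOpen (U : Set G) ∧ ∀ u ∈ U, ∀ g, lam (u * g) = lam g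

include hρ hK in
lemma matrixCoeffs_le : matrixCoeffs (cInd K ρ) ≤ Submodule.span ℂ
    {f | ∃ lam : G → V →ₗ[ℂ] ℂ, IsShift K ρ lam ∧ ∃ a v, f = fun g => lam (g * a) v} := by
  refine Submodule.span_le.2 ?_
  rintro _ ⟨w', w, ⟨U, hU, hw'⟩, rfl⟩
  obtain ⟨Q, hQ⟩ := exists_eq_sum_cInd hρ hK w
  set lam : G → V →ₗ[ℂ] ℂ := fun g => w' ∘ₗ cInd K ρ g ∘ₗ cIndOf hρ hK
  have hlam : IsShift K ρ lam := by
    refine ⟨fun g k => LinearMap.ext fun v => ?_, U, hU, fun u hu g => LinearMap.ext fun v => ?_⟩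
    · change w' (cInd K ρ (g * k) _) = w' (cInd K ρ g (cIndOf hρ hK (ρ k v)))
      rw [map_mul, End.mul_apply, cInd_cIndOf]
    · change w' (cInd K ρ (u * g) _) = w' (cInd K ρ g _)
      rw [map_mul, End.mul_apply, hw' u hu]
  have e : (fun g => w' (cInd K ρ g w)) = ∑ q ∈ Q, fun g => lam (g * q.out) (w.1 q.out⁻¹) := by
    funext g
    rw [Finset.sum_apply]
    conv_lhs => rw [hQ]
    rw [_root_.map_sum, _root_.map_sum]
    refine sum_congr rfl fun q _ => ?_
    change _ = w' (cInd K ρ (g * q.out) _)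
    rw [map_mul, End.mul_apply]
  rw [SetLike.mem_coe, e]
  exact Submodule.sum_mem _ fun q _ => Submodule.subset_span ⟨lam, hlam, _, _, rfl⟩

end Induction

variable {ω : Fˣ →* ℂˣ} {ρ : Representation ℂ S.K V} {lam : GG F B → V →ₗ[ℂ] ℂ}

section Extension

lemma extZero_toA (Φ : GG F B → ℂ) (g : GG F B) : extZero Φ (toA g) = Φ g :=
  Setup.toA_injective.extend_apply _ _ _

lemma extZero_of_notMem (Φ : GG F B → ℂ) {x : AA F B} (hx : ∀ g, x ≠ toA g) : extZero Φ x = 0 :=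
  Function.extend_apply' _ _ _ fun ⟨g, hg⟩ => hx g hg.symm

lemma exists_toA_or (x : AA F B) : (∃ g, x = toA g) ∨ ∀ g, x ≠ toA g :=
  (em _).imp_right not_exists.1

lemma extZero_mul_right (Φ : GG F B → ℂ) (x : AA F B) (a : GG F B) :
    extZero Φ (x * toA a) = extZero (fun g => Φ (g * a)) x := by
  obtain ⟨g, rfl⟩ | hx := exists_toA_or x
  · rw [← toA_mul, extZero_toA, extZero_toA]
  · rw [extZero_of_notMem _ hx, extZero_of_notMem _ fun g hg => hx (g * a⁻¹)
      (by rw [toA_mul, ← hg, toA_cancel_right (mul_inv_cancel a)])]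

lemma extZero_mul_left (Φ : GG F B → ℂ) (x : AA F B) (a : GG F B) :
    extZero Φ (toA a * x) = extZero (fun g => Φ (a * g)) x := by
  obtain ⟨g, rfl⟩ | hx := exists_toA_or x
  · rw [← toA_mul, extZero_toA, extZero_toA]
  · rw [extZero_of_notMem _ hx, extZero_of_notMem _ fun g hg => hx (a⁻¹ * g)
      (by rw [toA_mul, ← hg, toA_cancel_left (inv_mul_cancel a)])]

lemma psiA_fst (hQ : IsQuat (F := F) (A := B) redTrace redNorm) (ψ : AddChar F Circle) (x : M2 F) :
    psiA ψ ((x, 0) : AA F B) = ψ x.trace := by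
  simp [psiA, hQ.tr_zero]

lemma psiA_snd (ψ : AddChar F Circle) (x : B) : psiA ψ ((0, x) : AA F B) = ψ (-redTrace x) := by
  simp [psiA]

open Classical in
/-- The restriction of a function on a group to a coset, extended by zero. -/
noncomputable def cosetPart {G : Type*} [Group G] {H : Subgroup G} (c : G ⧸ H) (Φ : G → ℂ) :
    G → ℂ :=
  fun g => if QuotientGroup.mk g = c then Φ g else 0

lemma indicator_cosetSet {H : Subgroup (GG F B)} (ψ : AddChar F Circle) (Φ : GG F B → ℂ)
    (y : AA F B) (c : GG F B ⧸ H) :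
    (cosetSet c).indicator (fourierIntegrand ψ Φ y) = fourierIntegrand ψ (cosetPart c Φ) y := by
  classical
  funext x
  obtain ⟨g, rfl⟩ | hx := exists_toA_or x
  · have : toA g ∈ cosetSet c ↔ QuotientGroup.mk g = c :=
      ⟨fun ⟨g', h, e⟩ => Setup.toA_injective e ▸ h, fun h => ⟨g, h, rfl⟩⟩
    simp [Set.indicator_apply, fourierIntegrand, extZero_toA, cosetPart, this]
  · simp [Set.indicator, fourierIntegrand, extZero_of_notMem _ hx]

end Extension

namespace Setup

include D

lemma norms_mul_unit (g : GG F B) {h : GG F B} (hh : h ∈ 𝓛) :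
    norm₁ (g * h) = norm₁ g ∧ norm₂ (g * h) = norm₂ g := by
  obtain ⟨h1, h2⟩ := D.norms_of_unit ⟨h, hh⟩
  rw [norm₁_mul, norm₂_mul D.quatB]
  exact ⟨by rw [h1, mul_one], by rw [h2, mul_one]⟩

lemma smul_mem_depthSet {r : F} (hr : normF F r ≤ 1) {X : M2 F} (hX : X ∈ S.chain.rad S.n) :
    ((r • X, 0) : AA F B) ∈ depthSet S := by
  refine ⟨?_, ?_⟩
  · have := D.chain.smul_mem_rad (r := r) (j := 0) hX
      (by rw [zpow_zero]; exact pow_le_one₀ (normF_nonneg _) hr)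
    simpa using this
  · rw [D.mem_radB_n', D.quatB.nrm_zero]
    exact pow_nonneg D.t_pos.le _

lemma formT_smul_of_trace {r : F} {X : M2 F} (hX : (S.ι₁ S.α * X).trace = 1) :
    formT S ((r • X, 0) : AA F B) = r := by
  rw [formT, mul_smul_comm, trace_smul, hX, mul_zero, D.quatB.tr_zero, sub_zero,
    smul_eq_mul, mul_one]

variable (hσ : S.IsRhoS ψF σ) (hρ : S.IsRhoExt ω σ ρ)
include hσ hρ

lemma exists_depth_unit (hlam : IsShift S.K ρ lam) {x : AA F B} (hx : x ∈ depthSet S) :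
    ∃ u ∈ 𝓛, toA u = 1 + x ∧ ∀ g, lam (g * u) = (ψF (formT S x) : ℂ) • lam g := by
  obtain ⟨u, hu, e⟩ := D.exists_mul_depth hσ 1 hx
  rw [coe_one, toA_one, one_mul] at hu
  refine ⟨u, u.2, hu, fun g => ?_⟩
  have := hlam.mul_right g (inclusion S.linkingUnits_le_K u)
  rw [hρ.extends_σ, e, map_one] at this
  exact this.trans (LinearMap.ext fun v => by simp)

lemma exists_smooth : ∃ U : Subgroup (GG F B), IsOpen (U : Set (GG F B)) ∧
    ∀ k : S.K, k.1 ∈ U → ρ k = 1 := by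
  refine ⟨_, D.isOpen_map_redKer, ?_⟩
  rintro k ⟨h, hh, e⟩
  have : k = inclusion S.linkingUnits_le_K h := Subtype.ext e.symm
  rw [this, hρ.extends_σ, D.apply_redKer hσ hh]

variable (hψF' : NontrivialOnInt ψF)
include hψF'

lemma eq_zero_of_smul {z : Circle} (hz : z ≠ 1) {l : V →ₗ[ℂ] ℂ} (h : l = (z : ℂ) • l) : l = 0 := by
  ext v
  exact eq_zero_of_eq_mul (fun hz' => hz (Subtype.ext hz')) (LinearMap.congr_fun h v)

/-- The support of the coefficients is bounded modulo the centre. -/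
lemma exists_support_bound (hlam : IsShift S.K ρ lam) :
    ∃ C > 0, ∀ g : GG F B, lam g ≠ 0 → size₁ g.1.1 ≤ C * norm₁ g := by
  obtain ⟨U, hU, hUl⟩ := hlam.smooth
  obtain ⟨ε, hε, -, hεU⟩ := exists_congruence D.quatB D.redTrace_ne hU
  obtain ⟨R, hR, hRn⟩ := D.exists_size₁_bound S.n
  obtain ⟨x₀, hx₀, hψx₀⟩ := D.exists_char_ne hψF'
  obtain ⟨k, hs, hk, -⟩ := D.s_eq
  have hq := one_lt_resCard F
  obtain ⟨m, hm⟩ : ∃ m : ℕ, R * (resCard F ^ m)⁻¹ ≤ ε := by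
    obtain ⟨m, hm⟩ := pow_unbounded_of_one_lt (R / ε) hq
    refine ⟨m, ?_⟩
    rw [div_lt_iff₀ hε] at hm
    rw [← div_eq_mul_inv, div_le_iff₀ (pow_pos (resCard_pos F) _)]
    linarith
  have key : ∀ d : ℤ, ∃ R' > 0, ∀ g : GG F B, lam g ≠ 0 → norm₁ g = resCard F ^ d →
      size₁ g.1.1 ≤ R' := by
    intro d
    obtain ⟨j, hj⟩ := D.chain.exists_nilpotent_small_or_bounded hs hk m d
    obtain ⟨R', hR', hR'j⟩ := D.exists_size₁_bound j
    refine ⟨R', hR', fun g hg hd => hR'j _ ?_⟩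
    refine (hj g.1 hd).resolve_left ?_
    rintro ⟨X, hX, -, hXt, b, Y, hY, hb, hbY⟩
    refine hg (D.eq_zero_of_smul hσ hρ hψF' hψx₀ ?_)
    obtain ⟨u, -, hu, hlu⟩ := D.exists_depth_unit hσ hρ hlam (D.smul_mem_depthSet hx₀ hX)
    rw [D.formT_smul_of_trace hXt] at hlu
    obtain ⟨u', hu', e⟩ := hεU (((x₀ * b) • Y, 0) : AA F B) (by
      refine ⟨?_, ?_⟩
      · change size₁ ((x₀ * b) • Y) ≤ ε
        rw [size₁_smul, normF_mul]
        have h1 : (normF F x₀ * normF F b) ^ 2 ≤ (resCard F ^ m)⁻¹ := by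
          have hb1 : (resCard F ^ m)⁻¹ ≤ 1 := inv_le_one_of_one_le₀ (one_le_pow₀ hq.le)
          have h2 : normF F x₀ * normF F b ≤ (resCard F ^ m)⁻¹ :=
            (mul_le_of_le_one_left (normF_nonneg _) hx₀).trans hb
          have h3 := mul_nonneg (normF_nonneg (F := F) x₀) (normF_nonneg b)
          nlinarith
        refine (mul_le_mul h1 (hRn Y hY) (size₁_nonneg _) (by positivity)).trans (by linarith)
      · change nrmB (0 : B) ≤ ε
        rw [D.quatB.nrm_zero]; exact hε.le)
    have hcomm : g * u = u' * g := toA_injective (by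
      rw [toA_mul, toA_mul, hu, e, mul_add, add_mul, mul_one, one_mul]
      congr 1
      refine Prod.ext ?_ ?_
      · change g.1.1 * (x₀ • X) = ((x₀ * b) • Y) * g.1.1
        rw [mul_smul_comm, hbY, smul_mul_assoc, smul_mul_assoc, smul_smul]
      · change g.2.1 * 0 = 0 * g.2.1
        rw [mul_zero, zero_mul])
    rw [← hlu, hcomm, hUl u' hu']
  obtain ⟨R₁, hR₁, h1⟩ := key 0
  obtain ⟨R₂, hR₂, h2⟩ := key (-1)
  refine ⟨max R₁ R₂ * resCard F, mul_pos (lt_max_of_lt_left hR₁) (resCard_pos F), fun g hg => ?_⟩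
  have hdet : g.1.1.det ≠ 0 := (isUnit_iff_isUnit_det _).1 g.1.isUnit |>.ne_zero
  set i := logF g.1.1.det
  have hi : norm₁ g = resCard F ^ i := normF_of_ne hdet
  obtain ⟨z, hz0, hz⟩ := exists_normF_eq_zpow (F := F) (-((i + 1) / 2))
  set k := centerHom F B (mk0 z hz0, 1)
  have hkK : k ∈ S.K := mem_sup_left (mem_sup_left ⟨_, rfl⟩)
  have hk1 : ((g * k).1 : M2 F) = z • g.1.1 := by
    change g.1.1 * algebraMap F (M2 F) z = _
    rw [← Algebra.commutes, ← smul_def]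
  have hlk : lam (g * k) ≠ 0 := by
    rw [hlam.mul_right g ⟨k, hkK⟩, hρ.central ⟨k, hkK⟩ (mk0 z hz0, 1) rfl]
    intro h
    refine hg ((smul_eq_zero.1 (?_ : ((ω (mk0 z hz0 * 1⁻¹) : ℂˣ) : ℂ) • lam g = 0)).resolve_left
      (Units.ne_zero _))
    ext v
    simpa using LinearMap.congr_fun h v
  have hnk : norm₁ (g * k) = resCard F ^ (i - 2 * ((i + 1) / 2)) := by
    rw [norm₁, hk1, Matrix.det_smul, normF_mul, normF_pow, hz, Fintype.card_fin]
    change _ * norm₁ g = _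
    rw [← zpow_natCast, ← zpow_mul, hi, ← zpow_add₀ (resCard_pos F).ne']
    congr 1; push_cast; ring
  have hle : size₁ ((g * k).1 : M2 F) ≤ max R₁ R₂ := by
    rcases (by omega : i - 2 * ((i + 1) / 2) = 0 ∨ i - 2 * ((i + 1) / 2) = -1) with h | h <;>
      rw [h] at hnk
    · exact (h1 _ hlk hnk).trans (le_max_left _ _)
    · exact (h2 _ hlk hnk).trans (le_max_right _ _)
  rw [hk1, size₁_smul, hz, ← zpow_natCast, ← zpow_mul] at hle
  have h3 : size₁ g.1.1 ≤ max R₁ R₂ * resCard F ^ (2 * ((i + 1) / 2)) := by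
    have := mul_le_mul_of_nonneg_right hle (zpow_pos (resCard_pos F) (2 * ((i + 1) / 2))).le
    rwa [mul_right_comm, ← zpow_add₀ (resCard_pos F).ne', show -((i + 1) / 2) * ((2 : ℕ) : ℤ) +
      2 * ((i + 1) / 2) = 0 by push_cast; ring, zpow_zero, one_mul] at this
  refine h3.trans ?_
  rw [mul_assoc, hi, ← zpow_one_add₀ (resCard_pos F).ne']
  exact mul_le_mul_of_nonneg_left (zpow_le_zpow_right₀ hq.le (by omega))
    (hR₁.le.trans (le_max_left _ _))

end Setup

/-- The Fourier transform of a function on `𝐆`. -/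
noncomputable def fourier (ψ : AddChar F Circle) (μ : Measure (AA F B))
    (Φ : GG F B → ℂ) (y : AA F B) : ℂ :=
  ∫ x, fourierIntegrand ψ Φ y x ∂μ

lemma exists_of_fourier_ne_zero {ψ : AddChar F Circle}
    {μ : Measure (AA F B)} {H : Subgroup (GG F B)} {c : GG F B ⧸ H} {Φ : GG F B → ℂ} {y : AA F B}
    (h : fourier ψ μ (cosetPart c Φ) y ≠ 0) :
    ∃ g, QuotientGroup.mk g = c ∧ Φ g ≠ 0 := by
  by_contra! hc
  refine h (integral_eq_zero_of_ae (Filter.Eventually.of_forall fun x => ?_))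
  obtain ⟨g, rfl⟩ | hx := exists_toA_or x
  · simpa [fourierIntegrand, extZero_toA, cosetPart] using fun h => .inl (hc g h)
  · simp [fourierIntegrand, extZero_of_notMem _ hx]

lemma mk_mul_of_mem {G : Type*} [Group G] {H : Subgroup G} (g : G) {u : G} (hu : u ∈ H) :
    (QuotientGroup.mk (g * u) : G ⧸ H) = QuotientGroup.mk g :=
  QuotientGroup.eq.2 (by simpa using inv_mem hu)

namespace Setup

variable (hB : finrank F B = 4) (μ : Measure (AA F B)) [μ.IsAddHaarMeasure]
  (ψ : AddChar F Circle)
include D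

section Translation

include hB

lemma fourier_mul_right (Φ : GG F B → ℂ) (y : AA F B) (a : GG F B) :
    fourier ψ μ Φ y = modulus a * fourier ψ μ (fun g => Φ (g * a)) (toA a * y) := by
  rw [fourier, integral_rmul D.quatB D.redTrace_ne hB μ a]
  simp only [fourier, fourierIntegrand, extZero_mul_right, mul_assoc]

lemma fourier_mul_left (Φ : GG F B → ℂ) (y : AA F B) (a : GG F B) :
    fourier ψ μ Φ y = modulus a * fourier ψ μ (fun g => Φ (a * g)) (y * toA a) := by
  rw [fourier, integral_lmul D.quatB D.redTrace_ne hB μ a]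
  simp only [fourier, fourierIntegrand, extZero_mul_left]
  congr 2
  funext x
  rw [mul_assoc, D.psiA_mul_comm, mul_assoc]

lemma fourier_cosetPart_eq_zero_of_mul {c : GG F B ⧸ 𝓛} {Φ : GG F B → ℂ}
    {y : AA F B} {u : GG F B} (hu : u ∈ 𝓛) {ζ : ℂ} (hζ : ζ ≠ 1)
    (h : ∀ g, QuotientGroup.mk g = c →
      Φ (g * u) * psiA ψ (toA (g * u) * y) = ζ * (Φ g * psiA ψ (toA g * y))) :
    fourier ψ μ (cosetPart c Φ) y = 0 := by
  refine eq_zero_of_eq_mul hζ ?_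
  nth_rw 1 [D.fourier_mul_right hB μ ψ _ y u]
  rw [D.modulus_of_unit ⟨u, hu⟩, Complex.ofReal_one, one_mul, fourier, fourier,
    ← integral_const_mul]
  congr 1
  funext x
  obtain ⟨g, rfl⟩ | hx := exists_toA_or x
  · rw [fourierIntegrand, fourierIntegrand, extZero_toA, extZero_toA, ← mul_assoc, ← toA_mul]
    by_cases hg : QuotientGroup.mk g = c
    · simp [cosetPart, hg, mk_mul_of_mem g hu, h g hg]
    · simp [cosetPart, hg, mk_mul_of_mem g hu]
  · simp [fourierIntegrand, extZero_of_notMem _ hx]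

end Translation

lemma fourier_cosetPart_eq_zero_of_add {c : GG F B ⧸ 𝓛} {Φ : GG F B → ℂ}
    {y l : AA F B} (hl : psiA ψ (l * y) ≠ 1)
    (h : ∀ g, QuotientGroup.mk g = c → ∀ l', l' = l ∨ l' = -l →
      ∃ u ∈ 𝓛, toA (g * u) = toA g + l' ∧ Φ (g * u) = Φ g) :
    fourier ψ μ (cosetPart c Φ) y = 0 := by
  have key : ∀ x l', l' = l ∨ l' = -l → extZero (cosetPart c Φ) x ≠ 0 →
      extZero (cosetPart c Φ) (x + l') = extZero (cosetPart c Φ) x := by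
    intro x l' hl' hx
    obtain ⟨g, rfl⟩ | hxg := exists_toA_or x
    · rw [extZero_toA] at hx
      have hg : QuotientGroup.mk g = c := by by_contra hg; exact hx (if_neg hg)
      obtain ⟨u, hu, e, e'⟩ := h g hg l' hl'
      simp [← e, extZero_toA, cosetPart, mk_mul_of_mem g hu, hg, e']
    · exact absurd (extZero_of_notMem _ hxg) hx
  refine eq_zero_of_eq_mul hl ?_
  rw [fourier, ← integral_const_mul]
  rw [← integral_add_right_eq_self _ l]
  congr 1
  funext x
  have e : extZero (cosetPart c Φ) (x + l) = extZero (cosetPart c Φ) x := by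
    by_cases hx : extZero (cosetPart c Φ) x = 0
    · by_contra hne
      have := key (x + l) (-l) (Or.inr rfl) (by rwa [hx] at hne)
      rw [add_neg_cancel_right] at this
      exact hne this.symm
    · exact key x l (Or.inl rfl) hx
  rw [fourierIntegrand, fourierIntegrand, e, add_mul, psiA_add D.quatB]
  ring

lemma twist_mul_unit {f : GG F B → ℂ} {r : ℝ} {g u : GG F B} (hu : u ∈ 𝓛) {ζ : ℂ}
    (h : f (g * u) = ζ * f g) : twist f r (g * u) = ζ * twist f r g := by
  obtain ⟨h1, h2⟩ := D.norms_mul_unit g hu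
  rw [twist, twist, h1, h2, h]; ring

lemma norms_eq_of_mk {g g' : GG F B} (h : (g : GG F B ⧸ 𝓛) = QuotientGroup.mk g') :
    norm₁ g = norm₁ g' ∧ norm₂ g = norm₂ g' := by
  have := D.norms_mul_unit g (QuotientGroup.eq.1 h)
  rw [mul_inv_cancel_left] at this
  exact ⟨this.1.symm, this.2.symm⟩

variable (hσ : S.IsRhoS ψF σ) (hρ : S.IsRhoExt ω σ ρ) (hlam : IsShift S.K ρ lam) (a : GG F B)
  (v : V) (y : AA F B) (r : ℝ)

/-- The contribution of the coset of `g` to the Fourier transform. -/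
local notation "𝓕" g:max => fourier ψ μ (cosetPart (g : GG F B ⧸ S.linkingUnits)
  (twist (fun g => lam (g * a) v) r)) y

include hσ hρ hlam

lemma exists_right_smooth : ∃ ε > 0, ε < 1 ∧ ∀ l ∈ ball F B ε, ∃ u ∈ 𝓛,
    toA u = 1 + l ∧ ∀ g, lam (g * u * a) = lam (g * a) := by
  obtain ⟨U, hU, hUρ⟩ := D.exists_smooth hσ hρ
  have hK : IsOpen (S.K : Set (GG F B)) := Subgroup.isOpen_mono S.linkingUnits_le_K
    D.isOpen_linkingUnits
  have h1 : IsOpen (((U ⊓ S.K).comap (MulAut.conj a⁻¹).toMonoidHom : Subgroup (GG F B)) :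
      Set (GG F B)) :=
    (hU.inter hK).preimage (f := fun x : GG F B => a⁻¹ * x * a⁻¹⁻¹) (by fun_prop)
  obtain ⟨ε, hε, hε1, h⟩ := exists_congruence D.quatB D.redTrace_ne
    (U := (U ⊓ S.K).comap (MulAut.conj a⁻¹).toMonoidHom ⊓ 𝓛)
    (h1.inter D.isOpen_linkingUnits)
  refine ⟨ε, hε, hε1, fun l hl => ?_⟩
  obtain ⟨u, ⟨⟨hu1, hu2⟩, hu3⟩, e⟩ := h l hl
  refine ⟨u, hu3, e, fun g => ?_⟩
  have e1 : g * u * a = g * a * (MulAut.conj a⁻¹ u) := by rw [MulAut.conj_apply]; group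
  rw [e1]
  refine (hlam.mul_right (g * a) ⟨_, hu2⟩).trans ?_
  rw [hUρ ⟨_, hu2⟩ hu1]; rfl

/-- Cosets on which the Fourier integrand oscillates under small translations do not contribute. -/
lemma exists_fourier_eq_zero : ∃ ε > 0, ∀ g : GG F B, ∀ l ∈ ball F B ε,
    psiA ψ (toA g * l * y) ≠ 1 → 𝓕 g = 0 := by
  obtain ⟨ε, hε, -, h⟩ := D.exists_right_smooth hσ hρ hlam a
  obtain ⟨R, hR, hRL⟩ := D.exists_order_bound
  refine ⟨ε / R, div_pos hε hR, fun g l hl hne =>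
    D.fourier_cosetPart_eq_zero_of_add μ ψ hne fun g' hg' l' hl' => ?_⟩
  obtain ⟨l₁, hl₁, rfl⟩ : ∃ l₁ ∈ ball F B (ε / R), l' = toA g * l₁ := by
    rcases hl' with rfl | rfl
    · exact ⟨l, hl, rfl⟩
    · exact ⟨-l, ball_neg D.quatB hl, (mul_neg _ _).symm⟩
  have hk : g'⁻¹ * g ∈ 𝓛 := QuotientGroup.eq.1 hg'
  obtain ⟨u, hu, e, hlu⟩ := h (toA (g'⁻¹ * g) * l₁) (by
    have := ball_mul D.quatB hR.le (hRL (D.order_of_unit ⟨_, hk⟩)) hl₁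
    rwa [mul_div_cancel₀ _ hR.ne'] at this)
  refine ⟨u, hu, ?_, ?_⟩
  · rw [toA_mul g' u, e, mul_add, mul_one, ← mul_assoc, ← toA_mul, mul_inv_cancel_left]
  · rw [D.twist_mul_unit hu (ζ := 1) (by rw [hlu, one_mul]), one_mul]

include hB in
/-- Cosets on which the coefficients transform through a nontrivial character do not contribute. -/
lemma fourier_eq_zero_of_depth {x z : AA F B} (hx : x ∈ depthSet S) (hz : z ∈ depthSet S)
    (hxz : z * toA a = toA a * x) (hψx : ψF (formT S x) ≠ 1)
    {c : GG F B ⧸ 𝓛} (h : ∀ g, QuotientGroup.mk g = c → lam (g * a) ≠ 0 →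
      psiA ψ (toA g * z * y) = 1) :
    fourier ψ μ (cosetPart c (twist (fun g => lam (g * a) v) r)) y = 0 := by
  obtain ⟨w, -, hw, hlw⟩ := D.exists_depth_unit hσ hρ hlam hx
  obtain ⟨u, hu, hd, -⟩ := D.exists_depth_unit hσ hρ hlam hz
  have hlu : ∀ g, lam (g * u * a) = (ψF (formT S x) : ℂ) • lam (g * a) := fun g => by
    rw [← hlw, mul_assoc, mul_assoc]
    congr 2
    apply toA_injective
    rw [toA_mul, toA_mul, hd, hw, add_mul, mul_add, one_mul, mul_one, hxz]
  refine D.fourier_cosetPart_eq_zero_of_mul hB μ ψ hu (fun h => hψx (Subtype.ext h)) fun g hg => ?_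
  rw [D.twist_mul_unit hu (by rw [hlu, LinearMap.smul_apply, smul_eq_mul]), mul_assoc]
  by_cases hl : lam (g * a) = 0
  · simp [twist, hl]
  · rw [toA_mul, hd, mul_add, add_mul, psiA_add D.quatB, h g hg hl, mul_one, mul_one]

variable (hψF' : NontrivialOnInt ψF) (hψ : Continuous ψ) (hψ' : ψ ≠ 1)
include hψF'

lemma exists_support_bound' :
    ∃ C > 0, ∀ g : GG F B, lam (g * a) ≠ 0 → size₁ g.1.1 ≤ C * norm₁ g := by
  obtain ⟨C, hC, h⟩ := D.exists_support_bound hσ hρ hψF' hlam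
  have h0 := size₁_nonneg ((a⁻¹).1 : M2 F)
  have ha := norm₁_pos a
  refine ⟨C * norm₁ a * (size₁ ((a⁻¹).1 : M2 F) + 1), by positivity, fun g hg => ?_⟩
  have e : g.1.1 = ((g * a).1 : M2 F) * ((a⁻¹).1 : M2 F) := by
    rw [← Units.val_mul, ← fst_mul, mul_inv_cancel_right]
  have h1 := h _ hg
  rw [norm₁_mul] at h1
  have hg0 := norm₁_pos g
  rw [e]
  calc size₁ _ ≤ _ := size₁_mul_le _ _
    _ ≤ C * (norm₁ g * norm₁ a) * (size₁ ((a⁻¹).1 : M2 F) + 1) :=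
      mul_le_mul h1 (by linarith) h0 (by positivity)
    _ = _ := by ring

include hB hψ in
lemma exists_fourier_eq_zero_of_small₁ :
    ∃ κ > 0, ∀ g : GG F B, norm₁ g * size₁ y.1 ≤ κ → 𝓕 g = 0 := by
  obtain ⟨x₀, hx₀, hψx₀⟩ := D.exists_char_ne hψF'
  obtain ⟨k, hs, hk, -⟩ := D.s_eq
  obtain ⟨m, hm⟩ := exists_trivial_ball hψ
  obtain ⟨C, hC, hCl⟩ := D.exists_support_bound' hσ hρ hlam a hψF'
  obtain ⟨X, hX, -, hXt, Y, hY, hXY⟩ := D.chain.exists_nilpotent_conj hs hk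
    ((isUnit_iff_isUnit_det _).1 (a⁻¹).1.isUnit).ne_zero
  have hq := zpow_pos (resCard_pos F) m
  have h0 := size₁_nonneg (x₀ • Y)
  have hy0 := size₁_nonneg y.1
  refine ⟨(resCard F ^ m) ^ 2 / (C * (size₁ (x₀ • Y) + 1)), by positivity,
    fun g hg => D.fourier_eq_zero_of_depth hB μ ψ hσ hρ hlam a v y r (D.smul_mem_depthSet hx₀ hX)
      (D.smul_mem_depthSet hx₀ hY) ?_ (by rwa [D.formT_smul_of_trace hXt]) fun g' hg' hl => ?_⟩
  · refine Prod.ext ?_ ((zero_mul _).trans (mul_zero _).symm)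
    change (x₀ • Y) * a.1.1 = a.1.1 * (x₀ • X)
    rw [smul_mul_assoc, mul_smul_comm, ((a.1).inv_mul_eq_iff_eq_mul.1 hXY.symm : Y = _), mul_assoc,
      mul_assoc, Prod.fst_inv, inv_mul, mul_one]
  · have e : toA g' * ((x₀ • Y, 0) : AA F B) * y = ((g'.1.1 * (x₀ • Y) * y.1, 0) : AA F B) :=
      Prod.ext rfl (by change g'.2.1 * 0 * y.2 = 0; rw [mul_zero, zero_mul])
    rw [e, psiA_fst D.quatB, hm _ (le_of_sq_le_sq ((normF_trace_sq_le _).trans ?_) hq.le),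
      Circle.coe_one]
    have h1 := hCl g' hl
    have hn := norm₁_pos g
    rw [(D.norms_eq_of_mk hg').1] at h1
    rw [le_div_iff₀ (by positivity)] at hg
    calc _ ≤ C * norm₁ g * size₁ (x₀ • Y) * size₁ y.1 := (size₁_mul_le _ _).trans
          (mul_le_mul_of_nonneg_right ((size₁_mul_le _ _).trans
            (mul_le_mul_of_nonneg_right h1 h0)) hy0)
      _ ≤ norm₁ g * size₁ y.1 * (C * (size₁ (x₀ • Y) + 1)) := by
          have := mul_nonneg (mul_nonneg hn.le hy0) hC.le
          linarith
      _ ≤ _ := hg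

include hB hψ in
lemma exists_fourier_eq_zero_of_small₂ :
    ∃ κ > 0, ∀ g : GG F B, norm₂ g * nrmB y.2 ≤ κ → 𝓕 g = 0 := by
  obtain ⟨x₀, hx₀, hψx₀⟩ := D.exists_char_ne hψF'
  obtain ⟨m, hm⟩ := exists_trivial_ball hψ
  obtain ⟨w, hw, hwx⟩ := D.exists_trace_mul (γ := S.α * t ^ S.n)
    (by rw [← mul_one (S.α * _), D.nrm_α_mul, D.quatE.nrm_one]) (x := -x₀) (by rwa [normF_neg])
  have hQ := D.quatB
  have hX : nrmB (S.ι₂ (t ^ S.n * w)) ≤ nrm nrE t ^ S.n := by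
    rw [D.nrm_redNorm_ι, D.quatE.nrm_mul, D.quatE.nrm_pow]
    exact mul_le_of_le_one_right (pow_nonneg D.t_pos.le _) hw
  set X : B := S.ι₂ (t ^ S.n * w) with hXd
  set Y : B := a.2 * X * (a⁻¹).2
  have ha := hQ.nrm_pos a.2.ne_zero
  have hY : nrmB Y = nrmB X := by
    rw [hQ.nrm_mul, hQ.nrm_mul, Prod.snd_inv, Units.val_inv_eq_inv_val, hQ.nrm_inv]
    field_simp
  have hdep : ∀ Z : B, nrmB Z ≤ nrm nrE t ^ S.n → ((0, Z) : AA F B) ∈ depthSet S := fun Z hZ =>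
    ⟨fun i x _ => by simp, D.mem_radB_n'.2 hZ⟩
  have hq := zpow_pos (resCard_pos F) m
  have h0 := nrm_nonneg (redNorm (F := F)) Y
  refine ⟨(resCard F ^ m) ^ 2 / (nrmB Y + 1), by positivity, fun g hg =>
    D.fourier_eq_zero_of_depth hB μ ψ hσ hρ hlam a v y r (hdep X hX) (hdep Y (hY.le.trans hX))
      (Prod.ext ((zero_mul _).trans (mul_zero _).symm) (Units.inv_mul_cancel_right _ a.2)) ?_
      fun g' hg' hl => ?_⟩
  · rwa [formT, mul_zero, Matrix.trace_zero, hXd, ← map_mul, ← mul_assoc,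
      show redTrace (S.ι₂ (S.α * t ^ S.n * w)) = -x₀ from (D.side₂.tr_ι _).trans hwx, sub_neg_eq_add,
      zero_add]
  · have e : toA g' * ((0, Y) : AA F B) * y = ((0, g'.2.1 * Y * y.2) : AA F B) :=
      Prod.ext (by change g'.1.1 * 0 * y.1 = 0; rw [mul_zero, zero_mul]) rfl
    rw [e, psiA_snd, hm _ (le_of_sq_le_sq ?_ hq.le), Circle.coe_one]
    rw [normF_neg]
    refine (hQ.norm_tr_sq_le _).trans ?_
    have h1 := mul_nonneg (norm₂_pos hQ g).le (nrm_nonneg (redNorm (F := F)) y.2)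
    rw [le_div_iff₀ (by positivity)] at hg
    rw [hQ.nrm_mul, hQ.nrm_mul, show nrm redNorm g'.2.1 = _ from (D.norms_eq_of_mk hg').2]
    linarith

include hψ' in
lemma exists_fourier_eq_zero_of_large₁ (hy : y.1 ≠ 0) :
    ∃ M, ∀ g : GG F B, M < norm₁ g → 𝓕 g = 0 := by
  obtain ⟨x₁, hx₁⟩ := AddChar.ne_one_iff.1 hψ'
  obtain ⟨ε, hε, h⟩ := D.exists_fourier_eq_zero μ ψ hσ hρ hlam a v y r
  obtain ⟨C, hC, hCl⟩ := D.exists_support_bound' hσ hρ hlam a hψF'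
  obtain ⟨i, j, hij⟩ : ∃ i j, y.1 i j ≠ 0 := by by_contra! h0; exact hy (Matrix.ext h0)
  set z : M2 F := Matrix.single j i (x₁ / y.1 i j)
  have hz : (y.1 * z).trace = x₁ := by
    rw [Matrix.trace_mul_single, MulOpposite.smul_eq_mul_unop]; exact mul_div_cancel₀ _ hij
  refine ⟨C * size₁ z / ε, fun g hg => ?_⟩
  by_contra hne
  obtain ⟨g', hg', hl⟩ := exists_of_fourier_ne_zero hne
  rw [← (D.norms_eq_of_mk hg').1, div_lt_iff₀ hε] at hg
  rw [← hg'] at hne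
  have hn := norm₁_pos g'
  refine hne (h g' ((g'.1.1)⁻¹ * z, 0) ⟨(size₁_mul_le _ _).trans ?_, ?_⟩ fun h0 => hx₁ ?_)
  · rw [size₁_inv, div_mul_eq_mul_div]
    refine (div_le_iff₀ (pow_pos hn 2)).2 ?_
    have h1 := mul_le_mul_of_nonneg_right (hCl g' fun h0 => hl (by simp [twist, h0]))
      (size₁_nonneg z)
    change _ ≤ ε * norm₁ g' ^ 2
    nlinarith
  · change nrmB (0 : B) ≤ ε
    rw [D.quatB.nrm_zero]; exact hε.le
  · have e : toA g' * (((g'.1.1)⁻¹ * z, 0) : AA F B) * y = (z * y.1, 0) := by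
      refine Prod.ext ?_ ?_
      · change g'.1.1 * ((g'.1.1)⁻¹ * z) * y.1 = _
        rw [Matrix.mul_nonsing_inv_cancel_left _ _ ((isUnit_iff_isUnit_det _).1 g'.1.isUnit)]
      · change g'.2.1 * 0 * y.2 = 0
        rw [mul_zero, zero_mul]
    rw [e, psiA_fst D.quatB, trace_mul_comm, hz] at h0
    exact Subtype.ext h0

omit hψF' in
include hψ' in
lemma exists_fourier_eq_zero_of_large₂ (hy : y.2 ≠ 0) :
    ∃ M, ∀ g : GG F B, M < norm₂ g → 𝓕 g = 0 := by
  obtain ⟨x₁, hx₁⟩ := AddChar.ne_one_iff.1 hψ'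
  obtain ⟨ε, hε, h⟩ := D.exists_fourier_eq_zero μ ψ hσ hρ hlam a v y r
  obtain ⟨b₀, hb₀⟩ := D.redTrace_ne
  have hQ := D.quatB
  set b : B := (-x₁ / redTrace b₀) • b₀ with hb
  refine ⟨nrmB (b * y.2⁻¹) / ε, fun g hg =>
    h g (0, g.2.1⁻¹ * (b * y.2⁻¹)) ⟨?_, ?_⟩ fun h0 => hx₁ ?_⟩
  · change size₁ (0 : M2 F) ≤ ε
    rw [size₁_zero]; exact hε.le
  · change nrmB (g.2.1⁻¹ * (b * y.2⁻¹)) ≤ ε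
    rw [div_lt_iff₀ hε] at hg
    rw [hQ.nrm_mul, hQ.nrm_inv, inv_mul_eq_div]
    exact (div_le_iff₀ (norm₂_pos hQ g)).2 (hg.le.trans_eq (mul_comm _ _))
  · have e : toA g * ((0, g.2.1⁻¹ * (b * y.2⁻¹)) : AA F B) * y = (0, b) := by
      refine Prod.ext ?_ ?_
      · change g.1.1 * 0 * y.1 = 0
        rw [mul_zero, zero_mul]
      · change g.2.1 * (g.2.1⁻¹ * (b * y.2⁻¹)) * y.2 = b
        rw [mul_inv_cancel_left₀ g.2.ne_zero, inv_mul_cancel_right₀ hy]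
    rw [e, psiA_snd, hb, hQ.tr_smul, div_mul_cancel₀ _ hb₀, neg_neg] at h0
    exact Subtype.ext h0

include hB hψ hψ' in
/-- The cosets that contribute to the Fourier transform have bounded norms. -/
lemma exists_norm_bound : ∃ M > 0, ∀ g : GG F B, 𝓕 g ≠ 0 →
    (M⁻¹ ≤ norm₁ g ∧ norm₁ g ≤ M) ∧ M⁻¹ ≤ norm₂ g ∧ norm₂ g ≤ M := by
  obtain ⟨κ₁, hκ₁, h1⟩ := D.exists_fourier_eq_zero_of_small₁ hB μ ψ hσ hρ hlam a v y r hψF' hψ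
  obtain ⟨κ₂, hκ₂, h2⟩ := D.exists_fourier_eq_zero_of_small₂ hB μ ψ hσ hρ hlam a v y r hψF' hψ
  have hQ := D.quatB
  by_cases hy1 : y.1 = 0
  · exact ⟨1, one_pos, fun g hg => absurd (h1 g (by rw [hy1, size₁_zero, mul_zero]; exact hκ₁.le)) hg⟩
  by_cases hy2 : y.2 = 0
  · exact ⟨1, one_pos, fun g hg => absurd (h2 g (by rw [hy2, hQ.nrm_zero, mul_zero]; exact hκ₂.le)) hg⟩
  obtain ⟨M₁, h3⟩ := D.exists_fourier_eq_zero_of_large₁ μ ψ hσ hρ hlam a v y r hψF' hψ' hy1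
  obtain ⟨M₂, h4⟩ := D.exists_fourier_eq_zero_of_large₂ μ ψ hσ hρ hlam a v y r hψ' hy2
  have hs : ∀ g : GG F B, ∀ {κ s n : ℝ}, 0 < κ → 0 ≤ s → 0 < n → (n * s ≤ κ → 𝓕 g = 0) → 𝓕 g ≠ 0 →
      n⁻¹ ≤ s / κ := fun g κ s n hκ _ hn h hg => by
    have := not_le.1 (mt h hg)
    rw [inv_le_iff_one_le_mul₀ hn, div_mul_eq_mul_div, one_le_div hκ]
    linarith
  have hs₁ := fun g => hs g hκ₁ (size₁_nonneg y.1) (norm₁_pos g) (h1 g)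
  have hs₂ := fun g => hs g hκ₂ (nrm_nonneg _ y.2) (norm₂_pos hQ g) (h2 g)
  have p₁ := div_nonneg (size₁_nonneg y.1) hκ₁.le
  have p₂ := div_nonneg (nrm_nonneg (redNorm (F := F)) y.2) hκ₂.le
  have l₁ := le_abs_self M₁
  have l₂ := le_abs_self M₂
  have l₃ := abs_nonneg M₁
  have l₄ := abs_nonneg M₂
  refine ⟨size₁ y.1 / κ₁ + nrmB y.2 / κ₂ + |M₁| + |M₂| + 1, by linarith, fun g hg =>
    ⟨⟨inv_le_of_inv_le₀ (norm₁_pos g) ?_, ?_⟩, inv_le_of_inv_le₀ (norm₂_pos hQ g) ?_, ?_⟩⟩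
  · linarith [hs₁ g hg]
  · linarith [not_lt.1 fun h => hg (h3 g h)]
  · linarith [hs₂ g hg]
  · linarith [not_lt.1 fun h => hg (h4 g h)]

end Setup

lemma integral_cosetSet {H : Subgroup (GG F B)} {ψ : AddChar F Circle} {μ : Measure (AA F B)}
    (hH : ∀ c : GG F B ⧸ H, MeasurableSet (cosetSet c)) (Φ : GG F B → ℂ) (y : AA F B)
    (c : GG F B ⧸ H) :
    ∫ x in cosetSet c, fourierIntegrand ψ Φ y x ∂μ = fourier ψ μ (cosetPart c Φ) y := by
  rw [← integral_indicator (hH c), indicator_cosetSet]; rfl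

namespace Setup

variable (hB : finrank F B = 4) (μ : Measure (AA F B)) [μ.IsAddHaarMeasure]
  {ψ : AddChar F Circle}
include D

lemma cosetSet_eq (g : GG F B) : cosetSet (g : GG F B ⧸ 𝓛) = lmul g '' unitSet S := by
  ext x
  constructor
  · rintro ⟨g', hg', rfl⟩
    refine ⟨_, ⟨g⁻¹ * g', QuotientGroup.eq.1 hg'.symm, rfl⟩, ?_⟩
    change toA g * _ = _
    rw [← toA_mul, mul_inv_cancel_left]
  · rintro ⟨_, ⟨u, hu, rfl⟩, rfl⟩
    exact ⟨g * u, QuotientGroup.eq.2 (by simpa using inv_mem hu), toA_mul _ _⟩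

lemma isOpen_cosetSet (c : GG F B ⧸ 𝓛) : IsOpen (cosetSet c) := by
  induction c using QuotientGroup.induction_on with
  | H g => rw [D.cosetSet_eq]; exact (lmul g).toHomeomorph.isOpenMap _ D.isOpen_unitSet

lemma isCompact_cosetSet (c : GG F B ⧸ 𝓛) : IsCompact (cosetSet c) := by
  induction c using QuotientGroup.induction_on with
  | H g => rw [D.cosetSet_eq]; exact D.isCompact_unitSet.image (lmul g).toHomeomorph.continuous

section Integrable

variable {Φ : GG F B → ℂ}
  (hΦ : ∃ ε > 0, ∀ l ∈ ball F B ε, ∃ u ∈ S.linkingUnits, toA u = 1 + l ∧ ∀ g, Φ (g * u) = Φ g)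
  (hψ : Continuous ψ) (y : AA F B)
include hΦ hψ

lemma integrableOn_cosetSet (c : GG F B ⧸ 𝓛) :
    IntegrableOn (fourierIntegrand ψ Φ y) (cosetSet c) μ := by
  obtain ⟨ε, hε, h⟩ := hΦ
  have hQ := D.quatB
  have hψA : Continuous (psiA ψ : AA F B → ℂ) := by
    have := continuous_redTrace hQ D.redTrace_ne
    exact (continuous_subtype_val.comp (hψ.comp continuous_fst.matrix_trace)).mul
      (continuous_subtype_val.comp (hψ.comp (this.comp continuous_snd).neg))
  refine ContinuousOn.integrableOn_compact' (D.isCompact_cosetSet c)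
    (D.isOpen_cosetSet c).measurableSet (ContinuousOn.mul ?_
      (hψA.comp (continuous_id.mul continuous_const)).continuousOn)
  rintro _ ⟨g, -, rfl⟩
  refine ContinuousAt.continuousWithinAt ?_
  have hcont : Continuous fun x : AA F B => toA g⁻¹ * x - 1 :=
    (continuous_const.mul continuous_id).sub continuous_const
  have hev : ∀ᶠ x in nhds (toA g), toA g⁻¹ * x - 1 ∈ ball F B ε := by
    refine hcont.continuousAt.eventually_mem ?_
    rw [← toA_mul, inv_mul_cancel, toA_one, sub_self]
    exact (isOpen_ball hQ D.redTrace_ne hε).mem_nhds (zero_mem_ball hQ hε.le)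
  refine continuousAt_const.congr (f := fun _ => extZero Φ (toA g)) ?_
  filter_upwards [hev] with x hx
  obtain ⟨u, -, hu, hΦu⟩ := h _ hx
  have e : x = toA (g * u) := by
    rw [toA_mul, hu, add_sub_cancel, toA_cancel_left (mul_inv_cancel g)]
  rw [e, extZero_toA, extZero_toA, hΦu]

lemma fourier_eq_sum (T : Finset (GG F B ⧸ 𝓛)) (hT : ∀ g, Φ g ≠ 0 → QuotientGroup.mk g ∈ T) :
    fourier ψ μ Φ y = ∑ c ∈ T, fourier ψ μ (cosetPart c Φ) y := by
  classical
  simp only [fourier]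
  rw [← integral_finsetSum]
  · congr 1
    funext x
    obtain ⟨g, rfl⟩ | hx := exists_toA_or x
    · simpa [fourierIntegrand, extZero_toA, cosetPart, ← Finset.sum_mul] using fun h =>
        .inl (by_contra fun h0 => h (hT g h0))
    · simp [fourierIntegrand, extZero_of_notMem _ hx]
  · intro c _
    have := (integrable_indicator_iff (D.isOpen_cosetSet c).measurableSet).2
      (D.integrableOn_cosetSet μ hΦ hψ y c)
    rwa [indicator_cosetSet] at this

end Integrable

variable (F B) in
/-- The elements of `𝐆` with norms in `[M⁻¹, M]`. -/
def normBox (M : ℝ) : Set (GG F B) :=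
  {g | (M⁻¹ ≤ norm₁ g ∧ norm₁ g ≤ M) ∧ M⁻¹ ≤ norm₂ g ∧ norm₂ g ≤ M}

omit
  D in
lemma normBox_mono {M M' : ℝ} (hM : 0 < M) (h : M ≤ M') : normBox F B M ⊆ normBox F B M' := by
  have := inv_anti₀ hM h
  exact fun g hg => ⟨⟨this.trans hg.1.1, hg.1.2.trans h⟩, this.trans hg.2.1, hg.2.2.trans h⟩

lemma mem_normBox_iff {M : ℝ} {g g' : GG F B} (h : (g : GG F B ⧸ 𝓛) = QuotientGroup.mk g') :
    g ∈ normBox F B M ↔ g' ∈ normBox F B M := by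
  obtain ⟨h1, h2⟩ := D.norms_eq_of_mk h
  simp only [normBox, Set.mem_ofPred_eq, h1, h2]

lemma exists_mem_normBox (g : GG F B) : ∃ M > 0, g ∈ normBox F B M := by
  have h1 := norm₁_pos g
  have h2 := norm₂_pos D.quatB g
  refine ⟨norm₁ g + norm₂ g + (norm₁ g)⁻¹ + (norm₂ g)⁻¹, by positivity, ?_⟩
  have h3 := inv_pos.2 h1
  have h4 := inv_pos.2 h2
  exact ⟨⟨inv_le_of_inv_le₀ h1 (by linarith), by linarith⟩,
    inv_le_of_inv_le₀ h2 (by linarith), by linarith⟩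

variable (hσ : S.IsRhoS ψF σ) (hρ : S.IsRhoExt ω σ ρ) (hlam : IsShift S.K ρ lam) (a : GG F B)
  (v : V) (y : AA F B) (r : ℝ)
include hσ hρ hlam

lemma smooth_twist : ∃ ε > 0, ∀ l ∈ ball F B ε, ∃ u ∈ 𝓛,
    toA u = 1 + l ∧ ∀ g, twist (fun g => lam (g * a) v) r (g * u) =
      twist (fun g => lam (g * a) v) r g := by
  obtain ⟨ε, hε, -, h⟩ := D.exists_right_smooth hσ hρ hlam a
  refine ⟨ε, hε, fun l hl => ?_⟩
  obtain ⟨u, hu, e, hlu⟩ := h l hl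
  refine ⟨u, hu, e, fun g => ?_⟩
  rw [D.twist_mul_unit hu (ζ := 1) (by rw [hlu, one_mul]), one_mul]

variable (hψF' : NontrivialOnInt ψF)
include hψF' hB

lemma finite_support (M : ℝ) (hM : 0 < M) : {c : GG F B ⧸ 𝓛 |
    ∃ g, QuotientGroup.mk g = c ∧ lam (g * a) ≠ 0 ∧ g ∈ normBox F B M}.Finite := by
  obtain ⟨C, hC, hCl⟩ := D.exists_support_bound' hσ hρ hlam a hψF'
  refine (finite_cosets D.quatB D.redTrace_ne hB D.isOpen_linkingUnits
    (max (C * M) M) (κ := (M⁻¹) ^ 2 * (M⁻¹) ^ 2) (by positivity)).subset ?_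
  rintro c ⟨g, rfl, hg, hM⟩
  refine ⟨g, rfl, ⟨(hCl g hg).trans (le_max_of_le_left ?_), hM.2.2.trans (le_max_right _ _)⟩, ?_⟩
  · exact mul_le_mul_of_nonneg_left hM.1.2 hC.le
  · exact mul_le_mul (pow_le_pow_left₀ (by positivity) hM.1.1 2)
      (pow_le_pow_left₀ (by positivity) hM.2.1 2) (by positivity) (by positivity)

section Shift

variable (hψ : Continuous ψ)
include hψ

omit hψF' hρ hσ hlam in
lemma fourier_coset_mul (g : GG F B) {κ : GG F B → ℂ} (hκ : ∀ g, ∀ h ∈ 𝓛, κ (g * h) = κ g)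
    {f : GG F B → ℂ} :
    fourier ψ μ (cosetPart (g : GG F B ⧸ 𝓛) fun g => κ g * f g) y =
      modulus g * κ g * ∫ x, unitExt S (fun h => f (g * h)) x * psiA ψ (x * (y * toA g)) ∂μ := by
  rw [D.fourier_mul_left hB μ ψ _ y g, fourier, mul_assoc, ← integral_const_mul (κ g)]
  congr 2
  funext x
  rw [fourierIntegrand, ← mul_assoc (κ g), ← mul_assoc x]
  congr 1
  by_cases hx : x ∈ unitSet S
  · obtain ⟨h, hh, rfl⟩ := hx
    rw [extZero_toA, cosetPart, if_pos (mk_mul_of_mem g hh), hκ g h hh]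
    exact congrArg _ (unitExt_apply (S := S) (fun h => f (g * h)) ⟨h, hh⟩).symm
  · rw [unitExt_of_notMem _ hx, mul_zero]
    obtain ⟨h, rfl⟩ | hxg := exists_toA_or x
    · rw [extZero_toA]
      refine if_neg fun e => hx ⟨h, ?_, rfl⟩
      simpa using QuotientGroup.eq.1 e.symm
    · exact extZero_of_notMem _ hxg

variable (hψ' : ψ ≠ 1)
include hψ'

lemma finite_fourier_support : {c : GG F B ⧸ 𝓛 |
    fourier ψ μ (cosetPart c (twist (fun g => lam (g * a) v) r)) y ≠ 0}.Finite := by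
  obtain ⟨M, hM, h⟩ := D.exists_norm_bound hB μ ψ hσ hρ hlam a v y r hψF' hψ hψ'
  refine (D.finite_support hB hσ hρ hlam a hψF' M hM).subset fun c hc => ?_
  obtain ⟨g, rfl, hg⟩ := exists_of_fourier_ne_zero hc
  exact ⟨g, rfl, fun h0 => hg (by simp [twist, h0]), h g hc⟩

lemma exists_normBox (p : GG F B) : ∃ M > 0, p ∈ normBox F B M ∧
    ∑ᶠ c : GG F B ⧸ 𝓛, fourier ψ μ (cosetPart c (twist (fun g => lam (g * a) v) r)) y =
      fourier ψ μ ((normBox F B M).indicator (twist (fun g => lam (g * a) v) r)) y := by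
  obtain ⟨M₁, hM₁, h⟩ := D.exists_norm_bound hB μ ψ hσ hρ hlam a v y r hψF' hψ hψ'
  obtain ⟨M₂, hM₂, hp⟩ := D.exists_mem_normBox p
  have hM : 0 < max M₁ M₂ := lt_max_of_lt_left hM₁
  refine ⟨_, hM, normBox_mono hM₂ (le_max_right _ _) hp, ?_⟩
  have hT := D.finite_support hB hσ hρ hlam a hψF' _ hM
  obtain ⟨ε, hε, hsm⟩ := D.smooth_twist hσ hρ hlam a v r
  rw [D.fourier_eq_sum μ ?_ hψ y hT.toFinset ?_, finsum_eq_sum_of_support_subset (s := hT.toFinset)]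
  · refine sum_congr rfl fun c hc => ?_
    obtain ⟨g, rfl, -, hg⟩ := hT.mem_toFinset.1 hc
    congr 1
    funext g'
    simp only [cosetPart]
    split_ifs with e
    · rw [Set.indicator_of_mem ((D.mem_normBox_iff e).2 hg)]
    · rfl
  · intro c hc
    obtain ⟨g, rfl, hg⟩ := exists_of_fourier_ne_zero hc
    exact hT.mem_toFinset.2 ⟨g, rfl, fun h0 => hg (by simp [twist, h0]),
      normBox_mono hM₁ (le_max_left _ _) (h g hc)⟩
  · refine ⟨ε, hε, fun l hl => ?_⟩
    obtain ⟨u, hu, e, hlu⟩ := hsm l hl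
    refine ⟨u, hu, e, fun g => ?_⟩
    classical simp only [Set.indicator_apply, D.mem_normBox_iff (mk_mul_of_mem g hu), hlu]
  · intro g hg
    have hm := Set.mem_of_indicator_ne_zero hg
    rw [Set.indicator_of_mem hm] at hg
    exact hT.mem_toFinset.2 ⟨g, rfl, fun h0 => hg (by simp [twist, h0]), hm⟩

/-- The Fourier transform of a translated coefficient. -/
lemma fourier_shift {w : S.K} {A : ℝ} (hA : 0 < A) (hw₁ : norm₁ w.1 = A)
    (hw₂ : norm₂ w.1 = A) (hw : ∀ (l : V →ₗ[ℂ] ℂ) (v : V),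
      (∀ z : AA F B, (∀ h : 𝓛, z ≠ toA (w.1 * h.1)) →
        ∫ x, unitExt S (fun h => l (σ h v)) x * psiA ψ (x * z) ∂μ = 0) ∧
      ∀ h : 𝓛, ∫ x, unitExt S (fun h => l (σ h v)) x * psiA ψ (x * toA (w.1 * h.1)) ∂μ =
          -((A ^ 2)⁻¹ : ℝ) * l (σ h⁻¹ (ρ w⁻¹ v))) :
    ∑ᶠ c : GG F B ⧸ 𝓛, fourier ψ μ (cosetPart c (twist (fun g => lam (g * a) v) r)) y =
      -extZero (twist (check fun g => lam (g * a) v) (2 - r)) y := by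
  have hQ := D.quatB
  obtain ⟨b, hb⟩ : ∃ b : GG F B, ∀ b', y = toA b' → b = b' := by
    obtain ⟨b, rfl⟩ | hy := exists_toA_or y
    · exact ⟨b, fun b' e => toA_injective e⟩
    · exact ⟨1, fun b' e => absurd e (hy b')⟩
  set g₁ : GG F B := b⁻¹ * a * w with hg₁
  obtain ⟨M, hM, hp, e⟩ := D.exists_normBox hB μ hσ hρ hlam a v y r hψF' hψ hψ' (g₁ * a⁻¹)
  rw [e, D.fourier_mul_right hB μ ψ _ y a⁻¹]
  set κ : GG F B → ℂ := fun g => (normBox F B M).indicator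
    (fun g => ((norm₁ g ^ (r - 2) : ℝ) : ℂ) * ((norm₂ g ^ (-r) : ℝ) : ℂ)) (g * a⁻¹) with hκd
  have hκ : ∀ g, ∀ h ∈ 𝓛, κ (g * h) = κ g := by
    intro g h hh
    have h1 : norm₁ (g * h * a⁻¹) = norm₁ (g * a⁻¹) := by
      rw [norm₁_mul, norm₁_mul g a⁻¹, (D.norms_mul_unit g hh).1]
    have h2 : norm₂ (g * h * a⁻¹) = norm₂ (g * a⁻¹) := by
      rw [norm₂_mul hQ, norm₂_mul hQ g a⁻¹, (D.norms_mul_unit g hh).2]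
    simp only [hκd, Set.indicator_apply, normBox, Set.mem_ofPred_eq, h1, h2]
  have hΨ : (fun g => (normBox F B M).indicator (twist (fun g => lam (g * a) v) r) (g * a⁻¹)) =
      fun g => κ g * lam g v := by
    funext g
    by_cases hm : g * a⁻¹ ∈ normBox F B M <;> simp [hκd, hm, twist]; ring
  rw [hΨ]
  obtain ⟨M', hM', hT⟩ : ∃ M' > 0, ∀ g, κ g ≠ 0 → g ∈ normBox F B M' := by
    obtain ⟨M₂, hM₂, ha⟩ := D.exists_mem_normBox a
    refine ⟨M * M₂, mul_pos hM hM₂, fun g hg => ?_⟩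
    have hm := Set.mem_of_indicator_ne_zero hg
    have e1 : norm₁ g = norm₁ (g * a⁻¹) * norm₁ a := by rw [← norm₁_mul, inv_mul_cancel_right]
    have e2 : norm₂ g = norm₂ (g * a⁻¹) * norm₂ a := by rw [← norm₂_mul hQ, inv_mul_cancel_right]
    have hi := inv_nonneg.2 hM.le
    have hi₂ := inv_nonneg.2 hM₂.le
    have p1 := (norm₁_pos (g * a⁻¹)).le
    have p2 := (norm₂_pos hQ (g * a⁻¹)).le
    rw [normBox, Set.mem_ofPred_eq, e1, e2, mul_inv]
    exact ⟨⟨mul_le_mul hm.1.1 ha.1.1 hi₂ p1, mul_le_mul hm.1.2 ha.1.2 (norm₁_pos a).le hM.le⟩,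
      mul_le_mul hm.2.1 ha.2.1 hi₂ p2, mul_le_mul hm.2.2 ha.2.2 (norm₂_pos hQ a).le hM.le⟩
  have hfin := D.finite_support hB hσ hρ hlam 1 hψF' M' hM'
  classical
  rw [D.fourier_eq_sum μ (Φ := fun g => κ g * lam g v) ?_ hψ _
    (insert (QuotientGroup.mk g₁) hfin.toFinset) ?_]
  rotate_left
  · obtain ⟨ε, hε, -, hsm⟩ := D.exists_right_smooth hσ hρ hlam 1
    refine ⟨ε, hε, fun l hl => ?_⟩
    obtain ⟨u, hu, e, hlu⟩ := hsm l hl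
    refine ⟨u, hu, e, fun g => ?_⟩
    have := hlu g
    rw [mul_one, mul_one] at this
    rw [hκ g u hu, this]
  · intro g hg
    refine Finset.mem_insert_of_mem (hfin.mem_toFinset.2 ⟨g, rfl, fun h0 => hg ?_,
      hT g (left_ne_zero_of_mul hg)⟩)
    rw [mul_one] at h0
    simp [h0]
  have hσρ : ∀ g, (fun h : 𝓛 => lam (g * h) v) = fun h => lam g (σ h v) := by
    intro g
    funext h
    exact (LinearMap.congr_fun (hlam.mul_right g (inclusion S.linkingUnits_le_K h))
      v).trans (by rw [LinearMap.comp_apply, hρ.extends_σ])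
  have hne : ∀ g : GG F B, (∀ b', y = toA b' → (g : GG F B ⧸ 𝓛) ≠
      QuotientGroup.mk g₁) → fourier ψ μ (cosetPart (QuotientGroup.mk g :
        GG F B ⧸ 𝓛) fun g => κ g * lam g v) (toA a⁻¹ * y) = 0 := by
    intro g hg
    rw [D.fourier_coset_mul hB μ _ hψ g hκ, hσρ, (hw _ _).1, mul_zero]
    intro h e
    have hy : y = toA (a * (w.1 * h.1) * g⁻¹) := by
      rw [toA_mul, toA_mul, ← e, ← mul_assoc, toA_cancel_right (mul_inv_cancel g),
        toA_cancel_left (mul_inv_cancel a)]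
    refine hg _ hy (QuotientGroup.eq.2 ?_)
    rw [hg₁, hb _ hy]
    convert inv_mem h.2 using 1
    group
  rw [Finset.sum_eq_single_of_mem _ (Finset.mem_insert_self _ _)]
  · obtain ⟨b', rfl⟩ | hy := exists_toA_or y
    · rw [D.fourier_coset_mul hB μ _ hψ g₁ hκ, hσρ]
      obtain rfl := hb _ rfl
      have e1 : toA a⁻¹ * toA b * toA g₁ = toA (w.1 * ((1 : 𝓛) : GG F B)) := by
        rw [← toA_mul, ← toA_mul, hg₁, coe_one]
        congr 1; group
      have e2 : lam g₁ (σ (1 : 𝓛)⁻¹ (ρ w⁻¹ v)) = lam (b⁻¹ * a) v := by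
        rw [inv_one, map_one σ, End.one_apply]
        have := LinearMap.congr_fun (hlam.mul_right g₁ w⁻¹) v
        rw [Subgroup.coe_inv, hg₁, mul_inv_cancel_right] at this
        exact this.symm
      rw [e1, (hw _ _).2, e2, extZero_toA, twist, check]
      have hn₁ := norm₁_pos b
      have hn₂ := norm₂_pos hQ b
      have ha₁ := norm₁_pos a
      have ha₂ := norm₂_pos hQ a
      have m₁ : norm₁ (g₁ * a⁻¹) = A / norm₁ b := by
        rw [hg₁, norm₁_mul, norm₁_mul, norm₁_mul, norm₁_inv, norm₁_inv, hw₁]; field_simp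
      have m₂ : norm₂ (g₁ * a⁻¹) = A / norm₂ b := by
        rw [hg₁, norm₂_mul hQ, norm₂_mul hQ, norm₂_mul hQ, norm₂_inv hQ, norm₂_inv hQ,
          hw₂]; field_simp
      have m₃ : modulus a⁻¹ * modulus g₁ = A ^ 4 / (norm₁ b ^ 2 * norm₂ b ^ 2) := by
        rw [modulus, modulus, hg₁, norm₁_mul, norm₁_mul, norm₂_mul hQ, norm₂_mul hQ, norm₁_inv,
          norm₁_inv, norm₂_inv hQ, norm₂_inv hQ, hw₁, hw₂]
        field_simp
      have hκ₁ : κ g₁ = (((A / norm₁ b) ^ (r - 2) * (A / norm₂ b) ^ (-r) : ℝ) : ℂ) := by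
        simp only [hκd, Set.indicator_of_mem hp, m₁, m₂, Complex.ofReal_mul]
      have hreal : modulus a⁻¹ * modulus g₁ * ((A / norm₁ b) ^ (r - 2) * (A / norm₂ b) ^ (-r)) *
          (A ^ 2)⁻¹ = norm₁ b ^ (2 - r - 2) * norm₂ b ^ (-(2 - r)) := by
        rw [m₃, Real.div_rpow hA.le hn₁.le, Real.div_rpow hA.le hn₂.le, Real.rpow_sub hA,
          Real.rpow_sub hn₁, Real.rpow_neg hA.le, Real.rpow_neg hn₂.le,
          show 2 - r - 2 = -r by ring, Real.rpow_neg hn₁.le, neg_sub, Real.rpow_sub hn₂,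
          Real.rpow_two, Real.rpow_two, Real.rpow_two]
        have := Real.rpow_pos_of_pos hA r
        have := Real.rpow_pos_of_pos hn₁ r
        have := Real.rpow_pos_of_pos hn₂ r
        field_simp
      have hcomplex := congrArg (fun x : ℝ => (x : ℂ)) hreal
      rw [hκ₁]
      simp only [Complex.ofReal_mul] at hcomplex ⊢
      rw [mul_assoc _ (((norm₁ b ^ (2 - r - 2) : ℝ) : ℂ)), ← hcomplex]
      ring
    · rw [hne g₁ fun b' e => absurd e (hy b'), mul_zero, extZero_of_notMem _ hy, neg_zero]
  · intro c _ hc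
    induction c using QuotientGroup.induction_on with
    | H g => exact hne g fun _ _ => hc

end Shift

end Setup

end LinkingOrder

theorem mainTheorem11
    {F E B V : Type*}
    [Field F] [ValuativeRel F] [TopologicalSpace F] [IsNonarchimedeanLocalField F]
    [Field E] [Algebra F E] [Algebra.IsSeparable F E]
    [DivisionRing B] [Algebra F B] [Algebra.IsCentral F B] (hB : Module.finrank F B = 4)
    [TopologicalSpace B] [IsTopologicalRing B] [IsModuleTopology F B]
    [MeasurableSpace (AA F B)] [BorelSpace (AA F B)]
    [AddCommGroup V] [Module ℂ V] [FiniteDimensional ℂ V]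
    (ϖ : 𝒪[F]) (hϖ : Irreducible ϖ)
    -- the additive character of level one that is used for strata
    (ψF : AddChar F Circle) (hψF : ∀ x : 𝒪[F], x ∈ 𝓂[F] → ψF x = 1)
    (hψF' : ∃ x : 𝒪[F], ψF x ≠ 1)
    -- the simple stratum, with the embeddings of `E = F(α)`
    (S : StratumData F E B) (hn : 1 ≤ S.n) (hS : S.IsSimple ϖ)
    -- the representations `ρ_S` and `ρ_{S,ω}`
    (σ : Representation ℂ S.linkingUnits V) (hσ : S.IsRhoS ψF σ)
    (ω : Fˣ →* ℂˣ) (ρ : Representation ℂ S.K V) (hρ : S.IsRhoExt ω σ ρ)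
    -- the additive character and the self-dual measure of the Fourier transform
    (ψ : AddChar F Circle) (hψ : Continuous ψ) (hψ' : ψ ≠ 1)
    (μ : MeasureTheory.Measure (AA F B)) [μ.IsAddHaarMeasure] (hμ : IsSelfDual ψ μ)
    (f : GG F B → ℂ) (hf : f ∈ matrixCoeffs (cInd S.K ρ)) (s : ℝ) (y : AA F B) :
    (∀ c : GG F B ⧸ S.linkingUnits,
      MeasureTheory.IntegrableOn (fourierIntegrand ψ (twist f s) y) (cosetSet c) μ) ∧
    {c : GG F B ⧸ S.linkingUnits |
      ∫ x in cosetSet c, fourierIntegrand ψ (twist f s) y x ∂μ ≠ 0}.Finite ∧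
    formalFourier S.linkingUnits ψ μ (twist f s) y = -extZero (twist (check f) (2 - s)) y := by
  have hstr : ∀ g : GG F B, (g.1 : M2 F) - 1 ∈ S.chain.rad S.n →
      (g.2 : B) - 1 ∈ radB F B S.n' → g ∈ S.linkingUnits := fun g h1 h2 => (hσ.stratum g h1 h2).1
  obtain ⟨trE, nrE, t, s', p₁, p₂, δ, D⟩ := exists_setup hB hϖ hn hS hstr
  haveI : FiniteDimensional F B := Module.finite_of_finrank_eq_succ hB
  obtain ⟨c, hc0, hc⟩ := exists_scaling hψF hψF' hψ hψ'
  have hα0 : S.α ≠ 0 := by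
    intro h0
    have := D.nrm_α_mul 1
    rw [h0, zero_mul, zero_mul, D.quatE.nrm_zero, D.quatE.nrm_one] at this
    exact zero_ne_one this
  obtain ⟨w, A, hA, hw₁, hw₂, hw⟩ := D.exists_fourier_coeff hσ μ hψF (c := Units.mk0 c hc0) hc
    (a := Units.mk0 S.α hα0) rfl hB hψF' hμ hρ hS.2.2.2.1
  have hmeas : ∀ c : GG F B ⧸ S.linkingUnits, MeasurableSet (cosetSet c) := fun c =>
    (D.isOpen_cosetSet c).measurableSet
  rw [formalFourier]
  replace hf := matrixCoeffs_le (D.exists_smooth hσ hρ) (Subgroup.isOpen_mono S.linkingUnits_le_K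
    D.isOpen_linkingUnits) hf
  have e0 : ∀ f₁ f₂ r, twist (f₁ + f₂ : GG F B → ℂ) r = twist f₁ r + twist f₂ r := fun f₁ f₂ r => by
    funext g; simp [twist]; ring
  have e1 : ∀ f₁ f₂ : GG F B → ℂ, extZero (f₁ + f₂) = extZero f₁ + extZero f₂ := by
    intro f₁ f₂
    funext x
    obtain ⟨g, rfl⟩ | hx := exists_toA_or x
    · simp [extZero_toA]
    · simp [extZero_of_notMem _ hx]
  induction hf using Submodule.closure_induction with
  | zero =>
    have h0 : ∀ r, twist (0 : GG F B → ℂ) r = 0 := fun r => by funext g; simp [twist]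
    have h1 : extZero (0 : GG F B → ℂ) = 0 := by simpa using e1 0 0
    have h2 : fourierIntegrand ψ (0 : GG F B → ℂ) y = 0 := by funext x; simp [fourierIntegrand, h1]
    simp only [h0, h1, h2, show check (0 : GG F B → ℂ) = 0 from rfl]
    exact ⟨fun c => MeasureTheory.integrableOn_zero, by simp, by simp⟩
  | add f₁ f₂ _ _ h₁ h₂ =>
    have e2 : fourierIntegrand ψ (twist (f₁ + f₂) s) y =
        fourierIntegrand ψ (twist f₁ s) y + fourierIntegrand ψ (twist f₂ s) y := by
      funext x; simp [fourierIntegrand, e0, e1, add_mul]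
    have e4 := fun c : GG F B ⧸ S.linkingUnits => MeasureTheory.integral_add (h₁.1 c) (h₂.1 c)
    rw [e2, show check (f₁ + f₂) = check f₁ + check f₂ from rfl, e0, e1]
    refine ⟨fun c => (h₁.1 c).add (h₂.1 c), (h₁.2.1.union h₂.2.1).subset fun c hc => ?_,
      (finsum_congr e4).trans ?_⟩
    · by_contra hn
      simp only [Set.mem_union, Set.mem_ofPred_eq, not_or, not_not] at hn
      exact hc ((e4 c).trans (by rw [hn.1, hn.2, add_zero]))
    · rw [finsum_add_distrib h₁.2.1 h₂.2.1, h₁.2.2, h₂.2.2, Pi.add_apply, neg_add]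
  | smul_mem z f hf =>
    obtain ⟨lam, hlam, a, v, rfl⟩ := hf
    rw [show (z • fun g => lam (g * a) v) = fun g => lam (g * a) (z • v) by funext g; simp]
    simp only [integral_cosetSet hmeas]
    exact ⟨D.integrableOn_cosetSet μ (D.smooth_twist hσ hρ hlam a _ s) hψ y,
      D.finite_fourier_support hB μ hσ hρ hlam a _ y s hψF' hψ hψ',
      D.fourier_shift hB μ hσ hρ hlam a _ y s hψF' hψ hψ' hA hw₁ hw₂ hw⟩
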